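/- **Definitions.** All graphs are locally finite, connected, drawn on an oriented surface, and considered up to orientation-preserving isomorphism preserving the root. $B_R$ denotes the subgraph spanned by the vertices at graph distance (height) at most $R$ from the root vertex, and $S_k$ the subgraph spanned by the vertices at height $k$; both carry the induced planar structure and (for $B_R$) the marking of the root. *Trees.* $\mathcal T$ is the set of planar rooted trees, finite or infinite, with root $r$ of degree $1$ and all degrees finite; $\mathcal T_N$ is the set of those with $N$ edges, $\mathcal T_\infty$ the set of infinite ones. $d_{\mathcal T}(T,T')=\inf\{1/R : R\ge 1,\ B_R(T)=B_R(T')\}$. $\nu_N$ is the uniform probability measure on $\mathcal T_N$. *Causal triangulations.* A finite causal triangulation (CT) of height $h$ is a triangulation $G$ of the closed disk (all faces are triangles, except one exterior face, which is bounded by a simple cycle), with a root vertex $S_0$ and a marked edge at $S_0$, such that $h$ is the maximal height of a vertex; for $0<k<h$ the vertices at height $k$ span a cycle; each vertex at height $h$ has degree $2$ and lies in a single triangle; and the vertices on the boundary of the disk alternate in height between $h$ and $h-1$. An infinite CT is an infinite triangulation of the plane (without exterior face), rooted in the same way, such that for every $k>0$ the vertices at height $k$ span a cycle. Multiple edges are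 allowed, and degenerate cycles of length $1$ (a loop) and $2$ (two parallel edges) are allowed for $k\ge1$; there is no loop at $S_0$. The area of a finite CT is its number of triangles. $\mathcal C$ is the set of all CTs, $\mathcal C_{\rm fin}$, $\mathcal C_\infty$ the sets of finite and infinite ones, $\mathcal C_N$ the set of finite CTs of area $2N$. $d_{\mathcal C}(G,G')=\inf\{\frac1{R+1} : R\ge 0,\ B_R(G)=B_R(G')\}$. $\rho_N$ is the uniform probability measure on $\mathcal C_N$. *The map $\beta$.* For $G\in\mathcal C$, of height $h\le\infty$, $\beta(G)$ is obtained from $G$ as follows: add a new vertex $r$, the root of $\beta(G)$, joined by an edge only to $S_0$ and placed immediately to the right of the marked edge as seen from $S_0$; delete all edges of the cycles $S_k$, $1\le k<h$, and all vertices at height $h$ with their edges (if $h<\infty$); and for each vertex $v$ of height $k$ with $1\le k<h-1$ delete the rightmost, as seen from $v$, of the edges from $v$ to $S_{k+1}$. **Theorem.** $d_{\mathcal C}$ and $d_{\mathcal T}$ are metrics, and $\mathcal C_{\rm fin}=\bigcup_{N\ge1}\mathcal C_N$. Moreover: 1. $\beta$ maps $\mathcal C$ into $\mathcal T$; it maps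 $\mathcal C_N$ bijectively onto $\mathcal T_{N+1}$ for every $N\ge1$, and $\mathcal C_\infty$ bijectively onto $\mathcal T_\infty$. 2. $d_{\mathcal T}(\beta(G),\beta(G'))=d_{\mathcal C}(G,G')$ for all $G,G'\in\mathcal C$. 3. For every $N\ge1$, $\rho_N$ is a probability measure and $\rho_N(\{G\})=\frac1{\sharp\mathcal C_N}=\frac1{\sharp\mathcal T_{N+1}}=\nu_{N+1}(\{\beta(G)\})$ for all $G\in\mathcal C_N$. 4. The measures $\nu_N$ converge weakly, as $N\to\infty$, to a Borel probability measure $\nu$ on $(\mathcal T,d_{\mathcal T})$ with $\nu(\mathcal T_\infty)=1$ (the uniform infinite planar tree), and the measures $\rho_N$ converge weakly to a Borel probability measure $\rho$ on $(\mathcal C,d_{\mathcal C})$ with $\rho(\mathcal C_\infty)=1$ (the uniform infinite causal triangulation). For every Borel set $A\subseteq\mathcal C_\infty$ one has $\rho(A)=\nu(\beta(A))$; that is, $\rho$ is the pushforward of $\nu$ under $\beta^{-1}$. -/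

import Mathlib

open MeasureTheory Filter Topology BoundedContinuousFunction

/-! ### First return maps -/

section FirstReturn

variable {α : Type*}

/-- All orbits of the permutation `f` are finite. -/
def HasFiniteOrbits (f : Equiv.Perm α) : Prop := ∀ a, ∃ n : ℕ, 0 < n ∧ (f ^ n) a = a

/-- `b` is the first element of `S` met on the `f`-orbit of `a` strictly after `a`. -/
def IsFirstReturn (f : Equiv.Perm α) (S : Set α) (a b : α) : Prop :=
  b ∈ S ∧ ∃ n : ℕ, 0 < n ∧ (f ^ n) a = b ∧ ∀ m : ℕ, 0 < m → m < n → (f ^ m) a ∉ S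

theorem IsFirstReturn.exists_of_mem {f : Equiv.Perm α} (hf : HasFiniteOrbits f) {S : Set α}
    {a : α} (ha : a ∈ S) : ∃ b, IsFirstReturn f S a b := by
  classical
  have hex : ∃ n : ℕ, 0 < n ∧ (f ^ n) a ∈ S := by
    obtain ⟨n, hn, h⟩ := hf a
    exact ⟨n, hn, by rw [h]; exact ha⟩
  refine ⟨(f ^ (Nat.find hex)) a, (Nat.find_spec hex).2, Nat.find hex, (Nat.find_spec hex).1,
    rfl, ?_⟩
  intro m hm hlt hmem
  exact Nat.find_min hex hlt ⟨hm, hmem⟩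

theorem IsFirstReturn.unique {f : Equiv.Perm α} {S : Set α} {a b c : α}
    (h : IsFirstReturn f S a b) (h' : IsFirstReturn f S a c) : b = c := by
  obtain ⟨hb, n, hn, rfl, hmin⟩ := h
  obtain ⟨hc, m, hm, rfl, hmin'⟩ := h'
  rcases lt_trichotomy n m with hlt | rfl | hlt
  · exact absurd hb (hmin' n hn hlt)
  · rfl
  · exact absurd hc (hmin m hm hlt)

theorem IsFirstReturn.injective {f : Equiv.Perm α} {S : Set α} {a b c : α} (ha : a ∈ S)
    (hb : b ∈ S) (h : IsFirstReturn f S a c) (h' : IsFirstReturn f S b c) : a = b := by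
  have key : ∀ (a b : α) (n m : ℕ), a ∈ S → 0 < n → n < m → (f ^ n) a = (f ^ m) b →
      (∀ k : ℕ, 0 < k → k < m → (f ^ k) b ∉ S) → False := by
    intro a b n m ha hn hlt heq hmin
    have : (f ^ n) a = (f ^ n) ((f ^ (m - n)) b) := by
      rw [heq, ← Equiv.Perm.mul_apply, ← pow_add]
      congr 2
      omega
    have h2 := (f ^ n).injective this
    exact hmin (m - n) (by omega) (by omega) (h2 ▸ ha)
  obtain ⟨-, n, hn, hnc, hmin⟩ := h
  obtain ⟨-, m, hm, hmc, hmin'⟩ := h'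
  rcases lt_trichotomy n m with hlt | rfl | hlt
  · exact (key a b n m ha hn hlt (hnc.trans hmc.symm) hmin').elim
  · exact (f ^ n).injective (hnc.trans hmc.symm)
  · exact (key b a m n hb hm hlt (hmc.trans hnc.symm) hmin).elim

theorem IsFirstReturn.exists_preimage {f : Equiv.Perm α} (hf : HasFiniteOrbits f) {S : Set α}
    {b : α} (hb : b ∈ S) : ∃ a ∈ S, IsFirstReturn f S a b := by
  classical
  have hex : ∃ n : ℕ, 0 < n ∧ ((f ^ n)⁻¹) b ∈ S := by
    obtain ⟨n, hn, h⟩ := hf b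
    exact ⟨n, hn, by rw [Equiv.Perm.inv_eq_iff_eq.mpr h.symm]; exact hb⟩
  refine ⟨((f ^ (Nat.find hex))⁻¹) b, (Nat.find_spec hex).2, hb, Nat.find hex,
    (Nat.find_spec hex).1, by simp, ?_⟩
  intro m hm hlt hmem
  refine Nat.find_min hex (m := Nat.find hex - m) (by omega) ⟨by omega, ?_⟩
  have hsplit : f ^ (Nat.find hex) = f ^ m * f ^ (Nat.find hex - m) := by
    rw [← pow_add]; congr 1; omega
  have hsplit' : f ^ (Nat.find hex) = f ^ (Nat.find hex - m) * f ^ m := by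
    rw [← pow_add]; congr 1; omega
  rw [hsplit', mul_inv_rev, ← Equiv.Perm.mul_apply, mul_inv_cancel_left] at hmem
  exact hmem

/-- The permutation of `S` induced by `f`: `a` is sent to the next element of `S` on its orbit. -/
noncomputable def firstReturn (f : Equiv.Perm α) (hf : HasFiniteOrbits f) (S : Set α) :
    Equiv.Perm S :=
  Equiv.ofBijective
    (fun a => ⟨(IsFirstReturn.exists_of_mem hf a.2).choose,
      (IsFirstReturn.exists_of_mem hf a.2).choose_spec.1⟩)
    (by
      constructor
      · intro a b hab
        have hab' := congrArg Subtype.val hab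
        dsimp only at hab'
        have h1 := (IsFirstReturn.exists_of_mem hf a.2).choose_spec
        have h2 := (IsFirstReturn.exists_of_mem hf b.2).choose_spec
        rw [hab'] at h1
        exact Subtype.ext (IsFirstReturn.injective a.2 b.2 h1 h2)
      · rintro ⟨b, hb⟩
        obtain ⟨a, ha, h⟩ := IsFirstReturn.exists_preimage hf hb
        refine ⟨⟨a, ha⟩, Subtype.ext ?_⟩
        exact (IsFirstReturn.exists_of_mem hf ha).choose_spec.unique h)

theorem isFirstReturn_firstReturn (f : Equiv.Perm α) (hf : HasFiniteOrbits f) (S : Set α) (a : S) :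
    IsFirstReturn f S a (firstReturn f hf S a) :=
  (IsFirstReturn.exists_of_mem hf a.2).choose_spec

theorem firstReturn_hasFiniteOrbits (f : Equiv.Perm α) (hf : HasFiniteOrbits f) (S : Set α) :
    HasFiniteOrbits (firstReturn f hf S) := by
  have key : ∀ (t : ℕ) (a : S), (f ^ t) a.1 ∈ S →
      ∃ k : ℕ, (((firstReturn f hf S) ^ k) a).1 = (f ^ t) a.1 ∧ (0 < t → 0 < k) := by
    intro t
    induction t using Nat.strong_induction_on with
    | _ t ih =>
      intro a hmem
      rcases Nat.eq_zero_or_pos t with rfl | ht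
      · exact ⟨0, by simp, by simp⟩
      · obtain ⟨-, n, hn, hna, hmin⟩ := isFirstReturn_firstReturn f hf S a
        have hle : n ≤ t := by
          by_contra hlt
          exact hmin t ht (by omega) hmem
        have hsplit : (f ^ (t - n)) (firstReturn f hf S a).1 = (f ^ t) a.1 := by
          rw [← hna, ← Equiv.Perm.mul_apply, ← pow_add]
          congr 2
          omega
        obtain ⟨k, hk, -⟩ := ih (t - n) (by omega) (firstReturn f hf S a) (by rw [hsplit]; exact hmem)
        refine ⟨k + 1, ?_, fun _ => Nat.succ_pos k⟩
        rw [pow_succ, Equiv.Perm.mul_apply, hk, hsplit]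
  intro a
  obtain ⟨n, hn, h⟩ := hf a.1
  obtain ⟨k, hk, hpos⟩ := key n a (by rw [h]; exact a.2)
  exact ⟨k, hpos hn, Subtype.ext (hk.trans h)⟩

theorem IsFirstReturn.map {γ : Type*} {f : Equiv.Perm α} {g : Equiv.Perm γ} (e : α ≃ γ)
    (he : ∀ a, e (f a) = g (e a)) {S : Set α} {S' : Set γ} (hS : ∀ a, a ∈ S ↔ e a ∈ S') {a b : α}
    (h : IsFirstReturn f S a b) : IsFirstReturn g S' (e a) (e b) := by
  have hpow : ∀ (n : ℕ) (a : α), e ((f ^ n) a) = (g ^ n) (e a) := by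
    intro n
    induction n with
    | zero => intro a; rfl
    | succ n ih => intro a; rw [pow_succ, pow_succ, Equiv.Perm.mul_apply, Equiv.Perm.mul_apply, ih, he]
  obtain ⟨hb, n, hn, hnb, hmin⟩ := h
  refine ⟨(hS b).1 hb, n, hn, by rw [← hpow, hnb], fun m hm hlt hmem => ?_⟩
  rw [← hpow] at hmem
  exact hmin m hm hlt ((hS _).2 hmem)

end FirstReturn

/-! ### Rooted maps -/

/-- A locally finite rooted map, i.e. a graph (loops and multiple edges are allowed) drawn on an
oriented surface, given by its rotation system. A dart is an edge with a direction; it starts at its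
origin vertex. `rot d` is the next dart counterclockwise around the origin of `d`, and
`flip d` is the same edge with the opposite direction. The map is rooted at a dart, so that a vertex
(the origin of the root dart) and an edge at this vertex are marked. -/
structure RootedMap where
  Dart : Type
  rot : Equiv.Perm Dart
  flip : Dart → Dart
  flip_flip : ∀ d, flip (flip d) = d
  flip_ne : ∀ d, flip d ≠ d
  finite_orbits : HasFiniteOrbits rot
  root : Dart

namespace RootedMap

variable (G : RootedMap)

/-- Vertices are the orbits of the rotation. -/
def Vertex : Type := Quotient (Equiv.Perm.SameCycle.setoid G.rot)

/-- The origin of a dart; the endpoint of `d` is `G.vert (G.flip d)`. -/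
def vert (d : G.Dart) : G.Vertex := Quotient.mk (Equiv.Perm.SameCycle.setoid G.rot) d

/-- The next dart along the boundary of the face that lies to the right of `d`. -/
def face : Equiv.Perm G.Dart := (Function.Involutive.toPerm G.flip G.flip_flip).trans G.rot

/-- Faces are the orbits of `face`. -/
def Face : Type := Quotient (Equiv.Perm.SameCycle.setoid G.face)

/-- The face to the right of a dart. -/
def faceOf (d : G.Dart) : G.Face := Quotient.mk (Equiv.Perm.SameCycle.setoid G.face) d

/-- The face to the right of `d` is a triangle (its boundary consists of three darts). -/
def IsTriangle (d : G.Dart) : Prop := (G.face ^ 3) d = d ∧ G.face d ≠ d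

/-- The number of triangles. -/
noncomputable def area : ℕ∞ := {f : G.Face | ∃ d, G.faceOf d = f ∧ G.IsTriangle d}.encard

/-- The underlying simple graph on the vertices. -/
def graph : SimpleGraph G.Vertex where
  Adj v w := v ≠ w ∧ ∃ d, G.vert d = v ∧ G.vert (G.flip d) = w
  symm := ⟨by
    rintro v w ⟨hne, d, hv, hw⟩
    exact ⟨hne.symm, G.flip d, hw, by rw [G.flip_flip]; exact hv⟩⟩
  loopless := ⟨fun v h => h.1 rfl⟩

/-- The height of a vertex: its graph distance from the root vertex. -/
noncomputable def height (v : G.Vertex) : ℕ := G.graph.dist (G.vert G.root) v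

/-- The height of the origin of a dart. -/
noncomputable def ht (d : G.Dart) : ℕ := G.height (G.vert d)

/-- The degree of a vertex (a loop counts twice). -/
noncomputable def degree (v : G.Vertex) : ℕ := Nat.card {d // G.vert d = v}

/-- The vertices at height `k` span a cycle: the graph that consists of them and of all edges
joining them is connected and every vertex has degree `2` in it. A loop at a single vertex and a
pair of parallel edges between two vertices count as cycles of length `1` and `2`. -/
def SpansCycle (k : ℕ) : Prop :=
  (G.graph.induce {v | G.height v = k}).Connected ∧
    ∀ v, G.height v = k → Nat.card {d // G.vert d = v ∧ G.ht (G.flip d) = k} = 2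

/-- Closed edge paths, as cyclically composable lists of darts. -/
def IsClosedPath (w : List G.Dart) : Prop :=
  Cycle.Chain (fun d e => G.vert (G.flip d) = G.vert e) (w : Cycle G.Dart)

/-- Elementary homotopies: insertion of an edge that is traversed back and forth, or of the boundary
of a triangle from the collection `F`. -/
inductive HomotopyStep (F : G.Dart → Prop) : List G.Dart → List G.Dart → Prop
  | spur (p q : List G.Dart) (d : G.Dart) :
      HomotopyStep F (p ++ q) (p ++ d :: G.flip d :: q)
  | triangle (p q : List G.Dart) (d : G.Dart) (hd : F d) :
      HomotopyStep F (p ++ q) (p ++ d :: G.face d :: G.face (G.face d) :: q)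

/-- The surface formed by the triangles to the right of the darts in `F` is simply connected:
every closed edge path can be contracted by elementary homotopies. -/
def SimplyConnected (F : G.Dart → Prop) : Prop :=
  ∀ w, G.IsClosedPath w → Relation.EqvGen
    (fun u v => G.IsClosedPath u ∧ G.IsClosedPath v ∧ G.HomotopyStep F u v) w []

/-- The map is a triangulation of the closed disk with the face to the right of `x` as exterior
face: it is finite and connected, all other faces are triangles, the exterior face is bounded by a
simple closed path, and the (compact, oriented) surface formed by the triangles is simply
connected. -/
structure IsDiskTriangulation (x : G.Dart) : Prop where
  finite : Finite G.Dart
  connected : G.graph.Connected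
  triangle : ∀ d, G.faceOf d ≠ G.faceOf x → G.IsTriangle d
  simple_boundary : ∀ d e, G.faceOf d = G.faceOf x → G.faceOf e = G.faceOf x →
    G.vert d = G.vert e → d = e
  simplyConnected : G.SimplyConnected (fun d => G.faceOf d ≠ G.faceOf x)

/-- The map is a triangulation of the plane: it is infinite and connected, all faces are
triangles, and the (non-compact, oriented, boundaryless) surface they form is simply connected. -/
structure IsPlaneTriangulation : Prop where
  infinite : Infinite G.Dart
  connected : G.graph.Connected
  triangle : ∀ d, G.IsTriangle d
  simplyConnected : G.SimplyConnected (fun _ => True)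

/-- Finite causal triangulations of height `h` with exterior face to the right of `x`. Loops are
allowed only as degenerate cycles `S_k`, `k ≥ 1`, so there is none at the root vertex. By convention,
every vertex at height `h` has degree `2` and is contained in a single triangle, and the vertices on
the boundary alternate in height between `h` and `h - 1`. -/
structure IsFiniteCTWith (x : G.Dart) (h : ℕ) : Prop where
  disk : G.IsDiskTriangulation x
  height_le : ∀ v, G.height v ≤ h
  exists_height : ∃ v, G.height v = h
  no_root_loop : ∀ d, G.ht d = 0 → G.ht (G.flip d) ≠ 0
  cycle : ∀ k, 0 < k → k < h → G.SpansCycle k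
  top_vertex : ∀ v, G.height v = h →
    G.degree v = 2 ∧ ∃! d, G.vert d = v ∧ G.faceOf d ≠ G.faceOf x
  alternate : ∀ d, G.faceOf d = G.faceOf x →
    (G.ht d = h ∧ G.ht (G.flip d) + 1 = h) ∨ (G.ht d + 1 = h ∧ G.ht (G.flip d) = h)

/-- Finite causal triangulations (of the disk). -/
def IsFiniteCT : Prop := ∃ x h, G.IsFiniteCTWith x h

/-- Infinite causal triangulations (of the plane). -/
structure IsInfiniteCT : Prop where
  plane : G.IsPlaneTriangulation
  no_root_loop : ∀ d, G.ht d = 0 → G.ht (G.flip d) ≠ 0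
  cycle : ∀ k, 0 < k → G.SpansCycle k

/-- Planar rooted trees whose root vertex has degree `1`: the graph is a tree, and the map has
neither loops nor multiple edges. -/
structure IsRootedTree : Prop where
  tree : G.graph.IsTree
  no_loop : ∀ d, G.vert (G.flip d) ≠ G.vert d
  no_multi : ∀ d e, G.vert d = G.vert e → G.vert (G.flip d) = G.vert (G.flip e) → d = e
  root_degree : G.degree (G.vert G.root) = 1

/-! ### Isomorphisms and balls -/

/-- Isomorphisms of rooted maps (orientation preserving, and respecting the root). -/
structure Iso (G H : RootedMap) where
  toEquiv : G.Dart ≃ H.Dart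
  map_rot : ∀ d, toEquiv (G.rot d) = H.rot (toEquiv d)
  map_flip : ∀ d, toEquiv (G.flip d) = H.flip (toEquiv d)
  map_root : toEquiv G.root = H.root

def Iso.refl (G : RootedMap) : Iso G G := ⟨Equiv.refl _, fun _ => rfl, fun _ => rfl, rfl⟩

def Iso.symm {G H : RootedMap} (e : Iso G H) : Iso H G where
  toEquiv := e.toEquiv.symm
  map_rot d := by rw [Equiv.symm_apply_eq, e.map_rot, Equiv.apply_symm_apply]
  map_flip d := by rw [Equiv.symm_apply_eq, e.map_flip, Equiv.apply_symm_apply]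
  map_root := by rw [Equiv.symm_apply_eq, e.map_root]

def Iso.trans {G H K : RootedMap} (e : Iso G H) (f : Iso H K) : Iso G K where
  toEquiv := e.toEquiv.trans f.toEquiv
  map_rot d := by simp [e.map_rot, f.map_rot]
  map_flip d := by simp [e.map_flip, f.map_flip]
  map_root := by simp [e.map_root, f.map_root]

instance isoSetoid : Setoid RootedMap where
  r G H := Nonempty (Iso G H)
  iseqv := ⟨fun G => ⟨Iso.refl G⟩, fun ⟨e⟩ => ⟨e.symm⟩, fun ⟨e⟩ ⟨f⟩ => ⟨e.trans f⟩⟩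

/-- The darts of the ball of radius `R` around the root vertex, i.e. of the submap spanned by the
vertices of height at most `R`. -/
def ballDarts (R : ℕ) : Set G.Dart := {d | G.ht d ≤ R ∧ G.ht (G.flip d) ≤ R}

theorem flip_mem_ballDarts {R : ℕ} {d : G.Dart} (hd : d ∈ G.ballDarts R) :
    G.flip d ∈ G.ballDarts R := ⟨hd.2, by rw [G.flip_flip]; exact hd.1⟩

/-- The balls of radius `R` of `G` and `H` around the root coincide as rooted planar graphs with a
marked edge (for `R = 0` and no loop at the roots, both are a single vertex). -/
def BallEq (R : ℕ) (G H : RootedMap) : Prop :=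
  ∃ e : G.ballDarts R ≃ H.ballDarts R,
    (∀ d : G.ballDarts R, e (firstReturn G.rot G.finite_orbits (G.ballDarts R) d) =
      firstReturn H.rot H.finite_orbits (H.ballDarts R) (e d)) ∧
    (∀ d : G.ballDarts R,
      e ⟨G.flip d, G.flip_mem_ballDarts d.2⟩ = ⟨H.flip (e d), H.flip_mem_ballDarts (e d).2⟩) ∧
    (∀ d : G.ballDarts R, d.1 = G.root ↔ (e d).1 = H.root)

/-! ### Submaps and pendant edges -/

/-- The submap with dart set `S`, rooted at `r`: all edges outside `S` are deleted. -/
noncomputable def submap (S : Set G.Dart) (hS : ∀ d ∈ S, G.flip d ∈ S) (r : G.Dart) (hr : r ∈ S) :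
    RootedMap where
  Dart := S
  rot := firstReturn G.rot G.finite_orbits S
  flip d := ⟨G.flip d, hS d d.2⟩
  flip_flip d := Subtype.ext (G.flip_flip d)
  flip_ne d h := G.flip_ne d (congrArg Subtype.val h)
  finite_orbits := firstReturn_hasFiniteOrbits _ _ _
  root := ⟨r, hr⟩

open Classical in
/-- The rotation after a new edge has been attached in the corner immediately clockwise of the root
dart. `inr true` is the new dart at the old root vertex, `inr false` is its flip. -/
noncomputable def pendantRot : Equiv.Perm (G.Dart ⊕ Bool) :=
  Equiv.swap (Sum.inl G.root) (Sum.inr true) * Equiv.sumCongr G.rot (Equiv.refl Bool)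

theorem pendantRot_inl (d : G.Dart) : G.pendantRot (Sum.inl d) =
    open Classical in if G.rot d = G.root then Sum.inr true else Sum.inl (G.rot d) := by
  classical
  by_cases h : G.rot d = G.root
  · simp [pendantRot, h]
  · simp only [pendantRot, Equiv.Perm.mul_apply, Equiv.sumCongr_apply, Sum.map_inl, h, if_false]
    rw [Equiv.swap_apply_of_ne_of_ne] <;> simp [h]

theorem pendantRot_true : G.pendantRot (Sum.inr true) = Sum.inl G.root := by
  classical simp [pendantRot]

theorem pendantRot_false : G.pendantRot (Sum.inr false) = Sum.inr false := by
  classical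
  simp only [pendantRot, Equiv.Perm.mul_apply, Equiv.sumCongr_apply, Sum.map_inr, Equiv.refl_apply]
  rw [Equiv.swap_apply_of_ne_of_ne] <;> simp

theorem pendantRot_hasFiniteOrbits : HasFiniteOrbits G.pendantRot := by
  classical
  have horb : ∀ d : G.Dart, {e | ∃ k : ℕ, (G.rot ^ k) d = e}.Finite := by
    intro d
    obtain ⟨n, hn, h⟩ := G.finite_orbits d
    refine ((Set.finite_lt_nat n).image fun k => (G.rot ^ k) d).subset ?_
    rintro e ⟨k, rfl⟩
    refine ⟨k % n, Nat.mod_lt _ hn, ?_⟩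
    have hfix : ∀ j : ℕ, ((G.rot ^ n) ^ j) d = d := by
      intro j
      induction j with
      | zero => rfl
      | succ j ih => rw [pow_succ, Equiv.Perm.mul_apply, h, ih]
    conv_rhs => rw [← Nat.mod_add_div k n, pow_add, Equiv.Perm.mul_apply, pow_mul, hfix]
  have hsucc : ∀ d e : G.Dart, (∃ k : ℕ, (G.rot ^ k) d = e) → ∃ k : ℕ, (G.rot ^ k) d = G.rot e := by
    rintro d e ⟨k, rfl⟩
    exact ⟨k + 1, by rw [pow_succ', Equiv.Perm.mul_apply]⟩
  have main : ∀ d : G.Dart, ∃ A : Set (G.Dart ⊕ Bool), A.Finite ∧ Sum.inl d ∈ A ∧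
      (∀ b, Sum.inr b ∈ A) ∧ ∀ x ∈ A, G.pendantRot x ∈ A := by
    intro d
    refine ⟨Sum.inl '' {e | ∃ k : ℕ, (G.rot ^ k) d = e} ∪
      Sum.inl '' {e | ∃ k : ℕ, (G.rot ^ k) G.root = e} ∪ Set.range Sum.inr,
      (((horb d).image _).union ((horb _).image _)).union (Set.finite_range _),
      Or.inl (Or.inl ⟨d, ⟨0, rfl⟩, rfl⟩), fun b => Or.inr ⟨b, rfl⟩, ?_⟩
    rintro x ((⟨e, he, rfl⟩ | ⟨e, he, rfl⟩) | ⟨b, rfl⟩)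
    · rw [pendantRot_inl]
      split_ifs
      · exact Or.inr ⟨_, rfl⟩
      · exact Or.inl (Or.inl ⟨_, hsucc _ _ he, rfl⟩)
    · rw [pendantRot_inl]
      split_ifs
      · exact Or.inr ⟨_, rfl⟩
      · exact Or.inl (Or.inr ⟨_, hsucc _ _ he, rfl⟩)
    · cases b
      · rw [pendantRot_false]; exact Or.inr ⟨_, rfl⟩
      · rw [pendantRot_true]; exact Or.inl (Or.inr ⟨_, ⟨0, rfl⟩, rfl⟩)
  have fin : ∀ (A : Set (G.Dart ⊕ Bool)), A.Finite → (∀ x ∈ A, G.pendantRot x ∈ A) →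
      ∀ x ∈ A, ∃ n : ℕ, 0 < n ∧ (G.pendantRot ^ n) x = x := by
    intro A hA hmaps x hx
    have hmem : ∀ n : ℕ, (G.pendantRot ^ n) x ∈ A := by
      intro n
      induction n with
      | zero => exact hx
      | succ n ih => rw [pow_succ', Equiv.Perm.mul_apply]; exact hmaps _ ih
    obtain ⟨i, -, j, -, hij, heq⟩ := Set.infinite_univ.exists_ne_map_eq_of_mapsTo
      (f := fun n : ℕ => (G.pendantRot ^ n) x) (fun n _ => hmem n) hA
    have key : ∀ i j : ℕ, i < j → (G.pendantRot ^ i) x = (G.pendantRot ^ j) x →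
        ∃ n : ℕ, 0 < n ∧ (G.pendantRot ^ n) x = x := by
      intro i j hlt heq
      refine ⟨j - i, by omega, (G.pendantRot ^ i).injective ?_⟩
      rw [heq, ← Equiv.Perm.mul_apply, ← pow_add]
      congr 2
      omega
    rcases lt_or_gt_of_ne hij with hlt | hlt
    · exact key i j hlt heq
    · exact key j i hlt heq.symm
  rintro (d | b)
  · obtain ⟨A, hA, hd, -, hmaps⟩ := main d
    exact fin A hA hmaps _ hd
  · obtain ⟨A, hA, -, hb, hmaps⟩ := main G.root
    exact fin A hA hmaps _ (hb b)

/-- The map obtained by attaching a new vertex `r` to the root vertex by an edge which is placed in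
the corner immediately clockwise of (i.e. to the right of) the root dart. The new root is the dart
from `r` to the old root vertex. -/
noncomputable def addPendant : RootedMap where
  Dart := G.Dart ⊕ Bool
  rot := G.pendantRot
  flip := Sum.map G.flip not
  flip_flip := by rintro (d | b) <;> simp [G.flip_flip]
  flip_ne := by rintro (d | b) <;> simp [G.flip_ne]
  finite_orbits := G.pendantRot_hasFiniteOrbits
  root := Sum.inr false

/-! ### The map `β` -/

/-- `d` points from its origin to a vertex one step further from the root. -/
def IsForward (d : G.Dart) : Prop := G.ht (G.flip d) = G.ht d + 1

/-- `d` is the rightmost forward dart at its origin, as seen from there: the dart that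
precedes it counterclockwise is not a forward dart. -/
def IsRightmostForward (d : G.Dart) : Prop := G.IsForward d ∧ ¬ G.IsForward (G.rot.symm d)

/-- The origin of `d` is a vertex of maximal height. -/
def IsTop (d : G.Dart) : Prop := ∀ e, G.ht e ≤ G.ht d

/-- The edges deleted by `β`: edges joining vertices at the same height, edges containing a vertex of
maximal height, and for each vertex other than the root vertex its rightmost forward edge. -/
def Deleted (d : G.Dart) : Prop :=
  G.ht (G.flip d) = G.ht d ∨ G.IsTop d ∨ G.IsTop (G.flip d) ∨
    (0 < G.ht d ∧ G.IsRightmostForward d) ∨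
    (0 < G.ht (G.flip d) ∧ G.IsRightmostForward (G.flip d))

theorem Deleted.of_flip {d : G.Dart} (h : G.Deleted (G.flip d)) : G.Deleted d := by
  unfold Deleted at *
  rw [G.flip_flip] at h
  rcases h with h | h | h | h | h
  · exact Or.inl h.symm
  · exact Or.inr (Or.inr (Or.inl h))
  · exact Or.inr (Or.inl h)
  · exact Or.inr (Or.inr (Or.inr (Or.inr h)))
  · exact Or.inr (Or.inr (Or.inr (Or.inl h)))

/-- The darts of `β(G)`: the darts of `G` that are not deleted, and the two darts of the new edge
between the new root `r` and the root vertex of `G`. -/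
def betaDarts : Set G.addPendant.Dart := {x | ∀ d : G.Dart, x = Sum.inl d → ¬ G.Deleted d}

theorem flip_mem_betaDarts : ∀ x ∈ G.betaDarts, G.addPendant.flip x ∈ G.betaDarts := by
  rintro (d | b) hx e he
  · have : G.flip d = e := Sum.inl.inj he
    subst this
    exact fun h => hx d rfl h.of_flip
  · cases he

theorem root_mem_betaDarts : G.addPendant.root ∈ G.betaDarts := by
  intro e he
  cases he

/-- The construction of the planar rooted tree `β(G)` from a causal triangulation `G`. -/
noncomputable def beta : RootedMap :=
  G.addPendant.submap G.betaDarts G.flip_mem_betaDarts G.addPendant.root G.root_mem_betaDarts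

/-! ### `β` respects isomorphisms -/

section Invariance

variable {G} {H : RootedMap}

theorem Iso.map_rot_symm (e : Iso G H) (d : G.Dart) :
    e.toEquiv (G.rot.symm d) = H.rot.symm (e.toEquiv d) := by
  rw [Equiv.eq_symm_apply, ← e.map_rot, Equiv.apply_symm_apply]

theorem Iso.sameCycle (e : Iso G H) {d d' : G.Dart} (h : G.rot.SameCycle d d') :
    H.rot.SameCycle (e.toEquiv d) (e.toEquiv d') := by
  obtain ⟨k, rfl⟩ := h
  refine ⟨k, ?_⟩
  have hs : H.rot = e.toEquiv.permCongr G.rot := by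
    ext x
    rw [Equiv.permCongr_apply, e.map_rot, Equiv.apply_symm_apply]
  have hz : ∀ k : ℤ, H.rot ^ k = e.toEquiv.permCongr (G.rot ^ k) := by
    intro k
    rw [hs]
    exact (map_zpow e.toEquiv.permCongrHom G.rot k).symm
  rw [hz, Equiv.permCongr_apply, Equiv.symm_apply_apply]

/-- The map on vertices. -/
def Iso.vertexMap (e : Iso G H) : G.Vertex → H.Vertex :=
  Quotient.map e.toEquiv fun _ _ h => e.sameCycle h

theorem Iso.vertexMap_vert (e : Iso G H) (d : G.Dart) :
    e.vertexMap (G.vert d) = H.vert (e.toEquiv d) := rfl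

theorem Iso.vertexMap_symm (e : Iso G H) (v : G.Vertex) : e.symm.vertexMap (e.vertexMap v) = v := by
  induction v using Quotient.inductionOn with
  | _ d =>
    change G.vert (e.toEquiv.symm (e.toEquiv d)) = G.vert d
    rw [Equiv.symm_apply_apply]

/-- The graph homomorphism induced by an isomorphism. -/
def Iso.graphHom (e : Iso G H) : G.graph →g H.graph where
  toFun := e.vertexMap
  map_rel' := by
    rintro v w ⟨hne, d, rfl, rfl⟩
    refine ⟨fun h => hne ?_, e.toEquiv d, rfl, ?_⟩
    · rw [← e.vertexMap_symm (G.vert d), h, e.vertexMap_symm]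
    · rw [e.vertexMap_vert, e.map_flip]

theorem Iso.dist_le (e : Iso G H) {v w : G.Vertex} (h : G.graph.Reachable v w) :
    H.graph.dist (e.vertexMap v) (e.vertexMap w) ≤ G.graph.dist v w := by
  obtain ⟨p, hp⟩ := h.exists_walk_length_eq_dist
  rw [← hp, ← SimpleGraph.Walk.length_map e.graphHom p]
  exact SimpleGraph.dist_le _

theorem Iso.dist_eq (e : Iso G H) (v w : G.Vertex) :
    H.graph.dist (e.vertexMap v) (e.vertexMap w) = G.graph.dist v w := by
  by_cases h : G.graph.Reachable v w
  · refine le_antisymm (e.dist_le h) ?_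
    have h' : H.graph.Reachable (e.vertexMap v) (e.vertexMap w) := h.map e.graphHom
    have := e.symm.dist_le h'
    rwa [e.vertexMap_symm, e.vertexMap_symm] at this
  · have h' : ¬ H.graph.Reachable (e.vertexMap v) (e.vertexMap w) := by
      intro hr
      apply h
      have : G.graph.Reachable (e.symm.vertexMap (e.vertexMap v))
          (e.symm.vertexMap (e.vertexMap w)) := hr.map e.symm.graphHom
      rwa [e.vertexMap_symm, e.vertexMap_symm] at this
    rw [SimpleGraph.dist_eq_zero_of_not_reachable h, SimpleGraph.dist_eq_zero_of_not_reachable h']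

theorem Iso.ht_eq (e : Iso G H) (d : G.Dart) : H.ht (e.toEquiv d) = G.ht d := by
  unfold ht height
  rw [← e.map_root, ← e.vertexMap_vert, ← e.vertexMap_vert, e.dist_eq]

theorem Iso.isForward_iff (e : Iso G H) (d : G.Dart) : H.IsForward (e.toEquiv d) ↔ G.IsForward d := by
  unfold IsForward
  rw [← e.map_flip, e.ht_eq, e.ht_eq]

theorem Iso.isRightmostForward_iff (e : Iso G H) (d : G.Dart) :
    H.IsRightmostForward (e.toEquiv d) ↔ G.IsRightmostForward d := by
  unfold IsRightmostForward
  rw [← e.map_rot_symm, e.isForward_iff, e.isForward_iff]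

theorem Iso.isTop_iff (e : Iso G H) (d : G.Dart) : H.IsTop (e.toEquiv d) ↔ G.IsTop d := by
  unfold IsTop
  rw [e.toEquiv.surjective.forall]
  simp only [e.ht_eq]

theorem Iso.deleted_iff (e : Iso G H) (d : G.Dart) : H.Deleted (e.toEquiv d) ↔ G.Deleted d := by
  unfold Deleted
  rw [← e.map_flip]
  simp only [e.ht_eq, e.isRightmostForward_iff, e.isTop_iff]

/-- Attaching the new edge respects isomorphisms. -/
def Iso.addPendant (e : Iso G H) : Iso G.addPendant H.addPendant where
  toEquiv := Equiv.sumCongr e.toEquiv (Equiv.refl Bool)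
  map_rot := by
    rintro (d | b)
    · change _ = H.pendantRot (Sum.inl (e.toEquiv d))
      change Equiv.sumCongr e.toEquiv (Equiv.refl Bool) (G.pendantRot (Sum.inl d)) = _
      rw [pendantRot_inl, pendantRot_inl, ← e.map_rot, ← e.map_root]
      by_cases h : G.rot d = G.root
      · simp [h]
      · simp [h]
    · change Equiv.sumCongr e.toEquiv (Equiv.refl Bool) (G.pendantRot (Sum.inr b)) =
        H.pendantRot (Sum.inr b)
      cases b
      · rw [pendantRot_false, pendantRot_false]; rfl
      · rw [pendantRot_true, pendantRot_true, ← e.map_root]; rfl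
  map_flip := by
    rintro (d | b)
    · exact congrArg Sum.inl (e.map_flip d)
    · rfl
  map_root := rfl

theorem Iso.mem_betaDarts_iff (e : Iso G H) (x : G.addPendant.Dart) :
    x ∈ G.betaDarts ↔ e.addPendant.toEquiv x ∈ H.betaDarts := by
  rcases x with d | b
  · constructor
    · intro h d' hd'
      have : e.toEquiv d = d' := Sum.inl.inj hd'
      subst this
      rw [e.deleted_iff]
      exact h d rfl
    · intro h d' hd'
      have : d = d' := Sum.inl.inj hd'
      subst this
      rw [← e.deleted_iff]
      exact h _ rfl
  · constructor
    · intro _ d' hd'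
      cases hd'
    · intro _ d' hd'
      cases hd'

/-- `β` respects isomorphisms. -/
def Iso.beta (e : Iso G H) : Iso G.beta H.beta where
  toEquiv := e.addPendant.toEquiv.subtypeEquiv e.mem_betaDarts_iff
  map_rot d := by
    apply Subtype.ext
    have h1 := isFirstReturn_firstReturn G.addPendant.rot G.addPendant.finite_orbits G.betaDarts d
    have h2 := h1.map e.addPendant.toEquiv e.addPendant.map_rot e.mem_betaDarts_iff
    exact h2.unique (isFirstReturn_firstReturn H.addPendant.rot H.addPendant.finite_orbits
      H.betaDarts (e.addPendant.toEquiv.subtypeEquiv e.mem_betaDarts_iff d))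
  map_flip d := Subtype.ext (e.addPendant.map_flip d.1)
  map_root := Subtype.ext e.addPendant.map_root

end Invariance

end RootedMap

/-! ### The spaces of causal triangulations and of trees -/

/-- Isomorphism classes of locally finite rooted maps. -/
def MapClass : Type 1 := Quotient RootedMap.isoSetoid

namespace MapClass

/-- The class of a map. -/
def of (G : RootedMap) : MapClass := Quotient.mk RootedMap.isoSetoid G

/-- `β` on isomorphism classes. -/
noncomputable def beta : MapClass → MapClass :=
  Quotient.map RootedMap.beta fun _ _ ⟨e⟩ => ⟨e.beta⟩

/-- The set `𝒞` of (classes of) causal triangulations, finite or infinite. -/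
def causal : Set MapClass := {x | ∃ G, of G = x ∧ (G.IsFiniteCT ∨ G.IsInfiniteCT)}

/-- The set `𝒯` of (classes of) planar rooted trees, finite or infinite, with root of degree `1` and
all degrees finite. -/
def trees : Set MapClass := {x | ∃ G, of G = x ∧ G.IsRootedTree}

/-- The balls of radius `R` coincide. -/
def BallEq (R : ℕ) (x y : MapClass) : Prop :=
  ∃ G H, of G = x ∧ of H = y ∧ RootedMap.BallEq R G H

end MapClass

/-- `𝒞`: causal triangulations up to isomorphism. -/
def CT : Type 1 := MapClass.causal

/-- `𝒯`: planar rooted trees up to isomorphism. -/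
def PlaneTree : Type 1 := MapClass.trees

/-- The topology of a metric `dist`: a set is open if with each point it contains a ball around
it. -/
abbrev topologyOfDist {X : Type*} (dist : X → X → ℝ) : TopologicalSpace X where
  IsOpen U := ∀ x ∈ U, ∃ ε > 0, ∀ y, dist x y < ε → y ∈ U
  isOpen_univ _ _ := ⟨1, one_pos, fun _ _ => trivial⟩
  isOpen_inter U V hU hV x hx := by
    obtain ⟨ε, hε, h⟩ := hU x hx.1
    obtain ⟨δ, hδ, h'⟩ := hV x hx.2
    exact ⟨min ε δ, lt_min hε hδ, fun y hy =>
      ⟨h y (hy.trans_le (min_le_left _ _)), h' y (hy.trans_le (min_le_right _ _))⟩⟩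
  isOpen_sUnion s hs x hx := by
    obtain ⟨U, hU, hxU⟩ := hx
    obtain ⟨ε, hε, h⟩ := hs U hU x hxU
    exact ⟨ε, hε, fun y hy => ⟨U, hU, h y hy⟩⟩

/-- `dist` is a metric. -/
def IsMetric {X : Type*} (dist : X → X → ℝ) : Prop :=
  (∀ x y, dist x y = 0 ↔ x = y) ∧ (∀ x y, dist x y = dist y x) ∧
    ∀ x y z, dist x z ≤ dist x y + dist y z

namespace CT

/-- Infinite causal triangulations. -/
def infinite : Set CT := {x | ∃ G, MapClass.of G = x.1 ∧ G.IsInfiniteCT}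

/-- Finite causal triangulations. -/
def finite : Set CT := {x | ∃ G, MapClass.of G = x.1 ∧ G.IsFiniteCT}

/-- `𝒞_N`: finite causal triangulations of area `2N`. -/
def ofArea (N : ℕ) : Set CT :=
  {x | ∃ G, MapClass.of G = x.1 ∧ G.IsFiniteCT ∧ G.area = ((2 * N : ℕ) : ℕ∞)}

/-- `d_𝒞(G, G') = inf {1 / (R + 1) : B_R(G) = B_R(G')}`. -/
noncomputable def dist (x y : CT) : ℝ :=
  sInf {t : ℝ | ∃ R : ℕ, MapClass.BallEq R x.1 y.1 ∧ t = 1 / ((R : ℝ) + 1)}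

noncomputable instance : TopologicalSpace CT := topologyOfDist dist

noncomputable instance : MeasurableSpace CT := borel CT

instance : BorelSpace CT := ⟨rfl⟩

/-- The uniform distribution `ρ_N` on causal triangulations of area `2N`. -/
noncomputable def unif (N : ℕ) : Measure CT := ProbabilityTheory.uniformOn (ofArea N)

end CT

namespace PlaneTree

/-- Infinite trees. -/
def infinite : Set PlaneTree :=
  {x | ∃ G, MapClass.of G = x.1 ∧ G.IsRootedTree ∧ Infinite G.Vertex}

/-- `𝒯_N`: trees with `N` edges. -/
def ofSize (N : ℕ) : Set PlaneTree :=
  {x | ∃ G, MapClass.of G = x.1 ∧ G.IsRootedTree ∧ G.graph.edgeSet.encard = (N : ℕ∞)}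

/-- `d_𝒯(T, T') = 1 / R`, where `R` is the radius of the largest ball common to `T` and `T'`
(and `d_𝒯(T, T) = 0`). Balls of radius `1` always coincide. -/
noncomputable def dist (x y : PlaneTree) : ℝ :=
  sInf {t : ℝ | ∃ R : ℕ, 1 ≤ R ∧ MapClass.BallEq R x.1 y.1 ∧ t = 1 / (R : ℝ)}

noncomputable instance : TopologicalSpace PlaneTree := topologyOfDist dist

noncomputable instance : MeasurableSpace PlaneTree := borel PlaneTree

instance : BorelSpace PlaneTree := ⟨rfl⟩

/-- The uniform distribution `ν_N` on trees with `N` edges. -/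
noncomputable def unif (N : ℕ) : Measure PlaneTree := ProbabilityTheory.uniformOn (ofSize N)

end PlaneTree

/-- `μ` is a probability measure and the measures `μs N` converge weakly to it as `N → ∞`. -/
def IsWeakLimit {X : Type*} [TopologicalSpace X] [MeasurableSpace X] (μs : ℕ → Measure X)
    (μ : Measure X) : Prop :=
  IsProbabilityMeasure μ ∧
    ∀ f : X →ᵇ ℝ, Tendsto (fun N => ∫ x, f x ∂(μs N)) atTop (𝓝 (∫ x, f x ∂μ))

/-! ### Orbits and first returns -/

section FirstReturnLemmas

variable {α : Type*} {f : Equiv.Perm α}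

/-! Trees and causal triangulations are described by the same data, and every assertion is read off
from these data.

Number the vertices of a tree other than `r` level by level, counterclockwise within each level, and
let `num i` be the number of children of the vertex `i`. A `LayerCode` consists of such numbers for
an infinite tree and of a height `h` at which this tree is cut; from the last levels on all numbers
are `1`, which makes the code unique. To draw a triangulation, the vertices of every level `k ≥ 1`
are joined to a cycle, and each vertex other than the root vertex receives one more edge, to the
right of the edges to its children. It ends at `target`, the vertex that precedes these children in
the cyclic order of the next level. The annuli between the cycles are then filled with triangles.
All these edges live in one map, `ambient`; the triangulation `ct` (levels up to `h`) and the tree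
`tree` (levels below `h`) are submaps of it, with rotations given by first returns. Since `β`
deletes the horizontal edges, the additional edges and the top level, `β` of `ct` is `tree`
(`nonempty_iso_beta`). Every triangle has exactly one horizontal side, so for `h = k` the area is `2
* (first k - 1)`, whereas the tree has `first k` edges; this gives the shift from `N` to `N + 1`.
Only `h = 1`, the tree with one edge, belongs to no triangulation.

Conversely, all trees and all causal triangulations have a code (`IsRootedTree.exists_iso_tree`,
`IsCausal.exists_iso_ct`). For a triangulation, the triangles and the fact that only two darts at a
vertex are horizontal force the cyclic order right, forward, left, backward around each vertex on a
cycle. The forward darts that are not rightmost are the tree edges, and an induction over the levels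
shows that the remaining edges end where the code says (`IsLabeling.left_eq_right`).

The balls of radius `R` in two triangulations coincide exactly if the codes agree up to level `R`
(`ballEq_ct_iff`), and the same holds for the balls of radius `R + 1` in the trees
(`ballEq_tree_iff`). Hence `β` is an isometry, and both distances are metrics because the distance
of codes is one.

For the limits, a tree with `N` edges is explored breadth first. The number of unexplored vertices
is a walk that starts at `1` and first reaches `0` after `N` steps. Such walks are counted by ballot
numbers, and the Catalan asymptotics give the limit of the probability of every cylinder
(`tendsto_uniformOn_cylinder`). The limits are the cylinder probabilities of `law`, a Markov chain
conditioned to survive, so the words converge weakly and the limit is almost surely infinite. The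
map from words to trees is continuous (`continuous_ofWord`), which gives `ν`. The range of `β` is
open and closed, so a left inverse of `β` is continuous too (`continuous_toCT`), and it carries `ν`
to `ρ`. -/

theorem HasFiniteOrbits.exists_pow_eq (hf : HasFiniteOrbits f) {a b : α} (h : f.SameCycle a b) :
    ∃ n : ℕ, (f ^ n) a = b := by
  obtain ⟨k, rfl⟩ := h
  obtain ⟨n, hn, hna⟩ := hf a
  have hn' : (n : ℤ) ≠ 0 := by omega
  have hz : ∀ q : ℤ, (f ^ ((n : ℤ) * q)) a = a := by
    intro q
    rw [zpow_mul, zpow_natCast]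
    exact Function.IsFixedPt.perm_zpow (e := f ^ n) hna q
  refine ⟨(k % n).toNat, ?_⟩
  rw [← zpow_natCast, Int.toNat_of_nonneg (Int.emod_nonneg _ hn')]
  conv_rhs => rw [← Int.emod_add_mul_ediv k n, zpow_add, Equiv.Perm.mul_apply, hz]

theorem sameCycle_iterate (f : Equiv.Perm α) (n : ℕ) (a : α) : f.SameCycle a ((f ^ n) a) :=
  ⟨n, by simp⟩

/-- A set that is closed under `f` is closed under the orbits of `f`. -/
theorem HasFiniteOrbits.induction (hf : HasFiniteOrbits f) {P : α → Prop}
    (hP : ∀ a, P a → P (f a)) {a b : α} (h : f.SameCycle a b) (ha : P a) : P b := by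
  obtain ⟨n, rfl⟩ := hf.exists_pow_eq h
  induction n with
  | zero => exact ha
  | succ n ih => rw [pow_succ']; exact hP _ (ih (sameCycle_iterate f n a))

theorem isFirstReturn_of_apply_mem {S : Set α} {a : α} (h : f a ∈ S) : IsFirstReturn f S a (f a) :=
  ⟨h, 1, one_pos, rfl, fun m h0 h1 => by omega⟩

/-- First returns are computed below by following the orbit dart by dart past the elements outside
`S`; this is one such step. -/
theorem IsFirstReturn.step {S : Set α} {a b : α} (h : f a ∉ S) (h' : IsFirstReturn f S (f a) b) :
    IsFirstReturn f S a b := by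
  obtain ⟨hb, n, hn, rfl, hmin⟩ := h'
  refine ⟨hb, n + 1, n.succ_pos, by rw [pow_succ, Equiv.Perm.mul_apply], fun m hm hlt => ?_⟩
  obtain ⟨m, rfl⟩ : ∃ k, m = k + 1 := ⟨m - 1, by omega⟩
  rw [pow_succ, Equiv.Perm.mul_apply]
  rcases Nat.eq_zero_or_pos m with rfl | hm'
  · exact h
  · exact hmin m hm' (by omega)

theorem firstReturn_eq (hf : HasFiniteOrbits f) {S : Set α} {a : S} {b : α}
    (h : IsFirstReturn f S a b) : (firstReturn f hf S a).1 = b :=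
  (isFirstReturn_firstReturn f hf S a).unique h

theorem firstReturn_of_apply_mem (hf : HasFiniteOrbits f) {S : Set α} {a : S} (h : f a ∈ S) :
    (firstReturn f hf S a).1 = f a :=
  firstReturn_eq hf (isFirstReturn_of_apply_mem h)

theorem sameCycle_firstReturn_self (hf : HasFiniteOrbits f) (S : Set α) (a : S) :
    f.SameCycle a.1 (firstReturn f hf S a).1 := by
  obtain ⟨-, n, -, h, -⟩ := isFirstReturn_firstReturn f hf S a
  exact ⟨n, by simpa using h⟩

theorem exists_pow_firstReturn_eq (hf : HasFiniteOrbits f) (S : Set α) (t : ℕ) :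
    ∀ a : S, (f ^ t) a.1 ∈ S → ∃ k : ℕ, (((firstReturn f hf S) ^ k) a).1 = (f ^ t) a.1 := by
  induction t using Nat.strong_induction_on with
  | _ t ih =>
    intro a hmem
    rcases Nat.eq_zero_or_pos t with rfl | ht
    · exact ⟨0, rfl⟩
    · obtain ⟨-, n, hn, hna, hmin⟩ := isFirstReturn_firstReturn f hf S a
      have hle : n ≤ t := by
        by_contra hlt
        exact hmin t ht (by omega) hmem
      have hsplit : (f ^ (t - n)) (firstReturn f hf S a).1 = (f ^ t) a.1 := by
        rw [← hna, ← Equiv.Perm.mul_apply, ← pow_add]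
        congr 2
        omega
      obtain ⟨k, hk⟩ := ih (t - n) (by omega) (firstReturn f hf S a) (by rw [hsplit]; exact hmem)
      exact ⟨k + 1, by rw [pow_succ, Equiv.Perm.mul_apply, hk, hsplit]⟩

/-- Consequently the deletion of edges changes neither the remaining vertices nor which darts start
at them. -/
theorem sameCycle_firstReturn_iff (hf : HasFiniteOrbits f) (S : Set α) (a b : S) :
    (firstReturn f hf S).SameCycle a b ↔ f.SameCycle a.1 b.1 := by
  constructor
  · intro h
    exact (firstReturn_hasFiniteOrbits f hf S).induction (P := fun c => f.SameCycle a.1 c.1)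
      (fun c hc => hc.trans (sameCycle_firstReturn_self hf S c)) h (Equiv.Perm.SameCycle.refl _ _)
  · intro h
    obtain ⟨n, hn⟩ := hf.exists_pow_eq h
    obtain ⟨k, hk⟩ := exists_pow_firstReturn_eq hf S n a (by rw [hn]; exact b.2)
    exact ⟨k, Subtype.ext (by rw [zpow_natCast, hk, hn])⟩

/-- A first return of a first return map is a first return of the original map. -/
theorem IsFirstReturn.of_firstReturn (hf : HasFiniteOrbits f) {S U : Set α} (hU : U ⊆ S)
    {a b : S} (h : IsFirstReturn (firstReturn f hf S) {x | x.1 ∈ U} a b) :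
    IsFirstReturn f U a.1 b.1 := by
  obtain ⟨hb, k, hk, rfl, hmin⟩ := h
  refine ⟨hb, ?_⟩
  clear hb
  induction k generalizing a with
  | zero => omega
  | succ k ih =>
    obtain ⟨-, n, hn, hna, hn'⟩ := isFirstReturn_firstReturn f hf S a
    rcases Nat.eq_zero_or_pos k with rfl | hk'
    · exact ⟨n, hn, by simpa using hna, fun m h1 h2 h3 => hn' m h1 h2 (hU h3)⟩
    · obtain ⟨l, hl, hl', hl''⟩ := ih (a := firstReturn f hf S a) hk' (by
        intro m h1 h2
        have := hmin (m + 1) (by omega) (by omega)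
        rwa [pow_succ, Equiv.Perm.mul_apply] at this)
      refine ⟨l + n, by omega, ?_, ?_⟩
      · rw [pow_add, Equiv.Perm.mul_apply, hna, hl', pow_succ, Equiv.Perm.mul_apply]
      · intro m h1 h2 h3
        -- Before time `n` the orbit avoids all of `S`; at time `n` it is at an element of `S` which
        -- `hmin` excludes from `U`; later times belong to the induction hypothesis.
        rcases lt_trichotomy m n with h4 | rfl | h4
        · exact hn' m h1 h4 (hU h3)
        · have := hmin 1 one_pos (by omega)
          rw [pow_one] at this
          rw [hna] at h3
          exact this h3
        · refine hl'' (m - n) (by omega) (by omega) ?_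
          rw [← hna, ← Equiv.Perm.mul_apply, ← pow_add, Nat.sub_add_cancel h4.le]
          exact h3
/-- The first element of an orbit that violates `P`. -/
theorem HasFiniteOrbits.exists_run (hf : HasFiniteOrbits f) {P : α → Prop} {a b : α}
    (h : f.SameCycle a b) (ha : P a) (hb : ¬ P b) :
    ∃ n : ℕ, (∀ m ≤ n, P ((f ^ m) a)) ∧ ¬ P ((f ^ (n + 1)) a) := by
  classical
  have hex : ∃ n : ℕ, ¬ P ((f ^ n) a) := by
    obtain ⟨n, rfl⟩ := hf.exists_pow_eq h
    exact ⟨n, hb⟩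
  obtain ⟨k, hk⟩ : ∃ k, Nat.find hex = k + 1 := by
    refine ⟨Nat.find hex - 1, ?_⟩
    have : Nat.find hex ≠ 0 := by
      intro h0
      have := Nat.find_spec hex
      rw [h0] at this
      exact this ha
    omega
  refine ⟨k, fun m hm => ?_, hk ▸ Nat.find_spec hex⟩
  by_contra hcon
  exact Nat.find_min hex (m := m) (by omega) hcon

/-- If the iterates of `a` satisfy `P` until they return to `a`, then so does the whole orbit. -/
theorem HasFiniteOrbits.forall_of_return (hf : HasFiniteOrbits f) {P : α → Prop} {a b : α} {n : ℕ}
    (hn : 0 < n) (ha : (f ^ n) a = a) (h : ∀ m, 0 < m → m < n → P ((f ^ m) a))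
    (hab : f.SameCycle a b) : b = a ∨ P b := by
  obtain ⟨k, rfl⟩ := hf.exists_pow_eq hab
  have hmod : (f ^ k) a = (f ^ (k % n)) a := by
    conv_lhs => rw [← Nat.mod_add_div k n, pow_add, Equiv.Perm.mul_apply, pow_mul]
    congr 1
    exact Function.IsFixedPt.perm_pow (e := f ^ n) ha _
  rw [hmod]
  rcases Nat.eq_zero_or_pos (k % n) with h0 | h0
  · left; rw [h0]; rfl
  · right; exact h _ h0 (Nat.mod_lt _ hn)

theorem HasFiniteOrbits.symm (hf : HasFiniteOrbits f) : HasFiniteOrbits f⁻¹ := by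
  intro a
  obtain ⟨n, hn, h⟩ := hf a
  exact ⟨n, hn, by rw [inv_pow, Equiv.Perm.inv_eq_iff_eq, h]⟩

end FirstReturnLemmas

/-! ### Heights, connectedness and homomorphisms of rooted maps -/

namespace RootedMap

variable {G H K : RootedMap}

theorem vert_eq_iff {d e : G.Dart} : G.vert d = G.vert e ↔ G.rot.SameCycle d e := Quotient.eq

theorem faceOf_eq_iff {d e : G.Dart} : G.faceOf d = G.faceOf e ↔ G.face.SameCycle d e := Quotient.eq

theorem vert_rot (d : G.Dart) : G.vert (G.rot d) = G.vert d :=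
  vert_eq_iff.2 ⟨-1, by simp⟩

theorem vert_rot_symm (d : G.Dart) : G.vert (G.rot.symm d) = G.vert d :=
  vert_eq_iff.2 ⟨1, by simp⟩

theorem vert_rot_pow (n : ℕ) (d : G.Dart) : G.vert ((G.rot ^ n) d) = G.vert d :=
  (vert_eq_iff.2 (sameCycle_iterate _ _ _)).symm

theorem faceOf_face (d : G.Dart) : G.faceOf (G.face d) = G.faceOf d :=
  faceOf_eq_iff.2 ⟨-1, by simp⟩

theorem face_apply (d : G.Dart) : G.face d = G.rot (G.flip d) := rfl

theorem vert_face (d : G.Dart) : G.vert (G.face d) = G.vert (G.flip d) := vert_rot _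

theorem exists_vert (v : G.Vertex) : ∃ d, G.vert d = v := Quotient.exists_rep v

theorem ht_congr {d e : G.Dart} (h : G.vert d = G.vert e) : G.ht d = G.ht e := by
  unfold ht; rw [h]

theorem ht_rot (d : G.Dart) : G.ht (G.rot d) = G.ht d := ht_congr (vert_rot d)

theorem ht_rot_symm (d : G.Dart) : G.ht (G.rot.symm d) = G.ht d := ht_congr (vert_rot_symm d)

theorem ht_rot_pow (n : ℕ) (d : G.Dart) : G.ht ((G.rot ^ n) d) = G.ht d :=
  ht_congr (vert_rot_pow n d)

theorem ht_root : G.ht G.root = 0 := SimpleGraph.dist_self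

theorem flip_injective : Function.Injective G.flip :=
  fun a b h => by rw [← G.flip_flip a, h, G.flip_flip]

theorem ht_flip_le (hG : G.graph.Connected) (d : G.Dart) : G.ht (G.flip d) ≤ G.ht d + 1 := by
  by_cases h : G.vert d = G.vert (G.flip d)
  · rw [ht_congr h]; omega
  · have hadj : G.graph.Adj (G.vert d) (G.vert (G.flip d)) := ⟨h, d, rfl, rfl⟩
    have h1 := hG.dist_triangle (u := G.vert G.root) (v := G.vert d) (w := G.vert (G.flip d))
    rw [SimpleGraph.dist_eq_one_iff_adj.2 hadj] at h1
    exact h1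

theorem ht_le_flip (hG : G.graph.Connected) (d : G.Dart) : G.ht d ≤ G.ht (G.flip d) + 1 := by
  have := ht_flip_le hG (G.flip d)
  rwa [G.flip_flip] at this

theorem vert_eq_of_ht_eq_zero (hG : G.graph.Connected) {d : G.Dart} (h : G.ht d = 0) :
    G.vert d = G.vert G.root :=
  ((hG.dist_eq_zero_iff (u := G.vert G.root) (v := G.vert d)).1 h).symm

theorem exists_descend (hG : G.graph.Connected) {d : G.Dart} {n : ℕ} (h : G.ht d = n + 1) :
    ∃ e, G.vert e = G.vert d ∧ G.ht (G.flip e) = n := by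
  obtain ⟨p, hp⟩ := hG.exists_walk_length_eq_dist (G.vert d) (G.vert G.root)
  have hlen : p.length = n + 1 := by
    rw [hp, SimpleGraph.dist_comm]; exact h
  have key : ∀ (u w : G.Vertex) (p : G.graph.Walk u w), p.length = n + 1 → ∃ v, G.graph.Adj u v ∧
      ∃ q : G.graph.Walk v w, q.length = n := by
    intro u w p hp
    cases p with
    | nil => simp at hp
    | @cons _ v _ hadj q => exact ⟨v, hadj, q, by simpa using hp⟩
  obtain ⟨w, hadj, q, hq⟩ := key _ _ p hlen
  obtain ⟨-, e, he, he'⟩ := hadj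
  refine ⟨e, he, ?_⟩
  have h1 : G.ht (G.flip e) ≤ n := by
    unfold ht height
    rw [he', SimpleGraph.dist_comm, ← hq]
    exact SimpleGraph.dist_le q
  have h2 := ht_le_flip hG e
  rw [ht_congr he, h] at h2
  omega

/-- Connectedness and the height are determined by a function with the local properties of the
height. -/
theorem connected_and_ht_eq (f : G.Dart → ℕ) (hrot : ∀ d, f (G.rot d) = f d) (hroot : f G.root = 0)
    (h0 : ∀ d, f d = 0 → G.vert d = G.vert G.root) (hflip : ∀ d, f (G.flip d) ≤ f d + 1)
    (hdesc : ∀ d n, f d = n + 1 → ∃ e, G.vert e = G.vert d ∧ f (G.flip e) = n) :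
    G.graph.Connected ∧ ∀ d, G.ht d = f d := by
  have hvert : ∀ d e, G.vert d = G.vert e → f d = f e := by
    intro d e h
    exact (G.finite_orbits.induction (P := fun x => f x = f d) (fun a ha => by rw [hrot, ha])
      (vert_eq_iff.1 h) rfl).symm
  -- Descending according to `f` gives walks to the root, so the height is at most `f`.
  have hw : ∀ n d, f d = n → ∃ p : G.graph.Walk (G.vert G.root) (G.vert d), p.length ≤ n := by
    intro n
    induction n with
    | zero => intro d hd; rw [h0 d hd]; exact ⟨SimpleGraph.Walk.nil, le_rfl⟩
    | succ n ih =>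
      intro d hd
      obtain ⟨e, he, he'⟩ := hdesc d n hd
      obtain ⟨p, hp⟩ := ih _ he'
      have hadj : G.graph.Adj (G.vert (G.flip e)) (G.vert d) := by
        refine ⟨fun hcon => ?_, G.flip e, rfl, by rw [G.flip_flip, he]⟩
        have := hvert _ _ hcon
        omega
      exact ⟨p.concat hadj, by rw [SimpleGraph.Walk.length_concat]; omega⟩
  -- Since `f` grows by at most one along an edge, walks cannot be shorter than `f`.
  have hlow : ∀ {u v : G.Vertex} (p : G.graph.Walk u v) (d e : G.Dart), G.vert d = u → G.vert e = v →
      f e ≤ f d + p.length := by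
    intro u v p
    induction p with
    | nil => intro d e hd he; rw [hvert e d (he.trans hd.symm)]; simp
    | @cons u w v hadj q ih =>
      intro d e hd he
      obtain ⟨-, x, hx, hx'⟩ : G.graph.Adj u w := id hadj
      have h1 := ih _ e hx' he
      have h2 := hflip x
      rw [hvert x d (hx.trans hd.symm)] at h2
      rw [SimpleGraph.Walk.length_cons]
      omega
  have hconn : G.graph.Connected := by
    have : Nonempty G.Vertex := ⟨G.vert G.root⟩
    refine SimpleGraph.Connected.mk fun u v => ?_
    obtain ⟨d, rfl⟩ := exists_vert u
    obtain ⟨e, rfl⟩ := exists_vert v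
    obtain ⟨p, -⟩ := hw _ d rfl
    obtain ⟨q, -⟩ := hw _ e rfl
    exact ⟨p.reverse.append q⟩
  refine ⟨hconn, fun d => le_antisymm ?_ ?_⟩
  · obtain ⟨p, hp⟩ := hw _ d rfl
    exact (SimpleGraph.dist_le p).trans hp
  · obtain ⟨p, hp⟩ := hconn.exists_walk_length_eq_dist (G.vert G.root) (G.vert d)
    have := hlow p G.root d rfl rfl
    rw [hroot, hp, zero_add] at this
    exact this

/-- In a connected map every dart is obtained from the root dart by `rot` and `flip`. -/
theorem dart_induction (hG : G.graph.Connected) {P : G.Dart → Prop} (hroot : P G.root)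
    (hrot : ∀ d, P d → P (G.rot d)) (hflip : ∀ d, P d → P (G.flip d)) (d : G.Dart) : P d := by
  have hv : ∀ d e, G.vert d = G.vert e → P d → P e := fun d e h hd =>
    G.finite_orbits.induction hrot (vert_eq_iff.1 h) hd
  suffices ∀ n d, G.ht d = n → P d from this _ d rfl
  intro n
  induction n with
  | zero => intro d hd; exact hv _ _ (vert_eq_of_ht_eq_zero hG hd).symm hroot
  | succ n ih =>
    intro d hd
    obtain ⟨e, he, he'⟩ := exists_descend hG hd
    refine hv e d he ?_
    rw [← G.flip_flip e]
    exact hflip _ (ih _ he')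

/-- An injective homomorphism of rooted maps onto a connected map is an isomorphism. -/
theorem nonempty_iso_of_hom (hH : H.graph.Connected) (φ : G.Dart → H.Dart)
    (hinj : Function.Injective φ) (hrot : ∀ d, φ (G.rot d) = H.rot (φ d))
    (hflip : ∀ d, φ (G.flip d) = H.flip (φ d)) (hroot : φ G.root = H.root) : Nonempty (Iso G H) := by
  have hsurj : Function.Surjective φ := by
    refine dart_induction hH ⟨_, hroot⟩ ?_ ?_
    · rintro _ ⟨d, rfl⟩; exact ⟨_, hrot d⟩
    · rintro _ ⟨d, rfl⟩; exact ⟨_, hflip d⟩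
  exact ⟨⟨Equiv.ofBijective φ ⟨hinj, hsurj⟩, hrot, hflip, hroot⟩⟩

section Submap

variable {S : Set G.Dart} {hS : ∀ d ∈ S, G.flip d ∈ S} {r : G.Dart} {hr : r ∈ S}

theorem submap_rot_eq {d : G.Dart} {hd : d ∈ S} {b : G.Dart} (h : IsFirstReturn G.rot S d b) :
    ((G.submap S hS r hr).rot ⟨d, hd⟩).1 = b :=
  firstReturn_eq G.finite_orbits (a := ⟨d, hd⟩) h

theorem submap_vert_eq_iff {d e : (G.submap S hS r hr).Dart} :
    (G.submap S hS r hr).vert d = (G.submap S hS r hr).vert e ↔ G.rot.SameCycle d.1 e.1 :=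
  vert_eq_iff.trans (sameCycle_firstReturn_iff G.finite_orbits S d e)

end Submap

/-! ### Isomorphisms of balls -/

/-- Isomorphisms of the balls of radius `R`. -/
structure BallIso (R : ℕ) (G H : RootedMap) where
  e : G.ballDarts R ≃ H.ballDarts R
  map_rot : ∀ d, e (firstReturn G.rot G.finite_orbits (G.ballDarts R) d) =
    firstReturn H.rot H.finite_orbits (H.ballDarts R) (e d)
  map_flip : ∀ d : G.ballDarts R,
    e ⟨G.flip d, G.flip_mem_ballDarts d.2⟩ = ⟨H.flip (e d), H.flip_mem_ballDarts (e d).2⟩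
  map_root : ∀ d : G.ballDarts R, d.1 = G.root ↔ (e d).1 = H.root

theorem ballEq_iff {R : ℕ} : BallEq R G H ↔ Nonempty (BallIso R G H) :=
  ⟨fun ⟨e, h1, h2, h3⟩ => ⟨⟨e, h1, h2, h3⟩⟩, fun ⟨⟨e, h1, h2, h3⟩⟩ => ⟨e, h1, h2, h3⟩⟩

namespace BallIso

variable {R : ℕ}

def symm (e : BallIso R G H) : BallIso R H G where
  e := e.e.symm
  map_rot d := by rw [Equiv.symm_apply_eq, e.map_rot, Equiv.apply_symm_apply]
  map_flip d := by
    rw [Equiv.symm_apply_eq, e.map_flip]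
    exact Subtype.ext (by rw [Equiv.apply_symm_apply])
  map_root d := by rw [e.map_root, Equiv.apply_symm_apply]

def trans (e : BallIso R G H) (f : BallIso R H K) : BallIso R G K where
  e := e.e.trans f.e
  map_rot d := by simp [e.map_rot, f.map_rot]
  map_flip d := by simp [e.map_flip, f.map_flip]
  map_root d := by rw [e.map_root, f.map_root]; rfl

def ofIso (R : ℕ) (e : Iso G H) : BallIso R G H where
  e := e.toEquiv.subtypeEquiv fun d => by
    simp only [ballDarts, Set.mem_ofPred_eq]
    rw [← e.map_flip, e.ht_eq, e.ht_eq]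
  map_rot d := by
    apply Subtype.ext
    refine (firstReturn_eq H.finite_orbits ?_).symm
    refine (isFirstReturn_firstReturn G.rot G.finite_orbits (G.ballDarts R) d).map
      e.toEquiv e.map_rot ?_
    intro a
    simp only [ballDarts, Set.mem_ofPred_eq]
    rw [← e.map_flip, e.ht_eq, e.ht_eq]
  map_flip d := Subtype.ext (e.map_flip d.1)
  map_root d := by
    change d.1 = G.root ↔ e.toEquiv d.1 = H.root
    rw [← e.map_root, e.toEquiv.apply_eq_iff_eq]

/-- A descending path from a vertex of the ball to the root stays inside the ball, and its image is
a path of the same length to the root of `H`. -/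
theorem ht_le (hG : G.graph.Connected) (hH : H.graph.Connected) (e : BallIso R G H) :
    ∀ n (d : G.ballDarts R), G.ht d = n → H.ht (e.e d) ≤ n := by
  have hv : ∀ a b : G.ballDarts R, G.vert a = G.vert b → H.vert (e.e a) = H.vert (e.e b) := by
    intro a b hab
    refine (firstReturn_hasFiniteOrbits G.rot G.finite_orbits (G.ballDarts R)).induction
      (P := fun x => H.vert (e.e a) = H.vert (e.e x)) ?_
      ((sameCycle_firstReturn_iff G.finite_orbits _ a b).2 (vert_eq_iff.1 hab)) rfl
    intro x hx
    rw [hx, e.map_rot]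
    exact vert_eq_iff.2 (sameCycle_firstReturn_self H.finite_orbits _ _)
  intro n
  induction n with
  | zero =>
    intro d hd
    by_cases hroot : G.root ∈ G.ballDarts R
    · have h1 := hv d ⟨G.root, hroot⟩ (vert_eq_of_ht_eq_zero hG hd)
      rw [ht_congr h1, (e.map_root _).1 rfl, ht_root]
    -- The root dart leaves the ball only for `R = 0`, and then all heights in the ball are `0`.
    · have hR : R = 0 := by
        by_contra hR
        apply hroot
        have := ht_flip_le hG G.root
        rw [ht_root] at this
        exact ⟨by rw [ht_root]; omega, by omega⟩
      have := (e.e d).2.1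
      omega
  | succ n ih =>
    intro d hd
    obtain ⟨x, hx, hx'⟩ := exists_descend hG hd
    have hxm : x ∈ G.ballDarts R := by
      have h1 := d.2.1
      rw [hd] at h1
      exact ⟨by rw [ht_congr hx, hd]; exact h1, by omega⟩
    have h1 := ih ⟨G.flip x, G.flip_mem_ballDarts hxm⟩ hx'
    rw [e.map_flip ⟨x, hxm⟩] at h1
    have h2 := ht_le_flip hH (e.e ⟨x, hxm⟩).1
    rw [← ht_congr (hv ⟨x, hxm⟩ d hx)]
    exact h2.trans (Nat.add_le_add_right h1 1)

theorem ht_eq (hG : G.graph.Connected) (hH : H.graph.Connected) (e : BallIso R G H)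
    (d : G.ballDarts R) : H.ht (e.e d) = G.ht d := by
  refine le_antisymm (e.ht_le hG hH _ d rfl) ?_
  have := e.symm.ht_le hH hG _ (e.e d) rfl
  rwa [show e.symm.e (e.e d) = d from e.e.symm_apply_apply d] at this

theorem rot_mem_ballDarts (hG : G.graph.Connected) {d : G.Dart} (h : G.ht d < R) :
    G.rot d ∈ G.ballDarts R := by
  have := ht_flip_le hG (G.rot d)
  rw [ht_rot] at this
  exact ⟨by rw [ht_rot]; exact h.le, by omega⟩

/-- All darts at a vertex of height less than `R` belong to the ball, so there the first return is
the rotation itself. -/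
theorem map_rot_of_lt (hG : G.graph.Connected) (hH : H.graph.Connected) (e : BallIso R G H)
    (d : G.ballDarts R) (h : G.ht d < R) :
    (e.e ⟨G.rot d, rot_mem_ballDarts hG h⟩).1 = H.rot (e.e d) := by
  have h1 := congrArg Subtype.val (e.map_rot d)
  have h2 : firstReturn G.rot G.finite_orbits (G.ballDarts R) d =
      ⟨G.rot d, rot_mem_ballDarts hG h⟩ :=
    Subtype.ext (firstReturn_of_apply_mem G.finite_orbits (rot_mem_ballDarts hG h))
  rw [h2, firstReturn_of_apply_mem H.finite_orbits
    (rot_mem_ballDarts hH (by rw [e.ht_eq hG hH]; exact h))] at h1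
  exact h1

end BallIso

end RootedMap

/-! ### Offspring sequences -/

/-- The numbers of children of the vertices of an infinite planar tree without finite levels, the
vertices being numbered level by level. -/
structure Offspring where
  num : ℕ → ℕ
  -- The queue of the breadth-first enumeration never runs empty: when `i` is reached, more than `i`
  -- vertices have been found.
  alive : ∀ i, i < 1 + ∑ j ∈ Finset.range i, num j

/-- The largest index `i` such that the block starting at `f i` starts at or before `j`. -/
def blockOf (f : ℕ → ℕ) (j : ℕ) : ℕ := Nat.findGreatest (fun i => f i ≤ j) j

/-- As `i ≤ f i`, no index above `j` can qualify, so the search bound in `blockOf` loses nothing. -/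
theorem blockOf_spec {f : ℕ → ℕ} (hf : ∀ i, i ≤ f i) {j i₀ : ℕ} (h0 : f i₀ ≤ j) :
    f (blockOf f j) ≤ j ∧ j < f (blockOf f j + 1) := by
  have hle : ∀ i, f i ≤ j → i ≤ j := fun i hi => (hf i).trans hi
  refine ⟨Nat.findGreatest_spec (P := fun i => f i ≤ j) (hle _ h0) h0, ?_⟩
  by_contra hcon
  push Not at hcon
  have := Nat.le_findGreatest (P := fun i => f i ≤ j) (hle _ hcon) hcon
  unfold blockOf at this
  omega

theorem blockOf_unique {f : ℕ → ℕ} (hf : ∀ i, i ≤ f i) (hm : Monotone f) {i j : ℕ} (h1 : f i ≤ j)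
    (h2 : j < f (i + 1)) : blockOf f j = i := by
  obtain ⟨h3, h4⟩ := blockOf_spec hf h1
  rcases lt_trichotomy (blockOf f j) i with h | h | h
  · have := hm (show blockOf f j + 1 ≤ i from h); omega
  · exact h
  · have := hm (show i + 1 ≤ blockOf f j from h); omega

namespace Offspring

variable (C : Offspring)

/-- The first child of `i` (or, if there is none, of the next vertex that has one). -/
def start (i : ℕ) : ℕ := 1 + ∑ j ∈ Finset.range i, C.num j

/-- The first vertex of level `k`. -/
def first : ℕ → ℕ
  | 0 => 0
  | k + 1 => C.start (first k)

def parent (j : ℕ) : ℕ := blockOf C.start j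

def level (j : ℕ) : ℕ := blockOf C.first j

theorem start_zero : C.start 0 = 1 := by simp [start]

theorem start_succ (i : ℕ) : C.start (i + 1) = C.start i + C.num i := by
  simp [start, Finset.sum_range_succ, add_assoc]

theorem lt_start (i : ℕ) : i < C.start i := C.alive i

theorem start_mono : Monotone C.start :=
  monotone_nat_of_le_succ fun i => by rw [start_succ]; omega

theorem first_zero : C.first 0 = 0 := rfl

theorem first_succ (k : ℕ) : C.first (k + 1) = C.start (C.first k) := rfl

theorem first_one : C.first 1 = 1 := C.start_zero

theorem first_lt (k : ℕ) : C.first k < C.first (k + 1) := C.lt_start _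

theorem first_strictMono : StrictMono C.first := strictMono_nat_of_lt_succ C.first_lt

theorem first_mono : Monotone C.first := C.first_strictMono.monotone

theorem le_first (k : ℕ) : k ≤ C.first k := C.first_strictMono.id_le k

theorem num_zero_pos : 0 < C.num 0 := by
  have := C.lt_start 1
  rw [C.start_succ 0, C.start_zero] at this
  omega

theorem parent_spec {j : ℕ} (hj : 1 ≤ j) : C.start (C.parent j) ≤ j ∧ j < C.start (C.parent j + 1) :=
  blockOf_spec (fun i => (C.lt_start i).le) (i₀ := 0) (by rw [start_zero]; exact hj)

theorem parent_eq {i j : ℕ} (h1 : C.start i ≤ j) (h2 : j < C.start (i + 1)) : C.parent j = i :=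
  blockOf_unique (fun i => (C.lt_start i).le) C.start_mono h1 h2

theorem parent_start_add {i m : ℕ} (h : m < C.num i) : C.parent (C.start i + m) = i :=
  C.parent_eq (by omega) (by rw [start_succ]; omega)

theorem parent_lt {j : ℕ} (hj : 1 ≤ j) : C.parent j < j :=
  (C.lt_start _).trans_le (C.parent_spec hj).1

theorem level_spec (j : ℕ) : C.first (C.level j) ≤ j ∧ j < C.first (C.level j + 1) :=
  blockOf_spec C.le_first (i₀ := 0) (Nat.zero_le _)

theorem level_eq {k j : ℕ} (h1 : C.first k ≤ j) (h2 : j < C.first (k + 1)) : C.level j = k :=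
  blockOf_unique C.le_first C.first_mono h1 h2

theorem level_eq_iff {k j : ℕ} : C.level j = k ↔ C.first k ≤ j ∧ j < C.first (k + 1) :=
  ⟨fun h => h ▸ C.level_spec j, fun h => C.level_eq h.1 h.2⟩

theorem level_lt_iff {k j : ℕ} : C.level j < k ↔ j < C.first k := by
  have h := C.level_spec j
  constructor
  · intro h1
    exact h.2.trans_le (C.first_mono h1)
  · intro h1
    by_contra h2
    push Not at h2
    have := C.first_mono h2
    omega

theorem level_first (k : ℕ) : C.level (C.first k) = k := C.level_eq le_rfl (C.first_lt k)

theorem level_zero : C.level 0 = 0 := C.level_first 0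

theorem level_mono : Monotone C.level := by
  intro i j hij
  by_contra h
  push Not at h
  have h1 := C.level_lt_iff.1 h
  have h2 := C.level_spec i
  omega

theorem level_one : C.level 1 = 1 :=
  (congrArg C.level C.first_one.symm).trans (C.level_first 1)

theorem level_eq_zero_iff {j : ℕ} : C.level j = 0 ↔ j = 0 := by
  rw [level_eq_iff, first_one, first_zero]; omega

theorem level_pos {j : ℕ} (hj : 1 ≤ j) : 1 ≤ C.level j := by
  have := C.level_eq_zero_iff (j := j)
  omega

/-- The monotone function `start` maps the boundaries of level `k` to those of level `k + 1`. -/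
theorem level_parent {j : ℕ} (hj : 1 ≤ j) : C.level j = C.level (C.parent j) + 1 := by
  obtain ⟨h1, h2⟩ := C.parent_spec hj
  obtain ⟨h3, h4⟩ := C.level_spec (C.parent j)
  refine C.level_eq ((C.start_mono h3).trans h1) (h2.trans_le ?_)
  exact C.start_mono h4

theorem level_start {i : ℕ} (h : 0 < C.num i) : C.level (C.start i) = C.level i + 1 := by
  have h1 := C.lt_start i
  rw [C.level_parent (by omega), C.parent_eq le_rfl (by rw [start_succ]; omega)]

/-- The cyclic successor within the level. -/
def next (i : ℕ) : ℕ := if i + 1 = C.first (C.level i + 1) then C.first (C.level i) else i + 1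

/-- The cyclic predecessor within the level. -/
def prev (i : ℕ) : ℕ := if i = C.first (C.level i) then C.first (C.level i + 1) - 1 else i - 1

theorem level_next (i : ℕ) : C.level (C.next i) = C.level i := by
  have h := C.level_spec i
  unfold next
  split_ifs with h1
  · exact C.level_first _
  · exact C.level_eq (by omega) (by omega)

theorem level_prev (i : ℕ) : C.level (C.prev i) = C.level i := by
  have h := C.level_spec i
  unfold prev
  split_ifs with h1
  · exact C.level_eq (by omega) (by omega)
  · exact C.level_eq (by omega) (by omega)

theorem prev_next (i : ℕ) : C.prev (C.next i) = i := by
  have h := C.level_spec i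
  have h' := C.level_next i
  unfold prev
  rw [h']
  unfold next
  split_ifs <;> omega

theorem next_prev (i : ℕ) : C.next (C.prev i) = i := by
  have h := C.level_spec i
  have h' := C.level_prev i
  unfold next
  rw [h']
  unfold prev
  split_ifs <;> omega

theorem prev_injective : Function.Injective C.prev := Function.LeftInverse.injective C.next_prev

theorem next_zero : C.next 0 = 0 := by
  have := C.level_next 0
  rw [level_zero, level_eq_zero_iff] at this
  exact this

theorem next_pos {i : ℕ} (hi : 1 ≤ i) : 1 ≤ C.next i := by
  rcases Nat.eq_zero_or_pos (C.next i) with h | h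
  · have := C.prev_next i
    rw [h, ← C.next_zero, prev_next] at this
    omega
  · exact h

theorem prev_pos {i : ℕ} (hi : 1 ≤ i) : 1 ≤ C.prev i := by
  rcases Nat.eq_zero_or_pos (C.prev i) with h | h
  · have := C.next_prev i
    rw [h, C.next_zero] at this
    omega
  · exact h

/-- Cyclic induction over a level. -/
theorem next_induction {P : ℕ → Prop} {k : ℕ} (h0 : ∃ i, C.level i = k ∧ P i)
    (h : ∀ i, C.level i = k → P i → P (C.next i)) {i : ℕ} (hi : C.level i = k) : P i := by
  obtain ⟨j, hj, hPj⟩ := h0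
  have up : ∀ (i₁ : ℕ), C.level i₁ = k → P i₁ → ∀ m, i₁ ≤ m → C.level m = k → P m := by
    intro i₁ h1 hP m hm
    induction m, hm using Nat.le_induction with
    | base => exact fun _ => hP
    | succ m hm ih =>
      intro hm'
      have h2 : C.level m = k := le_antisymm (hm' ▸ C.level_mono (Nat.le_succ m)) (h1 ▸ C.level_mono hm)
      have h3 := h m h2 (ih h2)
      rwa [next, if_neg] at h3
      rw [level_eq_iff] at hm'
      rw [h2]
      omega
  have hlast : C.level (C.first (k + 1) - 1) = k := by
    have := C.first_lt k
    exact C.level_eq (by omega) (by omega)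
  -- Passing from the last vertex of the level to the first closes the circle; from the first vertex
  -- all others are reached by increasing the index.
  have h1 := h _ hlast (up j hj hPj _ (by rw [level_eq_iff] at hj; omega) hlast)
  have h2 := C.first_lt k
  rw [next, hlast, if_pos (by omega)] at h1
  exact up _ (C.level_first k) h1 i (C.level_eq_iff.1 hi).1 hi

/-- The endpoint of the edge to the right of the edges to the children of `v`, in terms of the
preceding children. -/
def target (v : ℕ) : ℕ :=
  if C.first (C.level v + 1) < C.start v then C.start v - 1 else C.first (C.level v + 2) - 1

/-- A vertex shares the endpoint of its rightmost edge with its cyclic predecessor if that one is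
childless; otherwise the endpoint is the last child of the predecessor. The first vertex of a level
is treated separately, since its predecessor is the last one. -/
theorem target_eq (v : ℕ) : C.target v =
    if C.num (C.prev v) = 0 then C.target (C.prev v) else C.start (C.prev v + 1) - 1 := by
  have h1 := C.level_spec v
  have h2 : C.start (C.first (C.level v)) = C.first (C.level v + 1) := rfl
  have h3 : C.start (C.first (C.level v + 1)) = C.first (C.level v + 2) := rfl
  have h4 := C.first_lt (C.level v + 1)
  have hp := C.level_prev v
  by_cases h5 : v = C.first (C.level v)
  · have hprev : C.prev v = C.first (C.level v + 1) - 1 := if_pos h5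
    have h6 := C.start_succ (C.first (C.level v + 1) - 1)
    rw [Nat.sub_add_cancel (by omega), h3] at h6
    have h7 : C.start v = C.first (C.level v + 1) := by rw [← h2, ← h5]
    rw [target, if_neg (by omega)]
    split_ifs with h8
    · rw [hprev] at h8
      rw [h8, add_zero] at h6
      rw [target, hp, hprev, ← h6, if_pos h4]
    · rw [hprev, Nat.sub_add_cancel (by omega), h3]
  · have hprev : C.prev v = v - 1 := if_neg h5
    have h6 := C.start_succ (v - 1)
    rw [Nat.sub_add_cancel (by omega)] at h6
    have h7 := C.start_mono (show C.first (C.level v) ≤ v - 1 by omega)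
    split_ifs with h8
    · rw [hprev] at h8
      rw [target, target, hp, hprev, h6, h8, add_zero]
    · rw [hprev] at h8
      rw [hprev, Nat.sub_add_cancel (by omega), target, if_pos (by omega)]

/-- Induction along the edges with a common target. -/
theorem prev_induction {P : ℕ → Prop} (h0 : ∀ v, C.num (C.prev v) ≠ 0 → P v)
    (h1 : ∀ v, C.num (C.prev v) = 0 → P (C.prev v) → P v) (v : ℕ) : P v := by
  -- The next level is nonempty, so some vertex of this level has children and the recursion around
  -- the level has a starting point.
  obtain ⟨j, hj, hj'⟩ : ∃ j, C.level j = C.level v ∧ C.num j ≠ 0 := by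
    have h := C.level_start (i := C.parent (C.first (C.level v + 1)))
    have h2 := C.first_lt (C.level v)
    have h3 := C.level_parent (j := C.first (C.level v + 1)) (by omega)
    rw [C.level_first] at h3
    refine ⟨C.parent (C.first (C.level v + 1)), by omega, ?_⟩
    have h4 := C.parent_spec (j := C.first (C.level v + 1)) (by omega)
    rw [start_succ] at h4
    omega
  refine C.next_induction (k := C.level v) ⟨C.next j, by rw [level_next, hj], h0 _ ?_⟩ ?_ rfl
  · rwa [prev_next]
  · intro i _ hP
    by_cases h : C.num i = 0
    · exact h1 _ (by rwa [prev_next]) (by rwa [prev_next])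
    · exact h0 _ (by rwa [prev_next])

theorem level_target (v : ℕ) : C.level (C.target v) = C.level v + 1 := by
  refine C.prev_induction (P := fun v => C.level (C.target v) = C.level v + 1) ?_ ?_ v
  · intro v h
    rw [target_eq, if_neg h, ← C.level_prev v]
    have h1 := C.level_parent (j := C.start (C.prev v + 1) - 1)
      (by have := C.lt_start (C.prev v + 1); omega)
    rw [h1, C.parent_eq (i := C.prev v) (by rw [start_succ]; omega)
      (by have := C.lt_start (C.prev v + 1); omega)]
  · intro v h ih
    rw [target_eq, if_pos h, ih, level_prev]

/-! ### The rotation around the levels -/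

/-- The next edge, counterclockwise around the root, among the edges between two consecutive levels:
`inl i` is the edge from the parent of `i` to `i` (or from the root `r` if `i = 0`), and `inr i` is
the rightmost edge from `i` to the next level. -/
def sigmaFun : ℕ ⊕ ℕ → ℕ ⊕ ℕ
  | .inl i => if i = 0 then .inl 0 else
      if i + 1 = C.start (C.parent i + 1) then .inr (C.next (C.parent i)) else .inl (i + 1)
  | .inr i => if C.num i = 0 then .inr (C.next i) else .inl (C.start i)

def sigmaInv : ℕ ⊕ ℕ → ℕ ⊕ ℕ
  | .inl i => if i = 0 then .inl 0 else
      if i = C.start (C.parent i) then .inr (C.parent i) else .inl (i - 1)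
  | .inr i => if C.num (C.prev i) = 0 then .inr (C.prev i) else .inl (C.start (C.prev i + 1) - 1)

def sigma : Equiv.Perm (ℕ ⊕ ℕ) where
  toFun := C.sigmaFun
  invFun := C.sigmaInv
  left_inv := by
    rintro (i | i)
    · rcases Nat.eq_zero_or_pos i with rfl | hi
      · rfl
      · have h1 := C.parent_spec hi
        have h2 := C.start_succ (C.parent i)
        by_cases h : i + 1 = C.start (C.parent i + 1)
        · simp only [sigmaFun, if_neg hi.ne', if_pos h, sigmaInv, prev_next]
          rw [if_neg (by omega), ← h, Nat.add_sub_cancel]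
        · have h3 : C.parent (i + 1) = C.parent i := C.parent_eq (by omega) (by omega)
          simp only [sigmaFun, if_neg hi.ne', if_neg h, sigmaInv, h3]
          rw [if_neg (by omega), if_neg (by omega), Nat.add_sub_cancel]
    · by_cases h : C.num i = 0
      · simp only [sigmaFun, if_pos h, sigmaInv, prev_next]
      · have h1 := C.lt_start i
        have h2 : C.parent (C.start i) = i := C.parent_eq le_rfl (by rw [start_succ]; omega)
        simp only [sigmaFun, if_neg h, sigmaInv, h2]
        rw [if_neg (by omega), if_true]
  right_inv := by
    rintro (i | i)
    · rcases Nat.eq_zero_or_pos i with rfl | hi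
      · rfl
      · have h1 := C.parent_spec hi
        have h2 := C.start_succ (C.parent i)
        by_cases h : i = C.start (C.parent i)
        · simp only [sigmaInv, if_neg hi.ne', if_pos h, sigmaFun]
          rw [if_neg (by omega), ← h]
        · have h4 := C.lt_start (C.parent i)
          have h3 : C.parent (i - 1) = C.parent i := C.parent_eq (by omega) (by omega)
          simp only [sigmaInv, if_neg hi.ne', if_neg h, sigmaFun, h3]
          rw [if_neg (by omega), if_neg (by omega), Nat.sub_add_cancel hi]
    · by_cases h : C.num (C.prev i) = 0
      · simp only [sigmaInv, if_pos h, sigmaFun, next_prev]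
      · have h1 := C.lt_start (C.prev i + 1)
        have h2 := C.start_succ (C.prev i)
        have h3 : C.parent (C.start (C.prev i + 1) - 1) = C.prev i :=
          C.parent_eq (by omega) (by omega)
        simp only [sigmaInv, if_neg h, sigmaFun, h3, next_prev]
        rw [if_neg (by omega), if_pos (by omega)]

theorem sigma_inl_zero : C.sigma (.inl 0) = .inl 0 := rfl

theorem sigma_inl_last {i : ℕ} (hi : 1 ≤ i) (h : i + 1 = C.start (C.parent i + 1)) :
    C.sigma (.inl i) = .inr (C.next (C.parent i)) := by
  change C.sigmaFun (.inl i) = _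
  simp only [sigmaFun, if_neg (show i ≠ 0 by omega), if_pos h]

theorem sigma_inl {i : ℕ} (hi : 1 ≤ i) (h : i + 1 ≠ C.start (C.parent i + 1)) :
    C.sigma (.inl i) = .inl (i + 1) := by
  change C.sigmaFun (.inl i) = _
  simp only [sigmaFun, if_neg (show i ≠ 0 by omega), if_neg h]

theorem sigma_inr_zero {i : ℕ} (h : C.num i = 0) : C.sigma (.inr i) = .inr (C.next i) := by
  change C.sigmaFun (.inr i) = _
  simp only [sigmaFun, if_pos h]

theorem sigma_inr {i : ℕ} (h : C.num i ≠ 0) : C.sigma (.inr i) = .inl (C.start i) := by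
  change C.sigmaFun (.inr i) = _
  simp only [sigmaFun, if_neg h]

theorem sigma_symm_inl_zero : C.sigma.symm (.inl 0) = .inl 0 := rfl

theorem sigma_symm_inl_first {i : ℕ} (hi : 1 ≤ i) (h : i = C.start (C.parent i)) :
    C.sigma.symm (.inl i) = .inr (C.parent i) := by
  change C.sigmaInv (.inl i) = _
  simp only [sigmaInv, if_neg (show i ≠ 0 by omega), if_pos h]

theorem sigma_symm_inl {i : ℕ} (hi : 1 ≤ i) (h : i ≠ C.start (C.parent i)) :
    C.sigma.symm (.inl i) = .inl (i - 1) := by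
  change C.sigmaInv (.inl i) = _
  simp only [sigmaInv, if_neg (show i ≠ 0 by omega), if_neg h]

theorem sigma_symm_inr_zero {i : ℕ} (h : C.num (C.prev i) = 0) :
    C.sigma.symm (.inr i) = .inr (C.prev i) := by
  change C.sigmaInv (.inr i) = _
  simp only [sigmaInv, if_pos h]

theorem sigma_symm_inr {i : ℕ} (h : C.num (C.prev i) ≠ 0) :
    C.sigma.symm (.inr i) = .inl (C.start (C.prev i + 1) - 1) := by
  change C.sigmaInv (.inr i) = _
  simp only [sigmaInv, if_neg h]

/-- The origin of an edge; the root `r` has number `0`, and the vertex `i` has number `i + 1`. -/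
def src : ℕ ⊕ ℕ → ℕ
  | .inl i => if i = 0 then 0 else C.parent i + 1
  | .inr i => i + 1

/-- The endpoint of an edge. -/
def tgt : ℕ ⊕ ℕ → ℕ
  | .inl i => i
  | .inr i => C.target i

theorem src_inl {i : ℕ} (hi : 1 ≤ i) : C.src (.inl i) = C.parent i + 1 := by
  simp [src, show i ≠ 0 by omega]

/-- For `i ≥ 1`, consecutive edges are two sides of a triangle. Here they start at the same vertex,
and the third side is the horizontal edge between `i` and its predecessor on the upper level. -/
theorem src_tgt_of_sigma_eq_inl {a : ℕ ⊕ ℕ} {i : ℕ} (h : C.sigma a = .inl i) :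
    C.src a = C.src (.inl i) ∧ C.tgt a = C.prev i := by
  obtain rfl : a = C.sigma.symm (.inl i) := by rw [← h, Equiv.symm_apply_apply]
  rcases Nat.eq_zero_or_pos i with rfl | hi
  · rw [sigma_symm_inl_zero]
    refine ⟨rfl, ?_⟩
    conv_rhs => rw [← C.next_zero, prev_next]
    rfl
  · have h1 := C.parent_spec hi
    have h2 := C.level_parent hi
    have h3 := C.level_spec (C.parent i)
    have h4 := C.start_mono h3.1
    have h5 : C.start (C.first (C.level (C.parent i))) = C.first (C.level i) := by rw [h2]; rfl
    by_cases hf : i = C.start (C.parent i)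
    · rw [C.sigma_symm_inl_first hi hf]
      refine ⟨by rw [C.src_inl hi]; rfl, ?_⟩
      change C.target _ = _
      rw [target, prev, ← h2]
      by_cases h6 : i = C.first (C.level i)
      · rw [if_pos h6, if_neg (by omega)]
        rw [h2]
      · rw [if_neg h6, if_pos (by omega), ← hf]
    · rw [C.sigma_symm_inl hi hf]
      have h7 := C.lt_start (C.parent i)
      have h6 : C.parent (i - 1) = C.parent i := C.parent_eq (by omega) (by omega)
      refine ⟨by rw [C.src_inl hi, C.src_inl (by omega), h6], ?_⟩
      change i - 1 = _
      rw [prev, if_neg (by omega)]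

/-- The other kind of triangle: the two edges end at the same vertex, and the horizontal side lies
on the lower level. -/
theorem src_tgt_of_sigma_eq_inr {a : ℕ ⊕ ℕ} {v : ℕ} (h : C.sigma a = .inr v) :
    C.src a = C.prev v + 1 ∧ C.tgt a = C.target v := by
  obtain rfl : a = C.sigma.symm (.inr v) := by rw [← h, Equiv.symm_apply_apply]
  rw [C.target_eq v]
  by_cases h0 : C.num (C.prev v) = 0
  · rw [sigma_symm_inr_zero C h0, if_pos h0]
    exact ⟨rfl, rfl⟩
  · rw [sigma_symm_inr C h0, if_neg h0]
    have h1 := C.lt_start (C.prev v + 1)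
    have h2 := C.start_succ (C.prev v)
    refine ⟨?_, rfl⟩
    rw [C.src_inl (by omega), C.parent_eq (i := C.prev v) (by omega) (by omega)]

/-- The level of the endpoint of an edge. -/
def edgeLevel : ℕ ⊕ ℕ → ℕ
  | .inl i => C.level i
  | .inr i => C.level i + 1

theorem level_tgt (a : ℕ ⊕ ℕ) : C.level (C.tgt a) = C.edgeLevel a := by
  rcases a with i | i
  · rfl
  · exact C.level_target i

theorem edgeLevel_sigma (a : ℕ ⊕ ℕ) : C.edgeLevel (C.sigma a) = C.edgeLevel a := by
  rw [← level_tgt, ← level_tgt]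
  rcases h : C.sigma a with i | v
  · rw [(C.src_tgt_of_sigma_eq_inl h).2, level_prev]; rfl
  · rw [(C.src_tgt_of_sigma_eq_inr h).2]; rfl

theorem edgeLevel_sigma_symm (a : ℕ ⊕ ℕ) : C.edgeLevel (C.sigma.symm a) = C.edgeLevel a := by
  rw [← edgeLevel_sigma, Equiv.apply_symm_apply]

end Offspring

/-! ### The ambient layered map -/

theorem exists_pow_eq_self_of_finite {α : Type*} {f : Equiv.Perm α} {A : Set α} (hA : A.Finite)
    (hf : ∀ x ∈ A, f x ∈ A) {x : α} (hx : x ∈ A) : ∃ n : ℕ, 0 < n ∧ (f ^ n) x = x := by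
  have hmem : ∀ n : ℕ, (f ^ n) x ∈ A := by
    intro n
    induction n with
    | zero => exact hx
    | succ n ih => rw [pow_succ', Equiv.Perm.mul_apply]; exact hf _ ih
  obtain ⟨i, -, j, -, hij, heq⟩ := Set.infinite_univ.exists_ne_map_eq_of_mapsTo
    (f := fun n : ℕ => (f ^ n) x) (fun n _ => hmem n) hA
  wlog hlt : i < j generalizing i j
  · exact this j i hij.symm heq.symm (by omega)
  refine ⟨j - i, by omega, (f ^ i).injective ?_⟩
  rw [← Equiv.Perm.mul_apply, ← pow_add, show i + (j - i) = j by omega]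
  exact heq.symm

/-- Darts of a layered map: `F a` and `B a` are the two directions, away from the root and towards
it, of the edge `a` between two levels, and `hr i`, `hl i` those of the edge between `i` and its
predecessor on the same level. -/
inductive LDart
  | F (a : ℕ ⊕ ℕ)
  | B (a : ℕ ⊕ ℕ)
  | hr (i : ℕ)
  | hl (i : ℕ)

namespace Offspring

open LDart

variable (C : Offspring)

/-- Counterclockwise around the vertex `i` come `B (inl i)` towards its parent, `hr i`, `F (inr i)`,
the edges to the children, `hl (next i)`, then the rightmost edges `B (inr j)` that arrive at `i`
from below, and finally `B (inl i)` again. The root `r` has the single dart `F (inl 0)`. -/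
def rotFun : LDart → LDart
  | F a => match C.sigma a with
    | .inl v => F (.inl v)
    | .inr v => hl v
  | B (.inl i) => hr i
  | B (.inr i) => B (C.sigma.symm (.inr i))
  | hr i => F (.inr i)
  | hl i => B (C.sigma.symm (.inl i))

def rotInv : LDart → LDart
  | F (.inl v) => F (C.sigma.symm (.inl v))
  | F (.inr i) => hr i
  | B a => match C.sigma a with
    | .inl v => hl v
    | .inr v => B (.inr v)
  | hr i => B (.inl i)
  | hl v => F (C.sigma.symm (.inr v))

def rot : Equiv.Perm LDart where
  toFun := C.rotFun
  invFun := C.rotInv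
  left_inv := by
    rintro (a | a | i | i)
    · rcases h : C.sigma a with v | v <;> simp only [rotFun, rotInv, h] <;>
        rw [← h, Equiv.symm_apply_apply]
    · rcases a with i | i
      · rfl
      · simp only [rotFun, rotInv, Equiv.apply_symm_apply]
    · rfl
    · simp only [rotFun, rotInv, Equiv.apply_symm_apply]
  right_inv := by
    rintro (a | a | i | i)
    · rcases a with i | i
      · simp only [rotFun, rotInv, Equiv.apply_symm_apply]
      · rfl
    · rcases h : C.sigma a with v | v <;> simp only [rotFun, rotInv, h] <;>
        rw [← h, Equiv.symm_apply_apply]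
    · rfl
    · simp only [rotFun, rotInv, Equiv.apply_symm_apply]

theorem rot_F_of_inl {a : ℕ ⊕ ℕ} {v : ℕ} (h : C.sigma a = .inl v) : C.rot (F a) = F (.inl v) := by
  change C.rotFun (F a) = _
  simp only [rotFun, h]

theorem rot_F_of_inr {a : ℕ ⊕ ℕ} {v : ℕ} (h : C.sigma a = .inr v) : C.rot (F a) = hl v := by
  change C.rotFun (F a) = _
  simp only [rotFun, h]

theorem rot_B_inl (i : ℕ) : C.rot (B (.inl i)) = hr i := rfl

theorem rot_B_inr (i : ℕ) : C.rot (B (.inr i)) = B (C.sigma.symm (.inr i)) := rfl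

theorem rot_hr (i : ℕ) : C.rot (hr i) = F (.inr i) := rfl

theorem rot_hl (i : ℕ) : C.rot (hl i) = B (C.sigma.symm (.inl i)) := rfl

end Offspring

namespace LDart

def flip : LDart → LDart
  | F a => B a
  | B a => F a
  | hr i => hl i
  | hl i => hr i

theorem flip_flip (d : LDart) : d.flip.flip = d := by cases d <;> rfl

theorem flip_ne (d : LDart) : d.flip ≠ d := by cases d <;> simp [flip]

end LDart

namespace Offspring

open LDart

variable (C : Offspring)

/-- The number of the origin of a dart. -/
def org : LDart → ℕ
  | F a => C.src a
  | B a => C.tgt a + 1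
  | hr i => i + 1
  | hl i => C.prev i + 1

/-- The distance of the origin of a dart from the root `r`. -/
def hgt : LDart → ℕ
  | F a => C.edgeLevel a
  | B a => C.edgeLevel a + 1
  | hr i => C.level i + 1
  | hl i => C.level i + 1

/-- The distance of a vertex from the root `r`. -/
def vertexLevel : ℕ → ℕ
  | 0 => 0
  | i + 1 => C.level i + 1

theorem hgt_eq (d : LDart) : C.hgt d = C.vertexLevel (C.org d) := by
  rcases d with a | a | i | i
  · rcases a with i | i
    · rcases Nat.eq_zero_or_pos i with rfl | hi
      · exact C.level_zero
      · change C.level i = C.vertexLevel (C.src (.inl i))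
        rw [C.src_inl hi, C.level_parent hi]; rfl
    · rfl
  · change _ = C.level (C.tgt a) + 1
    rw [level_tgt]; rfl
  · rfl
  · change _ = C.level (C.prev i) + 1
    rw [level_prev]; rfl

theorem org_rot (d : LDart) : C.org (C.rot d) = C.org d := by
  rcases d with a | (i | i) | i | i
  · rcases h : C.sigma a with v | v
    · rw [C.rot_F_of_inl h]; exact (C.src_tgt_of_sigma_eq_inl h).1.symm
    · rw [C.rot_F_of_inr h]; exact (C.src_tgt_of_sigma_eq_inr h).1.symm
  · rfl
  · have h : C.sigma (C.sigma.symm (.inr i)) = .inr i := Equiv.apply_symm_apply _ _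
    rw [rot_B_inr]
    exact congrArg (· + 1) (C.src_tgt_of_sigma_eq_inr h).2
  · rfl
  · have h : C.sigma (C.sigma.symm (.inl i)) = .inl i := Equiv.apply_symm_apply _ _
    rw [rot_hl]
    exact congrArg (· + 1) (C.src_tgt_of_sigma_eq_inl h).2

theorem hgt_rot (d : LDart) : C.hgt (C.rot d) = C.hgt d := by rw [hgt_eq, org_rot, ← hgt_eq]

theorem finite_hgt_le (k : ℕ) : {d | C.hgt d ≤ k}.Finite := by
  have hfin : (Set.Iio (C.first (k + 1))).Finite := Set.finite_Iio _
  have hfin' : (Sum.inl '' Set.Iio (C.first (k + 1)) ∪ Sum.inr '' Set.Iio (C.first (k + 1)) :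
    Set (ℕ ⊕ ℕ)).Finite := (hfin.image _).union (hfin.image _)
  refine ((hfin'.image F).union ((hfin'.image B).union ((hfin.image hr).union
    (hfin.image hl)))).subset ?_
  have key : ∀ i, C.level i ≤ k → i < C.first (k + 1) := fun i hi =>
    C.level_lt_iff.1 (Nat.lt_succ_of_le hi)
  rintro ((i | i) | (i | i) | i | i) hd <;> replace hd : _ ≤ k := hd <;>
    simp only [hgt, edgeLevel] at hd
  · exact Or.inl ⟨_, Or.inl ⟨i, key i hd, rfl⟩, rfl⟩
  · exact Or.inl ⟨_, Or.inr ⟨i, key i (by omega), rfl⟩, rfl⟩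
  · exact Or.inr (Or.inl ⟨_, Or.inl ⟨i, key i (by omega), rfl⟩, rfl⟩)
  · exact Or.inr (Or.inl ⟨_, Or.inr ⟨i, key i (by omega), rfl⟩, rfl⟩)
  · exact Or.inr (Or.inr (Or.inl ⟨i, key i (by omega), rfl⟩))
  · exact Or.inr (Or.inr (Or.inr ⟨i, key i (by omega), rfl⟩))

theorem rot_hasFiniteOrbits : HasFiniteOrbits C.rot := fun d =>
  exists_pow_eq_self_of_finite (C.finite_hgt_le (C.hgt d))
    (fun x hx => (C.hgt_rot x).trans_le hx) (x := d) (le_refl (C.hgt d))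

/-- The layered map with all edges. Besides the edges of a causal triangulation it has a pendant
edge `F (inl 0)` from the root `r` to the vertex `0`, and edges `hr 0` and `F (inr 0)`. -/
abbrev ambient : RootedMap where
  Dart := LDart
  rot := C.rot
  flip := LDart.flip
  flip_flip := LDart.flip_flip
  flip_ne := LDart.flip_ne
  finite_orbits := C.rot_hasFiniteOrbits
  root := F (.inl 0)

/-- A dart at a given vertex. -/
def base : ℕ → LDart
  | 0 => F (.inl 0)
  | i + 1 => B (.inl i)

/-- Together with the invariance of `org` this identifies the orbits of the rotation with the fibres
of `org`. Forward darts are followed clockwise to `F (inr i)`, backward darts counterclockwise to `B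
(inl i)`. -/
theorem sameCycle_base (d : LDart) : C.rot.SameCycle d (base (C.org d)) := by
  have h1 : ∀ d, C.rot.SameCycle (C.rot d) (base (C.org (C.rot d))) →
      C.rot.SameCycle d (base (C.org d)) := by
    intro d h
    rw [org_rot] at h
    exact (sameCycle_iterate C.rot 1 d).trans h
  have h2 : ∀ d, C.rot.SameCycle d (base (C.org d)) →
      C.rot.SameCycle (C.rot d) (base (C.org (C.rot d))) := by
    intro d h
    rw [org_rot]
    exact (sameCycle_iterate C.rot 1 d).symm.trans h
  have hhr : ∀ i, C.rot.SameCycle (hr i) (base (C.org (hr i))) := fun i =>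
    h2 (B (.inl i)) (Equiv.Perm.SameCycle.refl _ _)
  have hFr : ∀ i, C.rot.SameCycle (F (.inr i)) (base (C.org (F (.inr i)))) := fun i => h2 _ (hhr i)
  have hFl : ∀ i, C.rot.SameCycle (F (.inl i)) (base (C.org (F (.inl i)))) := by
    intro i
    induction i using Nat.strong_induction_on with
    | _ i ih =>
      rcases Nat.eq_zero_or_pos i with rfl | hi
      · exact Equiv.Perm.SameCycle.refl _ _
      · have h : C.sigma (C.sigma.symm (.inl i)) = .inl i := Equiv.apply_symm_apply _ _
        rw [← C.rot_F_of_inl h]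
        apply h2
        by_cases hf : i = C.start (C.parent i)
        · rw [C.sigma_symm_inl_first hi hf]; exact hFr _
        · rw [C.sigma_symm_inl hi hf]; exact ih _ (by omega)
  have hF : ∀ a, C.rot.SameCycle (F a) (base (C.org (F a))) := by
    rintro (i | i)
    exacts [hFl i, hFr i]
  have hB : ∀ a, C.rot.SameCycle (B a) (base (C.org (B a))) := by
    rintro (i | i)
    · exact Equiv.Perm.SameCycle.refl _ _
    · refine C.prev_induction (P := fun i => C.rot.SameCycle (B (.inr i)) (base (C.org (B (.inr i)))))
        ?_ ?_ i
      · intro v hv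
        apply h1
        rw [rot_B_inr, sigma_symm_inr C hv]
        exact Equiv.Perm.SameCycle.refl _ _
      · intro v hv ih
        apply h1
        rw [rot_B_inr, sigma_symm_inr_zero C hv]
        exact ih
  rcases d with a | a | i | i
  · exact hF a
  · exact hB a
  · exact hhr i
  · exact h1 _ (hB _)

theorem sameCycle_iff {d e : LDart} : C.rot.SameCycle d e ↔ C.org d = C.org e := by
  constructor
  · intro h
    exact (C.rot_hasFiniteOrbits.induction (P := fun x => C.org x = C.org d)
      (fun x hx => by rw [org_rot, hx]) h rfl).symm
  · intro h
    have h1 := C.sameCycle_base d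
    rw [h] at h1
    exact h1.trans (C.sameCycle_base e).symm

end Offspring

/-- The parameters of causal triangulations and of planar rooted trees: an offspring sequence,
and a height at which the tree that it describes is cut. For uniqueness the sequence is constant
from the last level on. -/
structure LayerCode extends Offspring where
  h : ℕ∞
  one_le : 1 ≤ h
  tail : ∀ i, h ≤ ((toOffspring.level i + 1 : ℕ) : ℕ∞) → num i = 1

namespace LayerCode

open LDart Offspring

variable (P : LayerCode)

/-- The edges between the levels of the causal triangulation. -/
def IsEdge (a : ℕ ⊕ ℕ) : Prop := 1 ≤ a.elim id id ∧ ((P.edgeLevel a : ℕ) : ℕ∞) ≤ P.h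

/-- The darts of the causal triangulation. -/
def ctDarts : Set LDart := {d | match d with
  | F a => P.IsEdge a
  | B a => P.IsEdge a
  | hr i => P.IsEdge (.inr i)
  | hl i => P.IsEdge (.inr i)}

theorem flip_mem_ctDarts : ∀ d ∈ P.ctDarts, d.flip ∈ P.ctDarts := by
  rintro (a | a | i | i) hd <;> exact hd

theorem isEdge_inl {i : ℕ} : P.IsEdge (.inl i) ↔ 1 ≤ i ∧ ((P.level i : ℕ) : ℕ∞) ≤ P.h := Iff.rfl

theorem isEdge_inr {i : ℕ} : P.IsEdge (.inr i) ↔ 1 ≤ i ∧ ((P.level i : ℕ) : ℕ∞) < P.h := by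
  unfold IsEdge
  change 1 ≤ i ∧ ((P.level i + 1 : ℕ) : ℕ∞) ≤ P.h ↔ _
  rw [Nat.cast_add_one, ENat.add_one_le_iff (ENat.natCast_ne_top _)]

theorem isEdge_one : P.IsEdge (.inl 1) := by
  refine P.isEdge_inl.2 ⟨le_rfl, ?_⟩
  rw [P.level_one]
  exact_mod_cast P.one_le

/-- The causal triangulation with parameters `P`. -/
noncomputable def ct : RootedMap :=
  P.ambient.submap P.ctDarts P.flip_mem_ctDarts (F (.inl 1)) P.isEdge_one

/-- The darts of the tree. -/
def treeDarts : Set LDart := {d | match d with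
  | F (.inl i) => ((P.level i : ℕ) : ℕ∞) < P.h
  | B (.inl i) => ((P.level i : ℕ) : ℕ∞) < P.h
  | _ => False}

theorem flip_mem_treeDarts : ∀ d ∈ P.treeDarts, d.flip ∈ P.treeDarts := by
  rintro ((i | i) | (i | i) | i | i) hd <;> exact hd

theorem root_mem_treeDarts : F (.inl 0) ∈ P.treeDarts := by
  change ((P.level 0 : ℕ) : ℕ∞) < P.h
  rw [level_zero]
  exact lt_of_lt_of_le (by exact_mod_cast one_pos) P.one_le

/-- The tree with parameters `P`. -/
noncomputable def tree : RootedMap :=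
  P.ambient.submap P.treeDarts P.flip_mem_treeDarts (F (.inl 0)) P.root_mem_treeDarts

end LayerCode

/-! ### The rotation of the causal triangulation of a code -/

namespace LayerCode

open LDart Offspring

variable {P : LayerCode}

theorem isEdge_of_sigma_inl {a : ℕ ⊕ ℕ} {v : ℕ} (ha : P.IsEdge a) (h : P.sigma a = .inl v) :
    P.IsEdge (.inl v) := by
  refine ⟨?_, ?_⟩
  · rcases Nat.eq_zero_or_pos v with rfl | hv
    · obtain rfl : a = .inl 0 := by rw [← P.sigma.symm_apply_apply a, h]; rfl
      exact absurd ha.1 (by simp)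
    · exact hv
  · rw [← h, edgeLevel_sigma]; exact ha.2

theorem isEdge_of_sigma_inr {a : ℕ ⊕ ℕ} {v : ℕ} (ha : P.IsEdge a) (h : P.sigma a = .inr v)
    (hv : v ≠ 0) : P.IsEdge (.inr v) := by
  refine ⟨Nat.pos_of_ne_zero hv, ?_⟩
  rw [← h, edgeLevel_sigma]; exact ha.2

theorem isEdge_sigma_symm_inr {v : ℕ} (hv : P.IsEdge (.inr v)) :
    P.IsEdge (P.sigma.symm (.inr v)) := by
  refine ⟨?_, ?_⟩
  · have h1 := P.prev_pos hv.1
    by_cases h : P.num (P.prev v) = 0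
    · rw [sigma_symm_inr_zero _ h]; exact h1
    · rw [sigma_symm_inr _ h]
      have := P.lt_start (P.prev v + 1)
      change 1 ≤ P.start (P.prev v + 1) - 1
      omega
  · rw [edgeLevel_sigma_symm]; exact hv.2

/-- The vertex `1` is exceptional because it is the first child of the root vertex, which has no
additional rightmost edge `inr 0` in the triangulation. -/
theorem isEdge_sigma_symm_inl {v : ℕ} (hv : P.IsEdge (.inl v)) (h1 : v ≠ 1) :
    P.IsEdge (P.sigma.symm (.inl v)) := by
  have hv1 : 1 ≤ v := hv.1
  refine ⟨?_, ?_⟩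
  · by_cases h : v = P.start (P.parent v)
    · rw [P.sigma_symm_inl_first hv1 h]
      change 1 ≤ P.parent v
      rcases Nat.eq_zero_or_pos (P.parent v) with h0 | h0
      · rw [h0, P.start_zero] at h; omega
      · exact h0
    · rw [P.sigma_symm_inl hv1 h]
      change 1 ≤ v - 1
      omega
  · rw [edgeLevel_sigma_symm]; exact hv.2

theorem sigma_inr_root (P : LayerCode) : P.sigma (.inr 0) = .inl 1 := by
  rw [P.sigma_inr P.num_zero_pos.ne', P.start_zero]

theorem level_eq_of_isEdge {i : ℕ} (h : P.IsEdge (.inl i)) (h' : ¬ P.IsEdge (.inr i)) :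
    ((P.level i : ℕ) : ℕ∞) = P.h := by
  rw [isEdge_inr] at h'
  by_contra hcon
  exact h' ⟨h.1, lt_of_le_of_ne h.2 hcon⟩

/-- The last vertex of level `1`. -/
theorem isEdge_last (P : LayerCode) : P.IsEdge (.inl (P.start 1 - 1)) := by
  have h1 := P.lt_start 1
  have h2 := P.first_succ 1
  rw [P.first_one] at h2
  refine ⟨show 1 ≤ P.start 1 - 1 by omega, ?_⟩
  change ((P.level (P.start 1 - 1) : ℕ) : ℕ∞) ≤ P.h
  rw [P.level_eq (k := 1) (by rw [P.first_one]; omega) (by omega)]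
  exact_mod_cast P.one_le

theorem num_eq_one_of_level_eq {i : ℕ} (h : ((P.level i : ℕ) : ℕ∞) = P.h) : P.num i = 1 :=
  P.tail i (by rw [← h]; exact_mod_cast Nat.le_succ _)

theorem num_parent_eq_one {i : ℕ} (hi : 1 ≤ i) (h : ((P.level i : ℕ) : ℕ∞) = P.h) :
    P.num (P.parent i) = 1 := by
  refine P.tail _ ?_
  rw [← P.level_parent hi, h]

theorem isEdge_inr_parent {i : ℕ} (h2 : 2 ≤ P.h) (h : ((P.level i : ℕ) : ℕ∞) = P.h) :
    P.IsEdge (.inr (P.parent i)) := by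
  have hi : 1 ≤ i := by
    rcases Nat.eq_zero_or_pos i with rfl | hi
    · rw [← h, P.level_zero] at h2
      exact absurd h2 (by simp)
    · exact hi
  rw [isEdge_inr, ← h]
  have h3 := P.level_parent hi
  rw [← h] at h2
  replace h2 : 2 ≤ P.level i := by exact_mod_cast h2
  refine ⟨?_, by exact_mod_cast (show P.level (P.parent i) < P.level i by omega)⟩
  by_contra h0
  have h4 : P.parent i = 0 := by omega
  rw [h4, P.level_zero] at h3
  omega

/-- On a level of vertices with one child each, the edges alternate. -/
theorem sigma_symm_inl_of_num_eq_one {i : ℕ} (hi : 1 ≤ i) (h : P.num (P.parent i) = 1) :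
    P.sigma.symm (.inl i) = .inr (P.parent i) ∧ P.sigma (.inl i) = .inr (P.next (P.parent i)) := by
  have h1 := P.parent_spec hi
  rw [start_succ, h] at h1
  exact ⟨P.sigma_symm_inl_first hi (by omega),
    P.sigma_inl_last hi (by rw [start_succ, h]; omega)⟩

theorem ct_rot_eq {x : P.ct.Dart} {b : LDart} (h : IsFirstReturn P.rot P.ctDarts x.1 b) :
    (P.ct.rot x).1 = b := RootedMap.submap_rot_eq (hd := x.2) h

theorem ct_rot_eq_rot {x : P.ct.Dart} (h : P.rot x.1 ∈ P.ctDarts) : (P.ct.rot x).1 = P.rot x.1 :=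
  ct_rot_eq (isFirstReturn_of_apply_mem h)

theorem ct_flip (x : P.ct.Dart) : (P.ct.flip x).1 = x.1.flip := rfl

theorem ct_rot_F_inl {x : P.ct.Dart} {a : ℕ ⊕ ℕ} {v : ℕ} (hx : x.1 = F a)
    (h : P.sigma a = .inl v) : (P.ct.rot x).1 = F (.inl v) := by
  have hm : P.IsEdge a := by have := x.2; rw [hx] at this; exact this
  have h1 := P.rot_F_of_inl h
  rw [← h1, ← hx]
  refine ct_rot_eq_rot ?_
  rw [hx, h1]
  exact isEdge_of_sigma_inl hm h

theorem ct_rot_F_inr {x : P.ct.Dart} {a : ℕ ⊕ ℕ} {v : ℕ} (hx : x.1 = F a)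
    (h : P.sigma a = .inr v) (hv : v ≠ 0) : (P.ct.rot x).1 = hl v := by
  have hm : P.IsEdge a := by have := x.2; rw [hx] at this; exact this
  have h1 := P.rot_F_of_inr h
  rw [← h1, ← hx]
  refine ct_rot_eq_rot ?_
  rw [hx, h1]
  exact isEdge_of_sigma_inr hm h hv

theorem not_isEdge_inl_zero : ¬ P.IsEdge (.inl 0) := fun h => absurd h.1 (by simp)

theorem not_isEdge_inr_zero : ¬ P.IsEdge (.inr 0) := fun h => absurd h.1 (by simp)

/-- At the root vertex, four ambient darts `hl 0`, `B (inl 0)`, `hr 0`, `F (inr 0)` separate the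
last edge to a child from the first one; none of them belongs to the triangulation. -/
theorem isFirstReturn_F_last {a : ℕ ⊕ ℕ} (h : P.sigma a = .inr 0) :
    IsFirstReturn P.rot P.ctDarts (F a) (F (.inl 1)) := by
  have h1 := P.rot_F_of_inr h
  have h5 := P.rot_F_of_inl (sigma_inr_root P)
  refine IsFirstReturn.step ?_ ?_ <;> rw [h1]
  · exact not_isEdge_inr_zero
  refine IsFirstReturn.step ?_ ?_ <;> rw [rot_hl, sigma_symm_inl_zero]
  · exact not_isEdge_inl_zero
  refine IsFirstReturn.step ?_ ?_ <;> rw [rot_B_inl]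
  · exact not_isEdge_inr_zero
  refine IsFirstReturn.step ?_ ?_ <;> rw [rot_hr]
  · exact not_isEdge_inr_zero
  rw [← h5]
  refine isFirstReturn_of_apply_mem ?_
  rw [h5]
  exact P.isEdge_one

theorem ct_rot_F_last {x : P.ct.Dart} {a : ℕ ⊕ ℕ} (hx : x.1 = F a) (h : P.sigma a = .inr 0) :
    (P.ct.rot x).1 = F (.inl 1) :=
  ct_rot_eq (by rw [hx]; exact isFirstReturn_F_last h)

theorem ct_rot_B_inl {x : P.ct.Dart} {i : ℕ} (hx : x.1 = B (.inl i)) (h : P.IsEdge (.inr i)) :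
    (P.ct.rot x).1 = hr i := by
  rw [← P.rot_B_inl, ← hx]
  refine ct_rot_eq_rot ?_
  rw [hx]
  exact h

theorem ct_rot_B_inr {x : P.ct.Dart} {i : ℕ} (hx : x.1 = B (.inr i)) :
    (P.ct.rot x).1 = B (P.sigma.symm (.inr i)) := by
  have hm : P.IsEdge (.inr i) := by have := x.2; rw [hx] at this; exact this
  rw [← P.rot_B_inr, ← hx]
  refine ct_rot_eq_rot ?_
  rw [hx]
  exact isEdge_sigma_symm_inr hm

theorem ct_rot_hr {x : P.ct.Dart} {i : ℕ} (hx : x.1 = hr i) : (P.ct.rot x).1 = F (.inr i) := by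
  have hm : P.IsEdge (.inr i) := by have := x.2; rw [hx] at this; exact this
  rw [← P.rot_hr, ← hx]
  refine ct_rot_eq_rot ?_
  rw [hx]
  exact hm

theorem isEdge_inl_of_inr {i : ℕ} (h : P.IsEdge (.inr i)) : P.IsEdge (.inl i) :=
  ⟨h.1, (isEdge_inr P).1 h |>.2.le⟩

theorem ct_rot_hl {x : P.ct.Dart} {i : ℕ} (hx : x.1 = hl i) (h : i ≠ 1) :
    (P.ct.rot x).1 = B (P.sigma.symm (.inl i)) := by
  have hm : P.IsEdge (.inr i) := by have := x.2; rw [hx] at this; exact this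
  rw [← P.rot_hl, ← hx]
  refine ct_rot_eq_rot ?_
  rw [hx]
  exact isEdge_sigma_symm_inl (isEdge_inl_of_inr hm) h

theorem prev_zero (P : LayerCode) : P.prev 0 = 0 := by
  conv_lhs => rw [← P.next_zero, P.prev_next]

theorem sigma_symm_inr_root (P : LayerCode) : P.sigma.symm (.inr 0) = .inl (P.start 1 - 1) := by
  rw [sigma_symm_inr _ (by rw [prev_zero]; exact P.num_zero_pos.ne'), prev_zero]

theorem sigma_symm_inl_one (P : LayerCode) : P.sigma.symm (.inl 1) = .inr 0 := by
  rw [Equiv.symm_apply_eq, sigma_inr_root]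

/-- Only `B (inr 0)` has to be skipped. -/
theorem isFirstReturn_hl_one : IsFirstReturn P.rot P.ctDarts (hl 1) (B (.inl (P.start 1 - 1))) := by
  have h1 : P.rot (hl 1) = B (.inr 0) := by rw [rot_hl, sigma_symm_inl_one]
  refine IsFirstReturn.step ?_ ?_ <;> rw [h1]
  · exact not_isEdge_inr_zero
  have h2 : P.rot (B (.inr 0)) = B (.inl (P.start 1 - 1)) := by rw [rot_B_inr, sigma_symm_inr_root]
  rw [← h2]
  refine isFirstReturn_of_apply_mem ?_
  rw [h2]
  exact isEdge_last P

theorem ct_rot_hl_one {x : P.ct.Dart} (hx : x.1 = hl 1) :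
    (P.ct.rot x).1 = B (.inl (P.start 1 - 1)) :=
  ct_rot_eq (by rw [hx]; exact isFirstReturn_hl_one)

/-- A vertex at height `h` has one child in the code, which lies above the cut. The absent darts `hr
i`, `F (inr i)`, `F (inl (start i))`, `hl (next i)` therefore follow each other, and the next dart
leads back down. -/
theorem isFirstReturn_top (h2 : 2 ≤ P.h) {i : ℕ} (h : ((P.level i : ℕ) : ℕ∞) = P.h) :
    IsFirstReturn P.rot P.ctDarts (B (.inl i)) (B (.inr (P.parent (P.next i)))) := by
  have hi : ¬ P.IsEdge (.inr i) := by rw [isEdge_inr]; exact fun h' => h'.2.ne h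
  have hi' : ((P.level (P.next i) : ℕ) : ℕ∞) = P.h := by rw [level_next, h]
  have hn : ¬ P.IsEdge (.inr (P.next i)) := by rw [isEdge_inr]; exact fun h' => h'.2.ne hi'
  have hpos : ∀ i, ((P.level i : ℕ) : ℕ∞) = P.h → 1 ≤ i := by
    intro i hi
    rcases Nat.eq_zero_or_pos i with rfl | h0
    · rw [← hi, P.level_zero] at h2; exact absurd h2 (by simp)
    · exact h0
  have h1 := num_eq_one_of_level_eq h
  have hlev := P.level_start (i := i) (by omega)
  have hpar : P.parent (P.start i) = i := P.parent_eq le_rfl (by rw [start_succ]; omega)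
  have hc : ¬ P.IsEdge (.inl (P.start i)) := by
    rw [isEdge_inl, hlev, ← h]
    intro h'
    have := h'.2
    norm_cast at this
    omega
  have hs := P.lt_start i
  have e1 : P.rot (F (.inr i)) = F (.inl (P.start i)) := P.rot_F_of_inl (P.sigma_inr (by omega))
  have e2 : P.rot (F (.inl (P.start i))) = hl (P.next i) := by
    have := (sigma_symm_inl_of_num_eq_one (P := P) (i := P.start i) (by omega) (by rw [hpar, h1])).2
    rw [hpar] at this
    exact P.rot_F_of_inr this
  have e3 : P.rot (hl (P.next i)) = B (.inr (P.parent (P.next i))) := by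
    rw [rot_hl, (sigma_symm_inl_of_num_eq_one (hpos _ hi') (num_parent_eq_one (hpos _ hi') hi')).1]
  refine IsFirstReturn.step ?_ ?_ <;> rw [rot_B_inl]
  · exact hi
  refine IsFirstReturn.step ?_ ?_ <;> rw [rot_hr]
  · exact hi
  refine IsFirstReturn.step ?_ ?_ <;> rw [e1]
  · exact hc
  refine IsFirstReturn.step ?_ ?_ <;> rw [e2]
  · exact hn
  rw [← e3]
  refine isFirstReturn_of_apply_mem ?_
  rw [e3]
  exact isEdge_inr_parent h2 hi'

theorem ct_rot_top {x : P.ct.Dart} {i : ℕ} (h2 : 2 ≤ P.h) (hx : x.1 = B (.inl i))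
    (h : ((P.level i : ℕ) : ℕ∞) = P.h) : (P.ct.rot x).1 = B (.inr (P.parent (P.next i))) :=
  ct_rot_eq (by rw [hx]; exact isFirstReturn_top h2 h)

/-! ### Vertices and heights -/

theorem ct_vert_eq_iff {x y : P.ct.Dart} :
    P.ct.vert x = P.ct.vert y ↔ P.org x.1 = P.org y.1 :=
  RootedMap.submap_vert_eq_iff.trans P.sameCycle_iff

theorem hgt_of_mem_ctDarts {d : LDart} (hd : d ∈ P.ctDarts) :
    1 ≤ P.hgt d ∧ ((P.hgt d : ℕ) : ℕ∞) ≤ P.h + 1 := by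
  have key : ∀ a, P.IsEdge a → 1 ≤ P.edgeLevel a := by
    rintro (i | i) h
    · exact P.level_pos h.1
    · exact Nat.le_add_left 1 _
  rcases d with a | a | i | i
  · exact ⟨key a hd, le_trans hd.2 le_self_add⟩
  · refine ⟨Nat.le_add_left 1 _, ?_⟩
    change ((P.edgeLevel a + 1 : ℕ) : ℕ∞) ≤ _
    push_cast
    gcongr
    exact hd.2
  · exact ⟨Nat.le_add_left 1 _, le_trans hd.2 le_self_add⟩
  · exact ⟨Nat.le_add_left 1 _, le_trans hd.2 le_self_add⟩

theorem hgt_flip (d : LDart) : P.hgt d.flip ≤ P.hgt d + 1 := by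
  rcases d with a | a | i | i
  · exact le_rfl
  · exact Nat.le_add_right _ 2
  · exact Nat.le_succ _
  · exact Nat.le_succ _

theorem hgt_congr {d e : LDart} (h : P.org d = P.org e) : P.hgt d = P.hgt e := by
  rw [hgt_eq, h, ← hgt_eq]

theorem ct_org_rot (x : P.ct.Dart) : P.org (P.ct.rot x).1 = P.org x.1 :=
  ct_vert_eq_iff.1 (RootedMap.vert_rot x)

/-- The vertex at the origin of a dart. -/
theorem exists_org_eq {d : LDart} (hd : d ∈ P.ctDarts) : ∃ i, P.org d = i + 1 ∧
    P.hgt d = P.level i + 1 := by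
  have h1 := (hgt_of_mem_ctDarts hd).1
  rw [hgt_eq] at h1 ⊢
  rcases h : P.org d with - | i
  · rw [h] at h1; exact absurd h1 (by simp [vertexLevel])
  · exact ⟨i, rfl, rfl⟩

/-- Distances from the root vertex are those from `r` minus one; the darts `B (inl i)` provide the
descent required by `connected_and_ht_eq`. -/
theorem ct_connected_and_ht (P : LayerCode) :
    P.ct.graph.Connected ∧ ∀ x : P.ct.Dart, P.ct.ht x = P.hgt x.1 - 1 := by
  have horg : P.org (F (.inl 1)) = 1 := by
    change P.src (.inl 1) = 1
    rw [P.src_inl le_rfl, P.parent_eq (i := 0) (by rw [P.start_zero])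
      (by rw [start_succ, P.start_zero]; have := P.num_zero_pos; omega)]
  refine RootedMap.connected_and_ht_eq (fun x : P.ct.Dart => P.hgt x.1 - 1) ?_ ?_ ?_ ?_ ?_
  · intro x
    rw [hgt_congr (ct_org_rot x)]
  · change P.hgt (F (.inl 1)) - 1 = 0
    rw [hgt_eq, horg]
    simp [vertexLevel, P.level_zero]
  · intro x hx
    obtain ⟨i, hi, hi'⟩ := exists_org_eq x.2
    change P.hgt x.1 - 1 = 0 at hx
    rw [hi', Nat.add_sub_cancel, P.level_eq_zero_iff] at hx
    refine ct_vert_eq_iff.2 ?_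
    change _ = P.org (F (.inl 1))
    rw [hi, hx, horg]
  · intro x
    have h1 := hgt_flip (P := P) x.1
    have h2 := (hgt_of_mem_ctDarts x.2).1
    change P.hgt x.1.flip - 1 ≤ P.hgt x.1 - 1 + 1
    omega
  · intro x n hx
    obtain ⟨i, hi, hi'⟩ := exists_org_eq x.2
    change P.hgt x.1 - 1 = n + 1 at hx
    rw [hi', Nat.add_sub_cancel] at hx
    have hm : B (.inl i) ∈ P.ctDarts := by
      refine ⟨?_, ?_⟩
      · change 1 ≤ i
        by_contra h0
        obtain rfl : i = 0 := by omega
        rw [P.level_zero] at hx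
        omega
      · have h1 := (hgt_of_mem_ctDarts x.2).2
        rw [hi'] at h1
        push_cast at h1
        exact (ENat.add_le_add_iff_right ENat.one_ne_top).1 h1
    refine ⟨⟨_, hm⟩, ct_vert_eq_iff.2 ?_, ?_⟩
    · rw [hi]; rfl
    · change P.level i - 1 = n
      omega

theorem ct_connected (P : LayerCode) : P.ct.graph.Connected := (ct_connected_and_ht P).1

theorem ct_ht (x : P.ct.Dart) : P.ct.ht x + 1 = P.hgt x.1 := by
  rw [(ct_connected_and_ht P).2]
  have := (hgt_of_mem_ctDarts x.2).1
  omega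

end LayerCode

namespace RootedMap

variable {G : RootedMap}

theorem isTriangle_face_iff {d : G.Dart} : G.IsTriangle (G.face d) ↔ G.IsTriangle d := by
  have h : (G.face ^ 3) (G.face d) = G.face ((G.face ^ 3) d) := by
    rw [← Equiv.Perm.mul_apply, ← Equiv.Perm.mul_apply, ← pow_succ, ← pow_succ']
  unfold IsTriangle
  rw [h, G.face.injective.eq_iff, G.face.injective.ne_iff]

theorem face_pow_three (d : G.Dart) : (G.face ^ 3) d = G.face (G.face (G.face d)) := rfl

/-! ### Homotopies of walks -/

/-- The list of darts `l` forms a walk from `u` to `v`. -/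
def IsWalk (G : RootedMap) : G.Vertex → List G.Dart → G.Vertex → Prop
  | u, [], v => u = v
  | u, d :: l, v => G.vert d = u ∧ IsWalk G (G.vert (G.flip d)) l v

theorem isWalk_append {u w : G.Vertex} {l l' : List G.Dart} :
    G.IsWalk u (l ++ l') w ↔ ∃ v, G.IsWalk u l v ∧ G.IsWalk v l' w := by
  induction l generalizing u with
  | nil => simp [IsWalk]
  | cons d l ih => simp [IsWalk, ih, and_assoc]

theorem isChain_append_singleton_iff (d : G.Dart) (l : List G.Dart) (e : G.Dart) :
    List.IsChain (fun d e => G.vert (G.flip d) = G.vert e) (d :: (l ++ [e])) ↔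
      G.IsWalk (G.vert d) (d :: l) (G.vert e) := by
  induction l generalizing d with
  | nil => simp [IsWalk]
  | cons x l ih =>
    rw [List.cons_append, List.isChain_cons_cons, ih x]
    simp [IsWalk, eq_comm]

theorem isClosedPath_iff {l : List G.Dart} : G.IsClosedPath l ↔ ∃ v, G.IsWalk v l v := by
  unfold IsClosedPath
  cases l with
  | nil => exact ⟨fun _ => ⟨G.vert G.root, rfl⟩, fun _ => by simp⟩
  | cons d l =>
    rw [Cycle.chain_coe_cons, isChain_append_singleton_iff]
    constructor
    · intro h; exact ⟨_, h⟩
    · rintro ⟨v, h⟩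
      obtain rfl := h.1
      exact h

/-- Elementary homotopies between closed paths. -/
abbrev ClosedStep (G : RootedMap) (F : G.Dart → Prop) (u v : List G.Dart) : Prop :=
  G.IsClosedPath u ∧ G.IsClosedPath v ∧ G.HomotopyStep F u v

/-- The walks `u` and `u'` from `s` to `t` are homotopic. -/
structure Htp (G : RootedMap) (F : G.Dart → Prop) (s t : G.Vertex) (u u' : List G.Dart) : Prop where
  left : G.IsWalk s u t
  right : G.IsWalk s u' t
  -- Demanding equivalence in every closed context makes the relation compatible with concatenation.
  eqv : ∀ p q v, G.IsWalk v p s → G.IsWalk t q v →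
    Relation.EqvGen (G.ClosedStep F) (p ++ u ++ q) (p ++ u' ++ q)

namespace Htp

variable {F : G.Dart → Prop} {s t r : G.Vertex} {u u' u'' w w' : List G.Dart}

theorem refl (h : G.IsWalk s u t) : G.Htp F s t u u := ⟨h, h, fun _ _ _ _ _ => .refl _⟩

theorem symm (h : G.Htp F s t u u') : G.Htp F s t u' u :=
  ⟨h.right, h.left, fun p q v hp hq => .symm _ _ (h.eqv p q v hp hq)⟩

theorem trans (h : G.Htp F s t u u') (h' : G.Htp F s t u' u'') : G.Htp F s t u u'' :=
  ⟨h.left, h'.right, fun p q v hp hq => .trans _ _ _ (h.eqv p q v hp hq) (h'.eqv p q v hp hq)⟩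

theorem append (h : G.Htp F s t u u') (h' : G.Htp F t r w w') :
    G.Htp F s r (u ++ w) (u' ++ w') := by
  refine ⟨isWalk_append.2 ⟨t, h.left, h'.left⟩, isWalk_append.2 ⟨t, h.right, h'.right⟩, ?_⟩
  intro p q v hp hq
  have h1 := h.eqv p (w ++ q) v hp (isWalk_append.2 ⟨r, h'.left, hq⟩)
  have h2 := h'.eqv (p ++ u') q v (isWalk_append.2 ⟨s, hp, h.right⟩) hq
  simp only [List.append_assoc] at h1 h2 ⊢
  exact h1.trans _ _ _ h2

theorem append_left (h : G.IsWalk s u t) (h' : G.Htp F t r w w') :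
    G.Htp F s r (u ++ w) (u ++ w') := (refl h).append h'

theorem append_right (h : G.Htp F s t u u') (h' : G.IsWalk t w r) :
    G.Htp F s r (u ++ w) (u' ++ w) := h.append (refl h')

theorem spur (F : G.Dart → Prop) (d : G.Dart) :
    G.Htp F (G.vert d) (G.vert d) [d, G.flip d] [] := by
  have hw : G.IsWalk (G.vert d) [d, G.flip d] (G.vert d) :=
    ⟨rfl, rfl, by rw [G.flip_flip]; rfl⟩
  refine ⟨hw, rfl, fun p q v hp hq => .symm _ _ (.rel _ _ ⟨?_, ?_, ?_⟩)⟩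
  · exact isClosedPath_iff.2 ⟨v, isWalk_append.2 ⟨_, isWalk_append.2 ⟨_, hp, rfl⟩, hq⟩⟩
  · exact isClosedPath_iff.2 ⟨v, isWalk_append.2 ⟨_, isWalk_append.2 ⟨_, hp, hw⟩, hq⟩⟩
  · simpa using HomotopyStep.spur p q d

theorem triangle {d : G.Dart} (hd : F d) (h3 : G.IsTriangle d) :
    G.Htp F (G.vert d) (G.vert d) [d, G.face d, G.face (G.face d)] [] := by
  have hw : G.IsWalk (G.vert d) [d, G.face d, G.face (G.face d)] (G.vert d) := by
    refine ⟨rfl, vert_face _, vert_face _, ?_⟩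
    change G.vert (G.flip (G.face (G.face d))) = _
    rw [← vert_face, ← face_pow_three, h3.1]
  refine ⟨hw, rfl, fun p q v hp hq => .symm _ _ (.rel _ _ ⟨?_, ?_, ?_⟩)⟩
  · exact isClosedPath_iff.2 ⟨v, isWalk_append.2 ⟨_, isWalk_append.2 ⟨_, hp, rfl⟩, hq⟩⟩
  · exact isClosedPath_iff.2 ⟨v, isWalk_append.2 ⟨_, isWalk_append.2 ⟨_, hp, hw⟩, hq⟩⟩
  · simpa using HomotopyStep.triangle p q d hd

end Htp

/-- With respect to a choice of walks `up v` from a base vertex to all vertices, the dart `d` is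
null-homotopic. -/
def IsNull (G : RootedMap) (F : G.Dart → Prop) (s : G.Vertex) (up : G.Vertex → List G.Dart)
    (d : G.Dart) : Prop :=
  G.Htp F s (G.vert (G.flip d)) (up (G.vert d) ++ [d]) (up (G.vert (G.flip d)))

section Null

variable {F : G.Dart → Prop} {s : G.Vertex} {up : G.Vertex → List G.Dart}

theorem isWalk_singleton (d : G.Dart) : G.IsWalk (G.vert d) [d] (G.vert (G.flip d)) := ⟨rfl, rfl⟩

theorem IsNull.flip (hup : ∀ v, G.IsWalk s (up v) v) {d : G.Dart} (h : G.IsNull F s up d) :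
    G.IsNull F s up (G.flip d) := by
  unfold IsNull at *
  rw [G.flip_flip]
  have h1 := (h.append_right (by simpa [G.flip_flip] using isWalk_singleton (G.flip d) :
    G.IsWalk _ [G.flip d] (G.vert d))).symm
  refine h1.trans ?_
  have h2 := Htp.append_left (F := F) (hup (G.vert d)) (Htp.spur F d)
  simpa using h2

/-- The walk `up` to the origin of the third side may be replaced by `up` to the origin of `d`
followed by the first two sides; then the whole boundary of the triangle can be removed. -/
theorem IsNull.third (hup : ∀ v, G.IsWalk s (up v) v) {d : G.Dart} (hd : F d)
    (h3 : G.IsTriangle d) (h1 : G.IsNull F s up d) (h2 : G.IsNull F s up (G.face d)) :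
    G.IsNull F s up (G.face (G.face d)) := by
  have hend : G.vert (G.flip (G.face (G.face d))) = G.vert d := by
    rw [← vert_face, ← face_pow_three, h3.1]
  unfold IsNull at *
  rw [hend, vert_face (G.face d)]
  rw [vert_face d] at h2
  have hw : G.IsWalk (G.vert (G.flip (G.face d))) [G.face (G.face d)] (G.vert d) :=
    ⟨vert_face _, hend⟩
  have hw' : G.IsWalk (G.vert (G.flip d)) [G.face d] (G.vert (G.flip (G.face d))) :=
    ⟨vert_face _, rfl⟩
  have h4 := ((h1.append_right hw').trans h2).symm.append_right hw
  have h5 := Htp.append_left (F := F) (hup (G.vert d)) (Htp.triangle hd h3)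
  simp only [List.append_assoc, List.cons_append, List.nil_append, List.append_nil] at h4 h5
  exact h4.trans h5

/-- The innermost pair of opposite darts is a spur; removing it leaves the same situation for a
shorter walk. -/
theorem htp_reverse {u v : G.Vertex} {l : List G.Dart} (h : G.IsWalk u l v) :
    G.Htp F v v ((l.map G.flip).reverse ++ l) [] := by
  induction l generalizing u with
  | nil => exact Htp.refl rfl
  | cons d l ih =>
    obtain ⟨rfl, h⟩ := h
    have h1 := ih h
    have h2 : G.IsWalk v (l.map G.flip).reverse (G.vert (G.flip d)) := by
      obtain ⟨w, hw, hw'⟩ := isWalk_append.1 h1.left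
      have : ∀ {l : List G.Dart} {w w' v : G.Vertex}, G.IsWalk w l v → G.IsWalk w' l v → l ≠ [] →
          w = w' := by
        intro l w w' v h h' hl
        cases l with
        | nil => exact absurd rfl hl
        | cons e l => exact h.1.symm.trans h'.1
      by_cases hl : l = []
      · subst hl
        obtain rfl : G.vert (G.flip d) = v := h
        rfl
      · rwa [this h hw' hl]
    have h3 := Htp.append_left (F := F) h2 (Htp.append_right (Htp.spur F (G.flip d)) h)
    rw [G.flip_flip] at h3
    simp only [List.map_cons, List.reverse_cons, List.append_assoc, List.cons_append,
      List.nil_append] at h3 ⊢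
    exact h3.trans h1

/-- If all darts are null, then `up u` followed by any walk from `u` to `v` is homotopic to `up v`.
A closed path at `v`, preceded by `up v` backwards and then forwards, thus becomes `up v` backwards
and forwards, which contracts. -/
theorem simplyConnected_of_isNull (hup : ∀ v, G.IsWalk s (up v) v) (h : ∀ d, G.IsNull F s up d) :
    G.SimplyConnected F := by
  have key : ∀ (l : List G.Dart) u v, G.IsWalk u l v → G.Htp F s v (up u ++ l) (up v) := by
    intro l
    induction l with
    | nil =>
      rintro u v hl
      obtain rfl : u = v := hl
      rw [List.append_nil]
      exact Htp.refl (hup u)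
    | cons d l ih =>
      rintro u v ⟨rfl, hl⟩
      have h1 := (h d).append_right hl
      rw [List.append_assoc] at h1
      exact h1.trans (ih _ _ hl)
  intro w hw
  obtain ⟨v, hv⟩ := isClosedPath_iff.1 hw
  have h1 := htp_reverse (F := F) (hup v)
  obtain ⟨x, hx, hx'⟩ := isWalk_append.1 h1.left
  have h2 : G.Htp F v v (((up v).map G.flip).reverse ++ up v ++ w) w :=
    h1.append_right hv
  -- An empty list does not show where it starts, so the splitting vertex `x` can be identified with
  -- `s` only if `up v` is nonempty.
  by_cases hnil : up v = []
  · have h3 := key w v v hv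
    have hs : s = v := by have := hup v; rw [hnil] at this; exact this
    subst hs
    rw [hnil] at h3
    have h4 := h3.eqv [] [] s rfl rfl
    simpa using h4
  · have hxs : x = s := by
      have h5 := hup v
      cases hu : up v with
      | nil => exact absurd hu hnil
      | cons e l =>
        rw [hu] at h5 hx'
        exact hx'.1.symm.trans h5.1
    subst hxs
    have h3 := Htp.append_left (F := F) hx (key w v v hv)
    rw [← List.append_assoc] at h3
    have h4 := (h2.symm.trans (h3.trans h1)).eqv [] [] v rfl rfl
    simpa using h4

end Null

end RootedMap

/-! ### The faces of the causal triangulation of a code -/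

namespace LayerCode

open LDart Offspring RootedMap

variable {P : LayerCode}

theorem ct_face_B_inl {x : P.ct.Dart} {a : ℕ ⊕ ℕ} {v : ℕ} (hx : x.1 = B a)
    (h : P.sigma a = .inl v) : (P.ct.face x).1 = F (.inl v) :=
  ct_rot_F_inl (x := P.ct.flip x) (by rw [ct_flip, hx]; rfl) h

theorem ct_face_B_inr {x : P.ct.Dart} {a : ℕ ⊕ ℕ} {v : ℕ} (hx : x.1 = B a)
    (h : P.sigma a = .inr v) (hv : v ≠ 0) : (P.ct.face x).1 = hl v :=
  ct_rot_F_inr (x := P.ct.flip x) (by rw [ct_flip, hx]; rfl) h hv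

theorem ct_face_B_last {x : P.ct.Dart} {a : ℕ ⊕ ℕ} (hx : x.1 = B a) (h : P.sigma a = .inr 0) :
    (P.ct.face x).1 = F (.inl 1) :=
  ct_rot_F_last (x := P.ct.flip x) (by rw [ct_flip, hx]; rfl) h

theorem ct_face_F_inl {x : P.ct.Dart} {i : ℕ} (hx : x.1 = F (.inl i)) (h : P.IsEdge (.inr i)) :
    (P.ct.face x).1 = hr i :=
  ct_rot_B_inl (x := P.ct.flip x) (by rw [ct_flip, hx]; rfl) h

theorem ct_face_top {x : P.ct.Dart} {i : ℕ} (h2 : 2 ≤ P.h) (hx : x.1 = F (.inl i))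
    (h : ((P.level i : ℕ) : ℕ∞) = P.h) : (P.ct.face x).1 = B (.inr (P.parent (P.next i))) :=
  ct_rot_top (x := P.ct.flip x) h2 (by rw [ct_flip, hx]; rfl) h

theorem ct_face_F_inr {x : P.ct.Dart} {i : ℕ} (hx : x.1 = F (.inr i)) :
    (P.ct.face x).1 = B (P.sigma.symm (.inr i)) :=
  ct_rot_B_inr (x := P.ct.flip x) (by rw [ct_flip, hx]; rfl)

theorem ct_face_hl {x : P.ct.Dart} {i : ℕ} (hx : x.1 = hl i) : (P.ct.face x).1 = F (.inr i) :=
  ct_rot_hr (x := P.ct.flip x) (by rw [ct_flip, hx]; rfl)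

theorem ct_face_hr {x : P.ct.Dart} {i : ℕ} (hx : x.1 = hr i) (h : i ≠ 1) :
    (P.ct.face x).1 = B (P.sigma.symm (.inl i)) :=
  ct_rot_hl (x := P.ct.flip x) (by rw [ct_flip, hx]; rfl) h

theorem ct_face_hr_one {x : P.ct.Dart} (hx : x.1 = hr 1) :
    (P.ct.face x).1 = B (.inl (P.start 1 - 1)) :=
  ct_rot_hl_one (x := P.ct.flip x) (by rw [ct_flip, hx]; rfl)

/-- The darts with the exterior face on their right. -/
def IsExt (P : LayerCode) : LDart → Prop
  | F (.inl i) => ((P.level i : ℕ) : ℕ∞) = P.h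
  | B (.inr i) => ((P.level i + 1 : ℕ) : ℕ∞) = P.h
  | _ => False

def IsHor : LDart → Prop
  | hr _ => True
  | hl _ => True
  | _ => False

/-- This is the triangle above the horizontal edge, with apex `target i`. -/
theorem face_hl_triple {x : P.ct.Dart} {i : ℕ} (hx : x.1 = hl i) :
    (P.ct.face x).1 = F (.inr i) ∧ (P.ct.face (P.ct.face x)).1 = B (P.sigma.symm (.inr i)) ∧
      (P.ct.face ^ 3) x = x := by
  have hi : P.IsEdge (.inr i) := by have := x.2; rw [hx] at this; exact this
  have h0 : 1 ≤ i := hi.1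
  have h1 := ct_face_hl hx
  have h2 := ct_face_F_inr h1
  refine ⟨h1, h2, Subtype.ext ?_⟩
  rw [face_pow_three, hx]
  exact ct_face_B_inr h2 (Equiv.apply_symm_apply _ _) (by omega)

/-- This is the triangle below the horizontal edge, with the parent of `i` as apex. For `i = 1` the
rotation at the root vertex jumps from the last edge to the first one. -/
theorem face_hr_triple {x : P.ct.Dart} {i : ℕ} (hx : x.1 = hr i) :
    (∃ b, (P.ct.face x).1 = B b) ∧ (P.ct.face (P.ct.face x)).1 = F (.inl i) ∧
      (P.ct.face ^ 3) x = x := by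
  have hi : P.IsEdge (.inr i) := by have := x.2; rw [hx] at this; exact this
  by_cases h : i = 1
  · subst h
    have h1 := ct_face_hr_one hx
    have h2 := ct_face_B_last h1 (by
      rw [← sigma_symm_inr_root, Equiv.apply_symm_apply])
    refine ⟨⟨_, h1⟩, h2, Subtype.ext ?_⟩
    rw [face_pow_three, hx]
    exact ct_face_F_inl h2 hi
  · have h1 := ct_face_hr hx h
    have h2 := ct_face_B_inl h1 (Equiv.apply_symm_apply _ _)
    refine ⟨⟨_, h1⟩, h2, Subtype.ext ?_⟩
    rw [face_pow_three, hx]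
    exact ct_face_F_inl h2 hi

theorem isTriangle_of_isHor {x : P.ct.Dart} (h : IsHor x.1) : P.ct.IsTriangle x := by
  rcases hx : x.1 with a | a | i | i
  · rw [hx] at h; exact h.elim
  · rw [hx] at h; exact h.elim
  · obtain ⟨⟨b, hb⟩, -, h3⟩ := face_hr_triple hx
    exact ⟨h3, fun hc => by rw [hc, hx] at hb; cases hb⟩
  · obtain ⟨hb, -, h3⟩ := face_hl_triple hx
    exact ⟨h3, fun hc => by rw [hc, hx] at hb; cases hb⟩

theorem not_isExt_of_isHor {d : LDart} (h : IsHor d) : ¬ P.IsExt d := by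
  rcases d with a | a | i | i
  · exact h.elim
  · exact h.elim
  · exact id
  · exact id

/-- Every face other than the exterior one contains a horizontal dart. -/
theorem exists_isHor {x : P.ct.Dart} (h2 : 2 ≤ P.h) (h : ¬ P.IsExt x.1) :
    ∃ y : P.ct.Dart, IsHor y.1 ∧ P.ct.faceOf y = P.ct.faceOf x := by
  have hm := x.2
  have key : ∀ {y : P.ct.Dart} {i}, y.1 = F (.inl i) → P.IsEdge (.inr i) →
      ∃ z : P.ct.Dart, IsHor z.1 ∧ P.ct.faceOf z = P.ct.faceOf y := by
    intro y i hy hi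
    refine ⟨P.ct.face y, ?_, faceOf_face y⟩
    rw [ct_face_F_inl hy hi]; trivial
  rcases hx : x.1 with a | a | i | i
  · rw [hx] at h hm
    rcases a with i | i
    · refine key hx ?_
      by_contra hi
      exact h (level_eq_of_isEdge hm hi)
    · have h1 := ct_face_F_inr hx
      have hi : 1 ≤ i := hm.1
      have h3 := ct_face_B_inr h1 (Equiv.apply_symm_apply _ _) (by omega)
      refine ⟨P.ct.face (P.ct.face x), ?_, by rw [faceOf_face, faceOf_face]⟩
      rw [h3]; trivial
  · rw [hx] at h hm
    rcases ha : P.sigma a with v | v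
    · have h1 := ct_face_B_inl hx ha
      have hv := isEdge_of_sigma_inl hm ha
      -- If `v` were on the top level, `a` would be the rightmost edge of its parent, and `x` would
      -- have the exterior face on its right.
      obtain ⟨z, hz, hz'⟩ := key h1 (by
        by_contra hi
        have hlev := level_eq_of_isEdge hv hi
        have hv1 : 1 ≤ v := hv.1
        have h3 := (sigma_symm_inl_of_num_eq_one hv1 (num_parent_eq_one hv1 hlev)).1
        rw [← ha, Equiv.symm_apply_apply] at h3
        subst h3
        apply h
        change ((P.level (P.parent v) + 1 : ℕ) : ℕ∞) = P.h
        rw [← P.level_parent hv1, hlev])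
      exact ⟨z, hz, hz'.trans (faceOf_face x)⟩
    · by_cases hv : v = 0
      · subst hv
        have h1 := ct_face_B_last hx ha
        obtain ⟨z, hz, hz'⟩ := key h1 (by
          rw [isEdge_inr, P.level_one]
          exact ⟨le_rfl, lt_of_lt_of_le (by norm_num) h2⟩)
        exact ⟨z, hz, hz'.trans (faceOf_face x)⟩
      · refine ⟨P.ct.face x, ?_, faceOf_face x⟩
        rw [ct_face_B_inr hx ha hv]; trivial
  · exact ⟨x, by rw [hx]; trivial, rfl⟩
  · exact ⟨x, by rw [hx]; trivial, rfl⟩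

theorem isTriangle_of_faceOf_eq {G : RootedMap} {x y : G.Dart} (h : G.faceOf y = G.faceOf x)
    (hy : G.IsTriangle y) : G.IsTriangle x := by
  obtain ⟨k, rfl⟩ := faceOf_eq_iff.1 h
  induction k using Int.induction_on with
  | zero => exact hy
  | succ k ih =>
    rw [add_comm, zpow_add, zpow_one, Equiv.Perm.mul_apply, isTriangle_face_iff]
    exact ih (faceOf_eq_iff.2 ⟨_, rfl⟩)
  | pred k ih =>
    rw [← isTriangle_face_iff, ← Equiv.Perm.mul_apply, ← zpow_one_add,
      show 1 + (-(k : ℤ) - 1) = -k by ring]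
    exact ih (faceOf_eq_iff.2 ⟨_, rfl⟩)

theorem isTriangle_of_not_isExt {x : P.ct.Dart} (h2 : 2 ≤ P.h) (h : ¬ P.IsExt x.1) :
    P.ct.IsTriangle x := by
  obtain ⟨y, hy, hy'⟩ := exists_isHor h2 h
  exact isTriangle_of_faceOf_eq hy' (isTriangle_of_isHor hy)

/-- Distinct horizontal darts lie in distinct faces. -/
theorem eq_of_faceOf_eq {x y : P.ct.Dart} (hx : IsHor x.1) (hy : IsHor y.1)
    (h : P.ct.faceOf x = P.ct.faceOf y) : y = x := by
  have key : ∀ {x y : P.ct.Dart}, (P.ct.face ^ 3) x = x → ¬ IsHor (P.ct.face x).1 →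
      ¬ IsHor (P.ct.face (P.ct.face x)).1 → IsHor y.1 → P.ct.faceOf x = P.ct.faceOf y → y = x := by
    intro x y h3 h1 h2 hy h
    obtain ⟨k, hk⟩ := faceOf_eq_iff.1 h
    have hmod : (P.ct.face ^ k) x = (P.ct.face ^ (k % 3)) x := by
      conv_lhs => rw [← Int.emod_add_mul_ediv k 3, zpow_add, Equiv.Perm.mul_apply, zpow_mul]
      congr 1
      exact Function.IsFixedPt.perm_zpow (e := P.ct.face ^ (3 : ℤ)) h3 _
    rw [hmod] at hk
    have hlt := Int.emod_lt_of_pos k (b := 3) (by norm_num)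
    have hnn := Int.emod_nonneg k (b := 3) (by norm_num)
    generalize k % 3 = m at hk hlt hnn
    interval_cases m
    · exact hk.symm
    · rw [← hk] at hy; exact absurd hy h1
    · rw [← hk] at hy; exact absurd hy h2
  rcases hx' : x.1 with a | a | i | i
  · rw [hx'] at hx; exact hx.elim
  · rw [hx'] at hx; exact hx.elim
  · obtain ⟨⟨b, hb⟩, h2, h3⟩ := face_hr_triple hx'
    exact key h3 (by rw [hb]; exact id) (by rw [h2]; exact id) hy h
  · obtain ⟨hb, h2, h3⟩ := face_hl_triple hx'
    exact key h3 (by rw [hb]; exact id) (by rw [h2]; exact id) hy h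

/-- The boundary is a zigzag: up to a top vertex `t` from its parent, down from `t` along the
rightmost edge of the parent of `next t`, and up again to its child. -/
theorem isExt_face {x : P.ct.Dart} (h2 : 2 ≤ P.h) (h : P.IsExt x.1) :
    (∃ t, x.1 = F (.inl t) ∧ ((P.level t : ℕ) : ℕ∞) = P.h ∧
      (P.ct.face x).1 = B (.inr (P.parent (P.next t)))) ∨
    (∃ v, x.1 = B (.inr v) ∧ ((P.level v + 1 : ℕ) : ℕ∞) = P.h ∧
      (P.ct.face x).1 = F (.inl (P.start v))) := by
  rcases hx : x.1 with (i | i) | (i | i) | i | i <;> rw [hx] at h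
  · exact Or.inl ⟨i, rfl, h, ct_face_top h2 hx h⟩
  · exact h.elim
  · exact h.elim
  · refine Or.inr ⟨i, rfl, h, ct_face_B_inl hx (P.sigma_inr ?_)⟩
    rw [P.tail i h.symm.le]; exact one_ne_zero
  · exact h.elim
  · exact h.elim

theorem one_le_of_level_eq {i : ℕ} (h : ((P.level i : ℕ) : ℕ∞) = P.h) : 1 ≤ i := by
  rcases Nat.eq_zero_or_pos i with rfl | h0
  · have := P.one_le
    rw [← h, P.level_zero] at this
    exact absurd this (by simp)
  · exact h0

theorem isExt_face_of_isExt {x : P.ct.Dart} (h2 : 2 ≤ P.h) (h : P.IsExt x.1) :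
    P.IsExt (P.ct.face x).1 := by
  rcases isExt_face h2 h with ⟨t, -, ht, hf⟩ | ⟨v, -, hv, hf⟩
  · rw [hf]
    change ((P.level (P.parent (P.next t)) + 1 : ℕ) : ℕ∞) = P.h
    rw [← P.level_parent (P.next_pos (one_le_of_level_eq ht)), level_next, ht]
  · rw [hf]
    change ((P.level (P.start v) : ℕ) : ℕ∞) = P.h
    rw [P.level_start (by rw [P.tail v hv.symm.le]; exact one_pos), hv]

/-- Darts of the forms `F` and `B` alternate along the boundary, so three steps never lead back to
the start. -/
theorem not_isTriangle_of_isExt {x : P.ct.Dart} (h2 : 2 ≤ P.h) (h : P.IsExt x.1) :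
    ¬ P.ct.IsTriangle x := by
  rintro ⟨h3, -⟩
  have e1 := isExt_face_of_isExt h2 h
  have e2 := isExt_face_of_isExt h2 e1
  rw [face_pow_three] at h3
  rcases isExt_face h2 h with ⟨t, hx, -, hf⟩ | ⟨v, hx, -, hf⟩ <;>
  rcases isExt_face h2 e1 with ⟨t', hx', -, hf'⟩ | ⟨v', hx', -, hf'⟩ <;>
  rcases isExt_face h2 e2 with ⟨t'', hx'', -, hf''⟩ | ⟨v'', hx'', -, hf''⟩ <;>
  simp_all

/-- The underlying dart of the ambient layered map. -/
def ctVal (x : P.ct.Dart) : LDart := x.1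

/-- The number of triangles of a finite causal triangulation. -/
theorem area_ct (h2 : 2 ≤ P.h) {k : ℕ} (hk : P.h = k) :
    P.ct.area = ((2 * (P.first k - 1) : ℕ) : ℕ∞) := by
  -- Each triangle has exactly one horizontal side, so triangles are counted by horizontal darts.
  -- There are two of these for each vertex of the levels `1, …, k - 1`.
  have hset : {f : P.ct.Face | ∃ d, P.ct.faceOf d = f ∧ P.ct.IsTriangle d} =
      P.ct.faceOf '' {x | IsHor x.1} := by
    ext f
    constructor
    · rintro ⟨d, rfl, hd⟩
      obtain ⟨y, hy, hy'⟩ := exists_isHor h2 (fun h => not_isTriangle_of_isExt h2 h hd)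
      exact ⟨y, hy, hy'⟩
    · rintro ⟨y, hy, rfl⟩
      exact ⟨y, rfl, isTriangle_of_isHor hy⟩
  have himg : ctVal '' {x : P.ct.Dart | IsHor x.1} =
      hr '' Set.Ico 1 (P.first k) ∪ hl '' Set.Ico 1 (P.first k) := by
    have hiff : ∀ i, P.IsEdge (.inr i) ↔ i ∈ Set.Ico 1 (P.first k) := by
      intro i
      rw [isEdge_inr, hk, Nat.cast_lt, P.level_lt_iff]
      rfl
    ext d
    constructor
    · rintro ⟨⟨d, hd⟩, hh, rfl⟩
      rcases d with a | a | i | i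
      · exact hh.elim
      · exact hh.elim
      · exact Or.inl ⟨i, (hiff i).1 hd, rfl⟩
      · exact Or.inr ⟨i, (hiff i).1 hd, rfl⟩
    · rintro (⟨i, hi, rfl⟩ | ⟨i, hi, rfl⟩)
      · exact ⟨⟨hr i, (hiff i).2 hi⟩, trivial, rfl⟩
      · exact ⟨⟨hl i, (hiff i).2 hi⟩, trivial, rfl⟩
  have hinj : Set.InjOn P.ct.faceOf {x : P.ct.Dart | IsHor x.1} :=
    fun x hx y hy h => (eq_of_faceOf_eq hx hy h).symm
  have hval : {x : P.ct.Dart | IsHor x.1}.encard =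
      (ctVal '' {x : P.ct.Dart | IsHor x.1}).encard :=
    (Set.InjOn.encard_image (fun x _ y _ h => Subtype.ext h)).symm
  have hinj1 : Function.Injective hr := fun i j h => by cases h; rfl
  have hinj2 : Function.Injective hl := fun i j h => by cases h; rfl
  rw [RootedMap.area, hset, hinj.encard_image, hval, himg,
    Set.encard_union_eq, hinj1.encard_image, hinj2.encard_image]
  · have hc : (Set.Ico 1 (P.first k)).encard = ((P.first k - 1 : ℕ) : ℕ∞) := by
      rw [← Finset.coe_Ico, Set.encard_coe_eq_coe_finsetCard, Nat.card_Ico]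
    rw [hc]
    push_cast
    ring
  · rw [Set.disjoint_left]
    rintro _ ⟨i, -, rfl⟩ ⟨j, -, h⟩
    cases h

end LayerCode

namespace LayerCode

open LDart Offspring RootedMap

variable {P : LayerCode}

theorem parent_one (P : LayerCode) : P.parent 1 = 0 :=
  P.parent_eq (by rw [P.start_zero])
    (by rw [start_succ, P.start_zero]; have := P.num_zero_pos; omega)

theorem org_root (P : LayerCode) : P.org (P.ct.root).1 = 1 := by
  change P.src (.inl 1) = 1
  rw [P.src_inl le_rfl, parent_one]

theorem isEdge_of_org_eq {x : P.ct.Dart} {i : ℕ} (h : P.org x.1 = i + 1) (hi : 1 ≤ i) :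
    P.IsEdge (.inl i) := by
  have h1 := (hgt_of_mem_ctDarts x.2).2
  rw [hgt_eq, h] at h1
  change ((P.level i + 1 : ℕ) : ℕ∞) ≤ P.h + 1 at h1
  push_cast at h1
  exact ⟨hi, (ENat.add_le_add_iff_right ENat.one_ne_top).1 h1⟩

/-! ### Simple connectivity -/

open Classical in
/-- The branch of the tree from the root vertex to the vertex `i`. -/
noncomputable def branch (P : LayerCode) (i : ℕ) : List P.ct.Dart :=
  if h : P.IsEdge (.inl i) then P.branch (P.parent i) ++ [⟨F (.inl i), h⟩] else []
  termination_by i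
  decreasing_by exact P.parent_lt h.1

theorem isWalk_branch (i : ℕ) (x : P.ct.Dart) (hx : P.org x.1 = i + 1) :
    P.ct.IsWalk (P.ct.vert P.ct.root) (P.branch i) (P.ct.vert x) := by
  induction i using Nat.strong_induction_on generalizing x with
  | _ i ih =>
    rcases Nat.eq_zero_or_pos i with rfl | hi
    · rw [branch, dif_neg not_isEdge_inl_zero]
      exact ct_vert_eq_iff.2 (by rw [org_root, hx])
    · have he := isEdge_of_org_eq hx hi
      rw [branch, dif_pos he]
      refine isWalk_append.2 ⟨_, ih _ (P.parent_lt hi) ⟨F (.inl i), he⟩ (P.src_inl hi), rfl, ?_⟩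
      exact ct_vert_eq_iff.2 hx.symm

/-- The number of a vertex. -/
noncomputable def index (v : P.ct.Vertex) : ℕ := P.org (exists_vert v).choose.1 - 1

theorem index_vert (x : P.ct.Dart) : P.index (P.ct.vert x) = P.org x.1 - 1 := by
  unfold index
  rw [ct_vert_eq_iff.1 (exists_vert (P.ct.vert x)).choose_spec]

theorem isWalk_branch_index (v : P.ct.Vertex) :
    P.ct.IsWalk (P.ct.vert P.ct.root) (P.branch (P.index v)) v := by
  obtain ⟨x, rfl⟩ := exists_vert v
  obtain ⟨i, hi, -⟩ := exists_org_eq x.2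
  rw [index_vert, hi, Nat.add_sub_cancel]
  exact isWalk_branch i x hi

/-- With the tree branches as base walks, the tree edges are null by construction. The remaining
darts are treated level by level, always as the third side of a triangle whose other sides are known
to be null. -/
theorem ct_simplyConnected {Φ : P.ct.Dart → Prop}
    (hΦ : ∀ d e, P.ct.faceOf d = P.ct.faceOf e → Φ d → Φ e) (hhor : ∀ d, IsHor d.1 → Φ d) :
    P.ct.SimplyConnected Φ := by
  refine simplyConnected_of_isNull isWalk_branch_index ?_
  set up := fun v => P.branch (P.index v)
  set s := P.ct.vert P.ct.root
  have hFl : ∀ (x : P.ct.Dart) i, x.1 = F (.inl i) → P.ct.IsNull Φ s up x := by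
    intro x i hx
    have hm : P.IsEdge (.inl i) := by have := x.2; rw [hx] at this; exact this
    have hi : 1 ≤ i := hm.1
    have h1 : up (P.ct.vert (P.ct.flip x)) = up (P.ct.vert x) ++ [x] := by
      change P.branch (P.index _) = P.branch (P.index _) ++ _
      rw [index_vert, index_vert, ct_flip, hx]
      change P.branch (i + 1 - 1) = P.branch (P.src (.inl i) - 1) ++ _
      rw [P.src_inl hi, Nat.add_sub_cancel, Nat.add_sub_cancel, branch, dif_pos hm]
      congr 2
      exact Subtype.ext hx.symm
    unfold IsNull
    rw [h1]
    exact Htp.refl (isWalk_append.2 ⟨_, isWalk_branch_index _, isWalk_singleton x⟩)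
  have hflip : ∀ x, P.ct.IsNull Φ s up (P.ct.flip x) → P.ct.IsNull Φ s up x := by
    intro x hx
    have := hx.flip isWalk_branch_index
    rwa [P.ct.flip_flip] at this
  have hBl : ∀ (x : P.ct.Dart) i, x.1 = B (.inl i) → P.ct.IsNull Φ s up x := by
    intro x i hx
    exact hflip x (hFl _ i (by rw [ct_flip, hx]; rfl))
  -- From the horizontal edges of level `k` to the rightmost edges that start there, using the
  -- triangles above. The induction runs around the level and starts where the preceding edge is a
  -- tree edge.
  have hB : ∀ k, (∀ (x : P.ct.Dart) i, P.level i = k → x.1 = hr i → P.ct.IsNull Φ s up x) →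
      ∀ v, P.level v = k → ∀ x : P.ct.Dart, x.1 = F (.inr v) → P.ct.IsNull Φ s up x := by
    intro k hk v
    have hz : ∀ v, P.level v = k → ∀ x : P.ct.Dart, x.1 = F (.inr v) →
        P.ct.IsNull Φ s up (P.ct.face x) → P.ct.IsNull Φ s up x := by
      intro v hv x hx hy
      have hm : P.IsEdge (.inr v) := by have := x.2; rw [hx] at this; exact this
      have hm1 : 1 ≤ v := hm.1
      have h1 := ct_face_F_inr hx
      have h2 : (P.ct.face (P.ct.face x)).1 = hl v :=
        ct_face_B_inr h1 (Equiv.apply_symm_apply _ _) (by omega)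
      have h3 : (P.ct.face ^ 3) x = x := by
        refine Subtype.ext ?_
        rw [face_pow_three, ct_face_hl h2, hx]
      have hΦx : Φ (P.ct.face x) :=
        hΦ _ _ (faceOf_face _) (hhor (P.ct.face (P.ct.face x)) (by rw [h2]; trivial))
      have htri : P.ct.IsTriangle (P.ct.face x) :=
        isTriangle_face_iff.1 (isTriangle_of_isHor (by rw [h2]; trivial))
      have h4 := hy.third isWalk_branch_index hΦx htri
        (hflip _ (hk _ v hv (by rw [ct_flip, h2]; rfl)))
      rwa [← face_pow_three, h3] at h4
    refine P.prev_induction (P := fun v => P.level v = k → ∀ x : P.ct.Dart, x.1 = F (.inr v) →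
      P.ct.IsNull Φ s up x) ?_ ?_ v
    · intro v h0 hv x hx
      have h1 := ct_face_F_inr hx
      rw [sigma_symm_inr _ h0] at h1
      exact hz v hv x hx (hBl _ _ h1)
    · intro v h0 ih hv x hx
      have h1 := ct_face_F_inr hx
      rw [sigma_symm_inr_zero _ h0] at h1
      refine hz v hv x hx (hflip _ (ih (by rw [level_prev, hv]) _ ?_))
      rw [ct_flip, h1]; rfl
  -- From the rightmost edges of level `k` to the horizontal edges of level `k + 1`, using the
  -- triangles below. Level `0` has no horizontal edges.
  have hA : ∀ k, ∀ (x : P.ct.Dart) i, P.level i = k → x.1 = hr i → P.ct.IsNull Φ s up x := by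
    intro k
    induction k with
    | zero =>
      intro x i hi hx
      have hm : P.IsEdge (.inr i) := by have := x.2; rw [hx] at this; exact this
      rw [P.level_eq_zero_iff] at hi
      subst hi
      exact absurd hm not_isEdge_inr_zero
    | succ k ih =>
      intro x i hi hx
      have hm : P.IsEdge (.inr i) := by have := x.2; rw [hx] at this; exact this
      have hm1 : 1 ≤ i := hm.1
      obtain ⟨-, h2, h3⟩ := face_hr_triple hx
      have hy : P.ct.IsNull Φ s up (P.ct.face x) := by
        by_cases h1 : i = 1
        · subst h1
          exact hBl _ _ (ct_face_hr_one hx)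
        · have h4 := ct_face_hr hx h1
          by_cases hf : i = P.start (P.parent i)
          · rw [P.sigma_symm_inl_first hm1 hf] at h4
            have h5 := P.level_parent hm1
            refine hflip _ (hB k ih (P.parent i) (by omega) _ ?_)
            rw [ct_flip, h4]; rfl
          · rw [P.sigma_symm_inl hm1 hf] at h4
            exact hBl _ _ h4
      have hΦx : Φ (P.ct.face x) := hΦ _ _ (faceOf_face _).symm (hhor x (by rw [hx]; trivial))
      have htri : P.ct.IsTriangle (P.ct.face x) :=
        isTriangle_face_iff.2 (isTriangle_of_isHor (by rw [hx]; trivial))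
      have h6 := hy.third isWalk_branch_index hΦx htri (hFl _ _ h2)
      rwa [← face_pow_three, h3] at h6
  intro x
  rcases hx : x.1 with (i | i) | (i | i) | i | i
  · exact hFl x i hx
  · exact hB _ (hA _) i rfl x hx
  · exact hBl x i hx
  · exact hflip x (hB _ (hA _) i rfl _ (by rw [ct_flip, hx]; rfl))
  · exact hA _ x i rfl hx
  · exact hflip x (hA _ _ i rfl (by rw [ct_flip, hx]; rfl))

/-! ### The cycles -/

theorem org_of_ht_eq {x : P.ct.Dart} {k : ℕ} (h : P.ct.ht x = k) :
    ∃ i, P.org x.1 = i + 1 ∧ P.level i = k := by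
  obtain ⟨i, hi, hi'⟩ := exists_org_eq x.2
  have := ct_ht x
  exact ⟨i, hi, by omega⟩

theorem ht_of_org_eq {x : P.ct.Dart} {i : ℕ} (h : P.org x.1 = i + 1) : P.ct.ht x = P.level i := by
  have := ct_ht x
  rw [hgt_eq, h] at this
  exact Nat.add_right_cancel this

theorem isHor_of_hgt_eq {d : LDart} (h : P.hgt d.flip = P.hgt d) : IsHor d := by
  rcases d with a | a | i | i
  · exact absurd h (Nat.succ_ne_self _)
  · exact absurd h.symm (Nat.succ_ne_self _)
  · trivial
  · trivial

theorem ct_no_root_loop (d : P.ct.Dart) (hd : P.ct.ht d = 0) : P.ct.ht (P.ct.flip d) ≠ 0 := by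
  intro hd'
  have h1 := ct_ht d
  have h2 := ct_ht (P.ct.flip d)
  have hm := d.2
  have hh : IsHor d.1 := isHor_of_hgt_eq (P := P) (by rw [← ct_flip]; omega)
  rcases hx : d.1 with a | a | i | i <;> rw [hx] at hh hm h1
  · exact hh
  · exact hh
  · change _ = P.level i + 1 at h1
    obtain rfl : i = 0 := P.level_eq_zero_iff.1 (by omega)
    exact not_isEdge_inr_zero hm
  · change _ = P.level i + 1 at h1
    obtain rfl : i = 0 := P.level_eq_zero_iff.1 (by omega)
    exact not_isEdge_inr_zero hm

/-- The horizontal darts at the vertex `i` are `hr i` and `hl (next i)`, and `next` runs through the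
whole level. -/
theorem ct_spansCycle {k : ℕ} (hk : 0 < k) (hk' : (k : ℕ∞) < P.h) : P.ct.SpansCycle k := by
  have hedge : ∀ i, P.level i = k → P.IsEdge (.inr i) := by
    intro i hi
    rw [isEdge_inr, hi]
    refine ⟨?_, hk'⟩
    rcases Nat.eq_zero_or_pos i with rfl | h0
    · rw [P.level_zero] at hi; omega
    · exact h0
  constructor
  · let vx : ∀ i, P.level i = k → P.ct.Vertex := fun i hi => P.ct.vert ⟨hr i, hedge i hi⟩
    have hvx : ∀ i hi, P.ct.height (vx i hi) = k := by
      intro i hi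
      exact (ht_of_org_eq (i := i) rfl).trans hi
    have hreach : ∀ i (hi : P.level i = k), (P.ct.graph.induce {v | P.ct.height v = k}).Reachable
        ⟨vx (P.first k) (P.level_first k), hvx (P.first k) (P.level_first k)⟩ ⟨vx i hi, hvx i hi⟩ := by
      intro i hi
      refine P.next_induction (P := fun i => ∀ hi : P.level i = k,
        (P.ct.graph.induce {v | P.ct.height v = k}).Reachable
        ⟨vx (P.first k) (P.level_first k), hvx (P.first k) (P.level_first k)⟩ ⟨vx i hi, hvx i hi⟩) (k := k)
        ⟨_, P.level_first k, fun _ => SimpleGraph.Reachable.refl _⟩ ?_ hi hi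
      intro i hi ih hi'
      refine (ih hi).trans ?_
      -- If the level has a single vertex, the horizontal edge is a loop, which is not an edge of
      -- the simple graph.
      by_cases heq : vx i hi = vx (P.next i) hi'
      · have : (⟨vx i hi, hvx i hi⟩ : {v | P.ct.height v = k}) = ⟨vx (P.next i) hi', hvx (P.next i) hi'⟩ :=
          Subtype.ext heq
        rw [this]
      · refine SimpleGraph.Adj.reachable ?_
        change P.ct.graph.Adj (vx i hi) (vx (P.next i) hi')
        refine ⟨heq, ⟨hl (P.next i), hedge _ hi'⟩, ?_, rfl⟩
        refine ct_vert_eq_iff.2 ?_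
        change P.prev (P.next i) + 1 = i + 1
        rw [prev_next]
    have hne : Nonempty {v | P.ct.height v = k} := ⟨⟨vx (P.first k) (P.level_first k), hvx (P.first k) (P.level_first k)⟩⟩
    have hall : ∀ v : {v | P.ct.height v = k}, (P.ct.graph.induce {v | P.ct.height v = k}).Reachable
        ⟨vx (P.first k) (P.level_first k), hvx (P.first k) (P.level_first k)⟩ v := by
      rintro ⟨v, hv⟩
      obtain ⟨x, rfl⟩ := exists_vert v
      obtain ⟨i, hi, hi'⟩ := org_of_ht_eq (x := x) hv
      have : P.ct.vert x = vx i hi' := ct_vert_eq_iff.2 hi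
      have h2 := hreach i hi'
      convert h2
    exact SimpleGraph.Connected.mk fun u v => (hall u).symm.trans (hall v)
  · intro v hv
    obtain ⟨x, rfl⟩ := exists_vert v
    obtain ⟨i, hi, hi'⟩ := org_of_ht_eq (x := x) hv
    have hset : {d | P.ct.vert d = P.ct.vert x ∧ P.ct.ht (P.ct.flip d) = k} =
        {(⟨hr i, hedge i hi'⟩ : P.ct.Dart), (⟨hl (P.next i),
          hedge (P.next i) (by rw [level_next, hi'])⟩ : P.ct.Dart)} := by
      ext d
      constructor
      · rintro ⟨h1, h2⟩
        have h3 := ct_vert_eq_iff.1 h1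
        rw [hi] at h3
        have h4 := ct_ht d
        have h5 := ct_ht (P.ct.flip d)
        rw [ht_of_org_eq h3] at h4
        have hh : IsHor d.1 := isHor_of_hgt_eq (P := P) (by rw [← ct_flip]; omega)
        rcases hx : d.1 with a | a | j | j <;> rw [hx] at hh h3
        · exact hh.elim
        · exact hh.elim
        · obtain rfl : j = i := Nat.add_right_cancel h3
          exact Or.inl (Subtype.ext hx)
        · obtain rfl : P.prev j = i := Nat.add_right_cancel h3
          refine Or.inr (Subtype.ext (hx.trans ?_))
          exact congrArg hl (P.next_prev j).symm
      · rintro (rfl | rfl)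
        · refine ⟨ct_vert_eq_iff.2 hi.symm, (ht_of_org_eq (i := P.prev i) rfl).trans ?_⟩
          rw [level_prev, hi']
        · refine ⟨ct_vert_eq_iff.2 ?_, (ht_of_org_eq (i := P.next i) rfl).trans ?_⟩
          · change P.prev (P.next i) + 1 = _
            rw [prev_next, hi]
          · rw [level_next, hi']
    change Nat.card ({d | P.ct.vert d = P.ct.vert x ∧ P.ct.ht (P.ct.flip d) = k} : Set _) = 2
    rw [Nat.card_coe_set_eq, hset]
    refine Set.ncard_pair fun h => ?_
    cases congrArg Subtype.val h

theorem ct_isInfiniteCT (h : P.h = ⊤) : P.ct.IsInfiniteCT where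
  plane :=
    { infinite := by
        refine Infinite.of_injective (fun i : ℕ => (⟨hr (i + 1), ?_⟩ : P.ct.Dart)) ?_
        · change P.IsEdge (.inr (i + 1))
          rw [isEdge_inr, h]
          exact ⟨Nat.le_add_left 1 i, ENat.natCast_lt_top _⟩
        · intro i j hij
          cases congrArg Subtype.val hij
          rfl
      connected := ct_connected P
      triangle := fun d => isTriangle_of_not_isExt (by rw [h]; exact le_top) (by
        intro hd
        rcases hx : d.1 with (i | i) | (i | i) | i | i <;> rw [hx] at hd
        · exact ENat.natCast_ne_top _ (Eq.trans hd h)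
        · exact hd
        · exact hd
        · exact ENat.natCast_ne_top _ (Eq.trans hd h)
        · exact hd
        · exact hd)
      simplyConnected := ct_simplyConnected (fun _ _ _ _ => trivial) (fun _ _ => trivial) }
  no_root_loop := ct_no_root_loop
  cycle := fun k hk => ct_spansCycle hk (by rw [h]; exact ENat.natCast_lt_top _)

end LayerCode

/-! ### Finite causal triangulations and their boundary -/

namespace LayerCode

open LDart Offspring RootedMap

variable {P : LayerCode} {k : ℕ}

theorem isExt_iff_not_isTriangle (h2 : 2 ≤ P.h) (x : P.ct.Dart) :
    P.IsExt x.1 ↔ ¬ P.ct.IsTriangle x :=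
  ⟨not_isTriangle_of_isExt h2, fun h => by_contra fun h' => h (isTriangle_of_not_isExt h2 h')⟩

theorem finite_ct (hk : P.h = k) : Finite P.ct.Dart := by
  have hfin : (P.ctDarts).Finite := by
    refine (P.finite_hgt_le (k + 1)).subset fun d hd => ?_
    have := (hgt_of_mem_ctDarts hd).2
    rw [hk] at this
    exact_mod_cast this
  exact hfin.to_subtype

theorem isEdge_first (hk : P.h = k) : P.IsEdge (.inl (P.first k)) := by
  have h1 := P.one_le
  rw [hk] at h1
  replace h1 : 1 ≤ k := by exact_mod_cast h1
  rw [isEdge_inl, P.level_first, hk]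
  exact ⟨h1.trans (P.le_first k), le_rfl⟩

/-- A dart with the exterior face on its right. -/
def extDart (hk : P.h = k) : P.ct.Dart := ⟨F (.inl (P.first k)), isEdge_first hk⟩

/-- Two steps along the face lead from the edge ending at the top vertex `t` to the one ending at
`next t`, so the exterior darts form a single face. Conversely, being a triangle is a property of
the whole face. -/
theorem faceOf_eq_extDart_iff (h2 : 2 ≤ P.h) (hk : P.h = k) (x : P.ct.Dart) :
    P.ct.faceOf x = P.ct.faceOf (extDart hk) ↔ P.IsExt x.1 := by
  have hext : P.IsExt (F (.inl (P.first k))) := by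
    change ((P.level (P.first k) : ℕ) : ℕ∞) = P.h
    rw [P.level_first, hk]
  constructor
  · intro h
    rw [isExt_iff_not_isTriangle h2]
    intro h'
    exact (isExt_iff_not_isTriangle h2 (extDart hk)).1 hext (isTriangle_of_faceOf_eq h h')
  · have key : ∀ t, P.level t = k → ∀ y : P.ct.Dart, y.1 = F (.inl t) →
        P.ct.faceOf y = P.ct.faceOf (extDart hk) := by
      intro t ht
      refine P.next_induction (P := fun t => ∀ y : P.ct.Dart, y.1 = F (.inl t) →
        P.ct.faceOf y = P.ct.faceOf (extDart hk)) (k := k) ⟨_, P.level_first k, ?_⟩ ?_ ht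
      · intro y hy
        exact congrArg _ (Subtype.ext hy)
      · intro t ht ih y hy
        have ht' : ((P.level t : ℕ) : ℕ∞) = P.h := by rw [ht, hk]
        have hn' : ((P.level (P.next t) : ℕ) : ℕ∞) = P.h := by rw [level_next, ht, hk]
        have hm : P.IsEdge (.inl t) := P.isEdge_inl.2 ⟨one_le_of_level_eq ht', ht'.le⟩
        let z : P.ct.Dart := ⟨F (.inl t), hm⟩
        have h1 := ct_face_top (x := z) h2 rfl ht'
        have hone := num_parent_eq_one (one_le_of_level_eq hn') hn'
        have hs := P.parent_spec (one_le_of_level_eq hn')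
        rw [start_succ, hone] at hs
        have h3 := ct_face_B_inl h1 (P.sigma_inr (by omega))
        rw [← ih z rfl, ← faceOf_face z, ← faceOf_face (P.ct.face z)]
        refine congrArg _ (Subtype.ext ?_)
        rw [h3, hy]
        congr 2
        omega
    intro h
    rcases isExt_face h2 h with ⟨t, hx, ht, -⟩ | ⟨v, hx, hv, hf⟩
    · exact key t (by rw [hk] at ht; exact_mod_cast ht) x hx
    · rw [← faceOf_face x]
      refine key (P.start v) ?_ _ hf
      rw [P.level_start (by rw [P.tail v hv.symm.le]; exact one_pos)]
      rw [hk] at hv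
      exact_mod_cast hv

theorem target_eq_start_prev {v : ℕ} (h : P.num (P.prev v) = 1) : P.target v = P.start (P.prev v) := by
  rw [target_eq, if_neg (by omega), start_succ, h, Nat.add_sub_cancel]

/-- The darts at a vertex of maximal height. -/
theorem top_darts {t : ℕ} (ht : ((P.level t : ℕ) : ℕ∞) = P.h) {d : P.ct.Dart}
    (hd : P.org d.1 = t + 1) : d.1 = B (.inl t) ∨ d.1 = B (.inr (P.next (P.parent t))) := by
  have hm := d.2
  have ht1 := one_le_of_level_eq ht
  have hno : ∀ i, P.level i = P.level t → ¬ P.IsEdge (.inr i) := by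
    intro i hi h
    rw [isEdge_inr, hi, ht] at h
    exact lt_irrefl _ h.2
  rcases hx : d.1 with (i | i) | (i | i) | i | i <;> rw [hx] at hd hm
  · have hi : 1 ≤ i := hm.1
    change P.src (.inl i) = t + 1 at hd
    rw [P.src_inl hi] at hd
    have h1 := P.level_parent hi
    rw [Nat.add_right_cancel hd] at h1
    have h2 : ((P.level i : ℕ) : ℕ∞) ≤ P.h := hm.2
    rw [h1, ← ht] at h2
    norm_cast at h2
    omega
  · obtain rfl : i = t := Nat.add_right_cancel hd
    exact absurd hm (hno _ rfl)
  · obtain rfl : i = t := Nat.add_right_cancel hd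
    exact Or.inl rfl
  · right
    have h1 : P.target i = t := Nat.add_right_cancel hd
    have h2 := P.level_target i
    have hone : P.num (P.prev i) = 1 := by
      refine P.tail _ ?_
      rw [level_prev, ← h2, h1, ht]
    rw [target_eq_start_prev hone] at h1
    rw [← h1, P.parent_eq le_rfl (by rw [start_succ]; omega), next_prev]
  · obtain rfl : i = t := Nat.add_right_cancel hd
    exact absurd hm (hno _ rfl)
  · have h1 : P.prev i = t := Nat.add_right_cancel hd
    exact absurd hm (hno _ (by rw [← h1, level_prev]))

theorem target_next_parent {t : ℕ} (ht : ((P.level t : ℕ) : ℕ∞) = P.h) :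
    P.target (P.next (P.parent t)) = t := by
  have ht1 := one_le_of_level_eq ht
  have hone := num_parent_eq_one ht1 ht
  rw [target_eq_start_prev (by rw [prev_next]; exact hone), prev_next]
  have := P.parent_spec ht1
  rw [start_succ, hone] at this
  omega

theorem ct_isFiniteCTWith (h2 : 2 ≤ P.h) (hk : P.h = k) :
    P.ct.IsFiniteCTWith (extDart hk) k := by
  have hk2 : 2 ≤ k := by rw [hk] at h2; exact_mod_cast h2
  have hlev : ∀ {i}, ((P.level i : ℕ) : ℕ∞) = P.h ↔ P.level i = k := by
    intro i
    rw [hk, Nat.cast_inj]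
  have hext := faceOf_eq_extDart_iff h2 hk
  refine ⟨⟨finite_ct hk, ct_connected P, ?_, ?_, ?_⟩, ?_, ?_, ct_no_root_loop, ?_, ?_, ?_⟩
  · intro d hd
    exact isTriangle_of_not_isExt h2 (fun h => hd ((hext d).2 h))
  -- The boundary is a simple cycle. Darts starting on different levels cannot share their origin;
  -- on equal levels, single children make the passage to the parent, respectively to the target,
  -- injective.
  · intro d e hd he hde
    rw [hext] at hd he
    rw [ct_vert_eq_iff] at hde
    rcases isExt_face h2 hd with ⟨t, hx, ht, -⟩ | ⟨v, hx, hv, -⟩ <;>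
    rcases isExt_face h2 he with ⟨t', hx', ht', -⟩ | ⟨v', hx', hv', -⟩
    · have h1 := one_le_of_level_eq ht
      have h1' := one_le_of_level_eq ht'
      rw [hx, hx'] at hde
      change P.src (.inl t) = P.src (.inl t') at hde
      rw [P.src_inl h1, P.src_inl h1'] at hde
      have hp := Nat.add_right_cancel hde
      have h3 := P.parent_spec h1
      have h3' := P.parent_spec h1'
      have h4 := num_parent_eq_one h1 ht
      rw [start_succ] at h3 h3'
      rw [← hp] at h3'
      have : t = t' := by omega
      exact Subtype.ext (by rw [hx, hx', this])
    · exfalso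
      have h3 := hgt_congr hde
      rw [hx, hx'] at h3
      change P.level t = P.level v' + 1 + 1 at h3
      rw [hlev] at ht
      have h4 : P.level v' + 1 = k := by rw [hk] at hv'; exact_mod_cast hv'
      omega
    · exfalso
      have h3 := hgt_congr hde
      rw [hx, hx'] at h3
      change P.level v + 1 + 1 = P.level t' at h3
      rw [hlev] at ht'
      have h4 : P.level v + 1 = k := by rw [hk] at hv; exact_mod_cast hv
      omega
    · rw [hx, hx'] at hde
      have hde : P.target v = P.target v' := Nat.add_right_cancel hde
      have hone : ∀ {v}, ((P.level v + 1 : ℕ) : ℕ∞) = P.h → P.num (P.prev v) = 1 := by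
        intro v hv
        exact P.tail _ (by rw [level_prev, hv])
      rw [target_eq_start_prev (hone hv), target_eq_start_prev (hone hv')] at hde
      have h5 : P.prev v = P.prev v' := by
        have h6 := P.parent_eq (i := P.prev v) le_rfl (by rw [start_succ, hone hv]; omega)
        rw [hde, P.parent_eq (i := P.prev v') le_rfl (by rw [start_succ, hone hv']; omega)] at h6
        exact h6.symm
      exact Subtype.ext (by rw [hx, hx', P.prev_injective h5])
  · refine ct_simplyConnected ?_ ?_
    · intro d e hde hd
      rwa [← hde]
    · intro d hd
      rw [ne_eq, hext]
      exact not_isExt_of_isHor hd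
  · intro v
    obtain ⟨x, rfl⟩ := exists_vert v
    have h3 := (hgt_of_mem_ctDarts x.2).2
    have h4 := ct_ht x
    rw [hk] at h3
    norm_cast at h3
    change P.ct.ht x ≤ k
    omega
  · refine ⟨P.ct.vert (P.ct.flip (extDart hk)), ?_⟩
    exact (ht_of_org_eq (i := P.first k) rfl).trans (P.level_first k)
  · intro j hj hjk
    exact ct_spansCycle hj (by rw [hk]; exact_mod_cast hjk)
  · intro v hv
    obtain ⟨x, rfl⟩ := exists_vert v
    obtain ⟨t, ht, ht'⟩ := org_of_ht_eq (x := x) hv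
    have hth := hlev.2 ht'
    have ht1 := one_le_of_level_eq hth
    have hm1 : B (.inl t) ∈ P.ctDarts := P.isEdge_inl.2 ⟨ht1, hth.le⟩
    have hm2 : B (.inr (P.next (P.parent t))) ∈ P.ctDarts := by
      have h4 := isEdge_inr_parent h2 hth
      rw [isEdge_inr] at h4
      exact P.isEdge_inr.2 ⟨P.next_pos h4.1, by rw [level_next]; exact h4.2⟩
    have hset : {d | P.ct.vert d = P.ct.vert x} = {(⟨B (.inl t), hm1⟩ : P.ct.Dart),
        (⟨B (.inr (P.next (P.parent t))), hm2⟩ : P.ct.Dart)} := by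
      ext d
      constructor
      · intro hd
        rcases top_darts hth ((ct_vert_eq_iff.1 hd).trans ht) with h | h
        · exact Or.inl (Subtype.ext h)
        · exact Or.inr (Subtype.ext h)
      · rintro (rfl | rfl)
        · exact ct_vert_eq_iff.2 ht.symm
        · refine ct_vert_eq_iff.2 ?_
          rw [ht]
          exact congrArg (· + 1) (target_next_parent hth)
    -- Of the two darts at a top vertex, this one has the exterior face on its right, so the other
    -- one marks the only triangle.
    have hext2 : P.IsExt (B (.inr (P.next (P.parent t)))) := by
      change ((P.level (P.next (P.parent t)) + 1 : ℕ) : ℕ∞) = P.h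
      rw [level_next, ← P.level_parent ht1, hth]
    constructor
    · change Nat.card ({d | P.ct.vert d = P.ct.vert x} : Set _) = 2
      rw [Nat.card_coe_set_eq, hset]
      refine Set.ncard_pair fun h => ?_
      cases congrArg Subtype.val h
    · refine ⟨⟨B (.inl t), hm1⟩, ⟨ct_vert_eq_iff.2 ht.symm, ?_⟩, ?_⟩
      · exact fun h => (hext _).1 h
      · rintro d ⟨hd, hd'⟩
        have hd : d ∈ {d | P.ct.vert d = P.ct.vert x} := hd
        rw [hset] at hd
        rcases hd with rfl | rfl
        · rfl
        · exact absurd ((hext _).2 hext2) hd'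
  · intro d hd
    rw [hext] at hd
    have h3 := ct_ht d
    have h4 := ct_ht (P.ct.flip d)
    rw [ct_flip] at h4
    rcases isExt_face h2 hd with ⟨t, hx, ht, -⟩ | ⟨v, hx, hv, -⟩ <;> rw [hx] at h3 h4
    · rw [hlev] at ht
      change _ = P.level t at h3
      change _ = P.level t + 1 at h4
      right
      omega
    · have hv : P.level v + 1 = k := by rw [hk] at hv; exact_mod_cast hv
      change _ = P.level v + 1 + 1 at h3
      change _ = P.level v + 1 at h4
      left
      omega

theorem ct_isFiniteCT (h2 : 2 ≤ P.h) (hk : P.h = k) : P.ct.IsFiniteCT :=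
  ⟨_, _, ct_isFiniteCTWith h2 hk⟩

end LayerCode

/-- A graph with a height function for which every vertex has at most one neighbour that is not
higher is acyclic. -/
theorem SimpleGraph.isAcyclic_of_height {V : Type*} {G : SimpleGraph V} (f : V → ℕ)
    (hne : ∀ u v, G.Adj u v → f u ≠ f v)
    (huniq : ∀ v u w, G.Adj v u → G.Adj v w → f u < f v → f w < f v → u = w) : G.IsAcyclic := by
  classical
  intro v c hc
  -- At a highest vertex of a cycle both neighbours are lower, hence equal, which is impossible for
  -- a cycle.
  obtain ⟨w, hw, hmax⟩ := c.support.toFinset.exists_max_image f ⟨v, by simp⟩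
  have hw' : w ∈ c.support := by simpa using hw
  have hc' := hc.rotate hw'
  set c' := c.rotate w hw'
  have hmem : ∀ x ∈ c'.support, f x ≤ f w := by
    intro x hx
    refine hmax x ?_
    rw [List.mem_toFinset]
    exact (c.mem_support_rotate_iff w hw').1 hx
  have hnil := hc'.not_nil
  have h1 := c'.adj_snd hnil
  have h2 := (c'.adj_penultimate hnil).symm
  refine hc'.snd_ne_penultimate (huniq w _ _ h1 h2 ?_ ?_)
  · exact lt_of_le_of_ne (hmem _ (c'.getVert_mem_support 1)) (hne _ _ h1).symm
  · exact lt_of_le_of_ne (hmem _ (c'.getVert_mem_support _)) (hne _ _ h2).symm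

/-! ### Isomorphism invariance of the number of edges and of the area -/

namespace RootedMap

variable {G H : RootedMap}

def Iso.graphIso (e : Iso G H) : G.graph ≃g H.graph where
  toFun := e.vertexMap
  invFun := e.symm.vertexMap
  left_inv := e.vertexMap_symm
  right_inv := e.symm.vertexMap_symm
  map_rel_iff' {v w} := by
    constructor
    · intro h
      have := e.symm.graphHom.map_adj h
      change G.graph.Adj (e.symm.vertexMap (e.vertexMap v)) (e.symm.vertexMap (e.vertexMap w)) at this
      rwa [e.vertexMap_symm, e.vertexMap_symm] at this
    · intro h
      exact e.graphHom.map_adj h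

theorem Iso.encard_edgeSet_eq (e : Iso G H) : G.graph.edgeSet.encard = H.graph.edgeSet.encard :=
  Set.encard_congr e.graphIso.mapEdgeSet

theorem Iso.map_face (e : Iso G H) (d : G.Dart) : e.toEquiv (G.face d) = H.face (e.toEquiv d) := by
  rw [face_apply, e.map_rot, e.map_flip]; rfl

theorem Iso.isTriangle_iff (e : Iso G H) (d : G.Dart) :
    H.IsTriangle (e.toEquiv d) ↔ G.IsTriangle d := by
  unfold IsTriangle
  rw [face_pow_three, face_pow_three, ← e.map_face, ← e.map_face, ← e.map_face,
    e.toEquiv.injective.eq_iff, e.toEquiv.injective.ne_iff]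

theorem Iso.face_sameCycle (e : Iso G H) {d d' : G.Dart} (h : G.face.SameCycle d d') :
    H.face.SameCycle (e.toEquiv d) (e.toEquiv d') := by
  obtain ⟨k, rfl⟩ := h
  have hs : H.face = e.toEquiv.permCongr G.face := by
    ext x
    rw [Equiv.permCongr_apply, e.map_face, Equiv.apply_symm_apply]
  have hz : H.face ^ k = e.toEquiv.permCongr (G.face ^ k) := by
    rw [hs]
    exact (map_zpow e.toEquiv.permCongrHom G.face k).symm
  exact ⟨k, by rw [hz, Equiv.permCongr_apply, Equiv.symm_apply_apply]⟩

theorem Iso.area_le (e : Iso G H) : G.area ≤ H.area := by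
  let φ : G.Face → H.Face := Quotient.map e.toEquiv fun _ _ h => e.face_sameCycle h
  have hφ : Function.Injective φ := by
    intro a b hab
    induction a using Quotient.inductionOn with
    | _ a =>
    induction b using Quotient.inductionOn with
    | _ b =>
    have h1 : H.face.SameCycle (e.toEquiv a) (e.toEquiv b) := Quotient.exact hab
    have h2 := e.symm.face_sameCycle h1
    refine Quotient.sound ?_
    change G.face.SameCycle (e.toEquiv.symm _) (e.toEquiv.symm _) at h2
    rwa [Equiv.symm_apply_apply, Equiv.symm_apply_apply] at h2
  unfold area
  rw [← hφ.encard_image]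
  refine Set.encard_le_encard ?_
  rintro _ ⟨_, ⟨d, rfl, hd⟩, rfl⟩
  exact ⟨e.toEquiv d, rfl, (e.isTriangle_iff d).2 hd⟩

theorem Iso.area_eq (e : Iso G H) : G.area = H.area := le_antisymm e.area_le e.symm.area_le

end RootedMap

/-! ### The tree of a code -/

namespace LayerCode

open LDart Offspring RootedMap

variable {P : LayerCode}

theorem mem_treeDarts_F {i : ℕ} : F (.inl i) ∈ P.treeDarts ↔ ((P.level i : ℕ) : ℕ∞) < P.h := Iff.rfl

theorem mem_treeDarts_B {i : ℕ} : B (.inl i) ∈ P.treeDarts ↔ ((P.level i : ℕ) : ℕ∞) < P.h := Iff.rfl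

/-- Turning counterclockwise, the rightmost edges that end at a common vertex are passed one after
another until the edge from its parent is met. -/
theorem isFirstReturn_tree_B_inr (j : ℕ) (h : ((P.level (P.target j) : ℕ) : ℕ∞) < P.h) :
    IsFirstReturn P.rot P.treeDarts (B (.inr j)) (B (.inl (P.target j))) := by
  refine P.prev_induction (P := fun j => ((P.level (P.target j) : ℕ) : ℕ∞) < P.h →
    IsFirstReturn P.rot P.treeDarts (B (.inr j)) (B (.inl (P.target j)))) ?_ ?_ j h
  · intro v hv h
    have h1 : P.rot (B (.inr v)) = B (.inl (P.target v)) := by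
      rw [rot_B_inr, sigma_symm_inr _ hv, target_eq, if_neg hv]
    rw [← h1]
    refine isFirstReturn_of_apply_mem ?_
    rw [h1]
    exact h
  · intro v hv ih h
    rw [target_eq, if_pos hv] at h ⊢
    refine IsFirstReturn.step ?_ ?_ <;> rw [rot_B_inr, sigma_symm_inr_zero _ hv]
    · exact id
    · exact ih h

/-- After the horizontal dart on the left of a vertex, only rightmost edges arriving from below can
precede the edge to its parent. -/
theorem isFirstReturn_tree_hl (v : ℕ) (h : ((P.level v : ℕ) : ℕ∞) < P.h) :
    IsFirstReturn P.rot P.treeDarts (hl v) (B (.inl (P.prev v))) := by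
  have h1 := P.org_rot (hl v)
  rw [rot_hl] at h1
  have h1 : P.tgt (P.sigma.symm (.inl v)) = P.prev v := Nat.add_right_cancel h1
  rcases h2 : P.sigma.symm (.inl v) with i | i <;> rw [h2] at h1
  · have h3 : P.rot (hl v) = B (.inl (P.prev v)) := by rw [rot_hl, h2, ← h1]; rfl
    rw [← h3]
    refine isFirstReturn_of_apply_mem ?_
    rw [h3, mem_treeDarts_B, level_prev]
    exact h
  · have h1 : P.target i = P.prev v := h1
    refine IsFirstReturn.step ?_ ?_ <;> rw [rot_hl, h2]
    · exact id
    · rw [← h1]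
      exact isFirstReturn_tree_B_inr i (by rw [h1, level_prev]; exact h)

theorem isFirstReturn_tree_child {i : ℕ} (h : 0 < P.num i)
    (h' : ((P.level i + 1 : ℕ) : ℕ∞) < P.h) :
    IsFirstReturn P.rot P.treeDarts (B (.inl i)) (F (.inl (P.start i))) := by
  have h1 := P.rot_F_of_inl (P.sigma_inr h.ne')
  refine IsFirstReturn.step ?_ ?_ <;> rw [rot_B_inl]
  · exact id
  refine IsFirstReturn.step ?_ ?_ <;> rw [rot_hr]
  · exact id
  rw [← h1]
  refine isFirstReturn_of_apply_mem ?_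
  rw [h1, mem_treeDarts_F, P.level_start h]
  exact h'

/-- A leaf of the cut tree either has no child in the code or lies on the last level, where its only
child is above the cut. -/
theorem isFirstReturn_tree_leaf {i : ℕ} (hi : ((P.level i : ℕ) : ℕ∞) < P.h)
    (h : P.num i = 0 ∨ ¬ ((P.level i + 1 : ℕ) : ℕ∞) < P.h) :
    IsFirstReturn P.rot P.treeDarts (B (.inl i)) (B (.inl i)) := by
  have h0 := isFirstReturn_tree_hl (P := P) (P.next i) (by rw [level_next]; exact hi)
  rw [prev_next] at h0
  refine IsFirstReturn.step ?_ ?_ <;> rw [rot_B_inl]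
  · exact id
  refine IsFirstReturn.step ?_ ?_ <;> rw [rot_hr]
  · exact id
  by_cases hn : P.num i = 0
  · have h1 := P.rot_F_of_inr (P.sigma_inr_zero hn)
    refine IsFirstReturn.step ?_ ?_ <;> rw [h1]
    · exact id
    · exact h0
  · have h2 := h.resolve_left hn
    have hone : P.num i = 1 := P.tail i (not_lt.1 h2)
    have hlev := P.level_start (i := i) (by omega)
    have hpar : P.parent (P.start i) = i := P.parent_eq le_rfl (by rw [start_succ]; omega)
    have hs := P.lt_start i
    have h1 := P.rot_F_of_inl (P.sigma_inr hn)
    have h3 := P.rot_F_of_inr (sigma_symm_inl_of_num_eq_one (P := P) (i := P.start i) (by omega)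
      (by rw [hpar, hone])).2
    rw [hpar] at h3
    refine IsFirstReturn.step ?_ ?_ <;> rw [h1]
    · rw [mem_treeDarts_F, hlev]; exact h2
    refine IsFirstReturn.step ?_ ?_ <;> rw [h3]
    · exact id
    · exact h0

theorem isFirstReturn_tree_sibling {i : ℕ} (h1 : 1 ≤ i) (hi : ((P.level i : ℕ) : ℕ∞) < P.h)
    (h : i + 1 ≠ P.start (P.parent i + 1)) :
    IsFirstReturn P.rot P.treeDarts (F (.inl i)) (F (.inl (i + 1))) := by
  have h2 := P.rot_F_of_inl (P.sigma_inl h1 h)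
  rw [← h2]
  refine isFirstReturn_of_apply_mem ?_
  have h3 : P.edgeLevel (P.sigma (.inl i)) = P.level i := P.edgeLevel_sigma _
  rw [P.sigma_inl h1 h] at h3
  change P.level (i + 1) = P.level i at h3
  rw [h2, mem_treeDarts_F, h3]
  exact hi

theorem isFirstReturn_tree_last {i : ℕ} (h1 : 1 ≤ i) (hi : ((P.level i : ℕ) : ℕ∞) < P.h)
    (h : i + 1 = P.start (P.parent i + 1)) :
    IsFirstReturn P.rot P.treeDarts (F (.inl i)) (B (.inl (P.parent i))) := by
  have h2 := P.rot_F_of_inr (P.sigma_inl_last h1 h)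
  refine IsFirstReturn.step ?_ ?_ <;> rw [h2]
  · exact id
  have h3 := isFirstReturn_tree_hl (P := P) (P.next (P.parent i)) (by
    rw [level_next]
    refine lt_of_le_of_lt ?_ hi
    rw [P.level_parent h1]
    exact_mod_cast Nat.le_succ _)
  rwa [prev_next] at h3

theorem isFirstReturn_tree_root :
    IsFirstReturn P.rot P.treeDarts (F (.inl 0)) (F (.inl 0)) := by
  have h2 : P.rot (F (.inl 0)) = F (.inl 0) := P.rot_F_of_inl P.sigma_inl_zero
  have h3 := isFirstReturn_of_apply_mem (f := P.rot) (S := P.treeDarts) (a := F (.inl 0))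
    (by rw [h2]; exact P.root_mem_treeDarts)
  rwa [h2] at h3

theorem tree_rot_eq {x : P.tree.Dart} {b : LDart} (h : IsFirstReturn P.rot P.treeDarts x.1 b) :
    (P.tree.rot x).1 = b := RootedMap.submap_rot_eq (hd := x.2) h

theorem tree_flip (x : P.tree.Dart) : (P.tree.flip x).1 = x.1.flip := rfl

theorem tree_vert_eq_iff {x y : P.tree.Dart} :
    P.tree.vert x = P.tree.vert y ↔ P.org x.1 = P.org y.1 :=
  RootedMap.submap_vert_eq_iff.trans P.sameCycle_iff

theorem tree_cases (x : P.tree.Dart) : ∃ i, ((P.level i : ℕ) : ℕ∞) < P.h ∧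
    (x.1 = F (.inl i) ∨ x.1 = B (.inl i)) := by
  have hm := x.2
  rcases hx : x.1 with (i | i) | (i | i) | i | i <;> rw [hx] at hm
  · exact ⟨i, hm, Or.inl rfl⟩
  · exact hm.elim
  · exact ⟨i, hm, Or.inr rfl⟩
  · exact hm.elim
  · exact hm.elim
  · exact hm.elim

theorem level_lt_of_org_eq {x : P.tree.Dart} {i : ℕ} (h : P.org x.1 = i + 1) :
    ((P.level i : ℕ) : ℕ∞) < P.h := by
  obtain ⟨j, hj, hx | hx⟩ := tree_cases x <;> rw [hx] at h
  · change P.src (.inl j) = i + 1 at h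
    rcases Nat.eq_zero_or_pos j with rfl | hj1
    · cases h
    · rw [P.src_inl hj1] at h
      have h3 := P.level_parent hj1
      rw [Nat.add_right_cancel h] at h3
      refine lt_of_le_of_lt ?_ hj
      rw [h3]
      exact_mod_cast Nat.le_succ _
  · obtain rfl : j = i := Nat.add_right_cancel h
    exact hj

theorem tree_connected_and_ht (P : LayerCode) :
    P.tree.graph.Connected ∧ ∀ x : P.tree.Dart, P.tree.ht x = P.hgt x.1 := by
  refine RootedMap.connected_and_ht_eq (fun x : P.tree.Dart => P.hgt x.1) ?_ ?_ ?_ ?_ ?_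
  · intro x
    exact hgt_congr (tree_vert_eq_iff.1 (vert_rot x))
  · exact P.level_zero
  · intro x hx
    refine tree_vert_eq_iff.2 ?_
    change _ = 0
    change P.hgt x.1 = 0 at hx
    rcases h : P.org x.1 with - | i
    · rfl
    · rw [P.hgt_eq x.1, h] at hx
      cases hx
  · intro x
    exact hgt_flip x.1
  · intro x n hx
    change P.hgt x.1 = n + 1 at hx
    rcases h : P.org x.1 with - | i
    · rw [P.hgt_eq x.1, h] at hx
      cases hx
    · rw [P.hgt_eq x.1, h] at hx
      refine ⟨⟨B (.inl i), level_lt_of_org_eq h⟩, tree_vert_eq_iff.2 ?_, Nat.add_right_cancel hx⟩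
      rw [h]; rfl

theorem tree_connected (P : LayerCode) : P.tree.graph.Connected := (tree_connected_and_ht P).1

theorem tree_ht (x : P.tree.Dart) : P.tree.ht x = P.hgt x.1 := (tree_connected_and_ht P).2 x

theorem tree_eq_of_lower {d e : P.tree.Dart} (h : P.tree.vert d = P.tree.vert e)
    (hd : P.tree.ht (P.tree.flip d) < P.tree.ht d) (he : P.tree.ht (P.tree.flip e) < P.tree.ht e) :
    d = e := by
  have key : ∀ d : P.tree.Dart, P.tree.ht (P.tree.flip d) < P.tree.ht d →
      ∃ i, d.1 = B (.inl i) := by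
    intro d hd
    obtain ⟨i, -, hx | hx⟩ := tree_cases d
    · rw [tree_ht, tree_ht, tree_flip, hx] at hd
      exact absurd hd (not_lt.2 (Nat.le_succ _))
    · exact ⟨i, hx⟩
  obtain ⟨i, hi⟩ := key d hd
  obtain ⟨j, hj⟩ := key e he
  rw [tree_vert_eq_iff, hi, hj] at h
  obtain rfl : i = j := Nat.add_right_cancel h
  exact Subtype.ext (hi.trans hj.symm)

theorem tree_ht_ne (d : P.tree.Dart) : P.tree.ht (P.tree.flip d) ≠ P.tree.ht d := by
  obtain ⟨i, -, hx | hx⟩ := tree_cases d <;> rw [tree_ht, tree_ht, tree_flip, hx]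
  · exact Nat.succ_ne_self _
  · exact (Nat.succ_ne_self _).symm

theorem tree_isRootedTree (P : LayerCode) : P.tree.IsRootedTree where
  tree := by
    refine ⟨tree_connected P, SimpleGraph.isAcyclic_of_height P.tree.height ?_ ?_⟩
    · rintro _ _ ⟨-, d, rfl, rfl⟩
      exact (tree_ht_ne d).symm
    · rintro _ _ _ ⟨-, d, rfl, rfl⟩ ⟨-, e, he, rfl⟩ h1 h2
      rw [← he] at h2
      rw [tree_eq_of_lower (d := d) (e := e) he.symm h1 h2]
  no_loop d h := tree_ht_ne d (ht_congr h)
  no_multi d e h h' := by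
    rcases lt_or_gt_of_ne (tree_ht_ne d) with h1 | h1
    · refine tree_eq_of_lower h h1 ?_
      rw [← ht_congr h, ← ht_congr h']
      exact h1
    · refine flip_injective (tree_eq_of_lower h' ?_ ?_)
      · rw [P.tree.flip_flip]; exact h1
      · rw [P.tree.flip_flip, ← ht_congr h, ← ht_congr h']; exact h1
  root_degree := by
    have hset : {d | P.tree.vert d = P.tree.vert P.tree.root} = {P.tree.root} := by
      ext d
      refine ⟨fun hd => ?_, fun hd => by rw [Set.mem_singleton_iff.1 hd]; rfl⟩
      have hd := tree_vert_eq_iff.1 hd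
      change P.org d.1 = 0 at hd
      obtain ⟨i, -, hx | hx⟩ := tree_cases d <;> rw [hx] at hd
      · rcases Nat.eq_zero_or_pos i with rfl | hi
        · exact Subtype.ext hx
        · change P.src (.inl i) = 0 at hd
          rw [P.src_inl hi] at hd
          cases hd
      · cases hd
    change Nat.card ({d | P.tree.vert d = P.tree.vert P.tree.root} : Set _) = 1
    rw [Nat.card_coe_set_eq, hset, Set.ncard_singleton]

/-- Each edge is named by its upper vertex `i`; the levels of the endpoints show that no edge is
named twice. -/
theorem tree_encard_edgeSet (P : LayerCode) :
    P.tree.graph.edgeSet.encard = {i | ((P.level i : ℕ) : ℕ∞) < P.h}.encard := by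
  let f : {i | ((P.level i : ℕ) : ℕ∞) < P.h} → Sym2 P.tree.Vertex := fun i =>
    s(P.tree.vert (⟨F (.inl i.1), i.2⟩ : P.tree.Dart), P.tree.vert (⟨B (.inl i.1), i.2⟩ : P.tree.Dart))
  have hf : Function.Injective f := by
    intro i j hij
    have hij := Sym2.eq_iff.1 hij
    rcases hij with ⟨-, h2⟩ | ⟨h1, h2⟩
    · exact Subtype.ext (Nat.add_right_cancel (tree_vert_eq_iff.1 h2))
    · have h3 := hgt_congr (tree_vert_eq_iff.1 h1)
      have h4 := hgt_congr (tree_vert_eq_iff.1 h2)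
      change P.level i.1 = P.level j.1 + 1 at h3
      change P.level i.1 + 1 = P.level j.1 at h4
      omega
  have himg : P.tree.graph.edgeSet = f '' Set.univ := by
    ext e
    induction e using Sym2.ind with
    | _ v w =>
    rw [SimpleGraph.mem_edgeSet]
    constructor
    · rintro ⟨-, d, rfl, rfl⟩
      obtain ⟨i, hi, hx | hx⟩ := tree_cases d
      · obtain rfl : d = ⟨F (.inl i), hi⟩ := Subtype.ext hx
        exact ⟨⟨i, hi⟩, trivial, rfl⟩
      · obtain rfl : d = ⟨B (.inl i), hi⟩ := Subtype.ext hx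
        exact ⟨⟨i, hi⟩, trivial, Sym2.eq_swap⟩
    · rintro ⟨i, -, h⟩
      have hadj : P.tree.graph.Adj (P.tree.vert ⟨F (.inl i.1), i.2⟩)
          (P.tree.vert ⟨B (.inl i.1), i.2⟩) :=
        ⟨fun hc => tree_ht_ne (P := P) ⟨F (.inl i.1), i.2⟩ (ht_congr hc.symm), _, rfl, rfl⟩
      rw [← SimpleGraph.mem_edgeSet, ← h]
      exact hadj
  rw [himg, hf.encard_image, Set.encard_univ]
  rfl

theorem tree_encard_edgeSet_of_eq {k : ℕ} (hk : P.h = k) :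
    P.tree.graph.edgeSet.encard = ((P.first k : ℕ) : ℕ∞) := by
  have h : {i | ((P.level i : ℕ) : ℕ∞) < P.h} = ↑(Finset.range (P.first k)) := by
    ext i
    change ((P.level i : ℕ) : ℕ∞) < P.h ↔ i ∈ Finset.range (P.first k)
    rw [hk, Nat.cast_lt, P.level_lt_iff, Finset.mem_range]
  rw [tree_encard_edgeSet, h, Set.encard_coe_eq_coe_finsetCard, Finset.card_range]

theorem tree_infinite_vertex (h : P.h = ⊤) : Infinite P.tree.Vertex := by
  refine Infinite.of_injective (fun i : ℕ => P.tree.vert (⟨B (.inl i), ?_⟩ : P.tree.Dart)) ?_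
  · rw [mem_treeDarts_B, h]; exact ENat.natCast_lt_top _
  · intro i j hij
    exact Nat.add_right_cancel (tree_vert_eq_iff.1 hij)

theorem tree_finite {k : ℕ} (hk : P.h = k) : Finite P.tree.Dart := by
  have hfin : (P.treeDarts).Finite := by
    refine (P.finite_hgt_le (k + 1)).subset fun d hd => ?_
    change P.hgt d ≤ k + 1
    obtain ⟨i, hi, hx | hx⟩ := tree_cases ⟨d, hd⟩ <;> rw [hk] at hi <;>
      replace hi : P.level i < k := by exact_mod_cast hi
    · obtain rfl : d = _ := hx
      change P.level i ≤ _
      omega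
    · obtain rfl : d = _ := hx
      change P.level i + 1 ≤ _
      omega
  exact hfin.to_subtype

end LayerCode

theorem IsFirstReturn.of_between {α : Type*} {f : Equiv.Perm α} {S : Set α} {a b : α} {n m : ℕ}
    (hb : (f ^ n) a = b) (hbS : b ∈ S) (hmin : ∀ k, 0 < k → k < n → (f ^ k) a ∉ S) (hm : m < n) :
    IsFirstReturn f S ((f ^ m) a) b := by
  refine ⟨hbS, n - m, by omega, ?_, fun k h0 h1 => ?_⟩
  · rw [← Equiv.Perm.mul_apply, ← pow_add, Nat.sub_add_cancel hm.le, hb]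
  · rw [← Equiv.Perm.mul_apply, ← pow_add]
    exact hmin _ (by omega) (by omega)

namespace LayerCode

open LDart Offspring RootedMap

variable {P : LayerCode}

/-! ### The tree of a causal triangulation -/

theorem ct_ht_flip_F {x : P.ct.Dart} {a : ℕ ⊕ ℕ} (hx : x.1 = F a) : P.ct.IsForward x := by
  have h1 := ct_ht x
  have h2 := ct_ht (P.ct.flip x)
  rw [ct_flip, hx] at h2
  rw [hx] at h1
  change _ = P.edgeLevel a + 1 at h2
  change _ = P.edgeLevel a at h1
  change P.ct.ht (P.ct.flip x) = _
  omega

theorem exists_ct_ht {k : ℕ} (hk : 1 ≤ k) (hk' : (k : ℕ∞) ≤ P.h) : ∃ x : P.ct.Dart, P.ct.ht x = k := by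
  have hm : P.IsEdge (.inl (P.first k)) := by
    refine ⟨hk.trans (P.le_first k), ?_⟩
    change ((P.level _ : ℕ) : ℕ∞) ≤ _
    rw [P.level_first]
    exact hk'
  refine ⟨⟨B (.inl (P.first k)), hm⟩, ?_⟩
  have := ct_ht (P := P) ⟨B (.inl (P.first k)), hm⟩
  change _ = P.level (P.first k) + 1 at this
  rw [P.level_first] at this
  omega

theorem ct_deleted_flip (x : P.ct.Dart) : P.ct.Deleted (P.ct.flip x) ↔ P.ct.Deleted x :=
  ⟨fun h => h.of_flip, fun h => Deleted.of_flip _ (by rwa [P.ct.flip_flip])⟩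

/-- An edge to a child is kept unless the child has maximal height: it is preceded by another
forward dart or starts at the root vertex, so it is never deleted as a rightmost edge. -/
theorem ct_deleted_F_inl {x : P.ct.Dart} {i : ℕ} (hx : x.1 = F (.inl i)) :
    P.ct.Deleted x ↔ ¬ ((P.level i : ℕ) : ℕ∞) < P.h := by
  have hm : P.IsEdge (.inl i) := by have := x.2; rw [hx] at this; exact this
  have hfwd := ct_ht_flip_F hx
  have hfwd' : P.ct.ht (P.ct.flip x) = P.ct.ht x + 1 := hfwd
  have hlev : P.ct.ht (P.ct.flip x) = P.level i := by
    have h2 := ct_ht (P.ct.flip x)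
    rw [ct_flip, hx] at h2
    exact Nat.add_right_cancel h2
  constructor
  · rintro (h | h | h | ⟨h0, -, h⟩ | ⟨-, h, -⟩) hlt
    · omega
    · have := h (P.ct.flip x); omega
    · obtain ⟨y, hy⟩ := exists_ct_ht (P := P) (k := P.level i + 1) (by omega)
        (by push_cast; exact Order.add_one_le_of_lt hlt)
      have := h y
      omega
    · have h1 : i ≠ 1 := by
        rintro rfl
        rw [P.level_one] at hlev
        omega
      have ha := isEdge_sigma_symm_inl hm h1
      have h2 : P.ct.rot.symm x = ⟨F (P.sigma.symm (.inl i)), ha⟩ := P.ct.rot.symm_apply_eq.2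
        (Subtype.ext (hx.trans (ct_rot_F_inl rfl (Equiv.apply_symm_apply _ _)).symm))
      exact h (ct_ht_flip_F (congrArg ctVal h2))
    · have h3 : P.ct.ht (P.ct.flip (P.ct.flip x)) = P.ct.ht (P.ct.flip x) + 1 := h
      rw [P.ct.flip_flip] at h3
      omega
  · intro h
    refine Or.inr (Or.inr (Or.inl fun y => ?_))
    have h1 := (hgt_of_mem_ctDarts y.2).2
    rw [← ct_ht y, le_antisymm (not_lt.1 h) hm.2] at h1
    push_cast at h1
    rw [hlev]
    exact_mod_cast (ENat.add_le_add_iff_right ENat.one_ne_top).1 h1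

/-- The preceding dart is the horizontal dart `hr i`. -/
theorem ct_deleted_F_inr {x : P.ct.Dart} {i : ℕ} (hx : x.1 = F (.inr i)) : P.ct.Deleted x := by
  have hm : P.IsEdge (.inr i) := by have := x.2; rw [hx] at this; exact this
  have h0 := ct_ht x
  rw [hx] at h0
  change _ = P.level i + 1 at h0
  have h1 : 1 ≤ P.level i := P.level_pos hm.1
  refine Or.inr (Or.inr (Or.inr (Or.inl ⟨by omega, ct_ht_flip_F hx, ?_⟩)))
  have h2 : P.ct.rot.symm x = ⟨hr i, hm⟩ := P.ct.rot.symm_apply_eq.2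
    (Subtype.ext (hx.trans (ct_rot_hr rfl).symm))
  intro h
  replace h : P.ct.ht (P.ct.flip _) = P.ct.ht (P.ct.rot.symm x) + 1 := h
  generalize P.ct.rot.symm x = y at h h2
  subst h2
  have h3 := ct_ht (P := P) ⟨hr i, hm⟩
  have h4 := ct_ht (P.ct.flip ⟨hr i, hm⟩)
  change _ = P.level i + 1 at h3
  change _ = P.level i + 1 at h4
  omega

theorem ct_deleted_of_isHor {x : P.ct.Dart} (hx : IsHor x.1) : P.ct.Deleted x := by
  have h3 := ct_ht x
  have h4 := ct_ht (P.ct.flip x)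
  rw [ct_flip] at h4
  have h5 : P.hgt x.1.flip = P.hgt x.1 := by
    rcases hd : x.1 with a | a | i | i <;> rw [hd] at hx
    · exact hx.elim
    · exact hx.elim
    · rfl
    · rfl
  exact Or.inl (by omega)

theorem ct_deleted_iff (x : P.ct.Dart) : P.ct.Deleted x ↔ x.1 ∉ P.treeDarts := by
  have hF : ∀ x : P.ct.Dart, ∀ a, x.1 = F a → (P.ct.Deleted x ↔ x.1 ∉ P.treeDarts) := by
    rintro x (i | i) hx
    · rw [hx]; exact ct_deleted_F_inl hx
    · rw [hx]; exact ⟨fun _ => id, fun _ => ct_deleted_F_inr hx⟩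
  rcases hx : x.1 with a | a | i | i
  · rw [← hx]; exact hF x a hx
  · have := hF (P.ct.flip x) a (by rw [ct_flip, hx]; rfl)
    rw [ct_deleted_flip, ct_flip, hx] at this
    rw [this]
    rcases a with i | i <;> exact Iff.rfl
  · exact ⟨fun _ => id, fun _ => ct_deleted_of_isHor (by rw [hx]; trivial)⟩
  · exact ⟨fun _ => id, fun _ => ct_deleted_of_isHor (by rw [hx]; trivial)⟩

/-- The darts of the causal triangulation and of the edge below it. -/
def plusDarts (P : LayerCode) : Set LDart := P.ctDarts ∪ {F (.inl 0), B (.inl 0)}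

theorem ctDarts_subset_plusDarts : P.ctDarts ⊆ P.plusDarts := Set.subset_union_left

theorem treeDarts_subset_plusDarts : P.treeDarts ⊆ P.plusDarts := by
  intro d hd
  obtain ⟨i, hi, hx⟩ := tree_cases ⟨d, hd⟩
  rcases Nat.eq_zero_or_pos i with rfl | h0
  · exact Or.inr hx
  · left
    rcases hx with hx | hx <;> obtain rfl : d = _ := hx <;> exact ⟨h0, hi.le⟩

/-- The darts of the causal triangulation with the edge added by `β`. -/
def plusMap : P.ct.addPendant.Dart → LDart
  | .inl d => ctVal d
  | .inr false => F (.inl 0)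
  | .inr true => B (.inl 0)

theorem plusMap_mem (x : P.ct.addPendant.Dart) : plusMap x ∈ P.plusDarts := by
  rcases x with d | b
  · exact Or.inl d.2
  · cases b
    · exact Or.inr (Or.inl rfl)
    · exact Or.inr (Or.inr rfl)

theorem F_zero_not_mem : F (.inl 0) ∉ P.ctDarts := not_isEdge_inl_zero

theorem B_zero_not_mem : B (.inl 0) ∉ P.ctDarts := not_isEdge_inl_zero

theorem plusMap_injective : Function.Injective (plusMap (P := P)) := by
  have h : ∀ (d : P.ct.Dart) (b : Bool), plusMap (P := P) (.inl d) ≠ plusMap (P := P) (.inr b) := by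
    intro d b hdb
    have h1 : plusMap (P := P) (.inl d) ∈ P.ctDarts := d.2
    rw [hdb] at h1
    cases b
    · exact F_zero_not_mem h1
    · exact B_zero_not_mem h1
  rintro (d | b) (e | c) hde
  · exact congrArg Sum.inl (Subtype.ext hde)
  · exact absurd hde (h _ _)
  · exact absurd hde.symm (h _ _)
  · cases b <;> cases c <;> first | rfl | cases hde

theorem plusMap_surj {d : LDart} (hd : d ∈ P.plusDarts) : ∃ x, plusMap (P := P) x = d := by
  rcases hd with hd | rfl | rfl
  · exact ⟨.inl ⟨d, hd⟩, rfl⟩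
  · exact ⟨.inr false, rfl⟩
  · exact ⟨.inr true, rfl⟩

theorem isFirstReturn_B_zero {S : Set LDart} (h1 : hr 0 ∉ S) (h2 : F (.inr 0) ∉ S)
    (h3 : F (.inl 1) ∈ S) : IsFirstReturn P.rot S (B (.inl 0)) (F (.inl 1)) := by
  have h5 := P.rot_F_of_inl (sigma_inr_root P)
  refine IsFirstReturn.step ?_ ?_ <;> rw [rot_B_inl]
  · exact h1
  refine IsFirstReturn.step ?_ ?_ <;> rw [rot_hr]
  · exact h2
  rw [← h5]
  refine isFirstReturn_of_apply_mem ?_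
  rw [h5]
  exact h3

theorem hr_zero_not_mem : hr 0 ∉ P.plusDarts := by
  rintro (h | h | h)
  · exact not_isEdge_inr_zero h
  · cases h
  · cases h

theorem hl_zero_not_mem : hl 0 ∉ P.plusDarts := by
  rintro (h | h | h)
  · exact not_isEdge_inr_zero h
  · cases h
  · cases h

theorem F_inr_zero_not_mem : F (.inr 0) ∉ P.plusDarts := by
  rintro (h | h | h)
  · exact not_isEdge_inr_zero h
  · cases h
  · cases h

/-- The ambient map contains the edge between `r` and the root vertex in just the corner where
`addPendant` attaches it. -/
theorem isFirstReturn_plusMap (x : P.ct.addPendant.Dart) :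
    IsFirstReturn P.rot P.plusDarts (plusMap x) (plusMap (P.ct.pendantRot x)) := by
  rcases x with d | b
  · rw [pendantRot_inl]
    split_ifs with h
    · have hd : d = ⟨F (.inl (P.start 1 - 1)), isEdge_last P⟩ := by
        apply P.ct.rot.injective
        rw [h]
        refine Subtype.ext (ct_rot_F_last rfl ?_).symm
        rw [← sigma_symm_inr_root, Equiv.apply_symm_apply]
      have h0 : P.rot (F (.inl (P.start 1 - 1))) = hl 0 := P.rot_F_of_inr (by
        rw [← sigma_symm_inr_root, Equiv.apply_symm_apply])
      have h1 : P.rot (hl 0) = B (.inl 0) := by rw [rot_hl, sigma_symm_inl_zero]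
      rw [hd]
      change IsFirstReturn P.rot P.plusDarts (F (.inl (P.start 1 - 1))) (B (.inl 0))
      refine IsFirstReturn.step ?_ ?_ <;> rw [h0]
      · exact hl_zero_not_mem
      rw [← h1]
      refine isFirstReturn_of_apply_mem ?_
      rw [h1]
      exact Or.inr (Or.inr rfl)
    · have h1 : IsFirstReturn P.rot P.ctDarts (ctVal d) (ctVal (P.ct.rot d)) :=
        isFirstReturn_firstReturn P.rot P.rot_hasFiniteOrbits P.ctDarts d
      obtain ⟨h2, n, hn, hnb, hmin⟩ := h1
      refine ⟨ctDarts_subset_plusDarts h2, n, hn, hnb, fun m h0 hm hmem => ?_⟩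
      change (P.rot ^ m) (ctVal d) ∈ P.plusDarts at hmem
      rcases hmem with hmem | hmem | hmem
      · exact hmin m h0 hm hmem
      · have h3 := P.sameCycle_iff.1 (sameCycle_iterate P.rot m (ctVal d))
        rw [hmem] at h3
        obtain ⟨i, hi, -⟩ := exists_org_eq d.2
        exact Nat.succ_ne_zero _ (hi.symm.trans h3)
      -- Had the orbit met `B (inl 0)`, the next dart of the triangulation would be the root dart `F
      -- (inl 1)`, which this case excludes.
      · have h3 := IsFirstReturn.of_between hnb h2 hmin hm
        rw [Set.mem_singleton_iff.1 hmem] at h3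
        have h4 := h3.unique (isFirstReturn_B_zero (fun h => hr_zero_not_mem (Or.inl h))
          (fun h => F_inr_zero_not_mem (Or.inl h)) P.isEdge_one)
        exact h (Subtype.ext h4)
  · cases b
    · rw [pendantRot_false]
      have h2 : P.rot (F (.inl 0)) = F (.inl 0) := P.rot_F_of_inl P.sigma_inl_zero
      have h3 := isFirstReturn_of_apply_mem (f := P.rot) (S := P.plusDarts) (a := F (.inl 0))
        (by rw [h2]; exact Or.inr (Or.inl rfl))
      rwa [h2] at h3
    · rw [pendantRot_true]
      exact isFirstReturn_B_zero hr_zero_not_mem F_inr_zero_not_mem (Or.inl P.isEdge_one)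

theorem mem_betaDarts_iff (x : P.ct.addPendant.Dart) :
    x ∈ P.ct.betaDarts ↔ plusMap x ∈ P.treeDarts := by
  rcases x with d | b
  · constructor
    · intro h
      have := h d rfl
      rw [ct_deleted_iff, not_not] at this
      exact this
    · rintro h e he
      obtain rfl : d = e := Sum.inl.inj he
      rw [ct_deleted_iff, not_not]
      exact h
  · constructor
    · intro _
      cases b <;> exact P.root_mem_treeDarts
    · intro _ e he
      cases he

/-- Both rotations are first returns of the ambient one. That of `β` arises in two stages, first to
`plusDarts` and then to the surviving darts, and `IsFirstReturn.of_firstReturn` composes them. -/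
theorem nonempty_iso_beta (P : LayerCode) : Nonempty (Iso P.ct.beta P.tree) := by
  let e₀ : P.ct.addPendant.Dart ≃ P.plusDarts :=
    Equiv.ofBijective (fun x => ⟨plusMap x, plusMap_mem x⟩)
      ⟨fun x y h => plusMap_injective (congrArg Subtype.val h), fun ⟨d, hd⟩ => by
        obtain ⟨x, rfl⟩ := plusMap_surj hd
        exact ⟨x, rfl⟩⟩
  have he₀ : ∀ x, e₀ (P.ct.addPendant.rot x) =
      firstReturn P.rot P.rot_hasFiniteOrbits P.plusDarts (e₀ x) := fun x =>
    Subtype.ext (firstReturn_eq P.rot_hasFiniteOrbits (isFirstReturn_plusMap x)).symm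
  let φ : P.ct.beta.Dart → P.tree.Dart := fun x => ⟨plusMap x.1, (mem_betaDarts_iff x.1).1 x.2⟩
  refine nonempty_iso_of_hom (tree_connected P) φ ?_ ?_ ?_ ?_
  · intro x y h
    exact Subtype.ext (plusMap_injective (congrArg Subtype.val h))
  · intro x
    have h1 : IsFirstReturn P.ct.addPendant.rot P.ct.betaDarts x.1 (P.ct.beta.rot x).1 :=
      isFirstReturn_firstReturn _ P.ct.addPendant.finite_orbits _ x
    have h2 := h1.map e₀ he₀ (S' := {y | y.1 ∈ P.treeDarts}) mem_betaDarts_iff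
    have h3 := h2.of_firstReturn P.rot_hasFiniteOrbits treeDarts_subset_plusDarts
    exact Subtype.ext (tree_rot_eq (x := φ x) h3).symm
  · rintro ⟨d | b, h⟩
    · rfl
    · cases b <;> rfl
  · rfl

end LayerCode

namespace Offspring

open LDart

variable {C C' : Offspring}

/-! ### Offspring sequences that agree on the lowest levels -/

theorem start_congr {n : ℕ} (h : ∀ j < n, C.num j = C'.num j) {i : ℕ} (hi : i ≤ n) :
    C'.start i = C.start i := by
  unfold start
  refine congrArg _ (Finset.sum_congr rfl fun j hj => (h j ?_).symm)
  have := Finset.mem_range.1 hj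
  omega

theorem first_congr {n : ℕ} (h : ∀ j < n, C.num j = C'.num j) :
    ∀ k, C.first k ≤ n → C'.first k = C.first k
  | 0, _ => rfl
  | k + 1, hk => by
    have h1 := C.first_lt k
    rw [first_succ, first_succ, first_congr h k (by omega), start_congr h (by omega)]

theorem first_succ_congr {n : ℕ} (h : ∀ j < n, C.num j = C'.num j) {k : ℕ} (hk : C.first k ≤ n) :
    C'.first (k + 1) = C.first (k + 1) := by
  rw [first_succ, first_succ, first_congr h k hk, start_congr h hk]

/-- The extent of a level is determined by the offspring of the vertices below this level. -/
theorem level_congr {n : ℕ} (h : ∀ j < n, C.num j = C'.num j) {i : ℕ}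
    (hi : C.first (C.level i) ≤ n) : C'.level i = C.level i := by
  have h1 := C.level_spec i
  refine C'.level_eq ?_ ?_
  · rw [first_congr h _ hi]; exact h1.1
  · rw [first_succ_congr h hi]; exact h1.2

/-- The vertices below level `R` have the same numbers of children. -/
def AgreeTo (R : ℕ) (C C' : Offspring) : Prop := ∀ j < C.first R, C.num j = C'.num j

namespace AgreeTo

variable {R : ℕ}

theorem first_eq (h : AgreeTo R C C') {k : ℕ} (hk : k ≤ R + 1) : C'.first k = C.first k := by
  rcases Nat.lt_or_ge R k with h1 | h1
  · obtain rfl : k = R + 1 := by omega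
    exact first_succ_congr h le_rfl
  · exact first_congr h k (C.first_mono h1)

theorem symm (h : AgreeTo R C C') : AgreeTo R C' C := fun j hj =>
  (h j (by rwa [h.first_eq (Nat.le_succ R)] at hj)).symm

theorem level_eq (h : AgreeTo R C C') {i : ℕ} (hi : C.level i ≤ R) : C'.level i = C.level i :=
  level_congr h (C.first_mono hi)

theorem num_eq (h : AgreeTo R C C') {i : ℕ} (hi : C.level i < R) : C'.num i = C.num i :=
  (h i (C.level_lt_iff.1 hi)).symm

theorem parent_lt {i : ℕ} (h1 : 1 ≤ i) (hi : C.level i ≤ R) : C.parent i < C.first R := by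
  rw [← level_lt_iff]
  have := C.level_parent h1
  omega

theorem parent_eq (h : AgreeTo R C C') {i : ℕ} (h1 : 1 ≤ i) (hi : C.level i ≤ R) :
    C'.parent i = C.parent i := by
  have h2 := parent_lt h1 hi
  have h3 := C.parent_spec h1
  refine C'.parent_eq ?_ ?_
  · rw [start_congr h h2.le]; exact h3.1
  · rw [start_congr h h2]; exact h3.2

theorem next_eq (h : AgreeTo R C C') {i : ℕ} (hi : C.level i ≤ R) : C'.next i = C.next i := by
  unfold next
  rw [h.level_eq hi, h.first_eq (by omega), h.first_eq (by omega)]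

theorem edgeLevel_eq (h : AgreeTo R C C') {a : ℕ ⊕ ℕ} (ha : C.edgeLevel a ≤ R) :
    C'.edgeLevel a = C.edgeLevel a := by
  rcases a with i | i
  · exact h.level_eq ha
  · exact congrArg (· + 1) (h.level_eq ((Nat.le_succ _).trans ha))

theorem sigma_eq (h : AgreeTo R C C') {a : ℕ ⊕ ℕ} (ha : C.edgeLevel a ≤ R) :
    C'.sigma a = C.sigma a := by
  rcases a with i | i
  · change C.level i ≤ R at ha
    change C'.sigmaFun (.inl i) = C.sigmaFun (.inl i)
    rcases Nat.eq_zero_or_pos i with rfl | h1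
    · rfl
    · have h2 := parent_lt h1 ha
      have h3 := C.level_parent h1
      simp only [sigmaFun]
      rw [h.parent_eq h1 ha, start_congr h h2, h.next_eq (by omega)]
  · change C.level i + 1 ≤ R at ha
    change C'.sigmaFun (.inr i) = C.sigmaFun (.inr i)
    simp only [sigmaFun]
    rw [h.num_eq ha, h.next_eq (by omega), start_congr h (C.level_lt_iff.1 ha).le]

theorem sigma_symm_eq (h : AgreeTo R C C') {a : ℕ ⊕ ℕ} (ha : C.edgeLevel a ≤ R) :
    C'.sigma.symm a = C.sigma.symm a := by
  rw [Equiv.symm_apply_eq, h.sigma_eq (by rwa [edgeLevel_sigma_symm]), Equiv.apply_symm_apply]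

end AgreeTo

/-- The higher one of the levels of the endpoints of a dart. -/
def dartLevel (C : Offspring) : LDart → ℕ
  | F a => C.edgeLevel a
  | B a => C.edgeLevel a
  | hr i => C.level i
  | hl i => C.level i

/-- The darts up to level `R`. -/
def lowDarts (R : ℕ) (C : Offspring) : Set LDart := {d | C.dartLevel d ≤ R}

/-- On the highest level retained, all forward darts at `i` are cut off, so the right horizontal
dart is directly followed by the left one. This is why the number of children of `i` is invisible in
the ball. -/
theorem isFirstReturn_lowDarts_hr (C : Offspring) (i : ℕ) :
    IsFirstReturn C.rot (lowDarts (C.level i) C) (hr i) (hl (C.next i)) := by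
  have hmem : hl (C.next i) ∈ lowDarts (C.level i) C := (C.level_next i).le
  have hend : ∀ a, C.sigma a = .inr (C.next i) →
      IsFirstReturn C.rot (lowDarts (C.level i) C) (F a) (hl (C.next i)) := by
    intro a ha
    rw [← C.rot_F_of_inr ha]
    refine isFirstReturn_of_apply_mem ?_
    rwa [C.rot_F_of_inr ha]
  have hrun : ∀ m j, C.start i ≤ j → j + 1 + m = C.start (i + 1) →
      IsFirstReturn C.rot (lowDarts (C.level i) C) (F (.inl j)) (hl (C.next i)) := by
    intro m
    induction m with
    | zero =>
      intro j hj hj'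
      have h1 := C.lt_start i
      have hp : C.parent j = i := C.parent_eq hj (by omega)
      apply hend
      rw [C.sigma_inl_last (by omega) (by rw [hp]; exact hj'), hp]
    | succ m ih =>
      intro j hj hj'
      have h1 := C.lt_start i
      have hp : C.parent j = i := C.parent_eq hj (by omega)
      have hp' : C.parent (j + 1) = i := C.parent_eq (by omega) (by omega)
      have h2 := C.rot_F_of_inl (C.sigma_inl (i := j) (by omega) (by rw [hp]; omega))
      refine IsFirstReturn.step ?_ ?_ <;> rw [h2]
      · intro hcon
        change C.level (j + 1) ≤ _ at hcon
        rw [C.level_parent (by omega), hp'] at hcon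
        omega
      · exact ih _ (by omega) (by omega)
  refine IsFirstReturn.step ?_ ?_ <;> rw [rot_hr]
  · exact Nat.not_succ_le_self _
  by_cases h0 : C.num i = 0
  · exact hend _ (C.sigma_inr_zero h0)
  · have h1 := C.rot_F_of_inl (C.sigma_inr h0)
    refine IsFirstReturn.step ?_ ?_ <;> rw [h1]
    · change ¬ C.level (C.start i) ≤ _
      rw [C.level_start (by omega)]
      omega
    · exact hrun (C.num i - 1) _ le_rfl (by rw [start_succ]; omega)

namespace AgreeTo

variable {R : ℕ}

theorem mem_lowDarts (h : AgreeTo R C C') {d : LDart} (hd : d ∈ lowDarts R C) :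
    d ∈ lowDarts R C' := by
  change C'.dartLevel d ≤ R
  rcases d with a | a | i | i
  · exact (h.edgeLevel_eq hd).trans_le hd
  · exact (h.edgeLevel_eq hd).trans_le hd
  · exact (h.level_eq hd).trans_le hd
  · exact (h.level_eq hd).trans_le hd

theorem lowDarts_eq (h : AgreeTo R C C') : lowDarts R C' = lowDarts R C :=
  Set.Subset.antisymm (fun _ => h.symm.mem_lowDarts) fun _ => h.mem_lowDarts

/-- Except for `hr i` on level `R`, the rotation of a low dart is again a low dart and is computed
from offspring numbers below level `R`. -/
theorem isFirstReturn_lowDarts (h : AgreeTo R C C') {d : LDart} (hd : d ∈ lowDarts R C) :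
    ∃ b, IsFirstReturn C.rot (lowDarts R C) d b ∧ IsFirstReturn C'.rot (lowDarts R C) d b := by
  have key : C'.rot d = C.rot d → C.rot d ∈ lowDarts R C → ∃ b,
      IsFirstReturn C.rot (lowDarts R C) d b ∧ IsFirstReturn C'.rot (lowDarts R C) d b := by
    intro h1 h2
    refine ⟨C.rot d, isFirstReturn_of_apply_mem h2, ?_⟩
    rw [← h1] at h2 ⊢
    exact isFirstReturn_of_apply_mem h2
  rcases d with a | (i | i) | i | i
  · have hs := h.sigma_eq hd
    have hl : C.edgeLevel (C.sigma a) ≤ R := (C.edgeLevel_sigma a).trans_le hd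
    rcases h1 : C.sigma a with v | v <;> rw [h1] at hs hl
    · rw [C.rot_F_of_inl h1, C'.rot_F_of_inl hs] at key
      exact key rfl hl
    · rw [C.rot_F_of_inr h1, C'.rot_F_of_inr hs] at key
      exact key rfl ((Nat.le_succ _).trans hl)
  · exact key rfl hd
  · refine key ?_ ?_
    · rw [rot_B_inr, rot_B_inr, h.sigma_symm_eq (a := .inr i) hd]
    · exact (C.edgeLevel_sigma_symm _).trans_le hd
  · rcases Nat.lt_or_ge (C.level i) R with h1 | h1
    · exact key rfl h1
    · have hlev : C.level i = R := le_antisymm hd h1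
      refine ⟨hl (C.next i), ?_, ?_⟩
      · have := isFirstReturn_lowDarts_hr C i
        rwa [hlev] at this
      · have := isFirstReturn_lowDarts_hr C' i
        rwa [h.level_eq hd, hlev, h.lowDarts_eq, h.next_eq hd] at this
  · refine key ?_ ?_
    · rw [rot_hl, rot_hl, h.sigma_symm_eq (a := .inl i) hd]
    · exact (C.edgeLevel_sigma_symm _).trans_le hd

theorem firstReturn_lowDarts (h : AgreeTo R C C') :
    firstReturn C'.rot C'.rot_hasFiniteOrbits (lowDarts R C) =
      firstReturn C.rot C.rot_hasFiniteOrbits (lowDarts R C) := by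
  ext d
  obtain ⟨b, h1, h2⟩ := h.isFirstReturn_lowDarts d.2
  rw [firstReturn_eq _ h1, firstReturn_eq _ h2]

/-- The first return to `U` factors through the first return to `lowDarts R C`, which is the same
permutation for both sequences. -/
theorem isFirstReturn (h : AgreeTo R C C') {U : Set LDart} (hU : U ⊆ lowDarts R C) {a b : LDart}
    (ha : a ∈ U) (hab : IsFirstReturn C.rot U a b) : IsFirstReturn C'.rot U a b := by
  have hf := firstReturn_hasFiniteOrbits C.rot C.rot_hasFiniteOrbits (lowDarts R C)
  obtain ⟨c, hc⟩ := IsFirstReturn.exists_of_mem hf (S := {x | x.1 ∈ U}) (a := ⟨a, hU ha⟩) ha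
  have h1 := hc.of_firstReturn C.rot_hasFiniteOrbits hU
  rw [← h.firstReturn_lowDarts] at hc
  have h2 := hc.of_firstReturn C'.rot_hasFiniteOrbits hU
  rwa [hab.unique h1]

end AgreeTo

end Offspring

/-! ### The balls of the maps with given codes -/

namespace LayerCode

open LDart Offspring RootedMap

variable {P P' : LayerCode} {R : ℕ}

/-- The codes describe the same ball of radius `R`. -/
def Agree (R : ℕ) (P P' : LayerCode) : Prop :=
  AgreeTo R P.toOffspring P'.toOffspring ∧
    -- A ball of radius `R` shows the height of the triangulation only if it is at most `R`; all
    -- greater values are identified.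
    min P.h ((R + 1 : ℕ) : ℕ∞) = min P'.h ((R + 1 : ℕ) : ℕ∞)

theorem ext_of_eq (hnum : ∀ i, P.num i = P'.num i) (hh : P.h = P'.h) : P = P' := by
  rcases P with ⟨⟨num, alive⟩, h, one_le, tail⟩
  rcases P' with ⟨⟨num', alive'⟩, h', one_le', tail'⟩
  obtain rfl : num = num' := funext hnum
  obtain rfl : h = h' := hh
  rfl

/-- The ball is then the whole object: from level `R` on, all offspring numbers are forced to be
`1`. -/
theorem Agree.eq_of_le (h : Agree R P P') (hR : P.h ≤ R) : P = P' := by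
  have h1 : P'.h = P.h := by
    have h2 := h.2
    rw [min_eq_left (hR.trans (by exact_mod_cast Nat.le_succ R))] at h2
    rcases min_choice P'.h ((R + 1 : ℕ) : ℕ∞) with h3 | h3 <;> rw [h3] at h2
    · exact h2.symm
    · rw [h2] at hR
      have : R + 1 ≤ R := by exact_mod_cast hR
      omega
  refine ext_of_eq (fun i => ?_) h1.symm
  rcases Nat.lt_or_ge i (P.first R) with h2 | h2
  · exact h.1 i h2
  · have key : ∀ k : ℕ, R ≤ k → P.h ≤ ((k + 1 : ℕ) : ℕ∞) := fun k hk =>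
      hR.trans (by exact_mod_cast (hk.trans (Nat.le_succ k)))
    have h3 : R ≤ P.level i := by
      by_contra hcon
      exact absurd (P.level_lt_iff.1 (not_le.1 hcon)) (not_lt.2 h2)
    have h4 : R ≤ P'.level i := by
      by_contra hcon
      have := P'.level_lt_iff.1 (not_le.1 hcon)
      rw [h.1.first_eq (Nat.le_succ R)] at this
      omega
    rw [P.tail i (key _ h3), P'.tail i (by rw [h1]; exact key _ h4)]

theorem Agree.symm (h : Agree R P P') : Agree R P' P := ⟨h.1.symm, h.2.symm⟩

theorem Agree.lt_of_lt (h : Agree R P P') (hR : (R : ℕ∞) < P.h) : (R : ℕ∞) < P'.h := by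
  by_contra hcon
  rw [h.symm.eq_of_le (not_lt.1 hcon)] at hcon
  exact hcon hR

theorem eq_of_forall_agree (h : ∀ R, Agree R P P') : P = P' := by
  refine ext_of_eq (fun i => (h (i + 1)).1 i ?_) ?_
  · exact (Nat.lt_succ_self i).trans_le (P.le_first _)
  · by_contra hne
    wlog hlt : P.h < P'.h generalizing P P'
    · exact this (fun R => (h R).symm) (Ne.symm hne) (lt_of_le_of_ne (not_lt.1 hlt) (Ne.symm hne))
    obtain ⟨k, hk⟩ := ENat.ne_top_iff_exists.1 (ne_top_of_lt hlt)
    exact hne (congrArg LayerCode.h ((h k).eq_of_le hk.ge))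

/-- Balls of submaps of two maps with the same darts. -/
theorem ballEq_submap {C C' : Offspring} {S S' U : Set LDart} {hS : ∀ d ∈ S, d.flip ∈ S}
    {hS' : ∀ d ∈ S', d.flip ∈ S'} {r : LDart} {hr : r ∈ S} {hr' : r ∈ S'}
    (hU : ∀ x : S, x ∈ (C.ambient.submap S hS r hr).ballDarts R ↔ x.1 ∈ U)
    (hU' : ∀ x : S', x ∈ (C'.ambient.submap S' hS' r hr').ballDarts R ↔ x.1 ∈ U)
    (hUS : U ⊆ S) (hUS' : U ⊆ S')
    (h : ∀ a ∈ U, ∀ b, IsFirstReturn C.rot U a b → IsFirstReturn C'.rot U a b) :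
    BallEq R (C.ambient.submap S hS r hr) (C'.ambient.submap S' hS' r hr') := by
  have key : ∀ {C : Offspring} {S : Set LDart} {hS : ∀ d ∈ S, d.flip ∈ S} {r : LDart} {hr : r ∈ S}
      (_ : ∀ x : S, x ∈ (C.ambient.submap S hS r hr).ballDarts R ↔ x.1 ∈ U) (_ : U ⊆ S)
      (d : (C.ambient.submap S hS r hr).ballDarts R),
      IsFirstReturn C.rot U d.1.1 (firstReturn (C.ambient.submap S hS r hr).rot
        (C.ambient.submap S hS r hr).finite_orbits ((C.ambient.submap S hS r hr).ballDarts R) d).1.1 := by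
    intro C S hS r hr hU hUS d
    have h1 := isFirstReturn_firstReturn (C.ambient.submap S hS r hr).rot
      (C.ambient.submap S hS r hr).finite_orbits ((C.ambient.submap S hS r hr).ballDarts R) d
    have h2 : (C.ambient.submap S hS r hr).ballDarts R = {x : S | x.1 ∈ U} := Set.ext hU
    have h3 : IsFirstReturn (firstReturn C.rot C.rot_hasFiniteOrbits S) {x : S | x.1 ∈ U} d.1 _ :=
      have h4 : ∀ {V W : Set S} {f : Equiv.Perm S} {a b : S}, V = W → IsFirstReturn f V a b →
        IsFirstReturn f W a b := by rintro V _ f a b rfl h; exact h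
      h4 h2 h1
    exact h3.of_firstReturn C.rot_hasFiniteOrbits hUS
  let e : (C.ambient.submap S hS r hr).ballDarts R ≃ (C'.ambient.submap S' hS' r hr').ballDarts R :=
    { toFun := fun d => ⟨⟨d.1.1, hUS' ((hU d.1).1 d.2)⟩, (hU' _).2 ((hU d.1).1 d.2)⟩
      invFun := fun d => ⟨⟨d.1.1, hUS ((hU' d.1).1 d.2)⟩, (hU _).2 ((hU' d.1).1 d.2)⟩
      left_inv := fun _ => rfl
      right_inv := fun _ => rfl }
  refine ⟨e, fun d => ?_, fun d => rfl, fun d => ?_⟩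
  · refine Subtype.ext (Subtype.ext ?_)
    exact (h _ ((hU d.1).1 d.2) _ (key hU hUS d)).unique (key hU' hUS' (e d))
  · have h1 : d.1.1 = r ↔ (e d).1.1 = r := Iff.rfl
    exact ⟨fun h => Subtype.ext (h1.1 (congrArg Subtype.val h)),
      fun h => Subtype.ext (h1.2 (congrArg Subtype.val h))⟩

theorem isEdge_of_edgeLevel_le {a : ℕ ⊕ ℕ} (h1 : 1 ≤ a.elim id id) (ha : P.edgeLevel a ≤ R)
    (hR : (R : ℕ∞) < P.h) : P.IsEdge a :=
  ⟨h1, le_trans (by exact_mod_cast ha) hR.le⟩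

theorem mem_ct_ballDarts_iff (x : P.ct.Dart) :
    x ∈ P.ct.ballDarts R ↔ x.1 ∈ P.ctDarts ∩ lowDarts R P.toOffspring := by
  have h1 := ct_ht x
  have h2 := ct_ht (P.ct.flip x)
  rw [ct_flip] at h2
  change P.ct.ht x ≤ R ∧ P.ct.ht (P.ct.flip x) ≤ R ↔ x.1 ∈ P.ctDarts ∧ P.dartLevel x.1 ≤ R
  have h3 : P.dartLevel x.1 + 1 = max (P.hgt x.1) (P.hgt x.1.flip) := by
    rcases x.1 with a | a | i | i
    · exact (max_eq_right (Nat.le_succ _)).symm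
    · exact (max_eq_left (Nat.le_succ _)).symm
    · exact (max_self _).symm
    · exact (max_self _).symm
  have h4 : x.1 ∈ P.ctDarts := x.2
  rw [and_iff_right h4]
  omega

theorem ctDarts_inter_lowDarts_subset (h : AgreeTo R P.toOffspring P'.toOffspring)
    (hR' : (R : ℕ∞) < P'.h) :
    P.ctDarts ∩ lowDarts R P.toOffspring ⊆ P'.ctDarts ∩ lowDarts R P'.toOffspring := by
  rintro d ⟨hd, hd'⟩
  have h1 := h.mem_lowDarts hd'
  refine ⟨?_, h1⟩
  have key : ∀ i, P.IsEdge (.inr i) → P'.level i ≤ R → P'.IsEdge (.inr i) := fun i hi hi' =>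
    (isEdge_inr P').2 ⟨hi.1, lt_of_le_of_lt (by exact_mod_cast hi') hR'⟩
  rcases d with a | a | i | i
  · exact isEdge_of_edgeLevel_le hd.1 h1 hR'
  · exact isEdge_of_edgeLevel_le hd.1 h1 hR'
  · exact key i hd h1
  · exact key i hd h1

/-- The additional vertex `r` shifts heights by one, so radius `R + 1` in the tree selects the same
levels as radius `R` in the triangulation. -/
theorem mem_tree_ballDarts_iff (x : P.tree.Dart) :
    x ∈ P.tree.ballDarts (R + 1) ↔ x.1 ∈ P.treeDarts ∩ lowDarts R P.toOffspring := by
  have h4 : x.1 ∈ P.treeDarts := x.2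
  change P.tree.ht x ≤ R + 1 ∧ P.tree.ht (P.tree.flip x) ≤ R + 1 ↔
    x.1 ∈ P.treeDarts ∧ P.dartLevel x.1 ≤ R
  rw [and_iff_right h4, tree_ht, tree_ht, tree_flip]
  obtain ⟨i, -, hx | hx⟩ := tree_cases x <;> rw [hx]
  · change P.level i ≤ R + 1 ∧ P.level i + 1 ≤ R + 1 ↔ P.level i ≤ R
    omega
  · change P.level i + 1 ≤ R + 1 ∧ P.level i ≤ R + 1 ↔ P.level i ≤ R
    omega

theorem treeDarts_inter_lowDarts_subset (h : AgreeTo R P.toOffspring P'.toOffspring)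
    (hR' : (R : ℕ∞) < P'.h) :
    P.treeDarts ∩ lowDarts R P.toOffspring ⊆ P'.treeDarts ∩ lowDarts R P'.toOffspring := by
  rintro d ⟨hd, hd'⟩
  have h1 := h.mem_lowDarts hd'
  refine ⟨?_, h1⟩
  have key : ∀ i, P'.level i ≤ R → ((P'.level i : ℕ) : ℕ∞) < P'.h := fun i hi' =>
    lt_of_le_of_lt (by exact_mod_cast hi') hR'
  rcases d with (i | i) | (i | i) | i | i
  · exact key i h1
  · exact hd
  · exact key i h1
  · exact hd
  · exact hd
  · exact hd

theorem Agree.ballEq_ct (h : Agree R P P') : BallEq R P.ct P'.ct := by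
  by_cases hR : (R : ℕ∞) < P.h
  · have hR' := h.lt_of_lt hR
    have heq : P'.ctDarts ∩ lowDarts R P'.toOffspring = P.ctDarts ∩ lowDarts R P.toOffspring :=
      Set.Subset.antisymm (ctDarts_inter_lowDarts_subset h.1.symm hR)
        (ctDarts_inter_lowDarts_subset h.1 hR')
    refine ballEq_submap (U := P.ctDarts ∩ lowDarts R P.toOffspring) mem_ct_ballDarts_iff ?_
      Set.inter_subset_left ?_ fun a ha b hab => h.1.isFirstReturn Set.inter_subset_right ha hab
    · rw [← heq]; exact mem_ct_ballDarts_iff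
    · rw [← heq]; exact Set.inter_subset_left
  · rw [h.eq_of_le (not_lt.1 hR)]
    exact ballEq_iff.2 ⟨BallIso.ofIso R (Iso.refl _)⟩

theorem Agree.ballEq_tree (h : Agree R P P') : BallEq (R + 1) P.tree P'.tree := by
  by_cases hR : (R : ℕ∞) < P.h
  · have hR' := h.lt_of_lt hR
    have heq : P'.treeDarts ∩ lowDarts R P'.toOffspring = P.treeDarts ∩ lowDarts R P.toOffspring :=
      Set.Subset.antisymm (treeDarts_inter_lowDarts_subset h.1.symm hR)
        (treeDarts_inter_lowDarts_subset h.1 hR')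
    refine ballEq_submap (U := P.treeDarts ∩ lowDarts R P.toOffspring) mem_tree_ballDarts_iff ?_
      Set.inter_subset_left ?_ fun a ha b hab => h.1.isFirstReturn Set.inter_subset_right ha hab
    · rw [← heq]; exact mem_tree_ballDarts_iff
    · rw [← heq]; exact Set.inter_subset_left
  · rw [h.eq_of_le (not_lt.1 hR)]
    exact ballEq_iff.2 ⟨BallIso.ofIso _ (Iso.refl _)⟩

end LayerCode

/-! ### Following an isomorphism of balls around a vertex -/

namespace RootedMap.BallIso

variable {G H : RootedMap} {R : ℕ} {e : BallIso R G H}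

/-- The isomorphism `e` maps `d` to `d'`. -/
def Rel (e : BallIso R G H) (d : G.Dart) (d' : H.Dart) : Prop :=
  ∃ h : d ∈ G.ballDarts R, (e.e ⟨d, h⟩).1 = d'

theorem Rel.flip {d : G.Dart} {d' : H.Dart} (h : e.Rel d d') : e.Rel (G.flip d) (H.flip d') := by
  obtain ⟨h1, rfl⟩ := h
  exact ⟨G.flip_mem_ballDarts h1, congrArg Subtype.val (e.map_flip ⟨d, h1⟩)⟩

theorem Rel.ht_eq (hG : G.graph.Connected) (hH : H.graph.Connected) {d : G.Dart} {d' : H.Dart}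
    (h : e.Rel d d') : H.ht d' = G.ht d := by
  obtain ⟨h1, rfl⟩ := h
  exact e.ht_eq hG hH ⟨d, h1⟩

theorem Rel.eq_iff {d c : G.Dart} {d' c' : H.Dart} (h : e.Rel d d') (h' : e.Rel c c') :
    d = c ↔ d' = c' := by
  obtain ⟨h1, rfl⟩ := h
  obtain ⟨h2, rfl⟩ := h'
  rw [← Subtype.ext_iff, e.e.apply_eq_iff_eq, Subtype.mk.injEq]

theorem rel_root (hroot : G.root ∈ G.ballDarts R) : e.Rel G.root H.root :=
  ⟨hroot, (e.map_root _).1 rfl⟩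

theorem Rel.rot_pow (hG : G.graph.Connected) (hH : H.graph.Connected) {d : G.Dart} {d' : H.Dart}
    (h : e.Rel d d') (hd : G.ht d < R) (n : ℕ) : e.Rel ((G.rot ^ n) d) ((H.rot ^ n) d') := by
  induction n with
  | zero => exact h
  | succ n ih =>
    obtain ⟨h1, h2⟩ := ih
    have hlt : G.ht ((G.rot ^ n) d) < R := by rwa [ht_rot_pow]
    have h3 := e.map_rot_of_lt hG hH ⟨_, h1⟩ hlt
    rw [h2] at h3
    rw [pow_succ', pow_succ', Equiv.Perm.mul_apply, Equiv.Perm.mul_apply]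
    exact ⟨rot_mem_ballDarts hG hlt, h3⟩

end RootedMap.BallIso

namespace Offspring

variable {C C' : Offspring}

/-- Agreement is proved vertex by vertex. -/
theorem agreeTo_of_step {K : ℕ} (Q : ℕ → Prop) (h0 : Q 0)
    (hstep : ∀ i, C.level i < K → (∀ j < i, C.num j = C'.num j) → (∀ j ≤ i, Q j) →
      C.num i = C'.num i ∧ ∀ k < C.num i, Q (C.start i + k)) : AgreeTo K C C' := by
  have key : ∀ i, (C.level i ≤ K → Q i) ∧ (C.level i < K → C.num i = C'.num i) := by
    intro i
    induction i using Nat.strong_induction_on with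
    | _ i ih =>
      have hQ : C.level i ≤ K → Q i := by
        intro hi
        rcases Nat.eq_zero_or_pos i with rfl | h1
        · exact h0
        · have hp := C.parent_lt h1
          have hl := C.level_parent h1
          have h2 := (hstep (C.parent i) (by omega)
            (fun j hj => (ih j (by omega)).2 (by have := C.level_mono hj.le; omega))
            (fun j hj => (ih j (by omega)).1 (by have := C.level_mono hj; omega))).2
          have h3 := C.parent_spec h1
          rw [start_succ] at h3
          have := h2 (i - C.start (C.parent i)) (by omega)
          rwa [Nat.add_sub_cancel' h3.1] at this
      refine ⟨hQ, fun hi => (hstep i hi (fun j hj => (ih j hj).2 ?_) fun j hj => ?_).1⟩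
      · have := C.level_mono hj.le; omega
      · rcases Nat.lt_or_ge j i with h1 | h1
        · exact (ih j h1).1 (by have := C.level_mono hj; omega)
        · obtain rfl : j = i := le_antisymm hj h1
          exact hQ hi.le
  exact fun j hj => (key j).2 (C.level_lt_iff.2 hj)

end Offspring

namespace LayerCode

open LDart Offspring RootedMap

variable {P P' : LayerCode} {R : ℕ}

/-- Codes agree if they agree below their heights. -/
theorem agree_of_agreeTo (hK : ∀ K ≤ R, (K : ℕ∞) < P.h ↔ (K : ℕ∞) < P'.h)
    (h : ∀ K ≤ R, (K : ℕ∞) < P.h → (K : ℕ∞) < P'.h → AgreeTo K P.toOffspring P'.toOffspring) :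
    Agree R P P' := by
  have hmin : min P.h ((R + 1 : ℕ) : ℕ∞) = min P'.h ((R + 1 : ℕ) : ℕ∞) := by
    refine eq_of_forall_lt_iff fun c => ?_
    by_cases hc : c = ⊤
    · rw [hc]; exact ⟨fun h => absurd h not_top_lt, fun h => absurd h not_top_lt⟩
    obtain ⟨K, rfl⟩ := ENat.ne_top_iff_exists.1 hc
    rw [lt_min_iff, lt_min_iff]
    refine and_congr_left fun h1 => hK K ?_
    have : K < R + 1 := by exact_mod_cast h1
    omega
  refine ⟨?_, hmin⟩
  by_cases hR : (R : ℕ∞) < P.h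
  · exact h R le_rfl hR ((hK R le_rfl).1 hR)
  -- If the common height `m` is at most `R`, agreement up to level `m - 1` suffices, since all
  -- later offspring numbers are `1`.
  · obtain ⟨m, hm⟩ := ENat.ne_top_iff_exists.1
      (ne_top_of_le_ne_top (ENat.natCast_ne_top R) (not_lt.1 hR))
    have hmR : m ≤ R := by
      rw [← hm] at hR
      exact_mod_cast not_lt.1 hR
    have hm' : P'.h = m := by
      rw [← hm, min_eq_left (by exact_mod_cast (by omega : m ≤ R + 1))] at hmin
      rcases min_choice P'.h ((R + 1 : ℕ) : ℕ∞) with h3 | h3 <;> rw [h3] at hmin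
      · exact hmin.symm
      · have : m = R + 1 := by exact_mod_cast hmin
        omega
    have hm1 : 1 ≤ m := by
      have := P.one_le
      rw [← hm] at this
      exact_mod_cast this
    have hlt : ((m - 1 : ℕ) : ℕ∞) < (m : ℕ∞) := by exact_mod_cast (by omega : m - 1 < m)
    have h1 := h (m - 1) (by omega) (by rwa [← hm]) (by rwa [hm'])
    intro j _
    rcases Nat.lt_or_ge (P.level j) (m - 1) with h2 | h2
    · exact h1 j (P.level_lt_iff.1 h2)
    · have h3 : m - 1 ≤ P'.level j := by
        by_contra hcon
        rw [not_le, P'.level_lt_iff, h1.first_eq (Nat.le_succ _), ← P.level_lt_iff] at hcon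
        omega
      rw [P.tail j, P'.tail j]
      · rw [hm']; exact_mod_cast (by omega : m ≤ P'.level j + 1)
      · rw [← hm]; exact_mod_cast (by omega : m ≤ P.level j + 1)

/-! ### Rigidity of trees -/

theorem tree_rot_pow {x : P.tree.Dart} {i : ℕ} (hx : x.1 = B (.inl i))
    (hi : ((P.level i + 1 : ℕ) : ℕ∞) < P.h) {k : ℕ} (hk : k < P.num i) :
    ((P.tree.rot ^ (k + 1)) x).1 = F (.inl (P.start i + k)) := by
  induction k with
  | zero =>
    refine tree_rot_eq ?_
    rw [hx]
    exact isFirstReturn_tree_child hk hi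
  | succ k ih =>
    have h1 := ih (by omega)
    have hp : P.parent (P.start i + k) = i := P.parent_start_add (by omega)
    have h2 := P.lt_start i
    have h3 := P.level_parent (j := P.start i + k) (by omega)
    rw [hp] at h3
    rw [pow_succ', Equiv.Perm.mul_apply]
    refine tree_rot_eq ?_
    rw [h1]
    exact isFirstReturn_tree_sibling (by omega) (by rw [h3]; exact hi)
      (by rw [hp, start_succ]; omega)

theorem tree_rot_pow_num {x : P.tree.Dart} {i : ℕ} (hx : x.1 = B (.inl i))
    (hi : ((P.level i + 1 : ℕ) : ℕ∞) < P.h) : (P.tree.rot ^ (P.num i + 1)) x = x := by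
  refine Subtype.ext ?_
  rcases Nat.eq_zero_or_pos (P.num i) with h0 | h0
  · rw [h0, hx]
    refine tree_rot_eq ?_
    rw [hx]
    exact isFirstReturn_tree_leaf (lt_of_le_of_lt (by exact_mod_cast Nat.le_succ _) hi) (Or.inl h0)
  · have h1 := tree_rot_pow hx hi (k := P.num i - 1) (by omega)
    rw [Nat.sub_add_cancel h0] at h1
    have hp : P.parent (P.start i + (P.num i - 1)) = i := P.parent_start_add (by omega)
    have h2 := P.lt_start i
    have h3 := P.level_parent (j := P.start i + (P.num i - 1)) (by omega)
    rw [hp] at h3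
    rw [pow_succ', Equiv.Perm.mul_apply, hx]
    refine tree_rot_eq ?_
    rw [h1]
    have h4 := isFirstReturn_tree_last (P := P) (i := P.start i + (P.num i - 1)) (by omega)
      (by rw [h3]; exact hi) (by rw [hp, start_succ]; omega)
    rwa [hp] at h4

/-- The condition `K < h` is visible in the ball as a dart that starts at height `K + 1`. -/
theorem lt_h_of_ballIso_tree (e : BallIso (R + 1) P.tree P'.tree) {K : ℕ} (hK : K ≤ R)
    (h : (K : ℕ∞) < P.h) : (K : ℕ∞) < P'.h := by
  have hm : B (.inl (P.first K)) ∈ P.treeDarts := by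
    rw [mem_treeDarts_B, P.level_first]; exact h
  let x : P.tree.Dart := ⟨_, hm⟩
  have h1 : P.tree.ht x = K + 1 := by
    rw [tree_ht]
    exact congrArg (· + 1) (P.level_first K)
  have h2 : P.tree.ht (P.tree.flip x) = K := by
    rw [tree_ht]
    exact P.level_first K
  have hb : x ∈ P.tree.ballDarts (R + 1) := ⟨by omega, by omega⟩
  have h3 := e.ht_eq (tree_connected P) (tree_connected P') ⟨x, hb⟩
  rw [h1, tree_ht] at h3
  obtain ⟨i, hi, hx | hx⟩ := tree_cases (e.e ⟨x, hb⟩).1 <;> rw [hx] at h3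
  · change P'.level i = K + 1 at h3
    rw [h3] at hi
    exact lt_of_le_of_lt (by exact_mod_cast Nat.le_succ K) hi
  · have h3 : P'.level i = K := Nat.add_right_cancel h3
    rwa [h3] at hi

/-- Starting from the dart to the parent, the rotation returns for the first time after one more
step than there are children. The isomorphism respects rotations below the radius, hence offspring
numbers, and it carries children to children. -/
theorem agreeTo_of_ballIso_tree (e : BallIso (R + 1) P.tree P'.tree) {K : ℕ} (hKR : K ≤ R)
    (hK : (K : ℕ∞) < P.h) (hK' : (K : ℕ∞) < P'.h) :
    AgreeTo K P.toOffspring P'.toOffspring := by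
  have hG := tree_connected P
  have hH := tree_connected P'
  refine agreeTo_of_step (fun i => ∀ (x : P.tree.Dart) (x' : P'.tree.Dart), x.1 = B (.inl i) →
    x'.1 = B (.inl i) → e.Rel x x') ?_ ?_
  · intro x x' hx hx'
    have h1 : x = P.tree.flip P.tree.root := Subtype.ext hx
    have h2 : x' = P'.tree.flip P'.tree.root := Subtype.ext hx'
    rw [h1, h2]
    refine (BallIso.rel_root ?_).flip
    have := ht_flip_le hG P.tree.root
    rw [ht_root] at this
    exact ⟨by rw [ht_root]; omega, by omega⟩
  · intro i hi hnum hQ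
    have hlev : P'.level i = P.level i := level_congr hnum (P.level_spec i).1
    have hstart : P'.start i = P.start i := start_congr hnum le_rfl
    have hi1 : ((P.level i + 1 : ℕ) : ℕ∞) < P.h :=
      lt_of_le_of_lt (by exact_mod_cast hi) hK
    have hi1' : ((P'.level i + 1 : ℕ) : ℕ∞) < P'.h :=
      lt_of_le_of_lt (by rw [hlev]; exact_mod_cast hi) hK'
    have hle : ∀ n : ℕ, (n : ℕ∞) ≤ ((n + 1 : ℕ) : ℕ∞) := fun n => by exact_mod_cast Nat.le_succ n
    let x : P.tree.Dart := ⟨B (.inl i), (hle _).trans_lt hi1⟩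
    let x' : P'.tree.Dart := ⟨B (.inl i), (hle _).trans_lt hi1'⟩
    have hrel := hQ i le_rfl x x' rfl rfl
    have hht : P.tree.ht x < R + 1 := by
      rw [tree_ht]
      change P.level i + 1 < R + 1
      omega
    have hpow := hrel.rot_pow hG hH hht
    have hreturn : ∀ n, (P.tree.rot ^ n) x = x ↔ (P'.tree.rot ^ n) x' = x' := fun n =>
      (hpow n).eq_iff hrel
    have hne : ∀ {P : LayerCode} {x : P.tree.Dart}, x.1 = B (.inl i) →
        ((P.level i + 1 : ℕ) : ℕ∞) < P.h → ∀ k < P.num i, (P.tree.rot ^ (k + 1)) x ≠ x := by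
      intro P x hx hi k hk h
      have h1 := tree_rot_pow hx hi hk
      rw [h, hx] at h1
      cases h1
    have hnumi : P.num i = P'.num i := by
      rcases lt_trichotomy (P.num i) (P'.num i) with h1 | h1 | h1
      · exact absurd ((hreturn _).1 (tree_rot_pow_num rfl hi1)) (hne rfl hi1' _ h1)
      · exact h1
      · exact absurd ((hreturn _).2 (tree_rot_pow_num rfl hi1')) (hne rfl hi1 _ h1)
    refine ⟨hnumi, fun k hk y y' hy hy' => ?_⟩
    have h1 : y = P.tree.flip ((P.tree.rot ^ (k + 1)) x) :=
      Subtype.ext (hy.trans (congrArg LDart.flip (tree_rot_pow (x := x) rfl hi1 hk)).symm)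
    have h2 : y' = P'.tree.flip ((P'.tree.rot ^ (k + 1)) x') := by
      refine Subtype.ext (hy'.trans (Eq.symm ?_))
      rw [← hstart]
      exact congrArg LDart.flip (tree_rot_pow (x := x') rfl hi1' (hnumi ▸ hk))
    rw [h1, h2]
    exact (hpow _).flip

theorem ballEq_tree_iff : BallEq (R + 1) P.tree P'.tree ↔ Agree R P P' := by
  refine ⟨fun h => ?_, Agree.ballEq_tree⟩
  obtain ⟨e⟩ := ballEq_iff.1 h
  exact agree_of_agreeTo
    (fun K hK => ⟨lt_h_of_ballIso_tree e hK, lt_h_of_ballIso_tree e.symm hK⟩)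
    fun K hK => agreeTo_of_ballIso_tree e hK

/-! ### Rigidity of causal triangulations -/

theorem ct_rot_pow_F {x : P.ct.Dart} {i : ℕ} (hx : x.1 = F (.inl (P.start i))) {k : ℕ}
    (hk : k < P.num i) : ((P.ct.rot ^ k) x).1 = F (.inl (P.start i + k)) := by
  induction k with
  | zero => exact hx
  | succ k ih =>
    have h1 := ih (by omega)
    have hp : P.parent (P.start i + k) = i := P.parent_start_add (by omega)
    have h2 := P.lt_start i
    rw [pow_succ', Equiv.Perm.mul_apply]
    exact ct_rot_F_inl h1 (P.sigma_inl (by omega) (by rw [hp, start_succ]; omega))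

theorem sigma_last_child {i : ℕ} (h : 0 < P.num i) :
    P.sigma (.inl (P.start i + (P.num i - 1))) = .inr (P.next i) := by
  have hp : P.parent (P.start i + (P.num i - 1)) = i := P.parent_start_add (by omega)
  have h2 := P.lt_start i
  rw [P.sigma_inl_last (by omega) (by rw [hp, start_succ]; omega), hp]

theorem ct_root_val : (P.ct.root).1 = F (.inl (P.start 0)) := by
  rw [P.start_zero]; rfl

theorem ct_rot_pow_root : (P.ct.rot ^ (P.num 0)) P.ct.root = P.ct.root := by
  have h0 := P.num_zero_pos
  have h1 := ct_rot_pow_F (ct_root_val (P := P)) (k := P.num 0 - 1) (by omega)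
  have h2 := sigma_last_child (P := P) h0
  rw [P.next_zero] at h2
  rw [show P.num 0 = (P.num 0 - 1) + 1 by omega, pow_succ', Equiv.Perm.mul_apply]
  exact Subtype.ext (ct_rot_F_last h1 h2)

theorem ct_rot_three {x : P.ct.Dart} {i : ℕ} (hx : x.1 = B (.inl i)) (hi : P.IsEdge (.inr i)) :
    (P.num i = 0 → ((P.ct.rot ^ 3) x).1 = hl (P.next i)) ∧
      (0 < P.num i → ((P.ct.rot ^ 3) x).1 = F (.inl (P.start i))) := by
  have h1 := ct_rot_B_inl hx hi
  have h2 := ct_rot_hr h1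
  constructor
  · intro h0
    have : 1 ≤ P.next i := P.next_pos hi.1
    exact ct_rot_F_inr h2 (P.sigma_inr_zero h0) (by omega)
  · intro h0
    exact ct_rot_F_inl h2 (P.sigma_inr h0.ne')

theorem ct_rot_pow_child {x : P.ct.Dart} {i : ℕ} (hx : x.1 = B (.inl i)) (hi : P.IsEdge (.inr i))
    {k : ℕ} (hk : k < P.num i) : ((P.ct.rot ^ (k + 3)) x).1 = F (.inl (P.start i + k)) := by
  rw [pow_add, Equiv.Perm.mul_apply]
  exact ct_rot_pow_F ((ct_rot_three hx hi).2 (by omega)) hk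

theorem ct_rot_pow_num {x : P.ct.Dart} {i : ℕ} (hx : x.1 = B (.inl i)) (hi : P.IsEdge (.inr i)) :
    ((P.ct.rot ^ (P.num i + 3)) x).1 = hl (P.next i) := by
  rcases Nat.eq_zero_or_pos (P.num i) with h0 | h0
  · have := (ct_rot_three hx hi).1 h0
    rw [h0]
    exact this
  · have h1 := ct_rot_pow_child hx hi (k := P.num i - 1) (by omega)
    have : 1 ≤ P.next i := P.next_pos hi.1
    rw [show P.num i + 3 = (P.num i - 1 + 3) + 1 by omega, pow_succ', Equiv.Perm.mul_apply]
    exact ct_rot_F_inr h1 (sigma_last_child h0) (by omega)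

/-- For `K ≥ 1`, the condition `K < h` is visible as a horizontal edge at height `K`; the top level
of a finite triangulation has none. -/
theorem lt_h_of_ballIso_ct (e : BallIso R P.ct P'.ct) {K : ℕ} (hK : K ≤ R)
    (h : (K : ℕ∞) < P.h) : (K : ℕ∞) < P'.h := by
  rcases Nat.eq_zero_or_pos K with rfl | hK0
  · exact lt_of_lt_of_le (by exact_mod_cast one_pos) P'.one_le
  have hm : hr (P.first K) ∈ P.ctDarts := by
    refine (isEdge_inr P).2 ⟨le_trans (Nat.succ_le_of_lt hK0) (P.le_first K), ?_⟩
    rw [P.level_first]; exact h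
  let x : P.ct.Dart := ⟨_, hm⟩
  have h1 : P.ct.ht x = K := by
    have := ct_ht x
    change _ = P.level (P.first K) + 1 at this
    rwa [P.level_first, Nat.add_right_cancel_iff] at this
  have h2 : P.ct.ht (P.ct.flip x) = K := by
    have := ct_ht (P.ct.flip x)
    change _ = P.level (P.first K) + 1 at this
    rwa [P.level_first, Nat.add_right_cancel_iff] at this
  have hrel : e.Rel x (e.e ⟨x, by omega, by omega⟩).1 := ⟨_, rfl⟩
  generalize (e.e ⟨x, by omega, by omega⟩).1 = y at hrel
  have h3 := hrel.ht_eq (ct_connected P) (ct_connected P')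
  have h4 := hrel.flip.ht_eq (ct_connected P) (ct_connected P')
  have h5 := ct_ht y
  have h6 := ct_ht (P'.ct.flip y)
  rw [ct_flip] at h6
  have hm' := y.2
  rcases hy : y.1 with a | a | i | i <;> rw [hy] at h5 h6 hm'
  · change _ = P'.edgeLevel a at h5
    change _ = P'.edgeLevel a + 1 at h6
    omega
  · change _ = P'.edgeLevel a + 1 at h5
    change _ = P'.edgeLevel a at h6
    omega
  · have h7 := ((isEdge_inr P').1 hm').2
    change _ = P'.level i + 1 at h5
    rwa [show P'.level i = K by omega] at h7
  · have h7 := ((isEdge_inr P').1 hm').2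
    change _ = P'.level i + 1 at h5
    rwa [show P'.level i = K by omega] at h7

/-- Rotating from `B (inl i)`, one meets `hr i`, `F (inr i)`, then the edges to the children, and
after `num i + 3` steps the horizontal dart on the left, which is the first non-forward one after
them. Since forward darts correspond to each other, `num i` is determined. At the root vertex, where
all darts are forward, the return time is used. -/
theorem agreeTo_of_ballIso_ct (e : BallIso R P.ct P'.ct) {K : ℕ} (hKR : K ≤ R)
    (hK : (K : ℕ∞) < P.h) (hK' : (K : ℕ∞) < P'.h) :
    AgreeTo K P.toOffspring P'.toOffspring := by
  have hG := ct_connected P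
  have hH := ct_connected P'
  refine agreeTo_of_step (fun i => 1 ≤ i → ∀ (x : P.ct.Dart) (x' : P'.ct.Dart), x.1 = B (.inl i) →
    x'.1 = B (.inl i) → e.Rel x x') (fun h => absurd h (by simp)) ?_
  intro i hi hnum hQ
  have hlev : P'.level i = P.level i := level_congr hnum (P.level_spec i).1
  have hstart : P'.start i = P.start i := start_congr hnum le_rfl
  rcases Nat.eq_zero_or_pos i with rfl | hi0
  · rw [P.level_zero] at hi
    have hrel : e.Rel P.ct.root P'.ct.root := by
      refine BallIso.rel_root ?_
      have := ht_flip_le hG P.ct.root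
      rw [ht_root] at this
      exact ⟨by rw [ht_root]; omega, by omega⟩
    have hpow := hrel.rot_pow hG hH (by rw [ht_root]; omega)
    have hreturn : ∀ n, (P.ct.rot ^ n) P.ct.root = P.ct.root ↔
      (P'.ct.rot ^ n) P'.ct.root = P'.ct.root := fun n => (hpow n).eq_iff hrel
    have hne : ∀ {P : LayerCode} {k : ℕ}, 0 < k → k < P.num 0 →
        (P.ct.rot ^ k) P.ct.root ≠ P.ct.root := by
      intro P k hk0 hk h
      have h1 := ct_rot_pow_F (ct_root_val (P := P)) hk
      rw [h, ct_root_val] at h1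
      injection h1 with h1
      injection h1 with h1
      omega
    have hnumi : P.num 0 = P'.num 0 := by
      rcases lt_trichotomy (P.num 0) (P'.num 0) with h1 | h1 | h1
      · exact absurd ((hreturn _).1 ct_rot_pow_root) (hne P.num_zero_pos h1)
      · exact h1
      · exact absurd ((hreturn _).2 ct_rot_pow_root) (hne P'.num_zero_pos h1)
    refine ⟨hnumi, fun k hk _ y y' hy hy' => ?_⟩
    have h1 : y = P.ct.flip ((P.ct.rot ^ k) P.ct.root) :=
      Subtype.ext (hy.trans (congrArg LDart.flip (ct_rot_pow_F ct_root_val hk)).symm)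
    have h2 : y' = P'.ct.flip ((P'.ct.rot ^ k) P'.ct.root) := by
      refine Subtype.ext (hy'.trans (Eq.symm ?_))
      rw [← hstart]
      exact congrArg LDart.flip (ct_rot_pow_F ct_root_val (hnumi ▸ hk))
    rw [h1, h2]
    exact (hpow _).flip
  · have hedge : P.IsEdge (.inr i) := (isEdge_inr P).2
      ⟨hi0, lt_trans (by exact_mod_cast hi) hK⟩
    have hedge' : P'.IsEdge (.inr i) := (isEdge_inr P').2
      ⟨hi0, lt_trans (by rw [hlev]; exact_mod_cast hi) hK'⟩
    let x : P.ct.Dart := ⟨B (.inl i), isEdge_inl_of_inr hedge⟩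
    let x' : P'.ct.Dart := ⟨B (.inl i), isEdge_inl_of_inr hedge'⟩
    have hrel := hQ i le_rfl hi0 x x' rfl rfl
    have hht : P.ct.ht x < R := by
      have := ct_ht x
      change _ = P.level i + 1 at this
      omega
    have hpow := hrel.rot_pow hG hH hht
    have hfwd : ∀ n, P.ct.IsForward ((P.ct.rot ^ n) x) ↔ P'.ct.IsForward ((P'.ct.rot ^ n) x') := by
      intro n
      unfold IsForward
      rw [(hpow n).ht_eq hG hH, (hpow n).flip.ht_eq hG hH]
    have hnot : ∀ {P : LayerCode} {y : P.ct.Dart} {j : ℕ}, y.1 = hl j → ¬ P.ct.IsForward y := by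
      intro P y j hy hf
      change P.ct.ht (P.ct.flip y) = P.ct.ht y + 1 at hf
      have h5 := ct_ht y
      have h6 := ct_ht (P.ct.flip y)
      rw [ct_flip, hy] at h6
      rw [hy] at h5
      change _ = P.level j + 1 at h5
      change _ = P.level j + 1 at h6
      omega
    have hnumi : P.num i = P'.num i := by
      rcases lt_trichotomy (P.num i) (P'.num i) with h1 | h1 | h1
      · exact absurd ((hfwd _).2 (ct_ht_flip_F (ct_rot_pow_child (x := x') rfl hedge' h1)))
          (hnot (ct_rot_pow_num (x := x) rfl hedge))
      · exact h1
      · exact absurd ((hfwd _).1 (ct_ht_flip_F (ct_rot_pow_child (x := x) rfl hedge h1)))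
          (hnot (ct_rot_pow_num (x := x') rfl hedge'))
    refine ⟨hnumi, fun k hk _ y y' hy hy' => ?_⟩
    have h1 : y = P.ct.flip ((P.ct.rot ^ (k + 3)) x) :=
      Subtype.ext (hy.trans (congrArg LDart.flip (ct_rot_pow_child (x := x) rfl hedge hk)).symm)
    have h2 : y' = P'.ct.flip ((P'.ct.rot ^ (k + 3)) x') := by
      refine Subtype.ext (hy'.trans (Eq.symm ?_))
      rw [← hstart]
      exact congrArg LDart.flip (ct_rot_pow_child (x := x') rfl hedge' (hnumi ▸ hk))
    rw [h1, h2]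
    exact (hpow _).flip

theorem ballEq_ct_iff : BallEq R P.ct P'.ct ↔ Agree R P P' := by
  refine ⟨fun h => ?_, Agree.ballEq_ct⟩
  obtain ⟨e⟩ := ballEq_iff.1 h
  exact agree_of_agreeTo
    (fun K hK => ⟨lt_h_of_ballIso_ct e hK, lt_h_of_ballIso_ct e.symm hK⟩)
    fun K hK => agreeTo_of_ballIso_ct e hK

end LayerCode

/-! ### The local structure of causal triangulations -/

namespace RootedMap

/-- The properties that finite and infinite causal triangulations have in common; `E` is the set of
darts with the exterior face on their right. -/
structure IsCausal (G : RootedMap) (h : ℕ∞) (E : G.Dart → Prop) : Prop where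
  connected : G.graph.Connected
  ht_le : ∀ d, (G.ht d : ℕ∞) ≤ h
  exists_ht : ∀ k : ℕ, (k : ℕ∞) ≤ h → ∃ d, G.ht d = k
  no_root_loop : ∀ d, G.ht d = 0 → G.ht (G.flip d) ≠ 0
  cycle : ∀ k : ℕ, 0 < k → (k : ℕ∞) < h → G.SpansCycle k
  face_triple : ∀ d, ¬ E d → G.face (G.face (G.face d)) = d
  ext_face : ∀ d, E (G.face d) ↔ E d
  ext_ht : ∀ d, E d → (G.ht d : ℕ∞) = h ∧ G.ht d = G.ht (G.flip d) + 1 ∨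
    (G.ht (G.flip d) : ℕ∞) = h ∧ G.ht (G.flip d) = G.ht d + 1
  top_rot : ∀ d, (G.ht d : ℕ∞) = h → G.rot (G.rot d) = d
  top_ext : ∀ d, (G.ht d : ℕ∞) = h → (E (G.rot d) ↔ ¬ E d)

variable {G : RootedMap}

theorem exists_ht_of_le (hG : G.graph.Connected) {d : G.Dart} :
    ∀ {k : ℕ}, k ≤ G.ht d → ∃ e, G.ht e = k := by
  suffices ∀ m k (d : G.Dart), G.ht d = k + m → ∃ e, G.ht e = k from fun {k} hk =>
    this (G.ht d - k) k d (by omega)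
  intro m
  induction m with
  | zero => exact fun k d h => ⟨d, h⟩
  | succ m ih =>
    intro k d h
    obtain ⟨e, -, he⟩ := exists_descend hG (n := k + m) (by rw [h]; rfl)
    exact ih k _ he

theorem rot_of_degree_two {d : G.Dart} (hd : G.degree (G.vert d) = 2) :
    G.rot d ≠ d ∧ G.rot (G.rot d) = d ∧ ∀ e, G.vert e = G.vert d → e = d ∨ e = G.rot d := by
  have hcard : ({e | G.vert e = G.vert d} : Set G.Dart).ncard = 2 := hd
  obtain ⟨a, b, hab, hset⟩ := Set.ncard_eq_two.1 hcard
  have hmem : ∀ e, G.vert e = G.vert d ↔ e = a ∨ e = b := fun e => Set.ext_iff.1 hset e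
  have hne : G.rot d ≠ d := by
    intro hfix
    have hsub : ∀ e, G.vert e = G.vert d → e = d := fun e he =>
      G.finite_orbits.induction (P := fun e => e = d) (fun a ha => by rw [ha, hfix])
        (vert_eq_iff.1 he.symm) rfl
    exact hab ((hsub a ((hmem a).2 (Or.inl rfl))).trans (hsub b ((hmem b).2 (Or.inr rfl))).symm)
  have h2 : G.rot (G.rot d) ≠ G.rot d := fun h => hne (G.rot.injective h)
  have e0 := (hmem d).1 rfl
  have e1 := (hmem (G.rot d)).1 (vert_rot d)
  have e2 := (hmem (G.rot (G.rot d))).1 ((vert_rot _).trans (vert_rot d))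
  refine ⟨hne, by grind, fun e he => ?_⟩
  have := (hmem e).1 he
  grind

theorem IsInfiniteCT.isCausal (hG : G.IsInfiniteCT) : G.IsCausal ⊤ fun _ => False where
  connected := hG.plane.connected
  ht_le _ := le_top
  exists_ht k _ := by
    rcases Nat.eq_zero_or_pos k with rfl | hk
    · exact ⟨G.root, ht_root⟩
    · obtain ⟨⟨v, hv⟩⟩ := (hG.cycle k hk).1.nonempty
      obtain ⟨d, rfl⟩ := exists_vert v
      exact ⟨d, hv⟩
  no_root_loop := hG.no_root_loop
  cycle k hk _ := hG.cycle k hk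
  face_triple d _ := (hG.plane.triangle d).1
  ext_face _ := Iff.rfl
  ext_ht _ h := h.elim
  top_rot d h := absurd h (ENat.natCast_ne_top _)
  top_ext d h := absurd h (ENat.natCast_ne_top _)

theorem IsFiniteCTWith.isCausal {x : G.Dart} {h : ℕ} (hG : G.IsFiniteCTWith x h) :
    G.IsCausal h fun d => G.faceOf d = G.faceOf x where
  connected := hG.disk.connected
  ht_le d := by exact_mod_cast hG.height_le (G.vert d)
  exists_ht k hk := by
    obtain ⟨v, hv⟩ := hG.exists_height
    obtain ⟨d, rfl⟩ := exists_vert v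
    refine exists_ht_of_le hG.disk.connected (d := d) ?_
    change k ≤ G.height (G.vert d)
    rw [hv]
    exact_mod_cast hk
  no_root_loop := hG.no_root_loop
  cycle k hk hk' := hG.cycle k hk (by exact_mod_cast hk')
  face_triple d hd := (hG.disk.triangle d hd).1
  ext_face d := by rw [faceOf_face]
  ext_ht d hd := by
    rcases hG.alternate d hd with ⟨h1, h2⟩ | ⟨h1, h2⟩
    · exact Or.inl ⟨by rw [h1], by omega⟩
    · exact Or.inr ⟨by rw [h2], by omega⟩
  top_rot d hd := by
    have hd' : G.ht d = h := by exact_mod_cast hd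
    exact (rot_of_degree_two (hG.top_vertex _ hd').1).2.1
  top_ext d hd := by
    have hd' : G.ht d = h := by exact_mod_cast hd
    obtain ⟨h1, y, ⟨hy, hy'⟩, huniq⟩ := hG.top_vertex _ hd'
    obtain ⟨hne, -, hmem⟩ := rot_of_degree_two h1
    have u0 : G.faceOf d ≠ G.faceOf x → d = y := fun h => huniq d ⟨rfl, h⟩
    have u1 : G.faceOf (G.rot d) ≠ G.faceOf x → G.rot d = y := fun h => huniq _ ⟨vert_rot d, h⟩
    constructor
    · intro h3 h4
      rcases hmem y hy with rfl | rfl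
      · exact hy' h4
      · exact hy' h3
    · intro h3
      by_contra h4
      exact hne ((u1 h4).trans (u0 h3).symm)

/-- `d` points from its origin to a vertex one step closer to the root. -/
def IsBackward (G : RootedMap) (d : G.Dart) : Prop := G.ht (G.flip d) + 1 = G.ht d

/-- `d` connects vertices at the same height. -/
def IsHorizontal (G : RootedMap) (d : G.Dart) : Prop := G.ht (G.flip d) = G.ht d

theorem IsForward.not_isBackward {d : G.Dart} (h1 : G.IsForward d) : ¬ G.IsBackward d := fun h2 => by
  unfold IsForward at h1; unfold IsBackward at h2; omega

theorem IsForward.not_isHorizontal {d : G.Dart} (h1 : G.IsForward d) : ¬ G.IsHorizontal d :=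
  fun h2 => by unfold IsForward at h1; unfold IsHorizontal at h2; omega

theorem IsBackward.not_isHorizontal {d : G.Dart} (h1 : G.IsBackward d) : ¬ G.IsHorizontal d :=
  fun h2 => by unfold IsBackward at h1; unfold IsHorizontal at h2; omega

theorem IsForward.flip {d : G.Dart} (h : G.IsForward d) : G.IsBackward (G.flip d) := by
  unfold IsForward at h
  unfold IsBackward
  rw [G.flip_flip, h]

theorem IsBackward.flip {d : G.Dart} (h : G.IsBackward d) : G.IsForward (G.flip d) := by
  unfold IsBackward at h
  unfold IsForward
  rw [G.flip_flip, h]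

theorem IsHorizontal.flip {d : G.Dart} (h : G.IsHorizontal d) : G.IsHorizontal (G.flip d) := by
  unfold IsHorizontal at h ⊢
  rw [G.flip_flip, h]

namespace IsCausal

variable {h : ℕ∞} {E : G.Dart → Prop}

theorem not_ext_of_hor (hG : G.IsCausal h E) {d : G.Dart} (hd : G.ht (G.flip d) = G.ht d) :
    ¬ E d := by
  intro hE
  rcases hG.ext_ht d hE with ⟨-, h1⟩ | ⟨-, h1⟩ <;> omega

theorem ht_face (d : G.Dart) : G.ht (G.face d) = G.ht (G.flip d) := ht_rot _

/-- The third side of a triangle closes up. -/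
theorem third (hG : G.IsCausal h E) {d : G.Dart} (hd : ¬ E d) :
    G.ht (G.flip (G.face (G.face d))) = G.ht d := by
  rw [← ht_face, hG.face_triple d hd]

/-- If the face between the two darts is a triangle, its third side would join heights that differ
by two. Along the exterior face only the heights `h` and `h - 1` occur. -/
theorem ht_corner (hG : G.IsCausal h E) (y : G.Dart) :
    ¬ (G.ht (G.flip y) + 1 = G.ht y ∧ G.IsForward (G.rot y)) ∧
      ¬ (G.IsForward y ∧ G.ht (G.flip (G.rot y)) + 1 = G.ht y) := by
  unfold IsForward
  rw [ht_rot]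
  have hface : G.face (G.flip y) = G.rot y := by rw [face_apply, G.flip_flip]
  by_cases hE : E (G.flip y)
  · have h1 := hG.ext_ht _ hE
    have h2 := hG.ext_ht (G.rot y) (by rw [← hface]; exact (hG.ext_face _).2 hE)
    rw [G.flip_flip] at h1
    rw [ht_rot] at h2
    have hinj : ∀ {a b : ℕ}, (a : ℕ∞) = h → (b : ℕ∞) = h → a = b := fun ha hb => by
      exact_mod_cast ha.trans hb.symm
    constructor
    · rintro ⟨h3, h4⟩
      rcases h1 with ⟨h1, h1'⟩ | ⟨h1, h1'⟩
      · omega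
      · rcases h2 with ⟨h2, h2'⟩ | ⟨h2, h2'⟩
        · omega
        · have := hinj h1 h2
          omega
    · rintro ⟨h3, h4⟩
      rcases h1 with ⟨h1, h1'⟩ | ⟨h1, h1'⟩
      · rcases h2 with ⟨h2, h2'⟩ | ⟨h2, h2'⟩
        · have := hinj h1 h2
          omega
        · omega
      · omega
  · have h1 := hG.third hE
    have h2 := ht_flip_le hG.connected (G.face (G.face (G.flip y)))
    have h3 := ht_le_flip hG.connected (G.face (G.face (G.flip y)))
    rw [h1, ht_face, hface] at h2 h3
    constructor
    · rintro ⟨h4, h5⟩; omega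
    · rintro ⟨h4, h5⟩; omega

/-- The triangles at an edge of a cycle. -/
theorem ht_hor (hG : G.IsCausal h E) {a : G.Dart} (ha : G.ht (G.flip a) = G.ht a) :
    G.ht (G.flip (G.rot (G.flip a))) = G.ht (G.flip (G.rot.symm a)) := by
  have h1 := hG.face_triple a (hG.not_ext_of_hor ha)
  have h2 : G.flip (G.face (G.face a)) = G.rot.symm a := by
    rw [Equiv.eq_symm_apply]
    exact h1
  rw [← h2, G.flip_flip, ht_face]
  rfl

theorem exists_bwd (hG : G.IsCausal h E) {d : G.Dart} (hd : 0 < G.ht d) :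
    ∃ e, G.vert e = G.vert d ∧ G.ht (G.flip e) + 1 = G.ht e := by
  obtain ⟨e, he, he'⟩ := exists_descend hG.connected (d := d) (n := G.ht d - 1) (by omega)
  exact ⟨e, he, by rw [ht_congr he]; omega⟩

/-- The end of a run of darts that satisfy `P`. -/
theorem _root_.HasFiniteOrbits.exists_run_end {α : Type*} {f : Equiv.Perm α}
    (hf : HasFiniteOrbits f) {P : α → Prop} {a b : α} (h : f.SameCycle a b) (ha : P a)
    (hb : ¬ P b) : ∃ x, f.SameCycle a x ∧ P x ∧ ¬ P (f x) := by
  obtain ⟨n, hn, hn'⟩ := hf.exists_run h ha hb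
  rw [pow_succ', Equiv.Perm.mul_apply] at hn'
  exact ⟨_, sameCycle_iterate f n a, hn n le_rfl, hn'⟩

theorem cases_dart (hG : G.IsCausal h E) (d : G.Dart) :
    G.IsForward d ∨ G.IsBackward d ∨ G.IsHorizontal d := by
  have h1 := ht_flip_le hG.connected d
  have h2 := ht_le_flip hG.connected d
  unfold IsForward IsBackward IsHorizontal
  omega

/-- The horizontal darts at a vertex that has both forward and backward darts. -/
theorem exists_right_left (hG : G.IsCausal h E) {y z : G.Dart} (hyz : G.vert y = G.vert z)
    (hy : G.IsForward y) (hz : G.IsBackward z) (hh : (G.ht y : ℕ∞) < h) :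
    ∃ r l, (G.IsForward (G.rot r) ∧ G.IsBackward (G.rot.symm r)) ∧
      (G.IsBackward (G.rot l) ∧ G.IsForward (G.rot.symm l)) ∧
      ∀ a, G.IsHorizontal a → G.vert a = G.vert y → a = r ∨ a = l := by
  have hpos : 0 < G.ht y := by
    have : G.ht (G.flip z) + 1 = G.ht z := hz
    rw [ht_congr hyz]; omega
  have hcard : ({a | G.vert a = G.vert y ∧ G.ht (G.flip a) = G.ht y} : Set G.Dart).ncard = 2 :=
    (hG.cycle _ hpos hh).2 _ rfl
  obtain ⟨b, c, hbc, hset⟩ := Set.ncard_eq_two.1 hcard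
  have hmem : ∀ a, G.IsHorizontal a → G.vert a = G.vert y → a = b ∨ a = c := fun a ha hav =>
    (Set.ext_iff.1 hset a).1 ⟨hav, by rw [← ht_congr hav]; exact ha⟩
  have fb : ∀ {d : G.Dart}, G.IsForward d → ¬ G.IsBackward d := IsForward.not_isBackward
  have bh : ∀ {d : G.Dart}, G.IsBackward d → ¬ G.IsHorizontal d := IsBackward.not_isHorizontal
  have cor1 : ∀ d, G.IsBackward d → ¬ G.IsForward (G.rot d) := fun d h1 h2 =>
    (hG.ht_corner d).1 ⟨h1, h2⟩
  have cor2 : ∀ d, G.IsForward d → ¬ G.IsBackward (G.rot d) := fun d h1 h2 =>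
    (hG.ht_corner d).2 ⟨h1, by rw [← ht_rot d]; exact h2⟩
  have hsymm : ∀ d, G.rot (G.rot⁻¹ d) = d := G.rot.apply_symm_apply
  have hc := vert_eq_iff.1 hyz
  -- By `ht_corner`, runs of forward and of backward darts are bounded by horizontal darts. The ends
  -- of one run of each kind are sought in both directions; only two horizontal darts are available
  -- for these four ends.
  obtain ⟨x1, v1, p1, q1⟩ := G.finite_orbits.exists_run_end (P := G.IsForward) hc hy
    fun hf => fb hf hz
  obtain ⟨x2, v2, p2, q2⟩ := G.finite_orbits.exists_run_end (P := G.IsBackward) hc.symm hz (fb hy)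
  obtain ⟨x3, v3, p3, q3⟩ := G.finite_orbits.symm.exists_run_end (P := G.IsForward) hc.inv hy
    fun hf => fb hf hz
  obtain ⟨x4, v4, p4, q4⟩ := G.finite_orbits.symm.exists_run_end (P := G.IsBackward) hc.symm.inv hz
    (fb hy)
  have w1 : G.vert (G.rot x1) = G.vert y := (vert_rot _).trans (vert_eq_iff.2 v1).symm
  have w2 : G.vert (G.rot x2) = G.vert y :=
    (vert_rot _).trans ((vert_eq_iff.2 v2).symm.trans hyz.symm)
  have w3 : G.vert (G.rot⁻¹ x3) = G.vert y :=
    (vert_rot_symm _).trans (vert_eq_iff.2 (Equiv.Perm.sameCycle_inv.1 v3)).symm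
  have w4 : G.vert (G.rot⁻¹ x4) = G.vert y := (vert_rot_symm _).trans
    ((vert_eq_iff.2 (Equiv.Perm.sameCycle_inv.1 v4)).symm.trans hyz.symm)
  have k1 : G.IsHorizontal (G.rot x1) := by
    rcases hG.cases_dart (G.rot x1) with h1 | h1 | h1
    exacts [absurd h1 q1, absurd h1 (cor2 _ p1), h1]
  have k2 : G.IsHorizontal (G.rot x2) := by
    rcases hG.cases_dart (G.rot x2) with h1 | h1 | h1
    exacts [absurd h1 (cor1 _ p2), absurd h1 q2, h1]
  have k3 : G.IsHorizontal (G.rot⁻¹ x3) := by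
    rcases hG.cases_dart (G.rot⁻¹ x3) with h1 | h1 | h1
    exacts [absurd h1 q3, absurd (by rw [hsymm]; exact p3) (cor1 _ h1), h1]
  have k4 : G.IsHorizontal (G.rot⁻¹ x4) := by
    rcases hG.cases_dart (G.rot⁻¹ x4) with h1 | h1 | h1
    exacts [absurd (by rw [hsymm]; exact p4) (cor2 _ h1), absurd h1 q4, h1]
  have m1 := hmem _ k1 w1
  have m2 := hmem _ k2 w2
  have m3 := hmem _ k3 w3
  have m4 := hmem _ k4 w4
  have n12 : G.rot x1 ≠ G.rot x2 := fun hcon => by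
    rw [G.rot.injective hcon] at p1; exact fb p1 p2
  have n34 : G.rot⁻¹ x3 ≠ G.rot⁻¹ x4 := fun hcon => by
    rw [G.rot⁻¹.injective hcon] at p3; exact fb p3 p4
  have hall : ∀ a, G.IsHorizontal a → G.vert a = G.vert y → a = G.rot x2 ∨ a = G.rot x1 := by
    intro a ha hav
    have := hmem a ha hav
    grind
  -- Were the same horizontal dart at both ends of the forward run, then turning around the vertex
  -- would meet only it and forward darts, and never `z`.
  have h13 : G.rot x1 ≠ G.rot⁻¹ x3 := by
    intro hcon
    have hclosed : ∀ a, (G.vert a = G.vert y ∧ (G.IsForward a ∨ a = G.rot x1)) →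
        G.vert (G.rot a) = G.vert y ∧ (G.IsForward (G.rot a) ∨ G.rot a = G.rot x1) := by
      rintro a ⟨hav, ha⟩
      refine ⟨(vert_rot a).trans hav, ?_⟩
      rcases ha with ha | rfl
      · rcases hG.cases_dart (G.rot a) with h1 | h1 | h1
        · exact Or.inl h1
        · exact absurd h1 (cor2 _ ha)
        · rcases hall _ h1 ((vert_rot a).trans hav) with h2 | h2
          · rw [G.rot.injective h2] at ha
            exact absurd p2 (fb ha)
          · exact Or.inr h2
      · left
        rw [hcon, hsymm]
        exact p3
    have := (G.finite_orbits.induction hclosed hc ⟨rfl, Or.inl hy⟩).2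
    rcases this with h1 | h1
    · exact fb h1 hz
    · rw [h1] at hz; exact bh hz k1
  have h23 : G.rot x2 = G.rot⁻¹ x3 := by
    rcases hall _ k3 w3 with h1 | h1
    · exact h1.symm
    · exact absurd h1.symm h13
  have h14 : G.rot x1 = G.rot⁻¹ x4 := by
    rcases hall _ k4 w4 with h1 | h1
    · exact absurd (h23.symm.trans h1.symm) n34
    · exact h1.symm
  refine ⟨G.rot x2, G.rot x1, ⟨?_, ?_⟩, ⟨?_, ?_⟩, hall⟩
  · rw [h23, hsymm]; exact p3
  · rw [Equiv.symm_apply_apply]; exact p2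
  · rw [h14, hsymm]; exact p4
  · rw [Equiv.symm_apply_apply]; exact p1

/-- One of the two sides of each edge at a top vertex is exterior, so the edge belongs to the
boundary, whose vertices alternate in height. -/
theorem top_isBackward (hG : G.IsCausal h E) {y : G.Dart} (hy : (G.ht y : ℕ∞) = h) :
    G.IsBackward y := by
  have hinj : ∀ {a : ℕ}, (a : ℕ∞) = h → a = G.ht y := fun ha => by exact_mod_cast ha.trans hy.symm
  unfold IsBackward
  by_cases hE : E y
  · rcases hG.ext_ht y hE with ⟨h1, h2⟩ | ⟨h1, h2⟩
    · omega
    · have := hinj h1; omega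
  · have h3 : E (G.flip y) := by
      rw [← hG.ext_face, face_apply, G.flip_flip]
      exact (hG.top_ext y hy).2 hE
    rcases hG.ext_ht _ h3 with ⟨h1, h2⟩ | ⟨h1, h2⟩ <;> rw [G.flip_flip] at h2
    · have := hinj h1; omega
    · omega

theorem top_ext_flip (hG : G.IsCausal h E) {y : G.Dart} (hy : (G.ht y : ℕ∞) = h) :
    E (G.flip y) ↔ ¬ E y := by
  rw [← hG.top_ext y hy, ← hG.ext_face, face_apply, G.flip_flip]

theorem ht_pos_of_isHorizontal (hG : G.IsCausal h E) {a : G.Dart} (ha : G.IsHorizontal a) :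
    0 < G.ht a := by
  unfold IsHorizontal at ha
  by_contra h0
  exact hG.no_root_loop a (by omega) (by omega)

theorem ht_lt_of_isHorizontal (hG : G.IsCausal h E) {a : G.Dart} (ha : G.IsHorizontal a) :
    (G.ht a : ℕ∞) < h :=
  lt_of_le_of_ne (hG.ht_le a) fun h1 => (hG.top_isBackward h1).not_isHorizontal ha

/-- Every vertex between the root and the boundary has forward darts. -/
theorem exists_isForward (hG : G.IsCausal h E) {d : G.Dart} (hd : 0 < G.ht d)
    (hd' : (G.ht d : ℕ∞) < h) : ∃ e, G.vert e = G.vert d ∧ G.IsForward e := by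
  by_contra hcon
  -- In contrapositive form: if `w` has forward darts, one of them is next to the horizontal edge
  -- from `v`, and the triangle there yields a forward dart at `v`.
  have hstep : ∀ v w : {v | G.height v = G.ht d}, (G.graph.induce {v | G.height v = G.ht d}).Adj v w →
      (¬ ∃ e, G.vert e = v ∧ G.IsForward e) → ¬ ∃ e, G.vert e = w ∧ G.IsForward e := by
    rintro ⟨v, hv⟩ ⟨w, hw⟩ ⟨-, a, hav, haw⟩ hno ⟨y, hyw, hy⟩
    change G.vert a = v at hav
    change G.vert (G.flip a) = w at haw
    change G.vert y = w at hyw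
    subst hav haw
    change G.ht a = G.ht d at hv
    change G.ht (G.flip a) = G.ht d at hw
    have ha : G.IsHorizontal a := hw.trans hv.symm
    obtain ⟨z, hz, hz'⟩ := hG.exists_bwd (d := y) (by rw [ht_congr hyw]; omega)
    obtain ⟨r, l, hr, hl, hall⟩ := hG.exists_right_left hz.symm hy hz'
      (by rw [ht_congr hyw, hw]; exact hd')
    rcases hall (G.flip a) ha.flip hyw.symm with h1 | h1
    · refine hno ⟨G.rot.symm a, vert_rot_symm a, ?_⟩
      have h2 := hG.ht_hor ha
      have h3 := hr.1
      rw [← h1] at h3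
      unfold IsForward at h3 ⊢
      rw [← h2, h3, ht_rot, ht_rot_symm, ha]
    · refine hno ⟨G.rot a, vert_rot a, ?_⟩
      have h2 := hG.ht_hor ha.flip
      rw [G.flip_flip] at h2
      have h3 := hl.2
      rw [← h1] at h3
      unfold IsForward at h3 ⊢
      rw [h2, h3, ht_rot, ht_rot_symm, ha]
  have hreach : ∀ {v w : {v | G.height v = G.ht d}},
      (G.graph.induce {v | G.height v = G.ht d}).Walk v w →
      (¬ ∃ e, G.vert e = v ∧ G.IsForward e) → ¬ ∃ e, G.vert e = w ∧ G.IsForward e := by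
    intro v w p
    induction p with
    | nil => exact id
    | cons hadj q ih => exact fun hv => ih (hstep _ _ hadj hv)
  -- Some vertex one step higher descends to the cycle, so at least one vertex of the cycle has a
  -- forward dart; the property spreads along the cycle.
  obtain ⟨x, hx⟩ := hG.exists_ht (G.ht d + 1) (by push_cast; exact Order.add_one_le_of_lt hd')
  obtain ⟨e, he, he'⟩ := exists_descend hG.connected hx
  obtain ⟨p⟩ := (hG.cycle _ hd hd').1.preconnected ⟨G.vert d, rfl⟩ ⟨G.vert (G.flip e), he'⟩
  refine hreach p hcon ⟨G.flip e, rfl, ?_⟩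
  unfold IsForward
  rw [G.flip_flip, ht_congr he, hx, he']

/-- The order of the darts around a vertex between the root and the boundary. -/
theorem right_left (hG : G.IsCausal h E) {a : G.Dart} (ha : G.IsHorizontal a) :
    ∃ r l, (G.IsForward (G.rot r) ∧ G.IsBackward (G.rot.symm r)) ∧
      (G.IsBackward (G.rot l) ∧ G.IsForward (G.rot.symm l)) ∧
      ∀ b, G.IsHorizontal b → G.vert b = G.vert a → b = r ∨ b = l := by
  have h1 := hG.ht_pos_of_isHorizontal ha
  have h2 := hG.ht_lt_of_isHorizontal ha
  obtain ⟨y, hy, hy'⟩ := hG.exists_isForward h1 h2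
  obtain ⟨z, hz, hz'⟩ := hG.exists_bwd h1
  obtain ⟨r, l, hr, hl, hall⟩ := hG.exists_right_left (hy.trans hz.symm) hy' hz'
    (by rw [ht_congr hy]; exact h2)
  exact ⟨r, l, hr, hl, fun b hb hba => hall b hb (hba.trans hy.symm)⟩

theorem isHorizontal_cases (hG : G.IsCausal h E) {a : G.Dart} (ha : G.IsHorizontal a) :
    (G.IsForward (G.rot a) ∧ G.IsBackward (G.rot.symm a)) ∨
      (G.IsBackward (G.rot a) ∧ G.IsForward (G.rot.symm a)) := by
  obtain ⟨r, l, hr, hl, hall⟩ := hG.right_left ha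
  rcases hall a ha rfl with rfl | rfl
  · exact Or.inl hr
  · exact Or.inr hl

theorem right_unique (hG : G.IsCausal h E) {a b : G.Dart} (ha : G.IsHorizontal a)
    (hb : G.IsHorizontal b) (hab : G.vert a = G.vert b) (ha' : G.IsForward (G.rot a))
    (hb' : G.IsForward (G.rot b)) : a = b := by
  obtain ⟨r, l, hr, hl, hall⟩ := hG.right_left ha
  have h1 : a = r := (hall a ha rfl).resolve_right fun h => by
    rw [h] at ha'; exact ha'.not_isBackward hl.1
  have h2 : b = r := (hall b hb hab.symm).resolve_right fun h => by
    rw [h] at hb'; exact hb'.not_isBackward hl.1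
  exact h1.trans h2.symm

theorem left_unique (hG : G.IsCausal h E) {a b : G.Dart} (ha : G.IsHorizontal a)
    (hb : G.IsHorizontal b) (hab : G.vert a = G.vert b) (ha' : G.IsBackward (G.rot a))
    (hb' : G.IsBackward (G.rot b)) : a = b := by
  obtain ⟨r, l, hr, hl, hall⟩ := hG.right_left ha
  have h1 : a = l := (hall a ha rfl).resolve_left fun h => by
    rw [h] at ha'; exact hr.1.not_isBackward ha'
  have h2 : b = l := (hall b hb hab.symm).resolve_left fun h => by
    rw [h] at hb'; exact hr.1.not_isBackward hb'
  exact h1.trans h2.symm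

/-- The dart after `a` and the dart before `flip a` are sides of one triangle and have the same
endpoint, so the second is forward if the first is. Hence `flip a` is of the left kind. -/
theorem flip_right (hG : G.IsCausal h E) {a : G.Dart} (ha : G.IsHorizontal a)
    (ha' : G.IsForward (G.rot a)) : G.IsBackward (G.rot (G.flip a)) := by
  have h2 := hG.ht_hor ha.flip
  rw [G.flip_flip] at h2
  rcases hG.isHorizontal_cases ha.flip with h1 | h1
  · have h3 := h1.2
    unfold IsForward at ha'
    unfold IsBackward at h3
    rw [← h2, ht_rot_symm, ha] at h3
    rw [ht_rot] at ha'
    omega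
  · exact h1.1

/-- After an edge that is not the rightmost one comes the horizontal edge to the right. -/
theorem isHorizontal_rot_flip (hG : G.IsCausal h E) {d : G.Dart} (hd : G.IsForward d)
    (hd' : G.IsForward (G.rot.symm d)) (hh : (G.ht (G.flip d) : ℕ∞) < h) :
    G.IsHorizontal (G.rot (G.flip d)) ∧ G.IsForward (G.rot (G.rot (G.flip d))) := by
  have hface : G.face (G.flip (G.rot.symm d)) = d := by
    rw [face_apply, G.flip_flip, Equiv.apply_symm_apply]
  unfold IsForward at hd hd'
  rw [ht_rot_symm] at hd'
  have hE : ¬ E (G.flip (G.rot.symm d)) := by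
    intro hE
    rcases hG.ext_ht _ hE with ⟨h1, h2⟩ | ⟨h1, h2⟩ <;>
      rw [G.flip_flip, ht_rot_symm] at h2
    · rw [hd] at hh; rw [hd'] at h1; exact hh.ne h1
    · omega
  have h3 := hG.third hE
  rw [hface, face_apply, hd'] at h3
  have h4 : G.IsHorizontal (G.rot (G.flip d)) := by
    unfold IsHorizontal
    rw [h3, ht_rot, hd]
  refine ⟨h4, ?_⟩
  rcases hG.isHorizontal_cases h4 with h5 | h5
  · exact h5.1
  · have h6 := h5.2
    rw [Equiv.symm_apply_apply] at h6
    exact absurd (show G.IsForward d from hd).flip h6.not_isBackward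

/-- After the forward edges comes the horizontal edge to the left. -/
theorem isHorizontal_of_not_isForward (hG : G.IsCausal h E) {x : G.Dart} (hx : G.IsForward x)
    (hx' : ¬ G.IsForward (G.rot x)) :
    G.IsHorizontal (G.rot x) ∧ G.IsBackward (G.rot (G.rot x)) := by
  have h1 : G.IsHorizontal (G.rot x) := by
    rcases hG.cases_dart (G.rot x) with h1 | h1 | h1
    · exact absurd h1 hx'
    · exact absurd ⟨hx, by rw [← ht_rot x]; exact h1⟩ (hG.ht_corner x).2
    · exact h1
  refine ⟨h1, ?_⟩
  rcases hG.isHorizontal_cases h1 with h2 | h2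
  · have h3 := h2.2
    rw [Equiv.symm_apply_apply] at h3
    exact absurd h3 hx.not_isBackward
  · exact h2.1

/-- The vertices next to the boundary have two forward darts. -/
theorem penultimate (hG : G.IsCausal h E) {r : G.Dart} (hr : G.IsHorizontal r)
    (hr' : G.IsForward (G.rot r)) (hh : ((G.ht r + 1 : ℕ) : ℕ∞) = h) :
    ¬ E (G.rot r) ∧ G.IsForward (G.rot (G.rot r)) ∧ E (G.rot (G.rot r)) ∧
      ¬ G.IsForward (G.rot (G.rot (G.rot r))) := by
  have hEr : ¬ E (G.rot r) := by
    have := hG.ext_face (G.flip r)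
    rw [face_apply, G.flip_flip] at this
    rw [this]
    exact hG.not_ext_of_hor hr.flip
  -- An edge ending at a top vertex has the exterior face on exactly one side.
  have key : ∀ f, G.ht f = G.ht r → G.IsForward f → (E (G.flip f) ↔ ¬ E f) := by
    intro f hf hf'
    have := hG.top_ext_flip (y := G.flip f) (by rw [hf', hf]; exact hh)
    rw [G.flip_flip] at this
    rw [this, not_not]
  have hht : G.ht (G.rot r) = G.ht r := ht_rot r
  have h1 := (key _ hht hr').2 hEr
  have h2 : E (G.rot (G.rot r)) := (hG.ext_face (G.flip (G.rot r))).2 h1 |> fun h => by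
    rwa [face_apply, G.flip_flip] at h
  have hht2 : G.ht (G.rot (G.rot r)) = G.ht r := (ht_rot _).trans hht
  have h3 : G.IsForward (G.rot (G.rot r)) := by
    rcases hG.ext_ht _ h2 with ⟨h4, -⟩ | ⟨-, h4⟩
    · rw [hht2, ← hh] at h4
      have : G.ht r = G.ht r + 1 := by exact_mod_cast h4
      omega
    · exact h4
  -- A third forward dart would be a side of a triangle whose upper side joins two top vertices, but
  -- top vertices have only backward darts.
  refine ⟨hEr, h3, h2, fun h4 => ?_⟩
  have h5 : ¬ E (G.flip (G.rot (G.rot r))) := fun h6 => (key _ hht2 h3).1 h6 h2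
  have h6 := hG.third h5
  have h7 : G.face (G.flip (G.rot (G.rot r))) = G.rot (G.rot (G.rot r)) := by
    rw [face_apply, G.flip_flip]
  have h8 : G.ht (G.face (G.rot (G.rot (G.rot r)))) = G.ht r + 1 := by
    rw [ht_face, h4, ht_rot, hht2]
  have h9 := hG.top_isBackward (y := G.face (G.rot (G.rot (G.rot r)))) (by rw [h8]; exact hh)
  unfold IsBackward at h9
  rw [h7, h3] at h6
  omega

/-- For `h = 1`, the triangle at a top vertex would have its third side from the root vertex to
itself, and this is the forbidden loop. -/
theorem two_le (hG : G.IsCausal h E) (h1 : 1 ≤ h) : 2 ≤ h := by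
  by_contra hcon
  have hh : h = 1 := le_antisymm (Order.le_of_lt_add_one (by
    rw [one_add_one_eq_two]; exact not_le.1 hcon)) h1
  have key : ∀ y, G.ht y = 1 → E y → False := by
    intro y hy hE
    have hy' : (G.ht y : ℕ∞) = h := by rw [hy, hh]; rfl
    have h2 : ¬ E (G.flip y) := fun h => (hG.top_ext_flip hy').1 h hE
    have h3 := hG.third h2
    have h4 := hG.top_isBackward hy'
    have h5 : (G.ht (G.rot y) : ℕ∞) = h := by rw [ht_rot]; exact hy'
    have h6 := hG.top_isBackward h5
    unfold IsBackward at h4 h6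
    rw [ht_rot] at h6
    have h7 : G.face (G.flip y) = G.rot y := by rw [face_apply, G.flip_flip]
    rw [h7] at h3
    refine hG.no_root_loop (G.face (G.rot y)) ?_ ?_
    · rw [ht_face]; omega
    · omega
  obtain ⟨y, hy⟩ := hG.exists_ht 1 (by exact_mod_cast h1)
  by_cases hE : E y
  · exact key y hy hE
  · exact key (G.rot y) ((ht_rot y).trans hy)
      ((hG.top_ext y (by rw [hy, hh]; rfl)).2 hE)

end IsCausal

end RootedMap

/-! ### Enumeration of the descendants of a vertex, level by level -/

section Enumeration

variable {X : Type*} (x0 : X) (cnt : X → ℕ) (ch : X → ℕ → X)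

def childList (x : X) : List X := (List.range (cnt x)).map (ch x)

/-- The vertices found when the children of the first `n` vertices have been listed. -/
def foundList : ℕ → List X
  | 0 => [x0]
  | n + 1 => foundList n ++ ((foundList n)[n]?.elim [] (childList cnt ch))

theorem foundList_prefix {m n : ℕ} (h : m ≤ n) : foundList x0 cnt ch m <+: foundList x0 cnt ch n := by
  induction n, h using Nat.le_induction with
  | base => exact List.prefix_rfl
  | succ n _ ih => exact ih.trans (List.prefix_append _ _)

theorem foundList_getElem? {m n i : ℕ} (h : m ≤ n) (hi : i < (foundList x0 cnt ch m).length) :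
    (foundList x0 cnt ch n)[i]? = (foundList x0 cnt ch m)[i]? := by
  obtain ⟨l, hl⟩ := foundList_prefix x0 cnt ch h
  rw [← hl, List.getElem?_append_left hi]

/-- The queue `L n` lists the vertices found after `n` of them have been expanded. Its length yields
`start`, and it never runs empty because no finite set is closed under children. -/
theorem exists_offspring (hinf : ∀ s : Set X, s.Finite → x0 ∈ s →
    (∀ x ∈ s, ∀ k < cnt x, ch x k ∈ s) → False) :
    ∃ (C : Offspring) (w : ℕ → X), w 0 = x0 ∧ (∀ i, C.num i = cnt (w i)) ∧
      ∀ i, ∀ k < C.num i, w (C.start i + k) = ch (w i) k := by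
  set L := foundList x0 cnt ch with hLdef
  have hsucc : ∀ n, L (n + 1) = L n ++ ((L n)[n]?.elim [] (childList cnt ch)) := fun _ => rfl
  have hlen : ∀ n, n < (L n).length := by
    intro n
    induction n using Nat.strong_induction_on with
    | _ n ih =>
      by_contra hcon
      push Not at hcon
      -- If the queue had at most `n` entries after `n` steps, all of them would be expanded, and
      -- the finite list would contain all their children.
      refine hinf {x | x ∈ L n} (List.finite_toSet _)
        ((foundList_prefix x0 cnt ch (Nat.zero_le n)).subset (List.mem_singleton_self x0)) ?_
      intro x hx k hk
      obtain ⟨j, hj, rfl⟩ := List.getElem_of_mem hx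
      have hjn : j < n := hj.trans_le hcon
      have h1 : (L j)[j]? = some (L n)[j] := by
        rw [← foundList_getElem? x0 cnt ch hjn.le (ih j hjn)]
        exact List.getElem?_eq_getElem hj
      refine (foundList_prefix x0 cnt ch hjn).subset ?_
      change _ ∈ L (j + 1)
      rw [hsucc, h1]
      exact List.mem_append_right _ (List.mem_map.2 ⟨k, List.mem_range.2 hk, rfl⟩)
  let w : ℕ → X := fun n => (L n)[n]'(hlen n)
  have hw : ∀ n, (L n)[n]? = some (w n) := fun n => List.getElem?_eq_getElem _
  have hsucc' : ∀ n, L (n + 1) = L n ++ childList cnt ch (w n) := fun n => by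
    rw [hsucc, hw]; rfl
  have hstart : ∀ n, (L n).length = 1 + ∑ j ∈ Finset.range n, cnt (w j) := by
    intro n
    induction n with
    | zero => rfl
    | succ n ih =>
      rw [hsucc', List.length_append, ih, Finset.sum_range_succ, childList, List.length_map,
        List.length_range, add_assoc]
  let C : Offspring := ⟨fun i => cnt (w i), fun i => by rw [← hstart]; exact hlen i⟩
  refine ⟨C, w, rfl, fun _ => rfl, fun i k hk => ?_⟩
  have hCs : C.start i = (L i).length := (hstart i).symm
  have h1 : i + 1 ≤ C.start i + k := by have := C.lt_start i; omega
  have hk' : k < (childList cnt ch (w i)).length := by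
    rw [childList, List.length_map, List.length_range]; exact hk
  have h2 : C.start i + k < (L (i + 1)).length := by
    rw [hsucc', List.length_append, hCs]; omega
  have h3 := hw (C.start i + k)
  rw [hLdef, foundList_getElem? x0 cnt ch h1 h2] at h3
  change (L (i + 1))[C.start i + k]? = _ at h3
  rw [hsucc', hCs, List.getElem?_append_right (by omega), Nat.add_sub_cancel_left,
    List.getElem?_eq_getElem hk'] at h3
  rw [hCs, ← Option.some_injective _ h3]
  simp [childList]

end Enumeration

/-- Codes for the descendants of a vertex. From height `t` on, every vertex is given a single,
fictitious child. -/
theorem exists_layerCode {D : Type*} (x0 : D) (cnt : D → ℕ) (ch : D → ℕ → D) (H : D → ℕ)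
    (I : D → Prop) (t h : ℕ∞) (h1 : 1 ≤ h) (hI0 : I x0) (hH0 : H x0 = 0)
    (hch : ∀ d, I d → (H d : ℕ∞) < t → ∀ k < cnt d, I (ch d k) ∧ H (ch d k) = H d + 1)
    (htail : ∀ d, I d → (H d : ℕ∞) < t → h ≤ ((H d + 1 : ℕ) : ℕ∞) → cnt d = 1)
    (hinf : ∀ s : Set D, s.Finite → x0 ∈ s → (∀ d ∈ s, I d ∧ (H d : ℕ∞) < t) →
      (∀ d ∈ s, ∀ k < cnt d, ch d k ∈ s) → False) :
    ∃ (P : LayerCode) (v : ℕ → D), P.h = h ∧ v 0 = x0 ∧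
      ∀ i, ((P.level i : ℕ) : ℕ∞) ≤ t → I (v i) ∧ H (v i) = P.level i ∧
        (((P.level i : ℕ) : ℕ∞) < t → P.num i = cnt (v i) ∧
          ∀ k < P.num i, v (P.start i + k) = ch (v i) k) := by
  classical
  -- The second component counts fictitious generations: `(d, m)` with `m > 0` is the `m`-th
  -- fictitious descendant of `d`, a vertex of height at least `t`.
  let real : D × ℕ → Prop := fun x => x.2 = 0 ∧ (H x.1 : ℕ∞) < t
  let cnt' : D × ℕ → ℕ := fun x => if real x then cnt x.1 else 1
  let ch' : D × ℕ → ℕ → D × ℕ := fun x k => if real x then (ch x.1 k, 0) else (x.1, x.2 + 1)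
  let Inv : D × ℕ → Prop := fun x => I x.1 ∧ (x.2 = 0 ∨ t ≤ (H x.1 : ℕ∞))
  have hInv : ∀ x, Inv x → ∀ k < cnt' x, Inv (ch' x k) ∧
      H (ch' x k).1 + (ch' x k).2 = H x.1 + x.2 + 1 := by
    rintro ⟨d, m⟩ ⟨hd, hm⟩ k hk
    by_cases hr : real (d, m)
    · have hr' : m = 0 ∧ (H d : ℕ∞) < t := hr
      simp only [cnt', if_pos hr] at hk
      simp only [ch', if_pos hr, Inv]
      obtain ⟨h2, h3⟩ := hch d hd hr'.2 k hk
      exact ⟨⟨h2, Or.inl trivial⟩, by omega⟩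
    · simp only [ch', if_neg hr, Inv]
      refine ⟨⟨hd, Or.inr ?_⟩, by omega⟩
      rcases hm with hm | hm
      · by_contra hcon
        exact hr ⟨hm, not_le.1 hcon⟩
      · exact hm
  obtain ⟨C, w, hw0, hnum, hchild⟩ := exists_offspring (x0, 0) cnt' ch' (by
    intro s hs h0 hclosed
    let s' : Set (D × ℕ) := {x ∈ s | Inv x}
    have hs' : s'.Finite := hs.subset (Set.sep_subset _ _)
    have hclosed' : ∀ x ∈ s', ∀ k < cnt' x, ch' x k ∈ s' := fun x hx k hk =>
      ⟨hclosed x hx.1 k hk, (hInv x hx.2 k hk).1⟩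
    have hreal : ∀ d, (d, 0) ∈ s' → (H d : ℕ∞) < t := by
      intro d hd
      by_contra hcon
      -- A closed set that contains a vertex of height at least `t` contains its infinite line of
      -- fictitious descendants, so it is not finite.
      have hmem : ∀ m, (d, m) ∈ s' := by
        intro m
        induction m with
        | zero => exact hd
        | succ m ih =>
          have hr : ¬ real (d, m) := fun h => hcon h.2
          have := hclosed' (d, m) ih 0 (by simp only [cnt', if_neg hr]; exact one_pos)
          simpa only [ch', if_neg hr] using this
      refine Set.infinite_of_injective_forall_mem (f := fun m : ℕ => (d, m)) ?_ hmem hs'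
      intro a b hab
      exact (Prod.mk.inj hab).2
    refine hinf ((fun d => (d, 0)) ⁻¹' s') (hs'.preimage fun a _ b _ hab => (Prod.mk.inj hab).1)
      ⟨h0, hI0, Or.inl rfl⟩ (fun d hd => ⟨hd.2.1, hreal d hd⟩) fun d hd k hk => ?_
    have hr : real (d, 0) := ⟨rfl, hreal d hd⟩
    have := hclosed' (d, 0) hd k (by simpa only [cnt', if_pos hr] using hk)
    simp only [ch', if_pos hr] at this
    exact this)
  have hall : ∀ i, Inv (w i) ∧ H (w i).1 + (w i).2 = C.level i := by
    intro i
    induction i using Nat.strong_induction_on with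
    | _ i ih =>
      rcases Nat.eq_zero_or_pos i with rfl | hi
      · rw [hw0, C.level_zero]
        exact ⟨⟨hI0, Or.inl rfl⟩, hH0⟩
      · obtain ⟨h2, h3⟩ := ih _ (C.parent_lt hi)
        have h4 := C.parent_spec hi
        rw [Offspring.start_succ] at h4
        have hk : i - C.start (C.parent i) < C.num (C.parent i) := by omega
        have h5 := hchild _ _ hk
        rw [Nat.add_sub_cancel' h4.1] at h5
        rw [hnum] at hk
        obtain ⟨h6, h7⟩ := hInv _ h2 _ hk
        rw [h5, C.level_parent hi, ← h3]
        exact ⟨h6, h7⟩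
  let P : LayerCode := ⟨C, h, h1, fun i hi => by
    obtain ⟨h2, h3⟩ := hall i
    rw [hnum]
    by_cases hr : real (w i)
    · simp only [cnt', if_pos hr]
      refine htail _ h2.1 hr.2 ?_
      rw [hr.1] at h3
      rwa [← h3] at hi
    · simp only [cnt', if_neg hr]⟩
  refine ⟨P, fun i => (w i).1, rfl, congrArg Prod.fst hw0, fun i hi => ?_⟩
  change ((C.level i : ℕ) : ℕ∞) ≤ t at hi
  obtain ⟨h2, h3⟩ := hall i
  have hm : (w i).2 = 0 := by
    by_contra hne
    rcases h2.2 with h4 | h4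
    · exact hne h4
    · have : ((C.level i : ℕ) : ℕ∞) ≤ (H (w i).1 : ℕ∞) := hi.trans h4
      have : C.level i ≤ H (w i).1 := by exact_mod_cast this
      omega
  rw [hm, add_zero] at h3
  refine ⟨h2.1, h3, fun hlt => ?_⟩
  have hr : real (w i) := ⟨hm, by rw [h3]; exact hlt⟩
  refine ⟨(hnum i).trans (by simp only [cnt', if_pos hr]), fun k hk => ?_⟩
  have := congrArg Prod.fst (hchild i k hk)
  simpa only [ch', if_pos hr] using this

/-- Vertices are determined by their labels if children are. -/
theorem Offspring.eq_of_label_eq {D : Type*} {C : Offspring} {v : ℕ → D} {t : ℕ∞}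
    (hlev : ∀ i j, ((C.level i : ℕ) : ℕ∞) ≤ t → ((C.level j : ℕ) : ℕ∞) ≤ t → v i = v j →
      C.level i = C.level j)
    (hstep : ∀ p q k l, ((C.level p : ℕ) : ℕ∞) < t → ((C.level q : ℕ) : ℕ∞) < t → k < C.num p →
      l < C.num q → v (C.start p + k) = v (C.start q + l) → v p = v q ∧ k = l) :
    ∀ i j, ((C.level i : ℕ) : ℕ∞) ≤ t → ((C.level j : ℕ) : ℕ∞) ≤ t → v i = v j → i = j := by
  intro i
  induction i using Nat.strong_induction_on with
  | _ i ih =>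
    intro j hi hj hij
    have hl := hlev i j hi hj hij
    rcases Nat.eq_zero_or_pos i with rfl | hi0
    · rw [C.level_zero] at hl
      exact (C.level_eq_zero_iff.1 hl.symm).symm
    · have hj0 : 1 ≤ j := by
        by_contra h0
        obtain rfl : j = 0 := by omega
        rw [C.level_zero, C.level_eq_zero_iff] at hl
        omega
      have hpi := C.level_parent hi0
      have hpj := C.level_parent hj0
      have h2 := C.parent_spec hi0
      have h3 := C.parent_spec hj0
      rw [Offspring.start_succ] at h2 h3
      have hlt : ∀ {a b : ℕ}, a = b + 1 → (a : ℕ∞) ≤ t → (b : ℕ∞) < t := fun {a b} hab ha =>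
        lt_of_lt_of_le (by exact_mod_cast (by omega : b < a)) ha
      obtain ⟨h4, h5⟩ := hstep (C.parent i) (C.parent j) (i - C.start (C.parent i))
        (j - C.start (C.parent j)) (hlt hpi hi) (hlt hpj hj) (by omega) (by omega) (by
          rw [Nat.add_sub_cancel' h2.1, Nat.add_sub_cancel' h3.1]; exact hij)
      have h6 := ih _ (C.parent_lt hi0) _ (hlt hpi hi).le (hlt hpj hj).le h4
      rw [h6] at h2 h5
      omega

/-- In a tree, a neighbour of `v` that is not farther from `r` is the one before `v` on the path
from `r` to `v`. -/
theorem SimpleGraph.IsTree.exists_predecessor {V : Type*} {G : SimpleGraph V} (hG : G.IsTree)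
    (r v : V) : ∃ w, ∀ u, G.Adj u v → G.dist r u ≤ G.dist r v →
      G.dist r v = G.dist r u + 1 ∧ u = w := by
  classical
  obtain ⟨q, hq, hq'⟩ := (hG.connected r v).exists_path_of_dist
  refine ⟨q.penultimate, fun u hadj hle => ?_⟩
  obtain ⟨p, hp, hp'⟩ := (hG.connected r u).exists_path_of_dist
  have hnot : v ∉ p.support := by
    intro hv
    have h1 := SimpleGraph.dist_le (p.takeUntil v hv)
    have h2 := p.length_takeUntil_lt_length hv hadj.ne'
    omega
  have hpath : (p.concat hadj).IsPath := hp.concat hnot hadj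
  -- Paths in a tree are unique, so `u` is the last vertex but one on the path to `v`.
  have heq : p.concat hadj = q := (hG.existsUnique_path r v).unique hpath hq
  constructor
  · rw [← hq', ← heq, SimpleGraph.Walk.length_concat, hp']
  · rw [← heq, SimpleGraph.Walk.penultimate_concat]

/-! ### Every planar rooted tree has a code -/

namespace RootedMap

variable {G : RootedMap}

namespace IsRootedTree

theorem ht_flip_ne (hG : G.IsRootedTree) (d : G.Dart) : G.ht (G.flip d) ≠ G.ht d := by
  intro heq
  obtain ⟨w, hw⟩ := hG.tree.exists_predecessor (G.vert G.root) (G.vert (G.flip d))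
  have h1 := (hw (G.vert d) ⟨(hG.no_loop d).symm, d, rfl, rfl⟩ heq.ge).1
  change G.ht (G.flip d) = G.ht d + 1 at h1
  omega

theorem forward_or_backward (hG : G.IsRootedTree) (d : G.Dart) : G.IsForward d ∨ G.IsBackward d := by
  have h1 := ht_flip_le hG.tree.connected d
  have h2 := ht_le_flip hG.tree.connected d
  have h3 := hG.ht_flip_ne d
  unfold IsForward IsBackward
  omega

theorem backward_unique (hG : G.IsRootedTree) {d e : G.Dart} (h : G.vert d = G.vert e)
    (hd : G.IsBackward d) (he : G.IsBackward e) : d = e := by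
  obtain ⟨w, hw⟩ := hG.tree.exists_predecessor (G.vert G.root) (G.vert d)
  have h1 := (hw (G.vert (G.flip d)) ⟨hG.no_loop d, G.flip d, rfl, by rw [G.flip_flip]⟩
    (by have : G.ht (G.flip d) + 1 = G.ht d := hd
        change G.ht (G.flip d) ≤ G.ht d; omega)).2
  have h2 := (hw (G.vert (G.flip e)) ⟨by rw [h]; exact hG.no_loop e, G.flip e, rfl,
    by rw [G.flip_flip, h]⟩
    (by have : G.ht (G.flip e) + 1 = G.ht e := he
        change G.ht (G.flip e) ≤ G.ht d; rw [ht_congr h]; omega)).2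
  exact hG.no_multi d e h (h1.trans h2.symm)

theorem eq_root (hG : G.IsRootedTree) {d : G.Dart} (h : G.vert d = G.vert G.root) : d = G.root := by
  have h1 := hG.root_degree
  unfold degree at h1
  obtain ⟨x, hx⟩ := Nat.card_eq_one_iff_exists.1 h1
  have h2 := hx ⟨d, h⟩
  have h3 := hx ⟨G.root, rfl⟩
  exact congrArg Subtype.val (h2.trans h3.symm)

theorem isForward_root (hG : G.IsRootedTree) : G.IsForward G.root := by
  rcases hG.forward_or_backward G.root with h | h
  · exact h
  · unfold IsBackward at h
    rw [ht_root] at h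
    omega

/-- The number of darts at the endpoint of `d`. -/
noncomputable def endDegree (G : RootedMap) (d : G.Dart) : ℕ := by
  classical exact Nat.find (G.finite_orbits (G.flip d))

theorem endDegree_spec (d : G.Dart) : 0 < endDegree G d ∧
    (G.rot ^ (endDegree G d)) (G.flip d) = G.flip d := by
  classical
  unfold endDegree
  exact Nat.find_spec (G.finite_orbits (G.flip d))

theorem endDegree_min {d : G.Dart} {m : ℕ} (hm : m < endDegree G d) (h0 : 0 < m) :
    (G.rot ^ m) (G.flip d) ≠ G.flip d := by
  classical
  intro h
  exact Nat.find_min (G.finite_orbits (G.flip d)) hm ⟨h0, h⟩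

noncomputable def numChildren (G : RootedMap) (d : G.Dart) : ℕ := endDegree G d - 1

/-- The edges to the children of the endpoint of `d`. -/
def child (G : RootedMap) (d : G.Dart) (k : ℕ) : G.Dart := (G.rot ^ (k + 1)) (G.flip d)

theorem vert_child (d : G.Dart) (k : ℕ) : G.vert (child G d k) = G.vert (G.flip d) :=
  vert_rot_pow _ _

theorem isForward_child (hG : G.IsRootedTree) {d : G.Dart} (hd : G.IsForward d) {k : ℕ}
    (hk : k < numChildren G d) : G.IsForward (child G d k) ∧ G.ht (child G d k) = G.ht d + 1 := by
  unfold numChildren at hk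
  refine ⟨?_, by rw [ht_congr (vert_child d k), hd]⟩
  rcases hG.forward_or_backward (child G d k) with h | h
  · exact h
  · exact absurd (hG.backward_unique (vert_child d k) h hd.flip)
      (endDegree_min (by omega) k.succ_pos)

theorem child_last (d : G.Dart) : (G.rot ^ (numChildren G d + 1)) (G.flip d) = G.flip d := by
  have := endDegree_spec d
  unfold numChildren
  rw [Nat.sub_add_cancel this.1]
  exact this.2

/-- Among the darts at the origin of `d`, the one towards the root is unique, and `d` is reached
from it by rotation; the number of rotations gives the index of the child. -/
theorem exists_child (hG : G.IsRootedTree) {d : G.Dart} (hd : G.IsForward d) (h0 : 0 < G.ht d) :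
    ∃ e k, G.IsForward e ∧ G.ht e < G.ht d ∧ k < numChildren G e ∧ d = child G e k := by
  obtain ⟨b, hb, hb'⟩ := exists_descend hG.tree.connected (d := d) (n := G.ht d - 1) (by omega)
  have hbb : G.IsBackward b := by
    unfold IsBackward
    rw [hb', ht_congr hb]; omega
  obtain ⟨m, hm⟩ := G.finite_orbits.exists_pow_eq (vert_eq_iff.1 hb)
  obtain ⟨h1, h2⟩ := endDegree_spec (G.flip b)
  have hmod : d = (G.rot ^ (m % endDegree G (G.flip b))) b := by
    rw [← hm]
    conv_lhs => rw [← Nat.mod_add_div m (endDegree G (G.flip b)), pow_add, Equiv.Perm.mul_apply, pow_mul]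
    congr 1
    rw [G.flip_flip] at h2
    exact Function.IsFixedPt.perm_pow (e := G.rot ^ _) h2 _
  have hne : m % endDegree G (G.flip b) ≠ 0 := by
    intro h3
    rw [h3] at hmod
    rw [hmod] at hd
    exact hd.not_isBackward hbb
  have hlt := Nat.mod_lt m h1
  refine ⟨G.flip b, m % endDegree G (G.flip b) - 1, hbb.flip, by rw [hb']; omega, ?_, ?_⟩
  · unfold numChildren; omega
  · unfold child
    rw [Nat.sub_add_cancel (by omega), G.flip_flip]
    exact hmod

theorem child_injective (hG : G.IsRootedTree) {d e : G.Dart} (hd : G.IsForward d)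
    (he : G.IsForward e) {k l : ℕ} (hk : k < numChildren G d) (hl : l < numChildren G e)
    (h : child G d k = child G e l) : d = e ∧ k = l := by
  have h1 : d = e := by
    apply flip_injective
    refine hG.backward_unique ?_ hd.flip he.flip
    rw [← vert_child d k, h, vert_child]
  subst h1
  refine ⟨rfl, ?_⟩
  unfold numChildren at hk hl
  have key : ∀ {k l : ℕ}, l < endDegree G d - 1 → k < l → child G d k ≠ child G d l := by
    intro k l hl hkl hcon
    unfold child at hcon
    have h3 : (G.rot ^ (l + 1)) (G.flip d) = (G.rot ^ (k + 1)) ((G.rot ^ (l - k)) (G.flip d)) := by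
      rw [← Equiv.Perm.mul_apply, ← pow_add]
      congr 2
      omega
    exact endDegree_min (m := l - k) (by omega) (by omega)
      ((G.rot ^ (k + 1)).injective (h3.symm.trans hcon.symm))
  rcases lt_trichotomy k l with h2 | h2 | h2
  · exact absurd h (key hl h2)
  · exact h2
  · exact absurd h.symm (key hk h2)

-- A vertex other than `r` is represented by the forward dart that ends there, whose origin height
-- is the level. Thus `h` is the maximal height in the tree, `t` is `h - 1`, and both are infinite
-- for infinite trees. From level `t` on, children are fictitious.
open LDart LayerCode Offspring in
theorem exists_iso_of_height (hG : G.IsRootedTree) (t h : ℕ∞) (h1 : 1 ≤ h)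
    (hth : ∀ n : ℕ, (n : ℕ∞) < t ↔ ((n + 1 : ℕ) : ℕ∞) < h) (hle : ∀ n : ℕ, (n : ℕ∞) < h → (n : ℕ∞) ≤ t)
    (htop : ∀ d, G.IsForward d → ¬ (G.ht d : ℕ∞) < t → G.rot (G.flip d) = G.flip d)
    (hbig : (∀ d, G.IsForward d → (G.ht d : ℕ∞) < t) → Infinite G.Dart) :
    ∃ P : LayerCode, Nonempty (Iso P.tree G) := by
  obtain ⟨P, v, hPh, hv0, hv⟩ := exists_layerCode G.root (numChildren G) (child G) G.ht G.IsForward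
    t h h1 hG.isForward_root ht_root (fun d hd _ k hk => hG.isForward_child hd hk)
    (fun d _ hd hd' => absurd ((hth _).1 hd) (not_lt.2 hd')) (by
      intro s hs h0 hst hclosed
      have hall : ∀ n d, G.ht d = n → G.IsForward d → d ∈ s := by
        intro n
        induction n using Nat.strong_induction_on with
        | _ n ih =>
          intro d hd hd'
          rcases Nat.eq_zero_or_pos (G.ht d) with h2 | h2
          · rw [hG.eq_root (vert_eq_of_ht_eq_zero hG.tree.connected h2)]
            exact h0
          · obtain ⟨e, k, he, he', hk, rfl⟩ := hG.exists_child hd' h2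
            exact hclosed e (ih _ (by omega) e rfl he) k hk
      have hinf := hbig fun d hd => (hst d (hall _ d rfl hd)).2
      have hfin : (Set.univ : Set G.Dart).Finite := by
        refine (hs.union (hs.image G.flip)).subset fun d _ => ?_
        rcases hG.forward_or_backward d with h2 | h2
        · exact Or.inl (hall _ d rfl h2)
        · exact Or.inr ⟨G.flip d, hall _ _ rfl h2.flip, G.flip_flip d⟩
      exact Set.infinite_univ hfin)
  have hlt : ∀ {i}, ((P.level i : ℕ) : ℕ∞) < P.h → ((P.level i : ℕ) : ℕ∞) ≤ t := fun hi =>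
    hle _ (by rw [← hPh]; exact hi)
  have hinj := eq_of_label_eq (C := P.toOffspring) (v := v) (t := t)
    (fun i j hi hj hij => by rw [← (hv i hi).2.1, hij, (hv j hj).2.1])
    (fun p q k l hp hq hk hl hkl => by
      obtain ⟨hpI, -, hp'⟩ := hv p hp.le
      obtain ⟨hqI, -, hq'⟩ := hv q hq.le
      rw [(hp' hp).2 k hk, (hq' hq).2 l hl] at hkl
      rw [(hp' hp).1] at hk
      rw [(hq' hq).1] at hl
      exact hG.child_injective hpI hqI hk hl hkl)
  let φ : LDart → G.Dart := fun d => match d with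
    | F (.inl i) => v i
    | B (.inl i) => G.flip (v i)
    | _ => G.root
  refine ⟨P, nonempty_iso_of_hom hG.tree.connected (fun x : P.tree.Dart => φ x.1) ?_ ?_ ?_ hv0⟩
  · intro x y hxy
    obtain ⟨i, hi, hx⟩ := tree_cases x
    obtain ⟨j, hj, hy⟩ := tree_cases y
    have hFi := (hv i (hlt hi)).1
    have hFj := (hv j (hlt hj)).1
    refine Subtype.ext ?_
    change φ x.1 = φ y.1 at hxy
    rcases hx with hx | hx <;> rcases hy with hy | hy <;> rw [hx, hy] at hxy <;> rw [hx, hy]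
    · rw [hinj i j (hlt hi) (hlt hj) hxy]
    · replace hxy : v i = G.flip (v j) := hxy
      rw [hxy] at hFi
      exact absurd hFj.flip hFi.not_isBackward
    · replace hxy : G.flip (v i) = v j := hxy
      rw [← hxy] at hFj
      exact absurd hFi.flip hFj.not_isBackward
    · rw [hinj i j (hlt hi) (hlt hj) (flip_injective hxy)]
  · intro x
    obtain ⟨i, hi, hx⟩ := tree_cases x
    have key : ∀ {b : LDart}, IsFirstReturn P.rot P.treeDarts x.1 b → φ b = G.rot (φ x.1) →
        φ (P.tree.rot x).1 = G.rot (φ x.1) := fun hb hb' => by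
      rw [tree_rot_eq hb, hb']
    have hti := hlt hi
    rcases hx with hx | hx <;> rw [hx] at key <;> rw [hx]
    · rcases Nat.eq_zero_or_pos i with rfl | hi0
      · refine key isFirstReturn_tree_root ?_
        change v 0 = G.rot (v 0)
        rw [hv0, hG.eq_root (vert_rot G.root)]
      · have h2 := P.parent_spec hi0
        have h3 := P.start_succ (P.parent i)
        have hl := P.level_parent hi0
        have hp : ((P.level (P.parent i) : ℕ) : ℕ∞) < t := lt_of_lt_of_le
          (by exact_mod_cast (by omega : P.level (P.parent i) < P.level i)) hti
        obtain ⟨hpI, -, hp'⟩ := hv (P.parent i) hp.le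
        obtain ⟨hnum, hch⟩ := hp' hp
        obtain ⟨k, hk⟩ := Nat.exists_eq_add_of_le h2.1
        have hvi : v i = child G (v (P.parent i)) k := by
          conv_lhs => rw [hk]
          exact hch k (by omega)
        by_cases hlast : i + 1 = P.start (P.parent i + 1)
        · refine key (isFirstReturn_tree_last hi0 hi hlast) ?_
          change G.flip (v (P.parent i)) = G.rot (v i)
          rw [hvi, ← child_last (v (P.parent i)), ← hnum, child, ← Equiv.Perm.mul_apply, ← pow_succ']
          congr 3
          omega
        · refine key (isFirstReturn_tree_sibling hi0 hi hlast) ?_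
          change v (i + 1) = G.rot (v i)
          have h4 := hch (k + 1) (by omega)
          rw [← add_assoc, ← hk] at h4
          rw [hvi, h4, child, child, ← Equiv.Perm.mul_apply, ← pow_succ']
    · obtain ⟨hiI, hiH, hi'⟩ := hv i hti
      by_cases hlt' : ((P.level i : ℕ) : ℕ∞) < t
      · obtain ⟨hnum, hch⟩ := hi' hlt'
        rcases Nat.eq_zero_or_pos (P.num i) with h0 | h0
        · refine key (isFirstReturn_tree_leaf hi (Or.inl h0)) ?_
          change G.flip (v i) = G.rot (G.flip (v i))
          have := child_last (v i)
          rw [← hnum, h0] at this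
          exact this.symm
        · refine key (isFirstReturn_tree_child h0 (by rw [hPh]; exact (hth _).1 hlt')) ?_
          exact hch 0 h0
      · refine key (isFirstReturn_tree_leaf hi (Or.inr ?_)) ?_
        · rw [hPh]; exact fun h => hlt' ((hth _).2 h)
        · exact (htop _ hiI (by rw [hiH]; exact hlt')).symm
  · intro x
    obtain ⟨i, -, hx | hx⟩ := tree_cases x
    · change φ (x.1.flip) = G.flip (φ x.1)
      rw [hx]; rfl
    · change φ (x.1.flip) = G.flip (φ x.1)
      rw [hx]
      exact (G.flip_flip _).symm

open LayerCode in
theorem exists_iso_tree (hG : G.IsRootedTree) : ∃ P : LayerCode, Nonempty (Iso P.tree G) := by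
  rcases finite_or_infinite G.Dart with hfin | hinf
  · have : Nonempty G.Dart := ⟨G.root⟩
    obtain ⟨m, hm⟩ := Finite.exists_max G.ht
    have hmax : ∀ d, G.ht d ≤ G.ht m := hm
    have h1 : 1 ≤ G.ht m := by
      have h2 : G.ht (G.flip G.root) = G.ht G.root + 1 := hG.isForward_root
      have := hmax (G.flip G.root)
      omega
    refine hG.exists_iso_of_height ((G.ht m - 1 : ℕ) : ℕ∞) (G.ht m) (by exact_mod_cast h1)
      (fun n => by norm_cast; omega) (fun n => by norm_cast; omega) ?_ ?_
    · intro d hd hd'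
      norm_cast at hd'
      have h0 : numChildren G d = 0 := by
        by_contra hne
        obtain ⟨h3, h4⟩ := hG.isForward_child hd (Nat.pos_of_ne_zero hne)
        have := hmax (G.flip (child G d 0))
        unfold IsForward at h3
        omega
      have := child_last d
      rw [h0] at this
      exact this
    · intro hall
      have hb : G.IsBackward m := by
        rcases hG.forward_or_backward m with h2 | h2
        · have := hmax (G.flip m)
          unfold IsForward at h2
          omega
        · exact h2
      have := hall _ hb.flip
      norm_cast at this
      unfold IsBackward at hb
      omega
  · exact hG.exists_iso_of_height ⊤ ⊤ le_top (fun n => by simp) (fun n _ => le_top)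
      (fun d _ h => absurd (ENat.natCast_lt_top _) h) fun _ => hinf

end IsRootedTree

end RootedMap

/-! ### Inner darts: the tree edges inside a causal triangulation -/

namespace RootedMap

variable {G : RootedMap} {h : ℕ∞} {E : G.Dart → Prop}

/-- `d` is a forward dart which is not the rightmost one at its origin. -/
def IsInner (G : RootedMap) (d : G.Dart) : Prop := G.IsForward d ∧ G.IsForward (G.rot.symm d)

/-- The first inner dart at the endpoint of `d`. -/
noncomputable def firstInner (G : RootedMap) (d : G.Dart) : G.Dart :=
  -- Away from the root vertex, `rot (flip d)` is the right horizontal dart and is followed by the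
  -- rightmost forward dart, which does not count. The root vertex is represented by the flipped
  -- root, and there the count starts at the root dart.
  if G.ht (G.flip d) = 0 then G.flip d else G.rot (G.rot (G.rot (G.flip d)))

/-- The inner darts at the endpoint of `d`. -/
noncomputable def innerChild (G : RootedMap) (d : G.Dart) (k : ℕ) : G.Dart :=
  (G.rot ^ k) (G.firstInner d)

/-- The number of inner darts at the endpoint of `d`. -/
noncomputable def innerCount (G : RootedMap) (d : G.Dart) : ℕ :=
  -- All darts at the root vertex are inner, so their number is a return time, necessarily positive.
  -- Elsewhere `firstInner` may already be the left horizontal dart, and then the count is `0`.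
  sInf {n | if G.ht (G.flip d) = 0 then 0 < n ∧ (G.rot ^ n) (G.firstInner d) = G.firstInner d
    else ¬ G.IsForward ((G.rot ^ n) (G.firstInner d))}

theorem rot_innerChild (d : G.Dart) (k : ℕ) : G.rot (G.innerChild d k) = G.innerChild d (k + 1) := by
  unfold innerChild
  rw [pow_succ', Equiv.Perm.mul_apply]

theorem vert_innerChild (d : G.Dart) (k : ℕ) : G.vert (G.innerChild d k) = G.vert (G.flip d) := by
  unfold innerChild firstInner
  rw [vert_rot_pow]
  split_ifs
  · rfl
  · simp only [vert_rot]

theorem innerCount_spec_of_eq_zero {d : G.Dart} (hd : G.ht (G.flip d) = 0) :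
    0 < G.innerCount d ∧ G.innerChild d (G.innerCount d) = G.firstInner d ∧
      ∀ n < G.innerCount d, 0 < n → G.innerChild d n ≠ G.firstInner d := by
  unfold innerCount innerChild
  simp only [hd, if_true]
  obtain ⟨n, hn⟩ := G.finite_orbits (G.firstInner d)
  have h1 := Nat.sInf_mem (s := {n | 0 < n ∧ (G.rot ^ n) (G.firstInner d) = G.firstInner d}) ⟨n, hn⟩
  exact ⟨h1.1, h1.2, fun m hm h0 hcon => Nat.notMem_of_lt_sInf hm ⟨h0, hcon⟩⟩

namespace IsCausal

theorem isForward_of_ht_eq_zero (hG : G.IsCausal h E) {d : G.Dart} (hd : G.ht d = 0) :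
    G.IsForward d := by
  have h1 := hG.no_root_loop d hd
  have h2 := ht_flip_le hG.connected d
  unfold IsForward
  omega

/-- The forward darts at a vertex different from the root vertex follow a horizontal one. -/
theorem exists_right (hG : G.IsCausal h E) {d : G.Dart} (hd : G.IsForward d) (h0 : 0 < G.ht d) :
    ∃ r j, G.IsHorizontal r ∧ 1 ≤ j ∧ (G.rot ^ j) r = d ∧
      ∀ i, 1 ≤ i → i ≤ j → G.IsForward ((G.rot ^ i) r) := by
  classical
  obtain ⟨z, hz, hz'⟩ := hG.exists_bwd h0
  obtain ⟨n, hn⟩ := G.finite_orbits.exists_pow_eq (vert_eq_iff.1 hz)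
  let m := Nat.findGreatest (fun m => ¬ G.IsForward ((G.rot ^ m) z)) n
  have hm : ¬ G.IsForward ((G.rot ^ m) z) :=
    Nat.findGreatest_spec (P := fun m => ¬ G.IsForward ((G.rot ^ m) z)) (Nat.zero_le n)
      fun h => h.not_isBackward hz'
  have hmn : m ≤ n := Nat.findGreatest_le n
  have hne : m ≠ n := by
    intro heq
    rw [heq, hn] at hm
    exact hm hd
  have hrun : ∀ i, 1 ≤ i → i ≤ n - m → G.IsForward ((G.rot ^ i) ((G.rot ^ m) z)) := by
    intro i h1 h2
    rw [← Equiv.Perm.mul_apply, ← pow_add]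
    by_contra hcon
    exact Nat.findGreatest_is_greatest (P := fun m => ¬ G.IsForward ((G.rot ^ m) z))
      (show m < i + m by omega) (by omega) hcon
  refine ⟨(G.rot ^ m) z, n - m, ?_, by omega, ?_, hrun⟩
  · have h1 := hrun 1 le_rfl (by omega)
    rw [pow_one] at h1
    rcases hG.cases_dart ((G.rot ^ m) z) with h2 | h2 | h2
    · exact absurd h2 hm
    · exact absurd ⟨h2, h1⟩ (hG.ht_corner _).1
    · exact h2
  · rw [← Equiv.Perm.mul_apply, ← pow_add, Nat.sub_add_cancel hmn, hn]

/-- The triangle below a horizontal edge. -/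
theorem rot_flip_below (hG : G.IsCausal h E) {d : G.Dart} (hd : G.IsHorizontal (G.rot (G.flip d))) :
    G.rot (G.flip (G.rot (G.flip d))) = G.flip (G.rot.symm d) := by
  have h1 := hG.face_triple _ (hG.not_ext_of_hor hd)
  simp only [face_apply] at h1
  have h2 := flip_injective (G.rot.injective h1)
  rw [← G.flip_flip (G.rot (G.flip (G.rot (G.flip d))))]
  refine congrArg G.flip ?_
  rw [Equiv.eq_symm_apply]
  exact h2

/-- The triangle above a horizontal edge. -/
theorem rot_flip_above (hG : G.IsCausal h E) {r : G.Dart} (hr : G.IsHorizontal r) :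
    G.rot (G.flip (G.rot r)) = G.flip (G.rot.symm (G.flip r)) := by
  have h1 := hG.face_triple _ (hG.not_ext_of_hor hr.flip)
  simp only [face_apply, G.flip_flip] at h1
  rw [← G.flip_flip (G.rot (G.flip (G.rot r)))]
  refine congrArg G.flip ?_
  rw [Equiv.eq_symm_apply]
  exact h1

theorem isHorizontal_of_isInner (hG : G.IsCausal h E) {d : G.Dart} (hd : G.IsInner d)
    (hh : (G.ht (G.flip d) : ℕ∞) < h) :
    G.IsHorizontal (G.rot (G.flip d)) ∧ G.IsForward (G.rot (G.rot (G.flip d))) :=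
  hG.isHorizontal_rot_flip hd.1 hd.2 hh

/-- This is the edge from the parent. The triangle below `r` provides a second forward dart at the
parent, directly to the right of it. -/
theorem isInner_flip_rot_symm (hG : G.IsCausal h E) {r : G.Dart} (hr : G.IsHorizontal r)
    (hr' : G.IsForward (G.rot r)) : G.IsInner (G.flip (G.rot.symm r)) := by
  rcases hG.isHorizontal_cases hr with h1 | h1
  · refine ⟨h1.2.flip, ?_⟩
    have h2 := hG.rot_flip_below (d := G.flip (G.rot.symm r))
      (by rw [G.flip_flip, Equiv.apply_symm_apply]; exact hr)
    rw [G.flip_flip, Equiv.apply_symm_apply] at h2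
    rw [← G.flip_flip (G.rot.symm (G.flip (G.rot.symm r))), ← h2]
    exact (hG.flip_right hr hr').flip
  · exact absurd h1.1 hr'.not_isBackward

theorem firstInner_of_isInner {d : G.Dart} (hd : G.IsInner d) :
    G.firstInner d = G.rot (G.rot (G.rot (G.flip d))) := by
  have h1 : G.ht (G.flip d) = G.ht d + 1 := hd.1
  exact if_neg (by omega)

theorem innerCount_spec {d : G.Dart} (hd : G.IsInner d) :
    ¬ G.IsForward (G.innerChild d (G.innerCount d)) ∧
      ∀ n < G.innerCount d, G.IsForward (G.innerChild d n) := by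
  have h1 : G.ht (G.flip d) = G.ht d + 1 := hd.1
  have h2 : G.ht (G.flip d) ≠ 0 := by omega
  have hne : ∃ n, ¬ G.IsForward (G.innerChild d n) := by
    have h3 : G.vert (G.firstInner d) = G.vert (G.flip d) := vert_innerChild d 0
    obtain ⟨n, hn⟩ := G.finite_orbits.exists_pow_eq (vert_eq_iff.1 h3)
    refine ⟨n, fun h => ?_⟩
    unfold innerChild at h
    rw [hn] at h
    exact h.not_isBackward hd.1.flip
  unfold innerCount
  simp only [h2, if_false]
  exact ⟨Nat.sInf_mem hne, fun n hn => by
    by_contra hcon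
    exact Nat.notMem_of_lt_sInf hn hcon⟩

theorem innerChild_end (hG : G.IsCausal h E) {d : G.Dart} (hd : G.IsInner d)
    (hh : (G.ht (G.flip d) : ℕ∞) < h) :
    G.IsHorizontal (G.innerChild d (G.innerCount d)) ∧
      G.IsBackward (G.rot (G.innerChild d (G.innerCount d))) := by
  obtain ⟨h1, h2⟩ := innerCount_spec hd
  rcases Nat.eq_zero_or_pos (G.innerCount d) with h0 | h0
  · rw [h0] at h1 ⊢
    have h3 : G.innerChild d 0 = G.rot (G.rot (G.rot (G.flip d))) := firstInner_of_isInner hd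
    rw [h3] at h1 ⊢
    exact hG.isHorizontal_of_not_isForward (hG.isHorizontal_of_isInner hd hh).2 h1
  · have h3 := rot_innerChild d (G.innerCount d - 1)
    rw [Nat.sub_add_cancel h0] at h3
    rw [← h3] at h1 ⊢
    exact hG.isHorizontal_of_not_isForward (h2 _ (by omega)) h1

theorem isInner_innerChild (hG : G.IsCausal h E) {d : G.Dart} (hd : G.IsInner d ∨ d = G.flip G.root)
    (hh : (G.ht (G.flip d) : ℕ∞) < h) {k : ℕ} (hk : k < G.innerCount d) :
    G.IsInner (G.innerChild d k) ∧ G.ht (G.flip (G.innerChild d k)) = G.ht (G.flip d) + 1 := by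
  have h1 : G.IsInner (G.innerChild d k) := by
    rcases hd with hd | rfl
    · refine ⟨(innerCount_spec hd).2 k hk, ?_⟩
      cases k with
      | zero =>
        have h3 : G.innerChild d 0 = G.rot (G.rot (G.rot (G.flip d))) := firstInner_of_isInner hd
        rw [h3, Equiv.symm_apply_apply]
        exact (hG.isHorizontal_of_isInner hd hh).2
      | succ k =>
        rw [← rot_innerChild, Equiv.symm_apply_apply]
        exact (innerCount_spec hd).2 k (by omega)
    · have h2 : G.ht (G.innerChild (G.flip G.root) k) = 0 := by
        rw [ht_congr (vert_innerChild _ _), G.flip_flip, ht_root]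
      exact ⟨hG.isForward_of_ht_eq_zero h2,
        hG.isForward_of_ht_eq_zero (by rw [ht_rot_symm]; exact h2)⟩
  refine ⟨h1, ?_⟩
  rw [h1.1, ht_congr (vert_innerChild d k)]

theorem eq_flip_root {d : G.Dart} (hd : G.IsInner d ∨ d = G.flip G.root)
    (h0 : G.ht (G.flip d) = 0) : d = G.flip G.root := by
  rcases hd with hd | hd
  · have h1 : G.ht (G.flip d) = G.ht d + 1 := hd.1
    omega
  · exact hd

theorem isInner_of_ht {d : G.Dart} (hd : G.IsInner d ∨ d = G.flip G.root)
    (h0 : G.ht (G.flip d) ≠ 0) : G.IsInner d := by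
  rcases hd with hd | rfl
  · exact hd
  · rw [G.flip_flip, ht_root] at h0
    exact absurd rfl h0

/-- An inner dart is recovered from its endpoint through the unique right horizontal dart there.
Within one vertex, a repetition would mean that turning around it meets only forward darts, or that
the root vertex is closed up too early. -/
theorem innerChild_injective (hG : G.IsCausal h E) {d e : G.Dart}
    (hd : G.IsInner d ∨ d = G.flip G.root) (he : G.IsInner e ∨ e = G.flip G.root)
    (hdh : (G.ht (G.flip d) : ℕ∞) < h) (heh : (G.ht (G.flip e) : ℕ∞) < h) {k l : ℕ}
    (hk : k < G.innerCount d) (hl : l < G.innerCount e) (hkl : G.innerChild d k = G.innerChild e l) :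
    d = e ∧ k = l := by
  have hvert : G.vert (G.flip d) = G.vert (G.flip e) := by
    rw [← vert_innerChild d k, hkl, vert_innerChild]
  have hht := ht_congr hvert
  have key : ∀ {k l : ℕ}, l < G.innerCount d → k < l → G.innerChild d k ≠ G.innerChild d l := by
    intro k l hl hkl hcon
    have h3 : (G.rot ^ l) (G.firstInner d) = (G.rot ^ k) ((G.rot ^ (l - k)) (G.firstInner d)) := by
      rw [← Equiv.Perm.mul_apply, ← pow_add]
      congr 2
      omega
    have h4 : (G.rot ^ (l - k)) (G.firstInner d) = G.firstInner d :=
      ((G.rot ^ k).injective (h3.symm.trans hcon.symm))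
    by_cases h0 : G.ht (G.flip d) = 0
    · exact (innerCount_spec_of_eq_zero h0).2.2 (l - k) (by omega) (by omega) h4
    · have hd' := isInner_of_ht hd h0
      have hall := (innerCount_spec hd').2
      have h5 := G.finite_orbits.forall_of_return (P := fun x => G.IsForward x) (by omega) h4
        (fun m _ hm => hall m (by omega)) (vert_eq_iff.1 (vert_innerChild d 0))
      have h6 : G.IsForward (G.flip d) := by
        rcases h5 with h5 | h5
        · rw [h5]; exact hall 0 (by omega)
        · exact h5
      exact h6.not_isBackward hd'.1.flip
  have hde : d = e := by
    by_cases h0 : G.ht (G.flip d) = 0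
    · rw [eq_flip_root hd h0, eq_flip_root he (hht.symm.trans h0)]
    · have h1 := hG.isHorizontal_of_isInner (isInner_of_ht hd h0) hdh
      have h2 := hG.isHorizontal_of_isInner (isInner_of_ht he (by rwa [← hht])) heh
      have h3 := hG.right_unique h1.1 h2.1 (by rw [vert_rot, vert_rot, hvert]) h1.2 h2.2
      exact flip_injective (G.rot.injective h3)
  subst hde
  refine ⟨rfl, ?_⟩
  rcases lt_trichotomy k l with h2 | h2 | h2
  · exact absurd hkl (key hl h2)
  · exact h2
  · exact absurd hkl.symm (key hk h2)

/-- Every inner dart is a child of an inner dart or of the flipped root. -/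
theorem exists_innerChild_eq (hG : G.IsCausal h E) {d : G.Dart} (hd : G.IsInner d) :
    ∃ e k, (G.IsInner e ∨ e = G.flip G.root) ∧ G.ht (G.flip e) = G.ht d ∧ k < G.innerCount e ∧
      d = G.innerChild e k := by
  rcases Nat.eq_zero_or_pos (G.ht d) with h0 | h0
  · have hz : G.ht (G.flip (G.flip G.root)) = 0 := by rw [G.flip_flip, ht_root]
    have hf : G.firstInner (G.flip G.root) = G.root := by
      unfold firstInner; rw [if_pos hz, G.flip_flip]
    obtain ⟨h1, h2, -⟩ := innerCount_spec_of_eq_zero hz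
    obtain ⟨m, hm⟩ := G.finite_orbits.exists_pow_eq
      (vert_eq_iff.1 (vert_eq_of_ht_eq_zero hG.connected h0).symm)
    unfold innerChild at h2
    rw [hf] at h2
    refine ⟨G.flip G.root, m % G.innerCount (G.flip G.root), Or.inr rfl, hz.trans h0.symm,
      Nat.mod_lt _ h1, ?_⟩
    unfold innerChild
    rw [hf, ← hm]
    conv_lhs => rw [← Nat.mod_add_div m (G.innerCount (G.flip G.root)), pow_add,
      Equiv.Perm.mul_apply, pow_mul]
    congr 1
    exact Function.IsFixedPt.perm_pow (e := G.rot ^ _) h2 _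
  · obtain ⟨r, j, hr, hj, hrd, hrun⟩ := hG.exists_right hd.1 h0
    have hr1 := hrun 1 le_rfl hj
    rw [pow_one] at hr1
    have hin := hG.isInner_flip_rot_symm hr hr1
    -- The first forward dart after `r` is the rightmost one, which is not inner.
    have hj2 : 2 ≤ j := by
      by_contra hcon
      obtain rfl : j = 1 := by omega
      have := hd.2
      rw [← hrd, pow_one, Equiv.symm_apply_apply] at this
      exact this.not_isHorizontal hr
    have hpow : ∀ i, G.innerChild (G.flip (G.rot.symm r)) i = (G.rot ^ (i + 2)) r := by
      intro i
      unfold innerChild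
      rw [firstInner_of_isInner hin, G.flip_flip, Equiv.apply_symm_apply, pow_add,
        Equiv.Perm.mul_apply]
      rfl
    refine ⟨G.flip (G.rot.symm r), j - 2, Or.inl hin, ?_, ?_, ?_⟩
    · rw [G.flip_flip, ht_rot_symm, ← hrd, ht_rot_pow]
    · by_contra hcon
      have h3 := (innerCount_spec hin).1
      rw [hpow] at h3
      exact h3 (hrun _ (by omega) (by omega))
    · rw [hpow, Nat.sub_add_cancel hj2, hrd]

/-- This keeps the enumeration of inner darts from dying out before height `h`. The top level is
reached by the second forward dart of a vertex next to the boundary. -/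
theorem exists_isInner (hG : G.IsCausal h E) (h1 : 1 ≤ h) {k : ℕ} (hk : 1 ≤ k) (hkh : (k : ℕ∞) ≤ h) :
    ∃ d, G.IsInner d ∧ G.ht (G.flip d) = k := by
  have lower : ∀ m : ℕ, 1 ≤ m → (m : ℕ∞) < h →
      ∃ r, G.IsHorizontal r ∧ G.IsForward (G.rot r) ∧ G.ht r = m := by
    intro m hm hmh
    obtain ⟨y, hy⟩ := hG.exists_ht m hmh.le
    obtain ⟨d, hdy, hd⟩ := hG.exists_isForward (d := y) (by omega) (by rw [hy]; exact hmh)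
    have hdm : G.ht d = m := (ht_congr hdy).trans hy
    obtain ⟨r, j, hr, hj, hrd, hrun⟩ := hG.exists_right hd (by omega)
    exact ⟨r, hr, by simpa using hrun 1 le_rfl hj, by rw [← hdm, ← hrd, ht_rot_pow]⟩
  rcases hkh.lt_or_eq with hlt | heq
  · obtain ⟨r, hr, hr', hrk⟩ := lower k hk hlt
    exact ⟨_, hG.isInner_flip_rot_symm hr hr', by rw [G.flip_flip, ht_rot_symm, hrk]⟩
  · have h2 := hG.two_le h1
    rw [← heq] at h2
    replace h2 : 2 ≤ k := by exact_mod_cast h2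
    obtain ⟨r, hr, hr', hrk⟩ := lower (k - 1) (by omega)
      (by rw [← heq]; exact_mod_cast (by omega : k - 1 < k))
    obtain ⟨-, h3, -⟩ := hG.penultimate hr hr' (by rw [hrk, ← heq]; congr 1; omega)
    refine ⟨G.rot (G.rot r), ⟨h3, by rw [Equiv.symm_apply_apply]; exact hr'⟩, ?_⟩
    rw [h3, ht_rot, ht_rot, hrk]; omega

/-- A vertex next to the boundary has exactly two forward darts, and the rightmost one is not
counted. This is the condition `tail` on codes. -/
theorem innerCount_eq_one (hG : G.IsCausal h E) (h1 : 1 ≤ h) {d : G.Dart}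
    (hd : G.IsInner d ∨ d = G.flip G.root) (hlt : (G.ht (G.flip d) : ℕ∞) < h)
    (hle : h ≤ ((G.ht (G.flip d) + 1 : ℕ) : ℕ∞)) : G.innerCount d = 1 := by
  have h2 := hG.two_le h1
  have h3 : 2 ≤ G.ht (G.flip d) + 1 := by exact_mod_cast h2.trans hle
  have hin := isInner_of_ht hd (by omega)
  obtain ⟨hr, hr'⟩ := hG.isHorizontal_of_isInner hin hlt
  obtain ⟨-, h4, -, h5⟩ := hG.penultimate hr hr' (by
    rw [ht_rot]
    exact le_antisymm (by push_cast; exact Order.add_one_le_of_lt hlt) hle)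
  obtain ⟨h6, h7⟩ := innerCount_spec hin
  have h8 : G.innerChild d 0 = G.rot (G.rot (G.rot (G.flip d))) := firstInner_of_isInner hin
  have h9 : G.innerChild d 1 = G.rot (G.rot (G.rot (G.rot (G.flip d)))) := by
    rw [← h8, rot_innerChild]
  by_contra hne
  rcases Nat.eq_zero_or_pos (G.innerCount d) with h0 | h0
  · rw [h0, h8] at h6
    exact h6 h4
  · have := h7 1 (by omega)
    rw [h9] at this
    exact h5 this

end IsCausal

end RootedMap

/-! ### Every causal triangulation has a code -/

namespace RootedMap

open LDart LayerCode Offspring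

variable {G : RootedMap} {E : G.Dart → Prop} {P : LayerCode} {v : ℕ → G.Dart}

/-- `v i` is the dart of `G` that corresponds to the edge from the parent of `i` to `i`. -/
structure IsLabeling (G : RootedMap) (P : LayerCode) (v : ℕ → G.Dart) : Prop where
  zero : v 0 = G.flip G.root
  inner : ∀ i, ((P.level i : ℕ) : ℕ∞) ≤ P.h → G.IsInner (v i) ∨ v i = G.flip G.root
  ht : ∀ i, ((P.level i : ℕ) : ℕ∞) ≤ P.h → G.ht (G.flip (v i)) = P.level i
  num : ∀ i, ((P.level i : ℕ) : ℕ∞) < P.h → P.num i = G.innerCount (v i)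
  child : ∀ i, ((P.level i : ℕ) : ℕ∞) < P.h → ∀ k < P.num i,
    v (P.start i + k) = G.innerChild (v i) k

theorem IsCausal.exists_isLabeling {h : ℕ∞} (hG : G.IsCausal h E) (h1 : 1 ≤ h) :
    ∃ (P : LayerCode) (v : ℕ → G.Dart), P.h = h ∧ IsLabeling G P v := by
  have hz : G.ht (G.flip (G.flip G.root)) = 0 := by rw [G.flip_flip, ht_root]
  obtain ⟨P, v, hPh, hv0, hv⟩ := exists_layerCode (G.flip G.root) G.innerCount G.innerChild
    (fun d => G.ht (G.flip d)) (fun d => G.IsInner d ∨ d = G.flip G.root) h h h1 (Or.inr rfl) hz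
    (fun d hd hdh k hk => ⟨Or.inl (hG.isInner_innerChild hd hdh hk).1,
      (hG.isInner_innerChild hd hdh hk).2⟩)
    (fun d hd hlt hle => hG.innerCount_eq_one h1 hd hlt hle) (by
      intro s hs h0 hst hclosed
      -- A set closed under children contains all inner darts. Since these reach every height up to
      -- `h`, it cannot be finite and stay strictly below `h`.
      have hall : ∀ n d, G.ht d = n → G.IsInner d → d ∈ s := by
        intro n
        induction n using Nat.strong_induction_on with
        | _ n ih =>
          intro d hd hd'
          obtain ⟨e, k, he, he', hk, rfl⟩ := hG.exists_innerChild_eq hd'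
          refine hclosed e ?_ k hk
          rcases he with he | rfl
          · have : G.ht (G.flip e) = G.ht e + 1 := he.1
            exact ih _ (by omega) e rfl he
          · exact h0
      obtain ⟨m, hm⟩ := (hs.image fun d => G.ht (G.flip d)).bddAbove
      have hlt : ((m + 1 : ℕ) : ℕ∞) ≤ h := by
        by_contra hcon
        push Not at hcon
        obtain ⟨k, rfl⟩ := ENat.ne_top_iff_exists.1 hcon.ne_top
        obtain ⟨d, hd, hd'⟩ := hG.exists_isInner h1 (k := k) (by exact_mod_cast h1) le_rfl
        have := (hst d (hall _ d rfl hd)).2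
        rw [hd'] at this
        exact lt_irrefl _ this
      obtain ⟨d, hd, hd'⟩ := hG.exists_isInner h1 (k := m + 1) (by omega) hlt
      have := hm ⟨d, hall _ d rfl hd, hd'⟩
      omega)
  refine ⟨P, v, hPh, hv0, ?_, ?_, ?_, ?_⟩ <;> intro i hi <;> rw [hPh] at hi
  · exact (hv i hi).1
  · exact (hv i hi).2.1
  · exact ((hv i hi.le).2.2 hi).1
  · exact ((hv i hi.le).2.2 hi).2

namespace IsLabeling

/-- The dart of `G` that corresponds to the edge `a`. -/
def label (v : ℕ → G.Dart) : ℕ ⊕ ℕ → G.Dart :=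
  Sum.elim v fun i => G.rot (G.rot (G.flip (v i)))

theorem level_ne_zero {i : ℕ} (hi : 1 ≤ i) : P.level i ≠ 0 := by
  have := P.level_pos hi
  omega

theorem isInner (hv : IsLabeling G P v) {i : ℕ} (hi : P.IsEdge (.inl i)) : G.IsInner (v i) :=
  IsCausal.isInner_of_ht (hv.inner i hi.2) (by rw [hv.ht i hi.2]; exact level_ne_zero hi.1)

theorem right (hG : G.IsCausal P.h E) (hv : IsLabeling G P v) {i : ℕ} (hi : P.IsEdge (.inr i)) :
    G.IsHorizontal (G.rot (G.flip (v i))) ∧ G.IsForward (G.rot (G.rot (G.flip (v i)))) :=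
  hG.isHorizontal_of_isInner (hv.isInner (isEdge_inl_of_inr hi))
    (by rw [hv.ht i (P.isEdge_inr.1 hi).2.le]; exact (P.isEdge_inr.1 hi).2)

theorem rot_child (hv : IsLabeling G P v) {i k : ℕ} (hi : ((P.level i : ℕ) : ℕ∞) < P.h)
    (hk : k < P.num i) : G.rot (v (P.start i + k)) = G.innerChild (v i) (k + 1) := by
  rw [hv.child i hi k hk, rot_innerChild]

theorem exists_child_index {i : ℕ} (hi : 1 ≤ i) :
    ∃ k, i = P.start (P.parent i) + k ∧ k < P.num (P.parent i) := by
  obtain ⟨h1, h2⟩ := P.parent_spec hi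
  rw [start_succ] at h2
  exact ⟨i - P.start (P.parent i), by omega, by omega⟩

theorem level_parent_lt {i : ℕ} (hi : P.IsEdge (.inl i)) :
    ((P.level (P.parent i) : ℕ) : ℕ∞) < P.h :=
  lt_of_lt_of_le (by
    have := P.level_parent (j := i) hi.1
    exact_mod_cast (show P.level (P.parent i) < P.level i by omega)) hi.2

theorem one (hv : IsLabeling G P v) : v 1 = G.root := by
  have h0 : ((P.level 0 : ℕ) : ℕ∞) < P.h := by
    rw [P.level_zero]; exact lt_of_lt_of_le (by simp) P.one_le
  have h1 := hv.child 0 h0 0 P.num_zero_pos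
  rw [P.start_zero] at h1
  have h2 : G.ht (G.flip (v 0)) = 0 := by rw [hv.zero, G.flip_flip, ht_root]
  refine h1.trans ?_
  unfold innerChild firstInner
  rw [if_pos h2, hv.zero, G.flip_flip]
  rfl

theorem vert_label (hv : IsLabeling G P v) {a : ℕ ⊕ ℕ} (ha : P.IsEdge a) :
    G.vert (label v a) = G.vert (G.flip (v (P.src a - 1))) := by
  rcases a with i | i
  · have hi : 1 ≤ i := ha.1
    obtain ⟨k, hk, hk'⟩ := exists_child_index (P := P) hi
    rw [P.src_inl hi, Nat.add_sub_cancel]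
    change G.vert (v i) = _
    have h1 := hv.child _ (level_parent_lt ha) k hk'
    rw [← hk] at h1
    rw [h1, vert_innerChild]
  · change G.vert (G.rot (G.rot (G.flip (v i)))) = _
    rw [vert_rot, vert_rot]
    rfl

theorem label_start (hv : IsLabeling G P v) {i : ℕ} (hi : P.IsEdge (.inr i)) :
    G.rot (label v (.inr i)) = G.innerChild (v i) 0 :=
  (IsCausal.firstInner_of_isInner (hv.isInner (isEdge_inl_of_inr hi))).symm

/-- The last dart before the horizontal one. -/
theorem rot_label_last (hv : IsLabeling G P v) {a : ℕ ⊕ ℕ} {w : ℕ} (ha : P.IsEdge a)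
    (h : P.sigma a = .inr w) :
    ((P.level (P.prev w) : ℕ) : ℕ∞) < P.h ∧
      G.rot (label v a) = G.innerChild (v (P.prev w)) (P.num (P.prev w)) := by
  rcases a with i | i
  · have hi : 1 ≤ i := ha.1
    obtain ⟨k, hk, hk'⟩ := exists_child_index (P := P) hi
    by_cases hl : i + 1 = P.start (P.parent i + 1)
    · rw [P.sigma_inl_last hi hl] at h
      obtain rfl := Sum.inr.inj h
      rw [prev_next]
      refine ⟨level_parent_lt ha, ?_⟩
      have h1 := hv.rot_child (level_parent_lt ha) hk'
      rw [← hk] at h1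
      refine h1.trans ?_
      rw [start_succ] at hl
      congr 1
      omega
    · rw [P.sigma_inl hi hl] at h
      cases h
  · by_cases h0 : P.num i = 0
    · rw [P.sigma_inr_zero h0] at h
      obtain rfl := Sum.inr.inj h
      rw [prev_next, h0]
      exact ⟨(P.isEdge_inr.1 ha).2, hv.label_start ha⟩
    · rw [P.sigma_inr h0] at h
      cases h

theorem rot_label_inl (hv : IsLabeling G P v) {a : ℕ ⊕ ℕ} {w : ℕ} (ha : P.IsEdge a)
    (h : P.sigma a = .inl w) : G.rot (label v a) = v w := by
  rcases a with i | i
  · have hi : 1 ≤ i := ha.1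
    obtain ⟨k, hk, hk'⟩ := exists_child_index (P := P) hi
    by_cases hl : i + 1 = P.start (P.parent i + 1)
    · rw [P.sigma_inl_last hi hl] at h
      cases h
    · rw [P.sigma_inl hi hl] at h
      obtain rfl := Sum.inl.inj h
      have h1 := hv.rot_child (level_parent_lt ha) hk'
      have h2 := P.start_succ (P.parent i)
      have h3 := hv.child _ (level_parent_lt ha) (k + 1) (by have := P.parent_spec hi; omega)
      rw [← add_assoc, ← hk] at h3
      rw [← hk] at h1
      exact h1.trans h3.symm
  · by_cases h0 : P.num i = 0
    · rw [P.sigma_inr_zero h0] at h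
      cases h
    · rw [P.sigma_inr h0] at h
      obtain rfl := Sum.inl.inj h
      exact (hv.label_start ha).trans (hv.child i (P.isEdge_inr.1 ha).2 0 (by omega)).symm

theorem rot_label_root (hv : IsLabeling G P v) {a : ℕ ⊕ ℕ} (ha : P.IsEdge a)
    (h : P.sigma a = .inr 0) : G.rot (label v a) = v 1 := by
  obtain ⟨h1, h2⟩ := hv.rot_label_last ha h
  rw [prev_zero] at h1 h2
  have hz : G.ht (G.flip (v 0)) = 0 := by rw [hv.zero, G.flip_flip, ht_root]
  rw [h2, hv.num 0 h1, (innerCount_spec_of_eq_zero hz).2.1, hv.one]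
  unfold firstInner
  rw [if_pos hz, hv.zero, G.flip_flip]

theorem rot_label_inr (hG : G.IsCausal P.h E) (hv : IsLabeling G P v) {a : ℕ ⊕ ℕ} {w : ℕ}
    (ha : P.IsEdge a) (h : P.sigma a = .inr w) (hw : w ≠ 0) :
    G.IsHorizontal (G.rot (label v a)) ∧ G.IsBackward (G.rot (G.rot (label v a))) := by
  obtain ⟨h1, h2⟩ := hv.rot_label_last ha h
  have h3 : 1 ≤ P.prev w := P.prev_pos (Nat.pos_of_ne_zero hw)
  rw [h2, hv.num _ h1]
  exact hG.innerChild_end (hv.isInner ⟨h3, h1.le⟩) (by rw [hv.ht _ h1.le]; exact h1)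

theorem rot_symm_label (hv : IsLabeling G P v) {w : ℕ} (hw : P.IsEdge (.inl w)) :
    ∃ a, P.IsEdge a ∧ G.rot.symm (v w) = label v a ∧ P.tgt a = P.prev w ∧
      (w ≠ 1 → a = P.sigma.symm (.inl w)) ∧ (w = 1 → a = .inl (P.start 1 - 1)) := by
  by_cases h1 : w = 1
  · refine ⟨.inl (P.start 1 - 1), P.isEdge_last, ?_, ?_, fun h => absurd h1 h, fun _ => rfl⟩
    · rw [Equiv.symm_apply_eq, h1]
      refine (hv.rot_label_root P.isEdge_last ?_).symm
      rw [← sigma_symm_inr_root, Equiv.apply_symm_apply]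
    · have h2 : P.first (P.level 1) = 1 := by rw [P.level_one, P.first_one]
      unfold prev
      rw [h1, if_pos h2.symm, P.level_one]
      change P.start 1 - 1 = P.start (P.first 1) - 1
      rw [P.first_one]
  · have h2 := isEdge_sigma_symm_inl hw h1
    have h3 : P.sigma (P.sigma.symm (.inl w)) = .inl w := Equiv.apply_symm_apply _ _
    refine ⟨P.sigma.symm (.inl w), h2, ?_, (P.src_tgt_of_sigma_eq_inl h3).2, fun _ => rfl,
      fun h => absurd h h1⟩
    rw [Equiv.symm_apply_eq, hv.rot_label_inl h2 h3]

/-- The edge on the left of the `w`-th vertex is the edge on the right of the next one, and the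
rightmost edges end where they should. -/
theorem left_eq_right (hG : G.IsCausal P.h E) (hv : IsLabeling G P v) (n : ℕ) :
    (∀ w, P.level w = n → P.IsEdge (.inr w) →
      G.rot (label v (P.sigma.symm (.inr w))) = G.flip (G.rot (G.flip (v w)))) ∧
    ∀ w, P.level w = n → P.IsEdge (.inr w) →
      G.vert (G.flip (label v (.inr w))) = G.vert (G.flip (v (P.target w))) := by
  induction n using Nat.strong_induction_on with
  | _ n ih =>
    have hS : ∀ w, P.level w = n → P.IsEdge (.inr w) →
        G.rot (label v (P.sigma.symm (.inr w))) = G.flip (G.rot (G.flip (v w))) := by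
      intro w hwn hw
      have ha := isEdge_sigma_symm_inr hw
      have has : P.sigma (P.sigma.symm (.inr w)) = .inr w := Equiv.apply_symm_apply _ _
      have hw1 : 1 ≤ w := hw.1
      obtain ⟨h1, h2⟩ := hv.rot_label_inr hG ha has (by omega)
      obtain ⟨h3, h4⟩ := hv.right hG hw
      -- Both sides are left horizontal darts, so it is enough that they start at the same vertex,
      -- the one with number `prev w`.
      refine hG.left_unique h1 h3.flip ?_ h2 (hG.flip_right h3 h4)
      rw [vert_rot, hv.vert_label ha, (P.src_tgt_of_sigma_eq_inr has).1, Nat.add_sub_cancel,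
        ← vert_rot (G.flip (G.rot (G.flip (v w)))), hG.rot_flip_below h3]
      -- The triangle below the edge has as its other side the edge `b` that precedes `v w`. If `b`
      -- is a tree edge its endpoint is clear; if it is a rightmost edge, it starts one level lower
      -- and the induction hypothesis applies.
      obtain ⟨b, hb, hb1, hb2, hb3, hb4⟩ := hv.rot_symm_label (isEdge_inl_of_inr hw)
      rw [hb1, ← hb2]
      rcases b with u | j
      · rfl
      · have hlev : P.level w = P.level j + 1 := by
          rw [← P.level_prev w, ← hb2]
          exact P.level_target j
        exact ((ih (P.level j) (by omega)).2 j rfl hb).symm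
    refine ⟨hS, fun w => ?_⟩
    refine P.prev_induction (P := fun w => P.level w = n → P.IsEdge (.inr w) →
      G.vert (G.flip (label v (.inr w))) = G.vert (G.flip (v (P.target w)))) ?_ ?_ w
    -- The triangle above the edge identifies the endpoint of the rightmost edge with that of the
    -- preceding edge; going around the level reduces this to a tree edge.
    · intro w h0 hwn hw
      have h1 := hG.rot_flip_above (hv.right hG hw).1
      rw [← hS w hwn hw, Equiv.symm_apply_apply, P.sigma_symm_inr h0] at h1
      rw [P.target_eq, if_neg h0, ← vert_rot]
      exact congrArg G.vert h1
    · intro w h0 hprev hwn hw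
      have h1 := hG.rot_flip_above (hv.right hG hw).1
      rw [← hS w hwn hw, Equiv.symm_apply_apply, P.sigma_symm_inr_zero h0] at h1
      rw [P.target_eq, if_pos h0, ← vert_rot]
      refine (congrArg G.vert h1).trans (hprev (by rw [P.level_prev, hwn]) ?_)
      have := P.isEdge_inr.1 hw
      exact P.isEdge_inr.2 ⟨P.prev_pos this.1, by rw [P.level_prev]; exact this.2⟩

theorem rot_flip_label_inr (hG : G.IsCausal P.h E) (hv : IsLabeling G P v) {w : ℕ}
    (hw : P.IsEdge (.inr w)) :
    G.rot (G.flip (label v (.inr w))) = G.flip (label v (P.sigma.symm (.inr w))) := by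
  have h1 := hG.rot_flip_above (hv.right hG hw).1
  rwa [← (hv.left_eq_right hG _).1 w rfl hw, Equiv.symm_apply_apply] at h1

/-- Only two darts start at a top vertex. The two edges in question are different because the
exterior face is to the right of `v i` but not of the rightmost edge, so the rotation exchanges
their flips. -/
theorem rot_flip_top (hG : G.IsCausal P.h E) (hv : IsLabeling G P v) {i : ℕ}
    (hi : ((P.level i : ℕ) : ℕ∞) = P.h) :
    G.rot (G.flip (v i)) = G.flip (label v (.inr (P.parent (P.next i)))) := by
  have h2 := hG.two_le P.one_le
  have hi1 := one_le_of_level_eq hi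
  have hp := isEdge_inr_parent h2 hi
  have hnum := num_parent_eq_one hi1 hi
  obtain ⟨h3, h4⟩ := P.sigma_symm_inl_of_num_eq_one hi1 hnum
  have hn1 : 1 ≤ P.next i := P.next_pos hi1
  have hn : ((P.level (P.next i) : ℕ) : ℕ∞) = P.h := by rw [P.level_next, hi]
  have hnp := isEdge_inr_parent h2 hn
  obtain ⟨h5, -⟩ := P.sigma_symm_inl_of_num_eq_one hn1 (num_parent_eq_one hn1 hn)
  have htgt : P.target (P.parent (P.next i)) = i := by
    have h6 := (P.src_tgt_of_sigma_eq_inl (a := .inr (P.parent (P.next i))) (i := P.next i)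
      (by rw [← h5, Equiv.apply_symm_apply])).2
    rw [prev_next] at h6
    exact h6
  have hvert := (hv.left_eq_right hG _).2 _ rfl hnp
  rw [htgt] at hvert
  have htop : (G.ht (G.flip (v i)) : ℕ∞) = P.h := by rw [hv.ht i hi.le, hi]
  have hrot := hG.top_rot _ htop
  have hlev : ∀ {j}, 1 ≤ j → ((P.level j : ℕ) : ℕ∞) = P.h →
      ((G.ht (G.rot (G.flip (v (P.parent j)))) + 1 : ℕ) : ℕ∞) = P.h := by
    intro j hj hjh
    have h7 := P.level_parent hj
    rw [ht_rot, hv.ht _ (level_parent_lt ⟨hj, hjh.le⟩).le, ← h7, hjh]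
  have hE : E (v i) := by
    have h8 := (hG.penultimate (hv.right hG hp).1 (hv.right hG hp).2 (hlev hi1 hi)).2.2.1
    have h9 : P.sigma (.inr (P.parent i)) = .inl i := by rw [← h3, Equiv.apply_symm_apply]
    have h10 := hv.rot_label_inl hp h9
    rw [← h10]
    exact h8
  have hnE := (hG.penultimate (hv.right hG hnp).1 (hv.right hG hnp).2 (hlev hn1 hn)).1
  obtain h11 | h11 := G.finite_orbits.forall_of_return (P := fun x => x = G.rot (G.flip (v i)))
    (n := 2) (by omega) hrot (fun m h h' => by obtain rfl : m = 1 := by omega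
                                               rfl) (vert_eq_iff.1 hvert.symm)
  · have h12 : label v (.inr (P.parent (P.next i))) = v i := flip_injective h11
    exact absurd (show E (label v (.inr (P.parent (P.next i)))) by rw [h12]; exact hE) hnE
  · exact h11.symm

/-- The dart of `G` that corresponds to a dart of `P.ct`. -/
def image (v : ℕ → G.Dart) : LDart → G.Dart
  | F a => label v a
  | B a => G.flip (label v a)
  | hr i => G.rot (G.flip (v i))
  | hl i => G.flip (G.rot (G.flip (v i)))

theorem image_flip (d : LDart) : image v d.flip = G.flip (image v d) := by
  rcases d with a | a | i | i
  · rfl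
  · exact (G.flip_flip _).symm
  · rfl
  · exact (G.flip_flip _).symm

theorem image_rot (hG : G.IsCausal P.h E) (hv : IsLabeling G P v) (x : P.ct.Dart) :
    image v (P.ct.rot x).1 = G.rot (image v x.1) := by
  have hm := x.2
  have h2 := hG.two_le P.one_le
  rcases hx : x.1 with a | (i | i) | i | i <;> rw [hx] at hm
  · replace hm : P.IsEdge a := hm
    rcases hs : P.sigma a with w | w
    · rw [ct_rot_F_inl hx hs]
      exact (hv.rot_label_inl hm hs).symm
    · rcases Nat.eq_zero_or_pos w with rfl | hw
      · rw [ct_rot_F_last hx hs]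
        exact (hv.rot_label_root hm hs).symm
      · rw [ct_rot_F_inr hx hs hw.ne']
        have h3 := (hv.left_eq_right hG _).1 w rfl (isEdge_of_sigma_inr hm hs hw.ne')
        rw [← hs, Equiv.symm_apply_apply] at h3
        exact h3.symm
  · replace hm : P.IsEdge (.inl i) := hm
    by_cases hi : P.IsEdge (.inr i)
    · rw [ct_rot_B_inl hx hi]
      rfl
    · have hl := P.level_eq_of_isEdge hm hi
      rw [ct_rot_top h2 hx hl]
      exact (hv.rot_flip_top hG hl).symm
  · rw [ct_rot_B_inr hx]
    exact (hv.rot_flip_label_inr hG hm).symm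
  · rw [ct_rot_hr hx]
    rfl
  · replace hm : P.IsEdge (.inr i) := hm
    have h3 := hG.rot_flip_below (hv.right hG hm).1
    obtain ⟨b, hb, hb1, -, hb3, hb4⟩ := hv.rot_symm_label (isEdge_inl_of_inr hm)
    rw [hb1] at h3
    by_cases h1 : i = 1
    · subst h1
      rw [hb4 rfl] at h3
      rw [ct_rot_hl_one hx]
      exact h3.symm
    · rw [hb3 h1] at h3
      rw [ct_rot_hl hx h1]
      exact h3.symm

theorem isForward_label (hG : G.IsCausal P.h E) (hv : IsLabeling G P v) {a : ℕ ⊕ ℕ}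
    (ha : P.IsEdge a) : G.IsForward (label v a) := by
  rcases a with i | i
  · exact (hv.isInner ha).1
  · exact (hv.right hG ha).2

theorem label_injective (hG : G.IsCausal P.h E) (hv : IsLabeling G P v) {i j : ℕ}
    (hi : ((P.level i : ℕ) : ℕ∞) ≤ P.h) (hj : ((P.level j : ℕ) : ℕ∞) ≤ P.h) (hij : v i = v j) :
    i = j := by
  refine eq_of_label_eq (C := P.toOffspring) (v := v) (t := P.h) (fun i j hi hj hij => ?_)
    (fun p q k l hp hq hk hl hkl => ?_) i j hi hj hij
  · rw [← hv.ht i hi, hij, hv.ht j hj]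
  · rw [hv.child p hp k hk, hv.child q hq l hl] at hkl
    rw [hv.num p hp] at hk
    rw [hv.num q hq] at hl
    exact hG.innerChild_injective (hv.inner p hp.le) (hv.inner q hq.le)
      (by rw [hv.ht p hp.le]; exact hp) (by rw [hv.ht q hq.le]; exact hq) hk hl hkl

/-- Forward, backward and horizontal darts are told apart by heights. A tree edge differs from a
rightmost edge by the dart that precedes it, and a right horizontal dart differs from a left one by
the dart that follows it. -/
theorem image_injective (hG : G.IsCausal P.h E) (hv : IsLabeling G P v) {x y : P.ct.Dart}
    (hxy : image v x.1 = image v y.1) : x = y := by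
  have hF : ∀ {a b}, P.IsEdge a → P.IsEdge b → label v a = label v b → a = b := by
    have mixed : ∀ {i j}, P.IsEdge (.inl i) → P.IsEdge (.inr j) →
        label v (.inl i) ≠ label v (.inr j) := by
      intro i j hi hj hij
      have h1 := (hv.isInner hi).2
      replace hij : v i = G.rot (G.rot (G.flip (v j))) := hij
      rw [hij, Equiv.symm_apply_apply] at h1
      exact h1.not_isHorizontal (hv.right hG hj).1
    rintro (i | i) (j | j) ha hb hab
    · rw [hv.label_injective hG ha.2 hb.2 hab]
    · exact absurd hab (mixed ha hb)
    · exact absurd hab.symm (mixed hb ha)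
    · rw [hv.label_injective hG (isEdge_inl_of_inr ha).2 (isEdge_inl_of_inr hb).2
        (flip_injective (G.rot.injective (G.rot.injective hab)))]
  have hB : ∀ {a b}, P.IsEdge a → P.IsEdge b → G.flip (label v a) ≠ label v b := by
    intro a b ha hb hab
    have h1 := (hv.isForward_label hG ha).flip
    rw [hab] at h1
    exact (hv.isForward_label hG hb).not_isBackward h1
  have hH : ∀ {a i}, P.IsEdge a → P.IsEdge (.inr i) → label v a ≠ G.rot (G.flip (v i)) := by
    intro a i ha hi hai
    have h1 := hv.isForward_label hG ha
    rw [hai] at h1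
    exact h1.not_isHorizontal (hv.right hG hi).1
  have hH' : ∀ {a i}, P.IsEdge a → P.IsEdge (.inr i) →
      label v a ≠ G.flip (G.rot (G.flip (v i))) := by
    intro a i ha hi hai
    have h1 := hv.isForward_label hG ha
    rw [hai] at h1
    exact h1.not_isHorizontal (hv.right hG hi).1.flip
  have hR : ∀ {i j}, P.IsEdge (.inr i) → P.IsEdge (.inr j) →
      G.rot (G.flip (v i)) = G.rot (G.flip (v j)) → i = j := fun hi hj hij =>
    hv.label_injective hG (isEdge_inl_of_inr hi).2 (isEdge_inl_of_inr hj).2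
      (flip_injective (G.rot.injective hij))
  have hL : ∀ {i j}, P.IsEdge (.inr i) → P.IsEdge (.inr j) →
      G.rot (G.flip (v i)) ≠ G.flip (G.rot (G.flip (v j))) := by
    intro i j hi hj hij
    have h1 := (hv.right hG hi).2
    rw [hij] at h1
    exact h1.not_isBackward (hG.flip_right (hv.right hG hj).1 (hv.right hG hj).2)
  have hx := x.2
  have hy := y.2
  refine Subtype.ext ?_
  generalize x.1 = d at *
  generalize y.1 = e at *
  rcases d with a | a | i | i <;> rcases e with b | b | j | j
  · rw [hF hx hy hxy]
  · exact absurd hxy.symm (hB hy hx)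
  · exact absurd hxy (hH hx hy)
  · exact absurd hxy (hH' hx hy)
  · exact absurd hxy (hB hx hy)
  · rw [hF hx hy (flip_injective hxy)]
  · exact absurd ((G.flip_flip _).symm.trans (congrArg G.flip hxy)) (hH' hx hy)
  · exact absurd (flip_injective hxy) (hH hx hy)
  · exact absurd hxy.symm (hH hy hx)
  · exact absurd ((G.flip_flip _).symm.trans (congrArg G.flip hxy.symm)) (hH' hy hx)
  · rw [hR hx hy hxy]
  · exact absurd hxy (hL hx hy)
  · exact absurd hxy.symm (hH' hy hx)
  · exact absurd (flip_injective hxy.symm) (hH hy hx)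
  · exact absurd hxy.symm (hL hy hx)
  · rw [hR hx hy (flip_injective hxy)]

theorem nonempty_iso (hG : G.IsCausal P.h E) (hv : IsLabeling G P v) : Nonempty (Iso P.ct G) :=
  nonempty_iso_of_hom hG.connected (fun x : P.ct.Dart => image v x.1)
    (fun _ _ hxy => hv.image_injective hG hxy) (hv.image_rot hG) (fun x => image_flip x.1) hv.one

end IsLabeling

theorem IsCausal.exists_iso_ct {h : ℕ∞} (hG : G.IsCausal h E) (h1 : 1 ≤ h) :
    ∃ P : LayerCode, P.h = h ∧ Nonempty (Iso P.ct G) := by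
  obtain ⟨P, v, rfl, hv⟩ := hG.exists_isLabeling h1
  exact ⟨P, rfl, hv.nonempty_iso hG⟩

theorem IsInfiniteCT.exists_iso_ct (hG : G.IsInfiniteCT) :
    ∃ P : LayerCode, P.h = ⊤ ∧ Nonempty (Iso P.ct G) :=
  hG.isCausal.exists_iso_ct le_top

theorem IsFiniteCT.exists_iso_ct (hG : G.IsFiniteCT) :
    ∃ (P : LayerCode) (k : ℕ), 2 ≤ P.h ∧ P.h = k ∧ Nonempty (Iso P.ct G) := by
  obtain ⟨x, k, hx⟩ := hG
  have hc := hx.isCausal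
  have h1 : (1 : ℕ∞) ≤ k := by
    by_contra hcon
    have hk : k = 0 := by
      by_contra hne
      exact hcon (by exact_mod_cast Nat.pos_of_ne_zero hne)
    have h2 := hc.isForward_of_ht_eq_zero (d := G.root) ht_root
    have h3 := hc.ht_le (G.flip G.root)
    rw [h2, hk] at h3
    simp at h3
  obtain ⟨P, hP, e⟩ := hc.exists_iso_ct h1
  exact ⟨P, k, hP ▸ hc.two_le h1, hP, e⟩

end RootedMap

/-! ### The metric spaces of causal triangulations and of trees -/

section Distance

/-- The distance defined by a decreasing sequence of relations `A 0, A 1, …`. -/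
noncomputable def agreeDist {X : Type*} (A : ℕ → X → X → Prop) (x y : X) : ℝ :=
  sInf {t : ℝ | ∃ R : ℕ, A R x y ∧ t = 1 / ((R : ℝ) + 1)}

variable {X : Type*} {A : ℕ → X → X → Prop}

theorem agreeDist_bddBelow (x y : X) :
    BddBelow {t : ℝ | ∃ R : ℕ, A R x y ∧ t = 1 / ((R : ℝ) + 1)} :=
  ⟨0, by rintro t ⟨R, -, rfl⟩; positivity⟩

theorem agreeDist_le {R : ℕ} {x y : X} (h : A R x y) : agreeDist A x y ≤ 1 / ((R : ℝ) + 1) :=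
  csInf_le (agreeDist_bddBelow x y) ⟨R, h, rfl⟩

theorem agreeDist_nonneg (x y : X) : 0 ≤ agreeDist A x y :=
  Real.sInf_nonneg (by rintro t ⟨R, -, rfl⟩; positivity)

/-- The bound is `1 / R` and not `1 / (R + 1)`: from `1 / (R' + 1) < 1 / R` one gets `R ≤ R'`. -/
theorem agree_of_agreeDist_lt (h0 : ∀ x y, A 0 x y) (hanti : ∀ x y, Antitone fun R => A R x y)
    {R : ℕ} {x y : X} (h : agreeDist A x y < 1 / (R : ℝ)) : A R x y := by
  obtain ⟨t, ⟨R', hR', rfl⟩, ht⟩ := exists_lt_of_csInf_lt (s := {t : ℝ | ∃ R : ℕ, A R x y ∧ t = 1 / ((R : ℝ) + 1)})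
    ⟨_, 0, h0 x y, rfl⟩ h
  rcases Nat.eq_zero_or_pos R with rfl | hR
  · exact h0 x y
  · refine hanti x y ?_ hR'
    have hR0 : (0 : ℝ) < R := by exact_mod_cast hR
    rw [one_div_lt_one_div (by positivity) hR0] at ht
    have : R < R' + 1 := by exact_mod_cast ht
    omega

/-- If `x`, `y` agree to order `R` and `y`, `z` to order `S`, then `x`, `z` agree to order `min R
S`; taking infima gives the triangle inequality. -/
theorem isMetric_agreeDist (h0 : ∀ x y, A 0 x y) (hanti : ∀ x y, Antitone fun R => A R x y)
    (hrefl : ∀ R x, A R x x) (hsymm : ∀ R x y, A R x y → A R y x)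
    (htrans : ∀ R x y z, A R x y → A R y z → A R x z) (heq : ∀ x y, (∀ R, A R x y) → x = y) :
    IsMetric (agreeDist A) := by
  have hne : ∀ x y, {t : ℝ | ∃ R : ℕ, A R x y ∧ t = 1 / ((R : ℝ) + 1)}.Nonempty :=
    fun x y => ⟨_, 0, h0 x y, rfl⟩
  refine ⟨fun x y => ⟨fun h => heq x y fun R => ?_, ?_⟩, fun x y => ?_, fun x y z => ?_⟩
  · rcases Nat.eq_zero_or_pos R with rfl | hR
    · exact h0 x y
    · refine agree_of_agreeDist_lt h0 hanti ?_
      rw [h]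
      have : (0 : ℝ) < R := by exact_mod_cast hR
      positivity
  · rintro rfl
    refine le_antisymm (le_of_forall_pos_le_add fun ε hε => ?_) (agreeDist_nonneg x x)
    obtain ⟨n, hn⟩ := exists_nat_one_div_lt hε
    rw [zero_add]
    exact (agreeDist_le (hrefl n x)).trans hn.le
  · unfold agreeDist
    congr 1
    ext t
    exact exists_congr fun R => and_congr_left fun _ => ⟨hsymm R x y, hsymm R y x⟩
  · have key : ∀ R S : ℕ, A R x y → A S y z →
        agreeDist A x z ≤ 1 / ((R : ℝ) + 1) + 1 / ((S : ℝ) + 1) := by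
      intro R S hR hS
      rcases le_total R S with h | h
      · have := agreeDist_le (htrans R x y z hR (hanti y z h hS))
        have h2 : (0 : ℝ) ≤ 1 / ((S : ℝ) + 1) := by positivity
        linarith
      · have := agreeDist_le (htrans S x y z (hanti x y h hR) hS)
        have h2 : (0 : ℝ) ≤ 1 / ((R : ℝ) + 1) := by positivity
        linarith
    have h1 : ∀ S : ℕ, A S y z → agreeDist A x z - 1 / ((S : ℝ) + 1) ≤ agreeDist A x y := by
      intro S hS
      refine le_csInf (hne x y) ?_
      rintro t ⟨R, hR, rfl⟩
      linarith [key R S hR hS]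
    have h2 : agreeDist A x z - agreeDist A x y ≤ agreeDist A y z := by
      refine le_csInf (hne y z) ?_
      rintro t ⟨S, hS, rfl⟩
      linarith [h1 S hS]
    linarith

theorem isMetric_of_surjective {Y : Type*} {d : X → X → ℝ} {d' : Y → Y → ℝ} (f : X → Y)
    (hf : Function.Surjective f) (hinj : Function.Injective f) (h : ∀ x y, d' (f x) (f y) = d x y)
    (hd : IsMetric d) : IsMetric d' := by
  refine ⟨hf.forall₂.2 fun x y => ?_, hf.forall₂.2 fun x y => ?_, hf.forall₃.2 fun x y z => ?_⟩
  · rw [h, hd.1, hinj.eq_iff]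
  · rw [h, h, hd.2.1]
  · rw [h, h, h]; exact hd.2.2 x y z

end Distance

/-! ### Trees and triangulations as classes of codes -/

namespace LayerCode

open RootedMap

variable {P P' : LayerCode} {R : ℕ}

theorem agree_zero (P P' : LayerCode) : Agree 0 P P' := by
  refine ⟨fun j hj => absurd hj (Nat.not_lt_zero j), ?_⟩
  rw [zero_add, Nat.cast_one, min_eq_right P.one_le, min_eq_right P'.one_le]

theorem agree_refl (R : ℕ) (P : LayerCode) : Agree R P P := ⟨fun _ _ => rfl, rfl⟩

theorem Agree.trans {P'' : LayerCode} (h : Agree R P P') (h' : Agree R P' P'') : Agree R P P'' :=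
  ⟨fun j hj => (h.1 j hj).trans (h'.1 j (by rwa [h.1.first_eq (Nat.le_succ R)])), h.2.trans h'.2⟩

theorem agree_antitone (P P' : LayerCode) : Antitone fun R => Agree R P P' := by
  intro R S hRS h
  refine ⟨fun j hj => h.1 j (hj.trans_le (P.first_mono hRS)), ?_⟩
  have hle : ((R + 1 : ℕ) : ℕ∞) ≤ ((S + 1 : ℕ) : ℕ∞) := by exact_mod_cast Nat.succ_le_succ hRS
  have := congrArg (fun a => min a ((R + 1 : ℕ) : ℕ∞)) h.2
  simpa only [min_assoc, min_eq_right hle] using this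

/-- The distance of two codes. -/
noncomputable def dist : LayerCode → LayerCode → ℝ := agreeDist Agree

theorem isMetric_dist : IsMetric LayerCode.dist :=
  isMetric_agreeDist agree_zero agree_antitone agree_refl (fun _ _ _ h => h.symm)
    (fun _ _ _ _ h h' => h.trans h') fun _ _ => eq_of_forall_agree

/-- The class of the tree with code `P`. -/
noncomputable def toTree (P : LayerCode) : PlaneTree :=
  ⟨MapClass.of P.tree, P.tree, rfl, P.tree_isRootedTree⟩

theorem isCT (h2 : 2 ≤ P.h) : P.ct.IsFiniteCT ∨ P.ct.IsInfiniteCT := by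
  by_cases h : P.h = ⊤
  · exact Or.inr (ct_isInfiniteCT h)
  · obtain ⟨k, hk⟩ := ENat.ne_top_iff_exists.1 h
    exact Or.inl (ct_isFiniteCT h2 hk.symm)

/-- The class of the causal triangulation with code `P`. -/
noncomputable def toCT (P : {P : LayerCode // 2 ≤ P.h}) : CT :=
  ⟨MapClass.of P.1.ct, P.1.ct, rfl, isCT P.2⟩

end LayerCode

namespace MapClass

theorem of_eq_iff {G H : RootedMap} : of G = of H ↔ Nonempty (RootedMap.Iso G H) := Quotient.eq

theorem ballEq_of {R : ℕ} {G H : RootedMap} : BallEq R (of G) (of H) ↔ RootedMap.BallEq R G H := by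
  constructor
  · rintro ⟨G', H', hG, hH, h⟩
    obtain ⟨e⟩ := of_eq_iff.1 hG
    obtain ⟨f⟩ := of_eq_iff.1 hH
    obtain ⟨g⟩ := RootedMap.ballEq_iff.1 h
    exact RootedMap.ballEq_iff.2
      ⟨((RootedMap.BallIso.ofIso R e.symm).trans g).trans (RootedMap.BallIso.ofIso R f)⟩
  · exact fun h => ⟨G, H, rfl, rfl, h⟩

end MapClass

namespace LayerCode

open RootedMap

theorem eq_of_iso_tree {P P' : LayerCode} (e : Iso P.tree P'.tree) : P = P' :=
  eq_of_forall_agree fun R =>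
    ballEq_tree_iff.1 (ballEq_iff.2 ⟨BallIso.ofIso (R + 1) e⟩)

theorem eq_of_iso_ct {P P' : LayerCode} (e : Iso P.ct P'.ct) : P = P' :=
  eq_of_forall_agree fun R => ballEq_ct_iff.1 (ballEq_iff.2 ⟨BallIso.ofIso R e⟩)

theorem toTree_injective : Function.Injective toTree := fun P P' h => by
  obtain ⟨e⟩ := MapClass.of_eq_iff.1 (congrArg Subtype.val h)
  exact eq_of_iso_tree e

theorem toTree_surjective : Function.Surjective toTree := by
  rintro ⟨x, G, rfl, hG⟩
  obtain ⟨P, e⟩ := hG.exists_iso_tree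
  exact ⟨P, Subtype.ext (MapClass.of_eq_iff.2 e)⟩

theorem toCT_injective : Function.Injective toCT := fun P P' h => by
  obtain ⟨e⟩ := MapClass.of_eq_iff.1 (congrArg Subtype.val h)
  exact Subtype.ext (eq_of_iso_ct e)

theorem toCT_surjective : Function.Surjective toCT := by
  rintro ⟨x, G, rfl, hG | hG⟩
  · obtain ⟨P, k, h2, -, e⟩ := hG.exists_iso_ct
    exact ⟨⟨P, h2⟩, Subtype.ext (MapClass.of_eq_iff.2 e)⟩
  · obtain ⟨P, h, e⟩ := hG.exists_iso_ct
    exact ⟨⟨P, by rw [h]; exact le_top⟩, Subtype.ext (MapClass.of_eq_iff.2 e)⟩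

theorem beta_toCT (P : {P : LayerCode // 2 ≤ P.h}) :
    MapClass.beta (toCT P).1 = (toTree P.1).1 :=
  MapClass.of_eq_iff.2 P.1.nonempty_iso_beta

theorem dist_toCT (P P' : {P : LayerCode // 2 ≤ P.h}) :
    CT.dist (toCT P) (toCT P') = LayerCode.dist P.1 P'.1 := by
  unfold CT.dist LayerCode.dist agreeDist
  refine congrArg sInf (Set.ext fun t => exists_congr fun R => and_congr_left fun _ => ?_)
  exact MapClass.ballEq_of.trans ballEq_ct_iff

/-- Trees are compared from radius `1` on with value `1 / R`; radius `R + 1` corresponds to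
agreement of order `R`, with value `1 / (R + 1)`. -/
theorem dist_toTree (P P' : LayerCode) :
    PlaneTree.dist (toTree P) (toTree P') = LayerCode.dist P P' := by
  unfold PlaneTree.dist LayerCode.dist agreeDist
  refine congrArg sInf (Set.ext fun t => ?_)
  have h : ∀ R, MapClass.BallEq (R + 1) (toTree P).1 (toTree P').1 ↔ Agree R P P' := fun R =>
    MapClass.ballEq_of.trans ballEq_tree_iff
  constructor
  · rintro ⟨R, hR, hb, rfl⟩
    obtain ⟨R, rfl⟩ := Nat.exists_eq_add_of_le' hR
    exact ⟨R, (h R).1 hb, by push_cast; rfl⟩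
  · rintro ⟨R, hR, rfl⟩
    exact ⟨R + 1, by omega, (h R).2 hR, by push_cast; rfl⟩

theorem toTree_mem_ofSize {P : LayerCode} {N : ℕ} :
    toTree P ∈ PlaneTree.ofSize N ↔ ∃ k : ℕ, P.h = k ∧ P.first k = N := by
  constructor
  · rintro ⟨G, hG, -, hN⟩
    obtain ⟨e⟩ := MapClass.of_eq_iff.1 hG
    rw [e.encard_edgeSet_eq] at hN
    by_cases h : P.h = ⊤
    · rw [tree_encard_edgeSet, h] at hN
      have huniv : {i | ((P.level i : ℕ) : ℕ∞) < ⊤} = Set.univ :=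
        Set.eq_univ_of_forall fun i => ENat.natCast_lt_top _
      rw [huniv, Set.infinite_univ.encard_eq] at hN
      exact absurd hN.symm (ENat.natCast_ne_top N)
    · obtain ⟨k, hk⟩ := ENat.ne_top_iff_exists.1 h
      rw [tree_encard_edgeSet_of_eq hk.symm] at hN
      exact ⟨k, hk.symm, by exact_mod_cast hN⟩
  · rintro ⟨k, hk, hN⟩
    exact ⟨P.tree, rfl, P.tree_isRootedTree, by rw [tree_encard_edgeSet_of_eq hk, hN]⟩

theorem toTree_mem_infinite {P : LayerCode} : toTree P ∈ PlaneTree.infinite ↔ P.h = ⊤ := by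
  constructor
  · rintro ⟨G, hG, -, hinf⟩
    obtain ⟨e⟩ := MapClass.of_eq_iff.1 hG
    by_contra h
    obtain ⟨k, hk⟩ := ENat.ne_top_iff_exists.1 h
    have hfin := tree_finite hk.symm
    have : Finite G.Dart := Finite.of_equiv _ e.toEquiv.symm
    have : Finite G.Vertex := Finite.of_surjective G.vert exists_vert
    exact not_finite G.Vertex
  · exact fun h => ⟨P.tree, rfl, P.tree_isRootedTree, tree_infinite_vertex h⟩

theorem toCT_mem_finite {P : {P : LayerCode // 2 ≤ P.h}} : toCT P ∈ CT.finite ↔ P.1.h ≠ ⊤ := by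
  constructor
  · rintro ⟨G, hG, hfin⟩
    obtain ⟨e⟩ := MapClass.of_eq_iff.1 hG
    obtain ⟨Q, k, -, hk, ⟨f⟩⟩ := hfin.exists_iso_ct
    rw [← eq_of_iso_ct (f.trans e), hk]
    exact ENat.natCast_ne_top k
  · intro h
    obtain ⟨k, hk⟩ := ENat.ne_top_iff_exists.1 h
    exact ⟨P.1.ct, rfl, ct_isFiniteCT P.2 hk.symm⟩

theorem toCT_mem_infinite {P : {P : LayerCode // 2 ≤ P.h}} :
    toCT P ∈ CT.infinite ↔ P.1.h = ⊤ := by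
  constructor
  · rintro ⟨G, hG, hinf⟩
    obtain ⟨e⟩ := MapClass.of_eq_iff.1 hG
    obtain ⟨Q, hQ, ⟨f⟩⟩ := hinf.exists_iso_ct
    rw [← eq_of_iso_ct (f.trans e), hQ]
  · exact fun h => ⟨P.1.ct, rfl, ct_isInfiniteCT h⟩

theorem toCT_mem_ofArea {P : {P : LayerCode // 2 ≤ P.h}} {N : ℕ} :
    toCT P ∈ CT.ofArea N ↔ ∃ k : ℕ, P.1.h = k ∧ P.1.first k = N + 1 := by
  constructor
  · rintro ⟨G, hG, hfin, hN⟩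
    obtain ⟨k, hk⟩ := ENat.ne_top_iff_exists.1 (toCT_mem_finite.1 ⟨G, hG, hfin⟩)
    obtain ⟨e⟩ := MapClass.of_eq_iff.1 hG
    rw [e.area_eq, area_ct P.2 hk.symm] at hN
    have h1 : 2 * (P.1.first k - 1) = 2 * N := by exact_mod_cast hN
    have h2 : 1 ≤ k := by exact_mod_cast hk ▸ P.1.one_le
    have h3 := P.1.le_first k
    exact ⟨k, hk.symm, by omega⟩
  · rintro ⟨k, hk, hN⟩
    refine ⟨P.1.ct, rfl, ct_isFiniteCT P.2 hk, ?_⟩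
    rw [area_ct P.2 hk, hN, Nat.add_sub_cancel]

theorem finite_eq_iUnion_ofArea : CT.finite = ⋃ N ∈ Set.Ici 1, CT.ofArea N := by
  ext x
  obtain ⟨P, rfl⟩ := toCT_surjective x
  simp only [Set.mem_iUnion, Set.mem_Ici, exists_prop, toCT_mem_ofArea, toCT_mem_finite]
  constructor
  · intro h
    obtain ⟨k, hk⟩ := ENat.ne_top_iff_exists.1 h
    have h2 : 2 ≤ k := by exact_mod_cast hk ▸ P.2
    have h3 := P.1.le_first k
    exact ⟨P.1.first k - 1, by omega, k, hk.symm, by omega⟩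
  · rintro ⟨N, -, k, hk, -⟩
    rw [hk]
    exact ENat.natCast_ne_top k

/-- The tree with a single edge is the only one with `h = 1`, and `N ≥ 1` excludes it. -/
theorem two_le_of_first {P : LayerCode} {k N : ℕ} (hk : P.h = k) (hN : P.first k = N + 1)
    (h1 : 1 ≤ N) : 2 ≤ P.h := by
  rw [hk]
  have h2 : k ≠ 0 := by rintro rfl; rw [P.first_zero] at hN; omega
  have h3 : k ≠ 1 := by rintro rfl; rw [P.first_one] at hN; omega
  exact_mod_cast (by omega : 2 ≤ k)

end LayerCode

theorem mapsTo_beta : Set.MapsTo MapClass.beta MapClass.causal MapClass.trees := by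
  intro x hx
  obtain ⟨P, hP⟩ := LayerCode.toCT_surjective ⟨x, hx⟩
  have h := LayerCode.beta_toCT P
  rw [hP] at h
  rw [h]
  exact (LayerCode.toTree P.1).2

/-- The map `β` from causal triangulations to trees. -/
noncomputable def CT.toPlaneTree : CT → PlaneTree :=
  mapsTo_beta.restrict MapClass.beta MapClass.causal MapClass.trees

namespace CT

open LayerCode

theorem toPlaneTree_toCT (P : {P : LayerCode // 2 ≤ P.h}) : (toCT P).toPlaneTree = toTree P.1 :=
  Subtype.ext (beta_toCT P)

theorem toPlaneTree_injective : Function.Injective toPlaneTree := by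
  intro x y
  obtain ⟨P, rfl⟩ := toCT_surjective x
  obtain ⟨Q, rfl⟩ := toCT_surjective y
  rw [toPlaneTree_toCT, toPlaneTree_toCT]
  exact fun h => congrArg toCT (Subtype.ext (toTree_injective h))

theorem dist_toPlaneTree (x y : CT) : PlaneTree.dist x.toPlaneTree y.toPlaneTree = CT.dist x y := by
  obtain ⟨P, rfl⟩ := toCT_surjective x
  obtain ⟨Q, rfl⟩ := toCT_surjective y
  rw [toPlaneTree_toCT, toPlaneTree_toCT, dist_toTree, dist_toCT]

theorem isMetric_dist : IsMetric CT.dist :=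
  isMetric_of_surjective toCT toCT_surjective toCT_injective (d := fun P Q => LayerCode.dist P.1 Q.1)
    dist_toCT ⟨fun _ _ => (LayerCode.isMetric_dist.1 _ _).trans Subtype.ext_iff.symm,
      fun _ _ => LayerCode.isMetric_dist.2.1 _ _, fun _ _ _ => LayerCode.isMetric_dist.2.2 _ _ _⟩

theorem _root_.PlaneTree.isMetric_dist : IsMetric PlaneTree.dist :=
  isMetric_of_surjective toTree toTree_surjective toTree_injective dist_toTree
    LayerCode.isMetric_dist

theorem bijOn_ofArea {N : ℕ} (hN : 1 ≤ N) :
    Set.BijOn toPlaneTree (ofArea N) (PlaneTree.ofSize (N + 1)) := by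
  refine ⟨fun x hx => ?_, toPlaneTree_injective.injOn, fun y hy => ?_⟩
  · obtain ⟨P, rfl⟩ := toCT_surjective x
    rw [toPlaneTree_toCT]
    exact toTree_mem_ofSize.2 (toCT_mem_ofArea.1 hx)
  · obtain ⟨P, rfl⟩ := toTree_surjective y
    obtain ⟨k, hk, hkN⟩ := toTree_mem_ofSize.1 hy
    exact ⟨toCT ⟨P, two_le_of_first hk hkN hN⟩, toCT_mem_ofArea.2 ⟨k, hk, hkN⟩,
      toPlaneTree_toCT _⟩

theorem bijOn_infinite : Set.BijOn toPlaneTree infinite PlaneTree.infinite := by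
  refine ⟨fun x hx => ?_, toPlaneTree_injective.injOn, fun y hy => ?_⟩
  · obtain ⟨P, rfl⟩ := toCT_surjective x
    rw [toPlaneTree_toCT]
    exact toTree_mem_infinite.2 (toCT_mem_infinite.1 hx)
  · obtain ⟨P, rfl⟩ := toTree_surjective y
    have hP := toTree_mem_infinite.1 hy
    exact ⟨toCT ⟨P, by rw [hP]; exact le_top⟩, toCT_mem_infinite.2 hP, toPlaneTree_toCT _⟩

end CT

/-! ### Excursions -/

namespace Excursion

/-- The number of unexplored vertices after the exploration of a vertex with `c` children. -/
def step : ℕ → ℕ → ℕ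
  | 0, _ => 0
  | s + 1, c => s + c

/-- The number of unexplored vertices after `i` steps of a breadth-first exploration, if the `i`-th
vertex has `w i` children. -/
def walk (s : ℕ) (w : ℕ → ℕ) : ℕ → ℕ
  | 0 => s
  | i + 1 => step (walk s w i) (w i)

def cons (c : ℕ) (w : ℕ → ℕ) : ℕ → ℕ
  | 0 => c
  | i + 1 => w i

def tail (w : ℕ → ℕ) (i : ℕ) : ℕ := w (i + 1)

theorem cons_tail (w : ℕ → ℕ) : cons (w 0) (tail w) = w := by
  funext i
  cases i <;> rfl

theorem cons_injective (c : ℕ) : Function.Injective (cons c) := fun _ _ h =>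
  funext fun i => congrFun h (i + 1)

theorem walk_succ' (s : ℕ) (w : ℕ → ℕ) (i : ℕ) :
    walk s w (i + 1) = walk (step s (w 0)) (tail w) i := by
  induction i with
  | zero => rfl
  | succ i ih =>
    change step (walk s w (i + 1)) (w (i + 1)) = _
    rw [ih]
    rfl

theorem walk_zero_left (w : ℕ → ℕ) (i : ℕ) : walk 0 w i = 0 := by
  induction i with
  | zero => rfl
  | succ i ih =>
    change step (walk 0 w i) (w i) = 0
    rw [ih]
    rfl

theorem walk_congr {s n : ℕ} {w w' : ℕ → ℕ} (h : ∀ i < n, w i = w' i) {i : ℕ} (hi : i ≤ n) :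
    walk s w i = walk s w' i := by
  induction i with
  | zero => rfl
  | succ i ih =>
    change step (walk s w i) (w i) = step (walk s w' i) (w' i)
    rw [ih (by omega), h i (by omega)]

/-- The walk decreases by at most one in each step. -/
theorem le_walk_add (s : ℕ) (w : ℕ → ℕ) (i : ℕ) : s ≤ walk s w i + i := by
  induction i with
  | zero => exact le_rfl
  | succ i ih =>
    have h : walk s w i ≤ walk s w (i + 1) + 1 := by
      change walk s w i ≤ step (walk s w i) (w i) + 1
      rcases walk s w i with _ | n
      · exact Nat.zero_le _
      · change n + 1 ≤ n + w i + 1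
        omega
    omega

/-- The sequences of offspring numbers for which the walk from `s` is at `0` for the first time after
`L` steps; by convention, they vanish from then on. -/
noncomputable def words : ℕ → ℕ → Finset (ℕ → ℕ)
  | 0, 0 => {0}
  | 0, _ + 1 => ∅
  | _ + 1, 0 => ∅
  | L + 1, s + 1 => by
    classical exact
      -- More than `L` children in the first step cannot be used up in the remaining `L` steps, so
      -- the union may be finite.
      (Finset.range (L + 1)).biUnion fun c => (words L (s + c)).map ⟨cons c, cons_injective c⟩

theorem mem_words {L s : ℕ} {w : ℕ → ℕ} :
    w ∈ words L s ↔ (∀ i < L, walk s w i ≠ 0) ∧ walk s w L = 0 ∧ ∀ i, L ≤ i → w i = 0 := by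
  induction L generalizing s w with
  | zero =>
    rcases s with _ | s
    · simp only [words, Finset.mem_singleton]
      exact ⟨by rintro rfl; exact ⟨fun i hi => absurd hi (Nat.not_lt_zero i), rfl, fun _ _ => rfl⟩,
        fun h => funext fun i => h.2.2 i (Nat.zero_le i)⟩
    · simp only [words]
      exact ⟨fun h => absurd h (Finset.notMem_empty _), fun h => absurd h.2.1 (Nat.succ_ne_zero s)⟩
  | succ L ih =>
    rcases s with _ | s
    · simp only [words]
      exact ⟨fun h => absurd h (Finset.notMem_empty _), fun h => absurd rfl (h.1 0 L.succ_pos)⟩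
    · simp only [words, Finset.mem_biUnion, Finset.mem_range, Finset.mem_map,
        Function.Embedding.coeFn_mk]
      constructor
      · rintro ⟨c, -, w, hw, rfl⟩
        obtain ⟨h1, h2, h3⟩ := ih.1 hw
        refine ⟨fun i hi => ?_, (walk_succ' _ _ _).trans h2, fun i hi => ?_⟩
        · rcases i with _ | i
          · exact Nat.succ_ne_zero s
          · rw [walk_succ']
            exact h1 i (by omega)
        · obtain ⟨i, rfl⟩ := Nat.exists_eq_add_of_le' (show 1 ≤ i by omega)
          exact h3 i (by omega)
      · rintro ⟨h1, h2, h3⟩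
        rw [walk_succ'] at h2
        have h4 := le_walk_add (s + w 0) (tail w) L
        rw [show walk (s + w 0) (tail w) L = 0 from h2] at h4
        refine ⟨w 0, by omega, tail w, ih.2 ⟨fun i hi => ?_, h2, fun i hi => h3 _ (by omega)⟩,
          cons_tail w⟩
        have := h1 (i + 1) (by omega)
        rwa [walk_succ'] at this

theorem words_eq_empty {L s : ℕ} (h : L < s) : words L s = ∅ := by
  refine Finset.eq_empty_of_forall_notMem fun w hw => ?_
  have h1 := le_walk_add s w L
  rw [(mem_words.1 hw).2.1] at h1
  omega

theorem words_succ_zero (L : ℕ) : words (L + 1) 0 = ∅ := by rw [words]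

theorem card_words_succ_succ (L s : ℕ) :
    (words (L + 1) (s + 1)).card = ∑ c ∈ Finset.range (L + 1), (words L (s + c)).card := by
  classical
  rw [words, Finset.card_biUnion]
  · simp
  · intro c _ d _ hcd
    rw [Function.onFun, Finset.disjoint_left]
    intro w hw hw'
    obtain ⟨u, -, rfl⟩ := Finset.mem_map.1 hw
    obtain ⟨u', -, h⟩ := Finset.mem_map.1 hw'
    exact hcd (congrFun h 0).symm

/-- In the sum over the first offspring number `c`, the term `c = 0` is split off, and the others
form the corresponding sum for a start one higher. -/
theorem card_words_succ (L s : ℕ) :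
    (words (L + 1) (s + 1)).card = (words L s).card + (words (L + 1) (s + 2)).card := by
  rw [card_words_succ_succ, card_words_succ_succ]
  have h1 := Finset.sum_range_succ (fun c => (words L (s + c)).card) (L + 1)
  have h2 := Finset.sum_range_succ' (fun c => (words L (s + c)).card) (L + 1)
  rw [words_eq_empty (show L < s + (L + 1) by omega), Finset.card_empty, add_zero] at h1
  rw [← h1, h2, add_zero, add_comm]
  refine congrArg _ (Finset.sum_congr rfl fun c _ => ?_)
  rw [show s + (c + 1) = s + 1 + c by ring]

theorem card_words_self (s : ℕ) : (words s s).card = 1 := by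
  induction s with
  | zero => simp [words]
  | succ s ih => rw [card_words_succ, ih, words_eq_empty (by omega), Finset.card_empty]

/-- The ballot numbers. -/
theorem card_words_add_choose (d s : ℕ) :
    (words (s + d + 1) s).card + (s + 2 * d + 1).choose d = (s + 2 * d + 1).choose (d + 1) := by
  -- Double induction along `card_words_succ`, with Pascal's rule on the right-hand side. For `s =
  -- 0` there are no words, and the formula is the symmetry of the binomial coefficients.
  induction d generalizing s with
  | zero =>
    induction s with
    | zero => simp [words]
    | succ s ih =>
      rw [show s + 1 + 0 + 1 = (s + 1) + 1 by ring, card_words_succ]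
      simp only [add_zero, mul_zero, Nat.choose_zero_right, zero_add, Nat.choose_one_right] at ih ⊢
      rw [card_words_self]
      omega
  | succ d ihd =>
    induction s with
    | zero =>
      rw [show 0 + (d + 1) + 1 = d + 1 + 1 by ring, words_succ_zero, Finset.card_empty, zero_add]
      rw [show 0 + 2 * (d + 1) + 1 = 2 * (d + 1) + 1 by ring]
      exact (Nat.choose_symm_half (d + 1)).symm
    | succ s ihs =>
      have h1 := ihd (s + 2)
      rw [show s + 1 + (d + 1) + 1 = (s + (d + 1) + 1) + 1 by ring, card_words_succ]
      rw [show s + 2 + d + 1 = s + (d + 1) + 1 + 1 by ring,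
        show s + 2 + 2 * d + 1 = s + 2 * (d + 1) + 1 by ring] at h1
      rw [show s + 1 + 2 * (d + 1) + 1 = (s + 2 * (d + 1) + 1) + 1 by ring,
        Nat.choose_succ_succ' _ d, Nat.choose_succ_succ' _ (d + 1)]
      omega

/-- The ballot formula for `s = 1` gives the Catalan numbers. -/
theorem succ_mul_card_words (n : ℕ) : (n + 1) * (words (n + 1) 1).card = n.centralBinom := by
  rcases n with _ | d
  · rw [card_words_self]; rfl
  · have h1 := card_words_add_choose d 1
    have h2 := Nat.choose_succ_right_eq (1 + 2 * d + 1) d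
    rw [show 1 + 2 * d + 1 - d = d + 2 by omega] at h2
    rw [Nat.centralBinom, show 2 * (d + 1) = 1 + 2 * d + 1 by ring,
      show d + 1 + 1 = 1 + d + 1 by ring]
    nlinarith

theorem card_words_one_pos (n : ℕ) : 0 < (words (n + 1) 1).card := by
  have h1 := succ_mul_card_words n
  have h2 := n.centralBinom_pos
  rw [← h1] at h2
  exact Nat.pos_of_mul_pos_left h2

theorem card_words_one_succ (n : ℕ) :
    (n + 2) * (words (n + 2) 1).card = 2 * (2 * n + 1) * (words (n + 1) 1).card := by
  have h1 := succ_mul_card_words n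
  have h2 := succ_mul_card_words (n + 1)
  have h3 := Nat.succ_mul_centralBinom_succ n
  rw [← h1, ← h2] at h3
  have h4 : (n + 1) * ((n + 2) * (words (n + 2) 1).card) =
      (n + 1) * (2 * (2 * n + 1) * (words (n + 1) 1).card) := by rw [h3]; ring
  exact Nat.eq_of_mul_eq_mul_left n.succ_pos h4

/-! ### Asymptotics -/

/-- The recursion of the Catalan numbers makes this ratio equal to `(n + 2) / (2 * (2 * n + 1))` for
`L = n + 1`. -/
theorem tendsto_ratio : Tendsto (fun L => ((words L 1).card : ℝ) / (words (L + 1) 1).card) atTop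
    (𝓝 (1 / 4)) := by
  rw [← tendsto_add_atTop_iff_nat 1]
  have h1 : ∀ n : ℕ, ((words (n + 1) 1).card : ℝ) / (words (n + 1 + 1) 1).card =
      1 / 4 + (3 / 4) * (1 / (2 * (n : ℝ) + 1)) := by
    intro n
    have h2 : ((n : ℝ) + 2) * (words (n + 2) 1).card =
        2 * (2 * n + 1) * (words (n + 1) 1).card := by exact_mod_cast card_words_one_succ n
    have h3 : (0 : ℝ) < (words (n + 2) 1).card := by exact_mod_cast card_words_one_pos (n + 1)
    have h4 : (0 : ℝ) < 2 * (n : ℝ) + 1 := by positivity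
    rw [div_eq_iff h3.ne']
    field_simp
    linarith
  simp only [h1]
  have h5 : Tendsto (fun n : ℕ => 1 / (2 * (n : ℝ) + 1)) atTop (𝓝 0) := by
    refine squeeze_zero (fun n => by positivity) (fun n => ?_) tendsto_one_div_add_atTop_nhds_zero_nat
    have : (0 : ℝ) ≤ n := n.cast_nonneg
    gcongr
    linarith
  have h6 := (h5.const_mul (3 / 4)).const_add (1 / 4)
  rwa [mul_zero, add_zero] at h6

/-- The limit of the ratio of the number of excursions from `s` to the number of those from `1`. -/
noncomputable def weight (s : ℕ) : ℝ := 2 * s * (1 / 2) ^ s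

theorem weight_zero : weight 0 = 0 := by simp [weight]

theorem weight_one : weight 1 = 1 := by simp [weight]

/-- This is the limit of `card_words_succ`, divided by the number of excursions from `1`. The
characteristic polynomial has the double root `1 / 2`, whence the form `s * (1 / 2) ^ s`. -/
theorem weight_add_two (s : ℕ) : weight (s + 2) = weight (s + 1) - weight s * (1 / 4) := by
  unfold weight
  push_cast
  ring

theorem weight_pos (s : ℕ) : 0 < weight (s + 1) := by
  unfold weight
  positivity

theorem weight_nonneg (s : ℕ) : 0 ≤ weight s := by
  unfold weight
  positivity

/-- The recursion for the weights is of second order, so two consecutive values are carried through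
the induction. -/
theorem tendsto_weight_aux (s : ℕ) :
    Tendsto (fun L => ((words L s).card : ℝ) / (words L 1).card) atTop (𝓝 (weight s)) ∧
    Tendsto (fun L => ((words L (s + 1)).card : ℝ) / (words L 1).card) atTop
      (𝓝 (weight (s + 1))) := by
  induction s with
  | zero =>
    constructor
    · rw [← tendsto_add_atTop_iff_nat 1, weight_zero]
      simp only [words_succ_zero, Finset.card_empty, Nat.cast_zero, zero_div]
      exact tendsto_const_nhds
    · rw [← tendsto_add_atTop_iff_nat 1, zero_add, weight_one]
      refine tendsto_const_nhds.congr fun n => ?_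
      have : (0 : ℝ) < (words (n + 1) 1).card := by exact_mod_cast card_words_one_pos n
      exact (div_self this.ne').symm
  | succ s ih =>
    refine ⟨ih.2, ?_⟩
    rw [← tendsto_add_atTop_iff_nat 2, weight_add_two]
    have h1 := ((tendsto_add_atTop_iff_nat 2).2 ih.2).sub
      (((tendsto_add_atTop_iff_nat 1).2 ih.1).mul ((tendsto_add_atTop_iff_nat 1).2 tendsto_ratio))
    refine h1.congr fun n => ?_
    have h2 : (0 : ℝ) < (words (n + 1) 1).card := by exact_mod_cast card_words_one_pos n
    have h3 : (0 : ℝ) < (words (n + 2) 1).card := by exact_mod_cast card_words_one_pos (n + 1)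
    have h4 : ((words (n + 2) (s + 1)).card : ℝ) =
        (words (n + 1) s).card + (words (n + 2) (s + 2)).card := by
      exact_mod_cast card_words_succ (n + 1) s
    change _ / ((words (n + 2) 1).card : ℝ) - _ * (_ / ((words (n + 2) 1).card : ℝ)) = _
    rw [h4, div_mul_div_cancel₀ h2.ne', ← sub_div, add_sub_cancel_left]

theorem tendsto_weight (s m : ℕ) :
    Tendsto (fun L => ((words L s).card : ℝ) / (words (L + m) 1).card) atTop
      (𝓝 (weight s * (1 / 4) ^ m)) := by
  induction m with
  | zero => simpa using (tendsto_weight_aux s).1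
  | succ m ih =>
    have h1 := ih.mul (tendsto_ratio.comp (tendsto_add_atTop_nat m))
    rw [pow_succ, ← mul_assoc]
    rw [← tendsto_add_atTop_iff_nat 1] at h1 ⊢
    refine h1.congr fun n => ?_
    have h2 : (0 : ℝ) < (words (n + 1 + m) 1).card := by
      rw [show n + 1 + m = n + m + 1 by ring]
      exact_mod_cast card_words_one_pos (n + m)
    exact div_mul_div_cancel₀ h2.ne'

/-! ### Cylinders -/

/-- The sequences with a given beginning. -/
def cylinder (c : ℕ → ℕ) (m : ℕ) : Set (ℕ → ℕ) := {w | ∀ i < m, w i = c i}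

/-- After a prescribed beginning of length `m`, what remains is an arbitrary excursion from the
state reached. With `L = 0` the formula would fail for beginnings that reach `0` too early, since a
walk stays at `0`. -/
theorem ncard_words_inter_cylinder {L : ℕ} (hL : 1 ≤ L) (m s : ℕ) (c : ℕ → ℕ) :
    ((words (L + m) s : Set (ℕ → ℕ)) ∩ cylinder c m).ncard = (words L (walk s c m)).card := by
  induction m generalizing s c with
  | zero =>
    have : cylinder c 0 = Set.univ := Set.eq_univ_of_forall fun w i hi => absurd hi (Nat.not_lt_zero i)
    rw [this, Set.inter_univ, Set.ncard_coe_finset]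
    rfl
  | succ m ih =>
    rcases s with _ | s
    · obtain ⟨L, rfl⟩ := Nat.exists_eq_add_of_le' hL
      rw [walk_zero_left, words_succ_zero, ← add_assoc, words_succ_zero]
      simp
    · rw [walk_succ', ← ih (step (s + 1) (c 0)) (tail c)]
      refine Eq.trans (congrArg Set.ncard ?_)
        (Set.ncard_image_of_injective _ (cons_injective (c 0)))
      ext w
      have hiff : w ∈ words (L + m + 1) (s + 1) ↔ tail w ∈ words (L + m) (s + w 0) := by
        conv_lhs => rw [← cons_tail w]
        rw [words]
        simp only [Finset.mem_biUnion, Finset.mem_range, Finset.mem_map, Function.Embedding.coeFn_mk]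
        constructor
        · rintro ⟨d, -, u, hu, h⟩
          obtain rfl : d = w 0 := congrFun h 0
          rw [← cons_injective _ h]
          exact hu
        · intro h
          refine ⟨w 0, ?_, tail w, h, rfl⟩
          by_contra hcon
          rw [words_eq_empty (by omega)] at h
          exact absurd h (Finset.notMem_empty _)
      simp only [Set.mem_inter_iff, Finset.mem_coe, Set.mem_image, ← add_assoc, hiff]
      constructor
      · rintro ⟨h1, h2⟩
        have h0 : w 0 = c 0 := h2 0 m.succ_pos
        refine ⟨tail w, ⟨?_, fun i hi => h2 (i + 1) (by omega)⟩, ?_⟩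
        · rw [← h0]; exact h1
        · rw [← h0]; exact cons_tail w
      · rintro ⟨u, ⟨h1, h2⟩, rfl⟩
        refine ⟨h1, fun i hi => ?_⟩
        rcases i with _ | i
        · rfl
        · exact h2 i (by omega)

end Excursion

/-! ### Coding trees by excursions -/

namespace LayerCode

open Offspring Excursion

variable {P P' : LayerCode} {w w' : ℕ → ℕ}

/-- The numbers of children in the tree with code `P`, in breadth-first order, are given by `w`. -/
structure IsCodeOf (P : LayerCode) (w : ℕ → ℕ) : Prop where
  num_eq : ∀ i, ((P.level i + 1 : ℕ) : ℕ∞) < P.h → P.num i = w i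
  eq_zero : ∀ i, ((P.level i + 1 : ℕ) : ℕ∞) = P.h → w i = 0

/-- A word shows where its tree ends: at the first level on which no vertex has children. -/
theorem IsCodeOf.h_eq_iff (hP : P.IsCodeOf w) {R : ℕ} (hR : (R : ℕ∞) < P.h) :
    P.h = ((R + 1 : ℕ) : ℕ∞) ↔ ∀ i, P.level i = R → w i = 0 := by
  constructor
  · intro h i hi
    exact hP.eq_zero i (by rw [hi, h])
  · intro hall
    by_contra hne
    have hlt : ((R + 1 : ℕ) : ℕ∞) < P.h :=
      lt_of_le_of_ne (by push_cast; exact Order.add_one_le_of_lt hR) (Ne.symm hne)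
    have h1 : 1 ≤ P.first (R + 1) := (Nat.succ_pos R).trans_le (P.le_first _)
    have h2 := P.level_parent h1
    rw [P.level_first] at h2
    have h3 : P.level (P.parent (P.first (R + 1))) = R := by omega
    have h4 := hP.num_eq _ (by rw [h3]; exact hlt)
    rw [hall _ h3] at h4
    have h5 := P.parent_spec h1
    rw [start_succ] at h5
    omega

/-- Level by level, the entries of the word on a level decide whether the tree ends there, and if
not they are the offspring numbers; after the end both codes continue with `1`. -/
theorem IsCodeOf.agree (hP : P.IsCodeOf w) (hP' : P'.IsCodeOf w') {R : ℕ}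
    (h : ∀ i < P.first R, w i = w' i) : Agree R P P' := by
  induction R with
  | zero => exact agree_zero P P'
  | succ R ih =>
    have hA := ih fun i hi => h i (hi.trans (P.first_lt R))
    by_cases hR : (R : ℕ∞) < P.h
    · have hR' := hA.lt_of_lt hR
      have hlev : ∀ i, P.level i = R ↔ P'.level i = R := fun i =>
        ⟨fun hi => (hA.1.level_eq hi.le).trans hi, fun hi => (hA.1.symm.level_eq hi.le).trans hi⟩
      have hw : ∀ i, P.level i = R → w i = w' i := fun i hi =>
        h i (P.level_lt_iff.1 (by omega))
      have hiff : P.h = ((R + 1 : ℕ) : ℕ∞) ↔ P'.h = ((R + 1 : ℕ) : ℕ∞) := by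
        rw [hP.h_eq_iff hR, hP'.h_eq_iff hR']
        exact forall_congr' fun i => by
          rw [← hlev i]
          exact ⟨fun h hi => (hw i hi).symm.trans (h hi), fun h hi => (hw i hi).trans (h hi)⟩
      have hle : ((R + 1 : ℕ) : ℕ∞) ≤ P.h := by push_cast; exact Order.add_one_le_of_lt hR
      have hle' : ((R + 1 : ℕ) : ℕ∞) ≤ P'.h := by push_cast; exact Order.add_one_le_of_lt hR'
      have hnum : (∀ i, P.level i = R → P.num i = P'.num i) →
          AgreeTo (R + 1) P.toOffspring P'.toOffspring := by
        intro hn j hj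
        rcases Nat.lt_or_ge j (P.first R) with h1 | h1
        · exact hA.1 j h1
        · exact hn j (P.level_eq h1 hj)
      by_cases heq : P.h = ((R + 1 : ℕ) : ℕ∞)
      · have heq' := hiff.1 heq
        refine ⟨hnum fun i hi => ?_, by rw [heq, heq']⟩
        rw [P.tail i (by rw [hi, heq]), P'.tail i (by rw [(hlev i).1 hi, heq'])]
      · have hlt := lt_of_le_of_ne hle (Ne.symm heq)
        have hlt' := lt_of_le_of_ne hle' (Ne.symm (fun h => heq (hiff.2 h)))
        refine ⟨hnum fun i hi => ?_, ?_⟩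
        · rw [hP.num_eq i (by rw [hi]; exact hlt), hw i hi,
            hP'.num_eq i (by rw [(hlev i).1 hi]; exact hlt')]
        · have h1 : ((R + 1 + 1 : ℕ) : ℕ∞) ≤ P.h := by
            rw [Nat.cast_succ (R + 1)]; exact Order.add_one_le_of_lt hlt
          have h2 : ((R + 1 + 1 : ℕ) : ℕ∞) ≤ P'.h := by
            rw [Nat.cast_succ (R + 1)]; exact Order.add_one_le_of_lt hlt'
          rw [min_eq_right h1, min_eq_right h2]
    · rw [hA.eq_of_le (not_lt.1 hR)]
      exact agree_refl _ _

theorem IsCodeOf.unique (hP : P.IsCodeOf w) (hP' : P'.IsCodeOf w) : P = P' :=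
  eq_of_forall_agree fun _ => hP.agree hP' fun _ _ => rfl

/-- The first child of the `i`-th vertex. -/
def startOf (w : ℕ → ℕ) (i : ℕ) : ℕ := 1 + ∑ j ∈ Finset.range i, w j

theorem startOf_succ (w : ℕ → ℕ) (i : ℕ) : startOf w (i + 1) = startOf w i + w i := by
  unfold startOf
  rw [Finset.sum_range_succ, add_assoc]

theorem startOf_mono (w : ℕ → ℕ) : Monotone (startOf w) :=
  monotone_nat_of_le_succ fun i => by rw [startOf_succ]; omega

theorem startOf_congr {n : ℕ} (h : ∀ j < n, w j = w' j) : startOf w n = startOf w' n :=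
  congrArg _ (Finset.sum_congr rfl fun j hj => h j (Finset.mem_range.1 hj))

/-- Giving one child to the last vertex and to all later ones keeps exactly one vertex in the queue
forever. -/
theorem exists_offspring_of_extinct {m : ℕ} (h1 : ∀ i < m, i < startOf w i) (hm : startOf w m = m) :
    ∃ C : Offspring, (∀ i, i + 1 < m → C.num i = w i) ∧ ∀ i < m, C.start i = startOf w i := by
  have hm0 : m ≠ 0 := by
    rintro rfl
    exact absurd hm (by simp [startOf])
  obtain ⟨n, rfl⟩ := Nat.exists_eq_succ_of_ne_zero hm0
  let f : ℕ → ℕ := fun i => if i < n then w i else 1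
  have hf : ∀ i ≤ n, startOf f i = startOf w i := fun i hi =>
    startOf_congr fun j hj => if_pos (by omega)
  have hn : startOf w n = n + 1 := by
    have h2 := h1 n (Nat.lt_succ_self n)
    rw [startOf_succ] at hm
    omega
  have hf' : ∀ k, startOf f (n + k) = n + 1 + k := by
    intro k
    induction k with
    | zero => rw [add_zero, add_zero, hf n le_rfl, hn]
    | succ k ih =>
      rw [← add_assoc, startOf_succ, ih, show f (n + k) = 1 from if_neg (by omega)]
      ring
  refine ⟨⟨f, fun i => ?_⟩, fun i hi => if_pos (by omega), fun i hi => hf i (by omega)⟩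
  change i < startOf f i
  rcases Nat.lt_or_ge i n with h2 | h2
  · rw [hf i h2.le]
    exact h1 i (by omega)
  · obtain ⟨k, rfl⟩ := Nat.exists_eq_add_of_le h2
    rw [hf']
    omega

/-- Cutting off the levels from `l + 1` on. -/
theorem exists_truncate (C : Offspring) (m : ℕ) :
    ∃ P : LayerCode, P.h = ((C.level m + 1 : ℕ) : ℕ∞) ∧ ∀ i, P.level i ≤ C.level m →
      C.level i = P.level i ∧ (P.level i < C.level m → P.num i = C.num i) := by
  obtain ⟨P, v, hPh, hv0, hv⟩ := exists_layerCode 0 C.num (fun i k => C.start i + k) C.level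
    (fun _ => True) (C.level m) ((C.level m + 1 : ℕ) : ℕ∞) (by exact_mod_cast Nat.le_add_left 1 _)
    trivial C.level_zero
    (fun i _ _ k hk => ⟨trivial, by
      rw [C.level_parent (by have := C.lt_start i; omega), C.parent_start_add hk]⟩)
    (fun i _ h1 h2 => by
      norm_cast at h1 h2
      omega)
    (fun s _ h0 hst hclosed => by
      have hall : ∀ i, i ∈ s := by
        intro i
        induction i using Nat.strong_induction_on with
        | _ i ih =>
          rcases Nat.eq_zero_or_pos i with rfl | hi
          · exact h0
          · obtain ⟨h2, h3⟩ := C.parent_spec hi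
            rw [start_succ] at h3
            have := hclosed _ (ih _ (C.parent_lt hi)) (i - C.start (C.parent i)) (by omega)
            rwa [Nat.add_sub_cancel' h2] at this
      exact lt_irrefl _ (hst m (hall m)).2)
  have hle : ∀ {i}, P.level i ≤ C.level m → ((P.level i : ℕ) : ℕ∞) ≤ (C.level m : ℕ∞) :=
    fun h => by exact_mod_cast h
  have hlt : ∀ {i}, P.level i < C.level m → ((P.level i : ℕ) : ℕ∞) < (C.level m : ℕ∞) :=
    fun h => by exact_mod_cast h
  have hvi : ∀ i, P.level i ≤ C.level m → v i = i := by
    intro i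
    induction i using Nat.strong_induction_on with
    | _ i ih =>
      intro hi
      rcases Nat.eq_zero_or_pos i with rfl | hi0
      · exact hv0
      · obtain ⟨h2, h3⟩ := P.parent_spec hi0
        rw [start_succ] at h3
        have h4 := P.level_parent hi0
        have hlp : P.level (P.parent i) < C.level m := by omega
        obtain ⟨h5, h6⟩ := (hv _ (hle hlp.le)).2.2 (hlt hlp)
        have h7 := h6 (i - P.start (P.parent i)) (by omega)
        rw [Nat.add_sub_cancel' h2, ih _ (P.parent_lt hi0) hlp.le] at h7
        have h8 : C.start (P.parent i) = P.start (P.parent i) := by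
          refine start_congr (n := P.parent i) (fun j hj => ?_) le_rfl
          have h9 : P.level j < C.level m := (P.level_mono hj.le).trans_lt hlp
          rw [((hv j (hle h9.le)).2.2 (hlt h9)).1, ih j (hj.trans (P.parent_lt hi0)) h9.le]
        rw [h7, h8, Nat.add_sub_cancel' h2]
  refine ⟨P, hPh, fun i hi => ⟨?_, fun hi' => ?_⟩⟩
  · rw [← (hv i (hle hi)).2.1, hvi i hi]
  · rw [((hv i (hle hi)).2.2 (hlt hi')).1, hvi i hi]

/-- If the queue never runs empty, the word itself is an infinite code. Otherwise let `m` be the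
last vertex before it does; the sequence is prolonged beyond `m` and the resulting tree is cut above
the level of `m`. -/
theorem exists_isCodeOf (w : ℕ → ℕ) : ∃ P : LayerCode, P.IsCodeOf w := by
  classical
  by_cases hall : ∀ i, i < startOf w i
  · exact ⟨⟨⟨w, hall⟩, ⊤, le_top, fun i hi => absurd hi (by simp)⟩, fun _ _ => rfl,
      fun i hi => absurd hi (ENat.natCast_ne_top _)⟩
  push Not at hall
  have hlt : ∀ i < Nat.find hall, i < startOf w i := fun i hi => not_le.1 (Nat.find_min hall hi)
  obtain ⟨m, hm⟩ : ∃ m, Nat.find hall = m + 1 :=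
    Nat.exists_eq_succ_of_ne_zero fun h => by
      have := Nat.find_spec hall
      rw [h] at this
      exact absurd this (by simp [startOf])
  have hspec := Nat.find_spec hall
  rw [hm] at hlt hspec
  have h1 := hlt m (Nat.lt_succ_self m)
  have h2 := startOf_succ w m
  obtain ⟨C, hC, hC'⟩ := exists_offspring_of_extinct hlt (by omega)
  obtain ⟨P, hPh, hP⟩ := exists_truncate C m
  refine ⟨P, fun i hi => ?_, fun i hi => ?_⟩ <;> rw [hPh] at hi <;> norm_cast at hi
  · obtain ⟨h3, h4⟩ := hP i (by omega)
    rw [h4 (by omega)]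
    refine hC i ?_
    have : i < m := by
      by_contra hcon
      have := C.level_mono (not_lt.1 hcon)
      omega
    omega
  · obtain ⟨h3, -⟩ := hP i (by omega)
    have h4 := C.level_spec m
    have h5 := C.level_spec i
    have h6 : C.level i = C.level m := by omega
    rw [h6, first_succ, hC' _ (by omega)] at h5
    rw [first_succ, hC' _ (by omega)] at h4
    -- From the first vertex of the last level up to `m + 1`, the monotone function `startOf w` is
    -- constantly `m + 1`, so the entries of `w` on this level vanish.
    have h7 := startOf_mono w h4.1
    have h8 := startOf_mono w (show i ≤ m by omega)
    have h9 := startOf_mono w h5.1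
    have h10 := startOf_succ w i
    have h11 := startOf_mono w (show i + 1 ≤ m + 1 by omega)
    omega

theorem IsCodeOf.startOf_eq (hP : P.IsCodeOf w) {i : ℕ}
    (hi : ∀ j < i, ((P.level j + 1 : ℕ) : ℕ∞) < P.h) : startOf w i = P.start i :=
  startOf_congr fun j hj => (hP.num_eq j (hi j hj)).symm

theorem IsCodeOf.lt_startOf (hP : P.IsCodeOf w) (h : P.h = ⊤) (i : ℕ) : i < startOf w i := by
  rw [hP.startOf_eq fun j _ => by rw [h]; exact ENat.natCast_lt_top _]
  exact P.lt_start i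

theorem IsCodeOf.startOf_spec (hP : P.IsCodeOf w) {k : ℕ} (hk : P.h = k) :
    (∀ i < P.first k, i < startOf w i) ∧ startOf w (P.first k) = P.first k := by
  have h1 : 1 ≤ k := by exact_mod_cast hk ▸ P.one_le
  obtain ⟨l, rfl⟩ := Nat.exists_eq_add_of_le' h1
  have hlow : ∀ i ≤ P.first l, startOf w i = P.start i := fun i hi =>
    hP.startOf_eq fun j hj => by
      have := P.level_lt_iff.2 (hj.trans_le hi)
      rw [hk]
      exact_mod_cast Nat.succ_lt_succ this
  have hhigh : ∀ i, P.first l ≤ i → i ≤ P.first (l + 1) → startOf w i = P.first (l + 1) := by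
    intro i hi
    induction i, hi using Nat.le_induction with
    | base => exact fun _ => hlow _ le_rfl
    | succ i hi ih =>
      intro hi'
      rw [startOf_succ, ih (by omega), hP.eq_zero i (by rw [P.level_eq hi hi', hk]), add_zero]
  refine ⟨fun i hi => ?_, hhigh _ (P.first_lt l).le le_rfl⟩
  rcases le_total i (P.first l) with h2 | h2
  · rw [hlow i h2]
    exact P.lt_start i
  · rw [hhigh i h2 hi.le]
    exact hi

/-- As long as the walk is positive, it counts the vertices found minus those explored. -/
theorem walk_add {n : ℕ} (h : ∀ i < n, walk 1 w i ≠ 0) : walk 1 w n + n = startOf w n := by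
  induction n with
  | zero => simp [walk, startOf]
  | succ n ih =>
    have h1 := ih fun i hi => h i (by omega)
    have h2 := h n n.lt_succ_self
    obtain ⟨s, hs⟩ := Nat.exists_eq_succ_of_ne_zero h2
    rw [startOf_succ, ← h1]
    change step (walk 1 w n) (w n) + _ = _
    rw [hs]
    change s + w n + _ = _
    omega

theorem walk_ne_zero_iff {n : ℕ} : (∀ i < n, walk 1 w i ≠ 0) ↔ ∀ i < n, i < startOf w i := by
  constructor
  · intro h i hi
    have h1 := walk_add fun j hj => h j (hj.trans hi)
    have h2 := h i hi
    omega
  · intro h i hi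
    induction i using Nat.strong_induction_on with
    | _ i ih =>
      have h1 := walk_add fun j hj => ih j hj (hj.trans hi)
      have h2 := h i hi
      omega

theorem mem_words_iff {N : ℕ} : w ∈ words N 1 ↔
    (∀ i < N, i < startOf w i) ∧ startOf w N = N ∧ ∀ i, N ≤ i → w i = 0 := by
  rw [mem_words, walk_ne_zero_iff]
  refine and_congr_right fun h => and_congr_left fun _ => ?_
  rw [← walk_add (walk_ne_zero_iff.2 h)]
  omega

theorem IsCodeOf.mem_words_iff (hP : P.IsCodeOf w) {N : ℕ} :
    w ∈ words N 1 ↔ (∃ k : ℕ, P.h = k ∧ P.first k = N) ∧ ∀ i, N ≤ i → w i = 0 := by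
  rw [LayerCode.mem_words_iff]
  constructor
  · rintro ⟨h1, h2, h3⟩
    refine ⟨?_, h3⟩
    have htop : P.h ≠ ⊤ := fun h => by
      have := hP.lt_startOf h N
      omega
    obtain ⟨k, hk⟩ := ENat.ne_top_iff_exists.1 htop
    obtain ⟨h4, h5⟩ := hP.startOf_spec hk.symm
    refine ⟨k, hk.symm, ?_⟩
    rcases lt_trichotomy (P.first k) N with h6 | h6 | h6
    · have := h1 _ h6
      omega
    · exact h6
    · have := h4 _ h6
      omega
  · rintro ⟨⟨k, hk, rfl⟩, h3⟩
    obtain ⟨h4, h5⟩ := hP.startOf_spec hk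
    exact ⟨h4, h5, h3⟩

/-- The code of the tree with offspring numbers `w`. -/
noncomputable def ofWord (w : ℕ → ℕ) : LayerCode := (exists_isCodeOf w).choose

theorem isCodeOf_ofWord (w : ℕ → ℕ) : (ofWord w).IsCodeOf w := (exists_isCodeOf w).choose_spec

theorem bijOn_ofWord (N : ℕ) :
    Set.BijOn ofWord (words N 1) {P : LayerCode | ∃ k : ℕ, P.h = k ∧ P.first k = N} := by
  classical
  refine ⟨fun w hw => ((isCodeOf_ofWord w).mem_words_iff.1 hw).1, fun w hw w' hw' h => ?_,
    fun P hP => ?_⟩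
  · have hP := isCodeOf_ofWord w
    have hP' := isCodeOf_ofWord w'
    rw [← h] at hP'
    obtain ⟨⟨k, hk, hN⟩, h3⟩ := hP.mem_words_iff.1 hw
    obtain ⟨-, h3'⟩ := hP'.mem_words_iff.1 hw'
    funext i
    rcases Nat.lt_or_ge i N with hi | hi
    · have hlev : (ofWord w).level i + 1 ≤ k := (ofWord w).level_lt_iff.2 (by rw [hN]; exact hi)
      rcases hlev.lt_or_eq with h4 | h4
      · rw [← hP.num_eq i (by rw [hk]; exact_mod_cast h4),
          ← hP'.num_eq i (by rw [hk]; exact_mod_cast h4)]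
      · rw [hP.eq_zero i (by rw [hk, h4]), hP'.eq_zero i (by rw [hk, h4])]
    · rw [h3 i hi, h3' i hi]
  -- Unlike the code, the word has the entry `0` on the last level.
  · let w : ℕ → ℕ := fun i => if ((P.level i + 1 : ℕ) : ℕ∞) < P.h then P.num i else 0
    have hw : P.IsCodeOf w := ⟨fun i hi => (if_pos hi).symm, fun i hi => if_neg hi.not_lt⟩
    refine ⟨w, hw.mem_words_iff.2 ⟨hP, fun i hi => if_neg ?_⟩, (isCodeOf_ofWord w).unique hw⟩
    obtain ⟨k, hk, hN⟩ := hP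
    intro hlt
    rw [hk] at hlt
    have h1 : P.level i < k := by
      have : P.level i + 1 < k := by exact_mod_cast hlt
      omega
    have h2 := P.level_lt_iff.1 h1
    omega

theorem agree_ofWord {R : ℕ} (h : ∀ i < (ofWord w).first R, w i = w' i) :
    Agree R (ofWord w) (ofWord w') :=
  (isCodeOf_ofWord w).agree (isCodeOf_ofWord w') h

theorem exists_walk_eq_zero (h : (ofWord w).h ≠ ⊤) : ∃ i, walk 1 w i = 0 := by
  obtain ⟨k, hk⟩ := ENat.ne_top_iff_exists.1 h
  obtain ⟨h1, h2⟩ := (isCodeOf_ofWord w).startOf_spec hk.symm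
  refine ⟨(ofWord w).first k, ?_⟩
  have h3 := walk_add (walk_ne_zero_iff.2 h1)
  omega

end LayerCode

/-! ### The law of an infinite excursion -/

section UniformOn

open ProbabilityTheory

variable {X Y : Type*} [MeasurableSpace X] [MeasurableSpace Y] [MeasurableSingletonClass X]
  [MeasurableSingletonClass Y]

theorem uniformOn_eq_encard_div {s : Set X} (hs : s.Finite) {A : Set X} (hA : MeasurableSet A) :
    uniformOn s A = ((s ∩ A).encard : ENNReal) / (s.encard : ENNReal) := by
  rw [uniformOn, cond_apply hs.measurableSet, Measure.count_apply hs.measurableSet,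
    Measure.count_apply (hs.measurableSet.inter hA), ENNReal.div_eq_inv_mul]

theorem uniformOn_singleton_of_mem {s : Set X} (hs : s.Finite) {x : X} (hx : x ∈ s) :
    uniformOn s {x} = 1 / (s.encard : ENNReal) := by
  rw [uniformOn_eq_encard_div hs (measurableSet_singleton x),
    Set.inter_eq_self_of_subset_right (Set.singleton_subset_iff.2 hx), Set.encard_singleton,
    ENat.toENNReal_one]

theorem map_uniformOn {s : Set X} {t : Set Y} {f : X → Y} (hf : Measurable f) (hs : s.Finite)
    (hst : Set.BijOn f s t) : (uniformOn s).map f = uniformOn t := by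
  have ht : t.Finite := hst.image_eq ▸ hs.image f
  ext A hA
  rw [Measure.map_apply hf hA, uniformOn_eq_encard_div hs (hf hA), uniformOn_eq_encard_div ht hA,
    ← hst.image_eq, hst.injOn.encard_image, ← Set.image_inter_preimage,
    (hst.injOn.mono Set.inter_subset_left).encard_image]

end UniformOn

namespace Excursion

theorem tendsto_weight_atTop : Tendsto weight atTop (𝓝 0) := by
  have h := (tendsto_self_mul_const_pow_of_lt_one (r := 1 / 2) (by norm_num) (by norm_num)).const_mul
    (2 : ℝ)
  rw [mul_zero] at h
  exact h.congr fun n => (mul_assoc _ _ _).symm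

/-- The recursion gives `weight (s + c) / 4 = weight (s + c + 1) - weight (s + c + 2)`, so the sum
telescopes; the remainder tends to `0`. -/
theorem hasSum_weight (s : ℕ) :
    HasSum (fun c => ENNReal.ofReal (weight (s + c) / (4 * weight (s + 1)))) 1 := by
  have h0 : ∀ c, 0 ≤ weight (s + c) / (4 * weight (s + 1)) := fun c =>
    div_nonneg (weight_nonneg _) (mul_nonneg (by norm_num) (weight_nonneg _))
  have h1 : ∀ n, ∑ c ∈ Finset.range n, weight (s + c) / (4 * weight (s + 1)) =
      (weight (s + 1) - weight (n + (s + 1))) / weight (s + 1) := by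
    intro n
    have hpos := weight_pos s
    induction n with
    | zero => simp
    | succ n ih =>
      have h2 := weight_add_two (s + n)
      rw [Finset.sum_range_succ, ih, show n + 1 + (s + 1) = s + n + 2 by ring, h2,
        show n + (s + 1) = s + n + 1 by ring]
      field_simp
      ring
  have h2 : HasSum (fun c => weight (s + c) / (4 * weight (s + 1))) 1 := by
    rw [hasSum_iff_tendsto_nat_of_nonneg h0]
    simp only [h1]
    have h3 := ((tendsto_const_nhds (x := weight (s + 1))).sub
      (tendsto_weight_atTop.comp (tendsto_add_atTop_nat (s + 1)))).div_const (weight (s + 1))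
    rwa [sub_zero, div_self (weight_pos s).ne'] at h3
  have h3 := ENNReal.ofReal_tsum_of_nonneg h0 h2.summable
  rw [h2.tsum_eq, ENNReal.ofReal_one] at h3
  rw [h3]
  exact ENNReal.summable.hasSum

/-- The law of the number of children of the next vertex of an infinite excursion, given the number
of unexplored vertices. -/
noncomputable def offspringLaw : ℕ → PMF ℕ
  | 0 => PMF.pure 0
  | s + 1 => ⟨fun c => ENNReal.ofReal (weight (s + c) / (4 * weight (s + 1))), hasSum_weight s⟩

/-- The offspring law is a Doob transform by `weight`: a step multiplies the weight of the current
state by the transition probability and leaves the weight of the next state times `1 / 4`. Hence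
products along a path telescope. -/
theorem ofReal_weight_mul_offspringLaw (s c : ℕ) :
    ENNReal.ofReal (weight s) * offspringLaw s c = ENNReal.ofReal (weight (step s c) * (1 / 4)) := by
  rcases s with _ | s
  · simp [step, weight_zero]
  · change ENNReal.ofReal (weight (s + 1)) * ENNReal.ofReal (weight (s + c) / (4 * weight (s + 1))) =
      ENNReal.ofReal (weight (s + c) * (1 / 4))
    have hpos := weight_pos s
    rw [← ENNReal.ofReal_mul hpos.le]
    congr 1
    field_simp

theorem prod_offspringLaw (c : ℕ → ℕ) (m : ℕ) :
    ∏ i ∈ Finset.range m, offspringLaw (walk 1 c i) (c i) =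
      ENNReal.ofReal (weight (walk 1 c m) * (1 / 4) ^ m) := by
  induction m with
  | zero => simp [walk, weight_one]
  | succ m ih =>
    rw [Finset.prod_range_succ, ih, ENNReal.ofReal_mul (weight_nonneg _), mul_right_comm,
      ofReal_weight_mul_offspringLaw, ← ENNReal.ofReal_mul (mul_nonneg (weight_nonneg _) (by norm_num)),
      mul_assoc, ← pow_succ']
    rfl

/-- The number of unexplored vertices when the vertex explored at time `i` has `y (i, s)` children if
there are `s` unexplored ones. -/
def state (y : ℕ × ℕ → ℕ) : ℕ → ℕ
  | 0 => 1
  | i + 1 => step (state y i) (y (i, state y i))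

def sample (y : ℕ × ℕ → ℕ) (i : ℕ) : ℕ := y (i, state y i)

theorem walk_sample (y : ℕ × ℕ → ℕ) (i : ℕ) : walk 1 (sample y) i = state y i := by
  induction i with
  | zero => rfl
  | succ i ih =>
    change step (walk 1 (sample y) i) (sample y i) = _
    rw [ih]
    rfl

/-- A cylinder prescribes `y` at the `m` distinct indices `(i, walk 1 c i)` only. As the coordinates
of `y` are independent, its probability is a finite product. -/
theorem sample_mem_cylinder {y : ℕ × ℕ → ℕ} {c : ℕ → ℕ} {m : ℕ} :
    sample y ∈ cylinder c m ↔ ∀ i < m, y (i, walk 1 c i) = c i := by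
  constructor
  · intro h i hi
    rw [← walk_congr h hi.le, walk_sample]
    exact h i hi
  · intro h i
    induction i using Nat.strong_induction_on with
    | _ i ih =>
      intro hi
      rw [← h i hi, ← walk_congr (fun j hj => ih j hj (hj.trans hi)) le_rfl, walk_sample]
      rfl

theorem measurable_sample : Measurable sample := by
  have h0 : Measurable fun p : (ℕ × ℕ → ℕ) × (ℕ × ℕ) => p.1 p.2 :=
    measurable_from_prod_countable_left fun j => measurable_pi_apply j
  have h1 : ∀ i, Measurable fun y => state y i := by
    intro i
    induction i with
    | zero => exact measurable_const
    | succ i ih =>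
      have h2 : Measurable fun y : ℕ × ℕ → ℕ => y (i, state y i) :=
        h0.comp (measurable_id.prodMk (measurable_const.prodMk ih))
      exact (measurable_of_countable fun p : ℕ × ℕ => step p.1 p.2).comp (ih.prodMk h2)
  exact measurable_pi_lambda _ fun i => h0.comp (measurable_id.prodMk (measurable_const.prodMk (h1 i)))

/-- The law of an infinite excursion. -/
noncomputable def law : Measure (ℕ → ℕ) :=
  (Measure.infinitePi fun j : ℕ × ℕ => (offspringLaw j.2).toMeasure).map sample

instance : IsProbabilityMeasure law :=
  Measure.isProbabilityMeasure_map measurable_sample.aemeasurable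

theorem isOpen_cylinder (c : ℕ → ℕ) (m : ℕ) : IsOpen (cylinder c m) :=
  PiNat.isOpen_cylinder (E := fun _ => ℕ) c m

theorem law_cylinder (c : ℕ → ℕ) (m : ℕ) :
    law (cylinder c m) = ENNReal.ofReal (weight (walk 1 c m) * (1 / 4) ^ m) := by
  rw [law, Measure.map_apply measurable_sample (isOpen_cylinder c m).measurableSet]
  have hinj : Function.Injective fun i => (i, walk 1 c i) := fun i j h => (Prod.ext_iff.1 h).1
  have h : sample ⁻¹' cylinder c m =
      Set.pi ((Finset.range m).map ⟨_, hinj⟩) fun j : ℕ × ℕ => {c j.1} := by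
    ext y
    rw [Set.mem_preimage, sample_mem_cylinder]
    simp
  rw [h, Measure.infinitePi_pi _ (fun _ _ => measurableSet_singleton _), Finset.prod_map,
    ← prod_offspringLaw]
  exact Finset.prod_congr rfl fun i _ => PMF.toMeasure_apply_singleton _ _ (measurableSet_singleton _)

/-- There are countably many beginnings of length `i` that end at `0`, and each has probability `0`
because `weight 0 = 0`. -/
theorem ae_walk_ne_zero : ∀ᵐ w ∂law, ∀ i, walk 1 w i ≠ 0 := by
  rw [ae_all_iff]
  intro i
  have h : {w : ℕ → ℕ | ¬walk 1 w i ≠ 0} ⊆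
      ⋃ c ∈ {c : Fin i → ℕ | walk 1 (fun j => if h : j < i then c ⟨j, h⟩ else 0) i = 0},
        cylinder (fun j => if h : j < i then c ⟨j, h⟩ else 0) i := by
    intro w hw
    have hw' : ∀ j < i, w j = if h : j < i then w (⟨j, h⟩ : Fin i) else 0 := fun j hj => by simp [hj]
    refine Set.mem_biUnion (x := fun j : Fin i => w j) ?_ hw'
    change walk 1 _ i = 0
    rw [← walk_congr hw' le_rfl]
    exact not_not.1 hw
  refine measure_mono_null h ((measure_biUnion_null_iff (Set.to_countable _)).2 fun c hc => ?_)
  rw [law_cylinder, show walk 1 _ i = 0 from hc, weight_zero, zero_mul, ENNReal.ofReal_zero]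

theorem finite_words_inter (N : ℕ) (A : Set (ℕ → ℕ)) : ((words N 1 : Set (ℕ → ℕ)) ∩ A).Finite :=
  (words N 1).finite_toSet.subset Set.inter_subset_left

theorem isProbabilityMeasure_uniformOn_words (N : ℕ) :
    IsProbabilityMeasure (ProbabilityTheory.uniformOn (words (N + 1) 1 : Set (ℕ → ℕ))) :=
  ProbabilityTheory.isProbabilityMeasure_uniformOn (words (N + 1) 1).finite_toSet
    (Finset.card_pos.1 (card_words_one_pos N))

theorem tendsto_uniformOn_cylinder (c : ℕ → ℕ) (m : ℕ) :
    Tendsto (fun N => ProbabilityTheory.uniformOn (words (N + 1) 1 : Set (ℕ → ℕ)) (cylinder c m)) atTop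
      (𝓝 (law (cylinder c m))) := by
  rw [law_cylinder, ← tendsto_add_atTop_iff_nat m]
  refine (((ENNReal.continuous_ofReal.tendsto _).comp
    ((tendsto_add_atTop_iff_nat 1).2 (tendsto_weight (walk 1 c m) m)))).congr fun N => ?_
  have h1 : 0 < (words (N + m + 1) 1).card := card_words_one_pos (N + m)
  have h2 : (0 : ℝ) < (words (N + m + 1) 1).card := by exact_mod_cast h1
  rw [uniformOn_eq_encard_div (Finset.finite_toSet _) (isOpen_cylinder c m).measurableSet,
    ← (finite_words_inter _ _).cast_ncard_eq, Set.encard_coe_eq_coe_finsetCard,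
    show N + m + 1 = N + 1 + m by ring, ncard_words_inter_cylinder (Nat.le_add_left 1 N)]
  rw [show N + m + 1 = N + 1 + m by ring] at h2
  change ENNReal.ofReal (_ / _) = _
  rw [ENNReal.ofReal_div_of_pos h2, ENNReal.ofReal_natCast, ENNReal.ofReal_natCast]
  rfl

/-- Uniform excursions of length `N` converge weakly to the infinite excursion. -/
theorem isWeakLimit_law :
    IsWeakLimit (fun N => ProbabilityTheory.uniformOn (words (N + 1) 1 : Set (ℕ → ℕ))) law := by
  refine ⟨inferInstance, ?_⟩
  let μ : ℕ → ProbabilityMeasure (ℕ → ℕ) := fun N => ⟨_, isProbabilityMeasure_uniformOn_words N⟩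
  let ν : ProbabilityMeasure (ℕ → ℕ) := ⟨law, inferInstance⟩
  refine (ProbabilityMeasure.tendsto_iff_forall_integral_tendsto (μs := μ) (μ := ν)).1 ?_
  -- Cylinders are closed under nonempty intersections and form a base of open sets, so convergence
  -- of their probabilities implies weak convergence.
  refine IsPiSystem.tendsto_probabilityMeasure_of_tendsto_of_mem (S := {A | ∃ c m, A = cylinder c m})
    ?_ ?_ ?_ ?_
  · rintro _ ⟨c, m, rfl⟩ _ ⟨d, n, rfl⟩ ⟨x, hx1, hx2⟩
    refine ⟨x, max m n, Set.ext fun w => ⟨fun h i hi => ?_, fun h => ⟨fun i hi => ?_, fun i hi => ?_⟩⟩⟩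
    · rcases lt_max_iff.1 hi with hi | hi
      · rw [h.1 i hi, hx1 i hi]
      · rw [h.2 i hi, hx2 i hi]
    · rw [h i (lt_max_of_lt_left hi), hx1 i hi]
    · rw [h i (lt_max_of_lt_right hi), hx2 i hi]
  · rintro _ ⟨c, m, rfl⟩
    exact (isOpen_cylinder c m).measurableSet
  · intro u hu x hx
    obtain ⟨_, ⟨c, m, rfl⟩, h1, h2⟩ :=
      (PiNat.isTopologicalBasis_cylinders (fun _ : ℕ => ℕ)).exists_subset_of_mem_open hx hu
    exact ⟨_, ⟨c, m, rfl⟩, (isOpen_cylinder c m).mem_nhds h1, h2⟩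
  · rintro _ ⟨c, m, rfl⟩
    exact (ENNReal.tendsto_toNNReal (measure_ne_top _ _)).comp (tendsto_uniformOn_cylinder c m)

end Excursion

/-! ### The uniform infinite tree and the uniform infinite causal triangulation -/

section TopologyOfDist

variable {X Y : Type*} {d : Y → Y → ℝ}

theorem IsMetric.nonneg (hd : IsMetric d) (x y : Y) : 0 ≤ d x y := by
  have h := hd.2.2 x y x
  rw [(hd.1 x x).2 rfl, hd.2.1 y x] at h
  linarith

theorem IsMetric.eventually_lt (hd : IsMetric d) (x : Y) {ε : ℝ} (hε : 0 < ε) :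
    letI := topologyOfDist d
    ∀ᶠ y in 𝓝 x, d x y < ε := by
  let _ := topologyOfDist d
  refine IsOpen.mem_nhds (s := {y | d x y < ε}) (fun y hy => ?_) ?_
  · refine ⟨ε - d x y, sub_pos.2 hy, fun z hz => ?_⟩
    have h := hd.2.2 x y z
    change d x z < ε
    linarith
  · change d x x < ε
    rwa [(hd.1 x x).2 rfl]

theorem IsMetric.t1Space (hd : IsMetric d) : @T1Space Y (topologyOfDist d) := by
  let _ := topologyOfDist d
  refine ⟨fun x => ⟨fun y hy => ⟨d y x, ?_, fun z hz => ?_⟩⟩⟩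
  · exact (hd.nonneg y x).lt_of_ne' fun h => hy ((hd.1 y x).1 h)
  · rintro rfl
    exact lt_irrefl _ hz

theorem continuous_of_eventually_lt [TopologicalSpace X] {f : X → Y}
    (h : ∀ x, ∀ ε > 0, ∀ᶠ y in 𝓝 x, d (f x) (f y) < ε) :
    @Continuous X Y _ (topologyOfDist d) f := by
  let _ := topologyOfDist d
  refine ⟨fun U hU => isOpen_iff_mem_nhds.2 fun x hx => ?_⟩
  obtain ⟨ε, hε, hball⟩ := hU _ hx
  exact (h x ε hε).mono fun y hy => hball _ hy

end TopologyOfDist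

section IsWeakLimit

variable {X Y : Type*} [TopologicalSpace X] [MeasurableSpace X] [BorelSpace X] [TopologicalSpace Y]
  [MeasurableSpace Y] [BorelSpace Y] {μs : ℕ → Measure X} {μ : Measure X}

theorem IsWeakLimit.map (h : IsWeakLimit μs μ) {f : X → Y} (hf : Continuous f) :
    IsWeakLimit (fun N => (μs N).map f) (μ.map f) := by
  have := h.1
  refine ⟨Measure.isProbabilityMeasure_map hf.measurable.aemeasurable, fun g => ?_⟩
  have hg : ∀ m : Measure X, ∫ y, g y ∂(m.map f) = ∫ x, g.compContinuous ⟨f, hf⟩ x ∂m := fun m =>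
    integral_map hf.measurable.aemeasurable g.continuous.measurable.aestronglyMeasurable
  simp only [hg]
  exact h.2 _

end IsWeakLimit

/-- Dropping initial terms is needed because there are no words, hence no trees, of size `0`. -/
theorem isWeakLimit_succ_iff {X : Type*} [TopologicalSpace X] [MeasurableSpace X]
    {μs : ℕ → Measure X} {μ : Measure X} : IsWeakLimit (fun N => μs (N + 1)) μ ↔ IsWeakLimit μs μ :=
  and_congr_right fun _ => forall_congr' fun f =>
    tendsto_add_atTop_iff_nat (f := fun N => ∫ x, f x ∂(μs N)) 1

instance : T1Space PlaneTree := PlaneTree.isMetric_dist.t1Space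

instance : T1Space CT := CT.isMetric_dist.t1Space

namespace PlaneTree

open LayerCode Excursion

theorem eventually_agree (P : LayerCode) (R : ℕ) :
    ∀ᶠ T in 𝓝 (toTree P), ∀ Q, toTree Q = T → Agree R P Q := by
  filter_upwards [isMetric_dist.eventually_lt (toTree P)
    (show (0 : ℝ) < 1 / ((R + 1 : ℕ) : ℝ) by positivity)] with T hT Q hQ
  rw [← hQ, dist_toTree] at hT
  exact agree_antitone P Q R.le_succ (agree_of_agreeDist_lt agree_zero agree_antitone hT)

/-- The set is closed: agreement to an order at least the height of a finite tree forces equal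
heights. -/
theorem measurableSet_infinite : MeasurableSet infinite := by
  refine (IsClosed.mk (isOpen_iff_mem_nhds.2 fun T hT => ?_)).measurableSet
  obtain ⟨P, rfl⟩ := toTree_surjective T
  obtain ⟨k, hk⟩ := ENat.ne_top_iff_exists.1 (mt toTree_mem_infinite.2 hT)
  filter_upwards [eventually_agree P k] with T hT
  obtain ⟨Q, rfl⟩ := toTree_surjective T
  intro hQ
  have h := (hT Q rfl).2
  rw [toTree_mem_infinite.1 hQ, ← hk, min_eq_right le_top,
    min_eq_left (by exact_mod_cast k.le_succ)] at h
  exact absurd (by exact_mod_cast h) k.lt_succ_self.ne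

/-- The tree with given offspring numbers in breadth-first order. -/
noncomputable def ofWord (w : ℕ → ℕ) : PlaneTree := toTree (LayerCode.ofWord w)

/-- The ball of a given radius depends on finitely many entries of the word. -/
theorem continuous_ofWord : Continuous ofWord := by
  refine continuous_of_eventually_lt fun w ε hε => ?_
  obtain ⟨R, hR⟩ := exists_nat_one_div_lt hε
  filter_upwards [(isOpen_cylinder w ((LayerCode.ofWord w).first R)).mem_nhds
    (show w ∈ cylinder w _ from fun _ _ => rfl)] with w' hw'
  change PlaneTree.dist (toTree _) (toTree _) < ε
  rw [dist_toTree]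
  exact (agreeDist_le (agree_ofWord fun i hi => (hw' i hi).symm)).trans_lt hR

theorem bijOn_ofWord (N : ℕ) : Set.BijOn ofWord (words N 1) (ofSize N) := by
  refine Set.BijOn.comp (t := {P : LayerCode | ∃ k : ℕ, P.h = k ∧ P.first k = N})
    ⟨fun P hP => toTree_mem_ofSize.2 hP, toTree_injective.injOn, fun T hT => ?_⟩
    (LayerCode.bijOn_ofWord N)
  obtain ⟨P, rfl⟩ := toTree_surjective T
  exact ⟨P, toTree_mem_ofSize.1 hT, rfl⟩

theorem finite_ofSize (N : ℕ) : (ofSize N).Finite :=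
  (bijOn_ofWord N).image_eq ▸ (words N 1).finite_toSet.image _

theorem unif_eq_map (N : ℕ) :
    unif N = (ProbabilityTheory.uniformOn (words N 1 : Set (ℕ → ℕ))).map ofWord :=
  (map_uniformOn continuous_ofWord.measurable (words N 1).finite_toSet (bijOn_ofWord N)).symm

theorem nonempty_ofSize_succ (N : ℕ) : (ofSize (N + 1)).Nonempty :=
  (bijOn_ofWord (N + 1)).image_eq ▸
    Set.Nonempty.image _ (Finset.card_pos.1 (card_words_one_pos N))

/-- The law of the uniform infinite planar tree. -/
noncomputable def uniformInfinite : Measure PlaneTree := law.map ofWord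

theorem isWeakLimit_unif : IsWeakLimit unif uniformInfinite := by
  rw [← isWeakLimit_succ_iff]
  simp only [unif_eq_map]
  exact isWeakLimit_law.map continuous_ofWord

theorem ae_mem_infinite : ∀ᵐ T ∂uniformInfinite, T ∈ infinite := by
  refine (ae_map_iff continuous_ofWord.measurable.aemeasurable measurableSet_infinite).2 ?_
  filter_upwards [ae_walk_ne_zero] with w hw
  refine toTree_mem_infinite.2 (by_contra fun h => ?_)
  obtain ⟨i, hi⟩ := LayerCode.exists_walk_eq_zero h
  exact hw i hi

theorem toTree_mem_range {P : LayerCode} : toTree P ∈ Set.range CT.toPlaneTree ↔ 2 ≤ P.h := by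
  constructor
  · rintro ⟨x, hx⟩
    obtain ⟨Q, rfl⟩ := toCT_surjective x
    rw [CT.toPlaneTree_toCT] at hx
    rw [← toTree_injective hx]
    exact Q.2
  · exact fun h => ⟨toCT ⟨P, h⟩, CT.toPlaneTree_toCT _⟩

/-- The range of `β` consists of the trees with `h ≥ 2`, and agreement of order `1` decides whether
this holds; so the range is open and closed. -/
theorem eventually_mem_range (T : PlaneTree) :
    ∀ᶠ T' in 𝓝 T, (T' ∈ Set.range CT.toPlaneTree ↔ T ∈ Set.range CT.toPlaneTree) := by
  obtain ⟨P, rfl⟩ := toTree_surjective T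
  filter_upwards [eventually_agree P 1] with T hT
  obtain ⟨Q, rfl⟩ := toTree_surjective T
  have h := (hT Q rfl).2
  have h2 : ∀ P' : LayerCode, 2 ≤ P'.h ↔ 2 ≤ min P'.h ((1 + 1 : ℕ) : ℕ∞) := fun P' => by
    rw [le_min_iff]
    exact (and_iff_left (by norm_num)).symm
  rw [toTree_mem_range, toTree_mem_range, h2 Q, h2 P, h]

instance : Nonempty CT :=
  ⟨((CT.bijOn_ofArea le_rfl).surjOn (nonempty_ofSize_succ 1).some_mem).choose⟩

/-- A left inverse of `β`. -/
noncomputable def toCT : PlaneTree → CT := Function.invFun CT.toPlaneTree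

theorem toCT_toPlaneTree (x : CT) : toCT x.toPlaneTree = x :=
  Function.leftInverse_invFun CT.toPlaneTree_injective x

theorem continuous_toCT : Continuous toCT := by
  refine continuous_of_eventually_lt fun T ε hε => ?_
  filter_upwards [eventually_mem_range T, isMetric_dist.eventually_lt T hε] with T' h1 h2
  by_cases hT : T ∈ Set.range CT.toPlaneTree
  · obtain ⟨x', rfl⟩ := h1.2 hT
    obtain ⟨x, rfl⟩ := hT
    rwa [toCT_toPlaneTree, toCT_toPlaneTree, ← CT.dist_toPlaneTree]
  -- Outside the range `Function.invFun` takes a constant default value, and nearby trees are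
  -- outside the range too.
  · have h3 : toCT T' = toCT T :=
      (Function.invFun_neg (mt h1.1 hT)).trans (Function.invFun_neg hT).symm
    rwa [h3, (CT.isMetric_dist.1 _ _).2 rfl]

theorem bijOn_toCT {N : ℕ} (hN : 1 ≤ N) : Set.BijOn toCT (ofSize (N + 1)) (CT.ofArea N) := by
  refine (CT.bijOn_ofArea hN).symm ⟨fun T hT => ?_, fun x _ => toCT_toPlaneTree x⟩
  obtain ⟨x, -, rfl⟩ := (CT.bijOn_ofArea hN).surjOn hT
  rw [toCT_toPlaneTree]

end PlaneTree

namespace CT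

theorem finite_ofArea {N : ℕ} (hN : 1 ≤ N) : (ofArea N).Finite :=
  (PlaneTree.bijOn_toCT hN).image_eq ▸ (PlaneTree.finite_ofSize _).image _

theorem nonempty_ofArea {N : ℕ} (hN : 1 ≤ N) : (ofArea N).Nonempty :=
  (PlaneTree.bijOn_toCT hN).image_eq ▸ (PlaneTree.nonempty_ofSize_succ _).image _

theorem encard_ofArea {N : ℕ} (hN : 1 ≤ N) : (ofArea N).encard = (PlaneTree.ofSize (N + 1)).encard := by
  rw [← (bijOn_ofArea hN).image_eq, (bijOn_ofArea hN).injOn.encard_image]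

/-- The law of the uniform infinite causal triangulation. -/
noncomputable def uniformInfinite : Measure CT := PlaneTree.uniformInfinite.map PlaneTree.toCT

theorem isWeakLimit_unif : IsWeakLimit unif uniformInfinite := by
  rw [← isWeakLimit_succ_iff]
  have h : ∀ N, unif (N + 1) = (PlaneTree.unif (N + 1 + 1)).map PlaneTree.toCT := fun N =>
    (map_uniformOn PlaneTree.continuous_toCT.measurable (PlaneTree.finite_ofSize _)
      (PlaneTree.bijOn_toCT (Nat.le_add_left 1 N))).symm
  simp only [h]
  -- One shift drops `N = 0`; the other one is the passage from area `2 * N` to `N + 1` edges.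
  exact (isWeakLimit_succ_iff.2 (isWeakLimit_succ_iff.2 PlaneTree.isWeakLimit_unif)).map
    PlaneTree.continuous_toCT

theorem continuous_toPlaneTree : Continuous toPlaneTree :=
  continuous_of_eventually_lt fun x ε hε => by
    simpa only [dist_toPlaneTree] using isMetric_dist.eventually_lt x hε

/-- The preimage under the left inverse and the image under `β` can differ only outside the range of
`β`, and almost every tree is infinite and so lies in this range. -/
theorem uniformInfinite_apply {A : Set CT} (hA : MeasurableSet A) :
    uniformInfinite A = PlaneTree.uniformInfinite (toPlaneTree '' A) := by
  rw [uniformInfinite, Measure.map_apply PlaneTree.continuous_toCT.measurable hA]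
  refine measure_congr (eventuallyEq_set.2 ?_)
  filter_upwards [PlaneTree.ae_mem_infinite] with T hT
  obtain ⟨x, -, rfl⟩ := bijOn_infinite.surjOn hT
  rw [Set.mem_preimage, PlaneTree.toCT_toPlaneTree, toPlaneTree_injective.mem_set_image]

theorem preimage_infinite : toPlaneTree ⁻¹' PlaneTree.infinite = infinite := by
  ext x
  refine ⟨fun h => ?_, fun h => bijOn_infinite.mapsTo h⟩
  obtain ⟨y, hy, hxy⟩ := bijOn_infinite.surjOn h
  rwa [← toPlaneTree_injective hxy]

theorem uniformInfinite_compl_infinite : uniformInfinite infiniteᶜ = 0 := by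
  have hm : MeasurableSet infinite :=
    preimage_infinite ▸ continuous_toPlaneTree.measurable PlaneTree.measurableSet_infinite
  rw [uniformInfinite_apply hm.compl]
  refine measure_mono_null ?_ PlaneTree.ae_mem_infinite
  rintro _ ⟨x, hx, rfl⟩ h
  exact hx (preimage_infinite ▸ h)

end CT

theorem mainTheorem8 :
    IsMetric CT.dist ∧ IsMetric PlaneTree.dist ∧
    CT.finite = ⋃ N ∈ Set.Ici 1, CT.ofArea N ∧
    ∃ hβ : Set.MapsTo MapClass.beta MapClass.causal MapClass.trees,
      let β : CT → PlaneTree := hβ.restrict MapClass.beta MapClass.causal MapClass.trees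
      (∀ N : ℕ, 1 ≤ N → Set.BijOn β (CT.ofArea N) (PlaneTree.ofSize (N + 1))) ∧
      Set.BijOn β CT.infinite PlaneTree.infinite ∧
      (∀ x y : CT, PlaneTree.dist (β x) (β y) = CT.dist x y) ∧
      (∀ N : ℕ, 1 ≤ N →
        IsProbabilityMeasure (CT.unif N) ∧
        ∀ x ∈ CT.ofArea N,
          CT.unif N {x} = 1 / ((CT.ofArea N).encard : ENNReal) ∧
          CT.unif N {x} = 1 / ((PlaneTree.ofSize (N + 1)).encard : ENNReal) ∧
          CT.unif N {x} = PlaneTree.unif (N + 1) {β x}) ∧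
      ∃ (ν : Measure PlaneTree) (ρ : Measure CT),
        IsWeakLimit PlaneTree.unif ν ∧ ν PlaneTree.infiniteᶜ = 0 ∧
        IsWeakLimit CT.unif ρ ∧ ρ CT.infiniteᶜ = 0 ∧
        ∀ A : Set CT, MeasurableSet A → A ⊆ CT.infinite → ρ A = ν (β '' A) := by
  refine ⟨CT.isMetric_dist, PlaneTree.isMetric_dist, LayerCode.finite_eq_iUnion_ofArea, mapsTo_beta,
    fun N hN => CT.bijOn_ofArea hN, CT.bijOn_infinite, CT.dist_toPlaneTree, fun N hN => ⟨?_, ?_⟩,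
    PlaneTree.uniformInfinite, CT.uniformInfinite, PlaneTree.isWeakLimit_unif,
    PlaneTree.ae_mem_infinite, CT.isWeakLimit_unif, CT.uniformInfinite_compl_infinite,
    fun A hA _ => CT.uniformInfinite_apply hA⟩
  · exact ProbabilityTheory.isProbabilityMeasure_uniformOn (CT.finite_ofArea hN)
      (CT.nonempty_ofArea hN)
  · intro x hx
    have h1 : CT.unif N {x} = 1 / ((CT.ofArea N).encard : ENNReal) :=
      uniformOn_singleton_of_mem (CT.finite_ofArea hN) hx
    have h2 : PlaneTree.unif (N + 1) {x.toPlaneTree} =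
        1 / ((PlaneTree.ofSize (N + 1)).encard : ENNReal) :=
      uniformOn_singleton_of_mem (PlaneTree.finite_ofSize _) ((CT.bijOn_ofArea hN).mapsTo hx)
    rw [← CT.encard_ofArea hN] at h2 ⊢
    exact ⟨h1, h1, h1.trans h2.symm⟩
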